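/- Let $S_0$ be a Riemann surface conformally equivalent to the unit disk, the complex plane or the Riemann sphere, and let $f:S_0\to S_0$ be a holomorphic branched covering of finite degree $d>1$ (a proper holomorphic map for which every point that is not a critical value has exactly $d$ preimages). Let $\bar S_\infty=\{x=(x_1,x_2,\dots): x_n\in S_0,\ f(x_{n+1})=x_n \text{ for all } n\}$ be the standard inverse limit, with the Tychonoff topology. The plaque inverse limit $S_\infty$ is the same set with the topology that has as a base the connected components of the open subsets of $\bar S_\infty$. For $U\subset S_\infty$ write $U_n=\{x_n : x\in U\}$. Let $I$ be the Boolean algebra of binary sequences modulo changes in finitely many places, ordered by $[b]\le[a]$ iff $b_n\le a_n$ for all but finitely many $n$, with minimal element $\mathbf 0=[0,0,0,\dots]$; put $\alpha(a)=\{b\in I: b\le a\}$. For an open set $U\subset S_\infty$ and a critical point $c$ of $f$, let $\mathrm{ind}(U,c)\in I$ be the class of the sequence whose $n$-th entry is $1$ iff $c\in U_n$. The signature of $x\in S_\infty$ with respect to $c$ is $$\mathrm{sign}(x,c)=\bigcap_{U}\alpha(\mathrm{ind}(U,c)),$$ where $U$ ranges over the open neighborhoods of $x$ in $S_\infty$ (equivalently,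 over any sequence of open neighborhoods shrinking to $x$). It is nontrivial if $\mathrm{sign}(x,c)\neq\{\mathbf 0\}$. Theorem. For every $x\in S_\infty$ the following are equivalent: (1) the signature of $x$ with respect to some critical point $c$ of $f$ is nontrivial; (2) there is an open neighborhood $U$ of $x$ in $S_\infty$ such that for every open neighborhood $W\subset U$ of $x$, deleting $x$ from $W$ breaks the path-component of $W$ containing $x$ into uncountably many path-components, i.e. if $P$ is that path-component, then $P\setminus\{x\}$ has uncountably many path-components; (3) there is an open neighborhood $U$ of $x$ in $S_\infty$ such that the property in (2) holds for every connected open neighborhood $W\subset U$ of $x$. -/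

import Mathlib

open Set Filter Topology
open scoped Manifold ContDiff

noncomputable section

/-! ### The three simply connected Riemann surfaces -/

/-- The Riemann sphere, as a topological space. -/
abbrev RiemannSphere : Type := OnePoint ℂ

namespace RiemannSphere

/-- The inversion `z ↦ 1 / z`, which exchanges `0` and `∞`. -/
def inv (p : RiemannSphere) : RiemannSphere :=
  p.elim ((0 : ℂ) : OnePoint ℂ)
    (fun z => if z = 0 then OnePoint.infty else ((z⁻¹ : ℂ) : OnePoint ℂ))

theorem inv_infty : inv OnePoint.infty = ((0 : ℂ) : OnePoint ℂ) := rfl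

theorem inv_zero : inv ((0 : ℂ) : OnePoint ℂ) = OnePoint.infty := by
  simp [inv]

theorem inv_coe {z : ℂ} (hz : z ≠ 0) :
    inv (z : OnePoint ℂ) = ((z⁻¹ : ℂ) : OnePoint ℂ) := by
  simp [inv, hz]

theorem inv_inv (p : RiemannSphere) : inv (inv p) = p := by
  induction p using OnePoint.rec with
  | infty => rw [inv_infty, inv_zero]
  | coe z =>
    by_cases hz : z = 0
    · subst hz; rw [inv_zero, inv_infty]
    · rw [inv_coe hz, inv_coe (inv_ne_zero hz), _root_.inv_inv]

theorem continuous_inv : Continuous inv := by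
  rw [OnePoint.continuous_iff]
  constructor
  · rw [inv_infty]
    have h1 : Tendsto (fun z : ℂ => ((z⁻¹ : ℂ) : OnePoint ℂ)) (coclosedCompact ℂ)
        (𝓝 ((0 : ℂ) : OnePoint ℂ)) := by
      refine (OnePoint.continuous_coe.tendsto (0 : ℂ)).comp ?_
      rw [coclosedCompact_eq_cocompact]
      simpa [Metric.cobounded_eq_cocompact] using (tendsto_inv₀_cobounded (α := ℂ))
    refine h1.congr' ?_
    have h2 : ∀ᶠ z : ℂ in coclosedCompact ℂ, z ≠ 0 := by
      rw [coclosedCompact_eq_cocompact]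
      exact (isCompact_singleton (x := (0 : ℂ))).compl_mem_cocompact
    filter_upwards [h2] with z hz
    exact (inv_coe hz).symm
  · rw [continuous_iff_continuousAt]
    intro z
    by_cases hz : z = 0
    · subst hz
      have h0 : ContinuousAt (fun z : ℂ => inv (z : OnePoint ℂ)) 0 := by
        rw [continuousAt_iff_punctured_nhds, inv_zero]
        have h1 : Tendsto (fun z : ℂ => ((z⁻¹ : ℂ) : OnePoint ℂ)) (𝓝[≠] (0 : ℂ))
            (𝓝 OnePoint.infty) := by
          refine OnePoint.tendsto_coe_infty.comp ?_
          rw [coclosedCompact_eq_cocompact, ← Metric.cobounded_eq_cocompact]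
          exact tendsto_inv₀_nhdsNE_zero
        refine h1.congr' ?_
        filter_upwards [self_mem_nhdsWithin] with z hz
        exact (inv_coe hz).symm
      exact h0
    · have h1 : ContinuousAt (fun z : ℂ => ((z⁻¹ : ℂ) : OnePoint ℂ)) z :=
        OnePoint.continuous_coe.continuousAt.comp (continuousAt_inv₀ hz)
      refine h1.congr ?_
      filter_upwards [isOpen_ne.mem_nhds hz] with w hw
      exact (inv_coe hw).symm

/-- The inversion as a homeomorphism of the sphere. -/
def invHomeo : RiemannSphere ≃ₜ RiemannSphere where
  toFun := inv
  invFun := inv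
  left_inv := inv_inv
  right_inv := inv_inv
  continuous_toFun := continuous_inv
  continuous_invFun := continuous_inv

/-- The chart `z ↦ z` on the complement of `∞`. -/
def chartZero : OpenPartialHomeomorph RiemannSphere ℂ :=
  (OnePoint.isOpenEmbedding_coe (X := ℂ)).toOpenPartialHomeomorph.symm

/-- The chart `z ↦ 1 / z` on the complement of `0`. -/
def chartInfty : OpenPartialHomeomorph RiemannSphere ℂ :=
  invHomeo.toOpenPartialHomeomorph.trans chartZero

theorem chartZero_source : chartZero.source = {OnePoint.infty}ᶜ := by
  simp [chartZero, OnePoint.compl_infty]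

theorem chartZero_coe (z : ℂ) : chartZero (z : OnePoint ℂ) = z := by
  have h := (OnePoint.isOpenEmbedding_coe (X := ℂ)).toOpenPartialHomeomorph.left_inv
    (x := z) (by simp)
  simpa [chartZero] using h

theorem chartZero_symm (z : ℂ) : chartZero.symm z = (z : OnePoint ℂ) := by
  simp [chartZero]

instance : ChartedSpace ℂ RiemannSphere where
  atlas := {chartZero, chartInfty}
  chartAt p := open Classical in if p = OnePoint.infty then chartInfty else chartZero
  mem_chart_source p := by
    split_ifs with h
    · subst h
      simp [chartInfty, chartZero_source, invHomeo, inv_infty]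
    · simpa [chartZero_source] using h
  chart_mem_atlas p := by
    split_ifs <;> simp

instance : IsManifold 𝓘(ℂ) ω RiemannSphere := by
  have key : ∀ g : ℂ → ℂ, ∀ s : Set ℂ, (∀ z ∈ s, z ≠ 0 ∧ g z = z⁻¹) →
      ContDiffOn ℂ ω g s := by
    intro g s h
    refine ContDiffOn.congr (f := fun z => z⁻¹) ?_ (fun z hz => (h z hz).2)
    exact fun z hz => (contDiffAt_inv ℂ (h z hz).1).contDiffWithinAt
  apply isManifold_of_contDiffOn
  rintro e e' (rfl | rfl) (rfl | rfl)
  · refine contDiffOn_id.congr fun z _ => ?_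
    simp [chartZero_symm, chartZero_coe]
  · refine key _ _ fun z hz => ?_
    have hz0 : z ≠ 0 := by
      rintro rfl
      simp [chartInfty, invHomeo, chartZero_symm, chartZero_source, inv_zero] at hz
    refine ⟨hz0, ?_⟩
    simp [chartInfty, invHomeo, chartZero_symm, inv_coe hz0, chartZero_coe]
  · refine key _ _ fun z hz => ?_
    have hz0 : z ≠ 0 := by
      rintro rfl
      simp [chartInfty, invHomeo, chartZero_symm, chartZero_source, inv_zero] at hz
    refine ⟨hz0, ?_⟩
    simp [chartInfty, invHomeo, chartZero_symm, inv_coe hz0, chartZero_coe]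
  · refine contDiffOn_id.congr fun z _ => ?_
    simp [chartInfty, invHomeo, chartZero_symm, inv_inv, chartZero_coe]

end RiemannSphere

/-- The open unit disk, as an open subset of the plane. -/
def unitDisk : TopologicalSpace.Opens ℂ := ⟨Metric.ball 0 1, Metric.isOpen_ball⟩

/-- `S` is conformally equivalent to the unit disk, to the complex plane or to the Riemann
sphere. -/
def IsDiskPlaneOrSphere (S : Type*) [TopologicalSpace S] [ChartedSpace ℂ S] : Prop :=
  Nonempty (Diffeomorph 𝓘(ℂ) 𝓘(ℂ) S unitDisk ω) ∨
  Nonempty (Diffeomorph 𝓘(ℂ) 𝓘(ℂ) S ℂ ω) ∨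
  Nonempty (Diffeomorph 𝓘(ℂ) 𝓘(ℂ) S RiemannSphere ω)

/-! ### Branched coverings -/

section BranchedCovering

variable {S : Type*} [TopologicalSpace S] [ChartedSpace ℂ S]

/-- `c` is a critical point of `f`: the derivative of `f` vanishes at `c`. -/
def IsCriticalPoint (f : S → S) (c : S) : Prop :=
  mfderiv 𝓘(ℂ) 𝓘(ℂ) f c = 0

/-- `f` is a holomorphic branched covering of (finite) degree `d`: a proper holomorphic map
such that each point that is not a critical value has exactly `d` preimages. -/
structure IsBranchedCovering (f : S → S) (d : ℕ) : Prop where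
  holomorphic : MDifferentiable 𝓘(ℂ) 𝓘(ℂ) f
  proper : IsProperMap f
  degree : ∀ y, (∀ z, f z = y → ¬ IsCriticalPoint f z) → (f ⁻¹' {y}).ncard = d

end BranchedCovering

/-! ### The plaque inverse limit -/

/-- The inverse limit of `S ← S ← S ← ⋯` (all maps being `f`) in the category of topological
spaces: the sequences `x` with `f (x (n + 1)) = x n`, with the Tychonoff topology. Coordinates
are numbered from `0`. -/
abbrev StandardInverseLimit {S : Type*} (f : S → S) : Type _ :=
  {x : ℕ → S // ∀ n, f (x (n + 1)) = x n}

/-- The underlying set of the plaque inverse limit is that of the standard inverse limit. -/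
def PlaqueInverseLimit {S : Type*} (f : S → S) : Type _ := StandardInverseLimit f

namespace PlaqueInverseLimit

variable {S : Type*} {f : S → S}

/-- The canonical projection onto the `n`-th coordinate. -/
def proj (n : ℕ) (x : PlaqueInverseLimit f) : S := Subtype.val x n

variable [TopologicalSpace S]

/-- The connected components of the open sets of the standard inverse limit. -/
def components (f : S → S) : Set (Set (StandardInverseLimit f)) :=
  {C | ∃ O : Set (StandardInverseLimit f), IsOpen O ∧ ∃ x ∈ O, C = connectedComponentIn O x}

/-- The plaque topology: the connected components of the open sets of the standard inverse
limit form a base of it. -/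
abbrev plaqueTopology (f : S → S) : TopologicalSpace (StandardInverseLimit f) :=
  TopologicalSpace.generateFrom (components f)

theorem isTopologicalBasis_components (f : S → S) :
    @TopologicalSpace.IsTopologicalBasis _ (plaqueTopology f) (components f) := by
  refine @TopologicalSpace.IsTopologicalBasis.mk _ (plaqueTopology f) _ ?_ ?_ rfl
  · rintro _ ⟨O₁, hO₁, x₁, hx₁, rfl⟩ _ ⟨O₂, hO₂, x₂, hx₂, rfl⟩ x ⟨h₁, h₂⟩
    have hx : x ∈ O₁ ∩ O₂ :=
      ⟨connectedComponentIn_subset _ _ h₁, connectedComponentIn_subset _ _ h₂⟩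
    refine ⟨_, ⟨O₁ ∩ O₂, hO₁.inter hO₂, x, hx, rfl⟩, mem_connectedComponentIn hx, ?_⟩
    rw [connectedComponentIn_eq h₁, connectedComponentIn_eq h₂]
    exact subset_inter (connectedComponentIn_mono _ inter_subset_left)
      (connectedComponentIn_mono _ inter_subset_right)
  · exact eq_univ_of_forall fun x =>
      ⟨_, ⟨univ, isOpen_univ, x, mem_univ _, rfl⟩, mem_connectedComponentIn (mem_univ _)⟩

instance : TopologicalSpace (PlaqueInverseLimit f) := plaqueTopology f

end PlaqueInverseLimit

/-! ### Signatures -/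

/-- The Boolean algebra of binary sequences modulo almost equality (that is, up to changes in
finitely many places). In it `[b] ≤ [a]` if and only if `b n ≤ a n` for all but finitely many
`n`, and `⊥` is the class `[0, 0, 0, …]`. -/
abbrev BinaryClass : Type := Germ (cofinite : Filter ℕ) Bool

/-- `α(a)`, the set of all classes below `a`. -/
def alpha (a : BinaryClass) : Set BinaryClass := {b | b ≤ a}

section Signature

variable {S : Type*} {f : S → S}

open Classical in
/-- The index of `U` with respect to `c`: the class of the sequence with `1` in the `n`-th place
if and only if `c` belongs to the `n`-th projection of `U`. -/
def ind (U : Set (PlaqueInverseLimit f)) (c : S) : BinaryClass :=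
  ((fun n => decide (c ∈ PlaqueInverseLimit.proj n '' U) : ℕ → Bool) : BinaryClass)

theorem ind_mono {U V : Set (PlaqueInverseLimit f)} (h : U ⊆ V) (c : S) :
    ind U c ≤ ind V c := by
  refine Germ.coe_le.2 (Eventually.of_forall fun n => ?_)
  by_cases hc : c ∈ PlaqueInverseLimit.proj n '' U
  · have hc' := image_mono h hc
    simp only [hc, hc', le_refl]
  · simp only [hc, decide_false, Bool.false_le]

variable [TopologicalSpace S]

/-- The signature of `x` with respect to `c`: the intersection of the sets `α(ind(U, c))` over
the open neighbourhoods `U` of `x`. By `sign_eq_of_shrinking` it is the same to intersect over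
any sequence of open neighbourhoods that shrinks to `x`. -/
def sign (x : PlaqueInverseLimit f) (c : S) : Set BinaryClass :=
  ⋂ (U : Set (PlaqueInverseLimit f)) (_ : IsOpen U) (_ : x ∈ U), alpha (ind U c)

/-- A sequence of open neighbourhoods of `x` that shrinks to `x`. -/
structure ShrinksTo {X : Type*} [TopologicalSpace X] (U : ℕ → Set X) (x : X) : Prop where
  isOpen : ∀ j, IsOpen (U j)
  mem : ∀ j, x ∈ U j
  anti : ∀ j, U (j + 1) ⊆ U j
  exists_subset : ∀ V, IsOpen V → x ∈ V → ∃ m, U m ⊆ V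

theorem sign_eq_of_shrinking {x : PlaqueInverseLimit f} {U : ℕ → Set (PlaqueInverseLimit f)}
    (hU : ShrinksTo U x) (c : S) : sign x c = ⋂ j, alpha (ind (U j) c) := by
  ext b
  simp only [sign, mem_iInter, alpha, mem_ofPred_eq]
  constructor
  · exact fun h j => h (U j) (hU.isOpen j) (hU.mem j)
  · intro h V hV hxV
    obtain ⟨m, hm⟩ := hU.exists_subset V hV hxV
    exact (h m).trans (ind_mono hm c)

end Signature

/-! ### Breaking a path component -/

/-- Deleting `x` from `W` breaks the path component of `W` that contains `x` into uncountably
many path components. -/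
def BreaksUncountably {X : Type*} [TopologicalSpace X] (W : Set X) (x : X) : Prop :=
  Uncountable (ZerothHomotopy ↥(pathComponentIn W x \ {x}))

end

/-!
Signatures and the breaking of path components in plaque inverse limits.

Most of the argument is topological: a branched covering `f` of degree greater than one is proper,
open and finite-to-one, its critical points are the points near which it is not injective, and
there are finitely many of them (`IsBranchedCovering.isTopBranched`). The finiteness is an
inversion at infinity on the plane, a Blaschke factorization on the disk, and compactness on the
sphere. Fix `x` and a coordinate `e` at `x 0` which maps onto a neighbourhood of the closed unit
disk. The components `levelComp f x (disc e r) n` of the preimages of small discs under `f^[n]`,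
taken around the coordinates of `x`, fit together to plaques, which are a base of connected
neighbourhoods of `x` (`isPreconnected_plaque`, `exists_plaque_subset`). In these terms the
signature of `x` with respect to `c` is nontrivial if and only if, for each disc, `c` lies in the
components of infinitely many levels (`sign_ne_bot_iff`).

*Trivial signatures.* Since there are finitely many critical points, the components around a small
disc contain none of them from some level on. Beyond that level they are mapped homeomorphically,
so `x` has small neighbourhoods homeomorphic to a disc (`exists_limit_section`). These remain path
connected without `x`, and do not break (`exists_connected_not_breaksUncountably`).

*A nontrivial signature.* A Cantor family of arms ending at `x` is constructed. The radii
`r j` tend to `0`; there are levels `n j`, and on the level `n j` two points `a j false`, `a j true` of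
the boundary of the component, over the point `r j` of the positive radius. A binary sequence `ε`
selects one of the two points for each `j`. Paths which join the selected points to each other on
the levels `n j`, off the countable postcritical set, project to base paths which are lifted to the
inverse limit. They are corrected so that they fit together at all levels (`exists_coherent`) and
form an arm from `x` (`IsArmSystem.exists_arms`, `joinedIn_of_infinite_concatenation`). A path
which joins the ends of two arms off `x` is compact, so it avoids a small disc on all high levels;
together with parts of the arms it joins far points of the two arms outside their disc
(`IsArmFamily.exists_joinedIn`). It suffices to show that, for a suitable choice of the pairs, each
arm is joined off `x` to countably many others only (`breaksUncountably_of_countable_classes`).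
There are two cases.

If for each disc there are infinitely many components with disconnected complement, then there are
boundary points `a j false` and `a j true` which the complement of the component separates
(`exists_endpoints_not_joinedIn`). Arms which are joined off `x` then have binary sequences that
agree from some point on (`IsArmFamily.countable_of_not_joinedIn`).

Otherwise the components around some disc have connected complements on all high levels. The
critical point gives pairs `a j false`, `a j true` with the same image on the level of the
preceding pair (`exists_endpoints_iterate_eq`), so that a point of an arm determines all points
further in, and the terms of the sequence from its place on. Because the surface is a
disk, a plane or a sphere, a connected complement means that all loops around the component are
measured by one index. To each of two radii of the disc there belongs a function `Θ` on the
surface, equal to `1` away from the lifts of this radius that begin at the component, whose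
argument counts the crossings of these lifts (`exists_isCrossingFunction`). A path which misses the
lifts of one of the radii makes at most one turn around the component, and its turn is comparable
for the two radii. Thus a path outside the component whose projection alternates at most `N` times
between the two radii makes at most `24 * N` turns (`exists_turn_of_path`). The number `N` belongs
to the projection to the base and does not depend on the level. Therefore one number of turns
serves for infinitely many levels, and far points of arms that are joined off `x` differ by an
integral number of turns along a circle in the inverse limit (`exists_int_turn`). There are
countably many such numbers (`IsArmFamily.countable_of_isPreconnected_compl`).
-/

set_option linter.unusedSectionVars false

/-! ### Components of preimages -/

section ComponentsOfPreimages

variable {X Y : Type*} [TopologicalSpace X] [TopologicalSpace Y]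

theorem mem_connectedComponentIn_of_mem_closure {A : Set X} {z w : X}
    (hw : w ∈ closure (connectedComponentIn A z)) (hwA : w ∈ A) :
    w ∈ connectedComponentIn A z := by
  by_cases hz : z ∈ A
  · have hsub : insert w (connectedComponentIn A z) ⊆ A :=
      insert_subset hwA (connectedComponentIn_subset A z)
    have hpre : IsPreconnected (insert w (connectedComponentIn A z)) :=
      isPreconnected_connectedComponentIn.subset_closure (subset_insert _ _)
        (insert_subset hw subset_closure)
    exact hpre.subset_connectedComponentIn (mem_insert_of_mem _ (mem_connectedComponentIn hz))
      hsub (mem_insert _ _)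
  · rw [connectedComponentIn_eq_empty hz] at hw
    simp at hw

theorem connectedComponentIn_preimage_eq {f : X → Y} (hf : Continuous f) {A : Set Y} {z : X}
    (hz : f z ∈ A) :
    connectedComponentIn (f ⁻¹' A) z =
      connectedComponentIn (f ⁻¹' connectedComponentIn A (f z)) z := by
  apply Subset.antisymm
  · refine isPreconnected_connectedComponentIn.subset_connectedComponentIn
      (mem_connectedComponentIn hz) (image_subset_iff.1 ?_)
    refine (isPreconnected_connectedComponentIn.image f hf.continuousOn).subset_connectedComponentIn
      (mem_image_of_mem f (mem_connectedComponentIn hz)) ?_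
    exact image_subset_iff.2 (connectedComponentIn_subset _ _)
  · exact connectedComponentIn_mono _ (preimage_mono (connectedComponentIn_subset _ _))

/-- A proper open map carries each component of the preimage of a connected open set onto that
set. -/
theorem image_connectedComponentIn_preimage [LocallyConnectedSpace X] {f : X → Y}
    (hc : Continuous f) (ho : IsOpenMap f) (hcl : IsClosedMap f) {V : Set Y} (hV : IsOpen V)
    (hVc : IsPreconnected V) {z : X} (hz : f z ∈ V) :
    f '' connectedComponentIn (f ⁻¹' V) z = V := by
  apply Subset.antisymm (image_subset_iff.2 (connectedComponentIn_subset _ _))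
  have hopen : IsOpen (connectedComponentIn (f ⁻¹' V) z) :=
    (hV.preimage hc).connectedComponentIn
  refine hVc.subset_of_closure_inter_subset (ho _ hopen)
    ⟨f z, hz, mem_image_of_mem f (mem_connectedComponentIn hz)⟩ ?_
  rintro y ⟨hy, hyV⟩
  obtain ⟨w, hw, rfl⟩ := hcl.closure_image_subset _ hy
  exact mem_image_of_mem f (mem_connectedComponentIn_of_mem_closure hw hyV)

end ComponentsOfPreimages

/-! ### Topological branched coverings -/

section Branched

variable {S : Type*} [TopologicalSpace S]

/-- The topological critical points of `f`: those near which `f` is not injective. -/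
def branchSet {S T : Type*} [TopologicalSpace S] (f : S → T) : Set S :=
  {c | ∀ U ∈ 𝓝 c, ¬ InjOn f U}

/-- The topological properties of a holomorphic branched covering of finite degree. -/
structure IsTopBranched (f : S → S) : Prop where
  proper : IsProperMap f
  isOpenMap : IsOpenMap f
  surjective : Function.Surjective f
  finite_fiber : ∀ y, (f ⁻¹' {y}).Finite
  finite_branchSet : (branchSet f).Finite

namespace IsTopBranched

variable {f : S → S} (hf : IsTopBranched f)
include hf

theorem continuous : Continuous f := hf.proper.continuous

theorem proper_iterate (n : ℕ) : IsProperMap f^[n] := by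
  induction n with
  | zero => exact isProperMap_id
  | succ n ih => exact ih.comp hf.proper

theorem continuous_iterate (n : ℕ) : Continuous f^[n] := hf.continuous.iterate n

theorem isOpenMap_iterate (n : ℕ) : IsOpenMap f^[n] := by
  induction n with
  | zero => exact IsOpenMap.id
  | succ n ih => exact ih.comp hf.isOpenMap

theorem surjective_iterate (n : ℕ) : Function.Surjective f^[n] := hf.surjective.iterate n

theorem finite_preimage_iterate (n : ℕ) {A : Set S} (hA : A.Finite) : (f^[n] ⁻¹' A).Finite := by
  induction n with
  | zero => exact hA
  | succ n ih =>
    rw [Function.iterate_succ, preimage_comp]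
    rw [← biUnion_of_singleton (f^[n] ⁻¹' A), preimage_iUnion₂]
    exact ih.biUnion fun y _ => hf.finite_fiber y

theorem countable_preimage_iterate (n : ℕ) {A : Set S} (hA : A.Countable) :
    (f^[n] ⁻¹' A).Countable := by
  rw [← biUnion_of_singleton A, preimage_iUnion₂]
  exact hA.biUnion fun y _ => (hf.finite_preimage_iterate n (finite_singleton y)).countable

end IsTopBranched

end Branched

/-! ### The plaque topology -/

section Plaque

variable {S : Type*} [TopologicalSpace S] {f : S → S}

namespace StandardInverseLimit

theorem iterate_apply (x : StandardInverseLimit f) (m n : ℕ) : f^[m] (x.1 (n + m)) = x.1 n := by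
  induction m with
  | zero => rfl
  | succ m ih => rw [Function.iterate_succ_apply, ← add_assoc, x.2, ih]

theorem iterate_apply_zero (x : StandardInverseLimit f) (n : ℕ) : f^[n] (x.1 n) = x.1 0 := by
  simpa using iterate_apply x n 0

theorem iterate_sub_apply (x : StandardInverseLimit f) {m n : ℕ} (h : n ≤ m) :
    f^[m - n] (x.1 m) = x.1 n := by
  obtain ⟨k, rfl⟩ := Nat.exists_eq_add_of_le h
  simpa using iterate_apply x k n

theorem continuous_coord (n : ℕ) : Continuous fun x : StandardInverseLimit f => x.1 n :=
  (continuous_apply n).comp continuous_subtype_val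

theorem continuous_iff_coord {X : Type*} [TopologicalSpace X] {g : X → StandardInverseLimit f} :
    Continuous g ↔ ∀ n, Continuous fun t => (g t).1 n := by
  rw [continuous_induced_rng, continuous_pi_iff]
  rfl

theorem exists_eq_of_infinite {x y : StandardInverseLimit f} (h : ∀ N, ∃ n ≥ N, x.1 n = y.1 n) :
    x = y := by
  refine Subtype.ext (funext fun n => ?_)
  obtain ⟨m, hm, he⟩ := h n
  rw [← iterate_sub_apply x hm, ← iterate_sub_apply y hm, he]

/-- Every neighbourhood in the inverse limit depends on one coordinate only. -/
theorem exists_coord_subset (hf : Continuous f) {O : Set (StandardInverseLimit f)} (hO : IsOpen O)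
    {x : StandardInverseLimit f} (hx : x ∈ O) (n : ℕ) :
    ∃ N ≥ n, ∃ G : Set S, IsOpen G ∧ x.1 N ∈ G ∧ ∀ y : StandardInverseLimit f, y.1 N ∈ G → y ∈ O := by
  obtain ⟨O', hO', rfl⟩ := isOpen_induced_iff.1 hO
  obtain ⟨I, u, hu, hsub⟩ := isOpen_pi_iff.1 hO' x.1 hx
  obtain ⟨N, hN⟩ : ∃ N, ∀ i ∈ I, i ≤ N := ⟨I.sup id, fun i hi => Finset.le_sup (f := id) hi⟩
  refine ⟨max n N, le_max_left _ _, ⋂ i ∈ I, f^[max n N - i] ⁻¹' u i, ?_, ?_, ?_⟩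
  · exact isOpen_biInter_finset fun i hi => (hu i hi).1.preimage (hf.iterate _)
  · simp only [mem_iInter, mem_preimage]
    intro i hi
    rw [iterate_sub_apply x ((hN i hi).trans (le_max_right _ _))]
    exact (hu i hi).2
  · intro y hy
    simp only [mem_iInter, mem_preimage] at hy
    refine hsub fun i hi => ?_
    have := hy i hi
    rwa [iterate_sub_apply y ((hN i hi).trans (le_max_right _ _))] at this

/-- The coordinates are proper: if one coordinate converges along an ultrafilter, then so do all the
others, since the iterates of `f` are proper. -/
theorem isProperMap_coord (hf : IsProperMap f) [T2Space S] (n : ℕ) :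
    IsProperMap fun x : StandardInverseLimit f => x.1 n := by
  have hit : ∀ m, IsProperMap f^[m] := fun m => by
    induction m with
    | zero => exact isProperMap_id
    | succ n ih => exact ih.comp hf
  rw [isProperMap_iff_ultrafilter]
  refine ⟨continuous_coord n, fun 𝒰 z hz => ?_⟩
  have key : ∀ m, ∃ w, Tendsto (fun x : StandardInverseLimit f => x.1 m) 𝒰 (𝓝 w) := by
    intro m
    rcases le_total n m with h | h
    · have h1 : Tendsto f^[m - n] (Ultrafilter.map (fun x : StandardInverseLimit f => x.1 m) 𝒰 :
          Filter S) (𝓝 z) := by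
        refine Filter.tendsto_map'_iff.2 (hz.congr fun x => ?_)
        exact (iterate_sub_apply x h).symm
      obtain ⟨w, -, hw⟩ := (isProperMap_iff_ultrafilter.1 (hit (m - n))).2 h1
      exact ⟨w, hw⟩
    · refine ⟨f^[n - m] z, ((((hit (n - m)).continuous).tendsto z).comp hz).congr fun x => ?_⟩
      exact iterate_sub_apply x h
  choose w hw using key
  have hcoh : ∀ m, f (w (m + 1)) = w m := fun m => by
    refine tendsto_nhds_unique ((hf.continuous.tendsto _).comp (hw (m + 1))) ((hw m).congr ?_)
    exact fun x => (x.2 m).symm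
  refine ⟨⟨w, hcoh⟩, tendsto_nhds_unique (hw n) hz, ?_⟩
  rw [nhds_induced, ← tendsto_iff_comap, tendsto_pi_nhds]
  exact hw

end StandardInverseLimit

open StandardInverseLimit

/-- The component of the preimage of `V` under the `n`-th iterate that contains the `n`-th
coordinate of `x`. -/
def levelComp (f : S → S) (x : StandardInverseLimit f) (V : Set S) (n : ℕ) : Set S :=
  connectedComponentIn (f^[n] ⁻¹' V) (x.1 n)

/-- The points of the inverse limit all of whose coordinates lie in the components
`levelComp f x V n`. For a connected open set `V` this is the component of the preimage of `V`
that contains `x`. -/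
def plaque (f : S → S) (x : StandardInverseLimit f) (V : Set S) : Set (StandardInverseLimit f) :=
  {y | ∀ n, y.1 n ∈ levelComp f x V n}

section LevelComp

variable {x : StandardInverseLimit f} {V : Set S} {n : ℕ}

theorem mem_levelComp (hx : x.1 0 ∈ V) (n : ℕ) : x.1 n ∈ levelComp f x V n :=
  mem_connectedComponentIn (by rwa [mem_preimage, iterate_apply_zero])

theorem mem_plaque (hx : x.1 0 ∈ V) : x ∈ plaque f x V := mem_levelComp hx

theorem iterate_mem_of_mem_levelComp {z : S} (hz : z ∈ levelComp f x V n) : f^[n] z ∈ V :=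
  connectedComponentIn_subset (f^[n] ⁻¹' V) _ hz

theorem levelComp_mono {V' : Set S} (h : V ⊆ V') (n : ℕ) : levelComp f x V n ⊆ levelComp f x V' n :=
  connectedComponentIn_mono _ (preimage_mono h)

theorem plaque_mono {V' : Set S} (h : V ⊆ V') : plaque f x V ⊆ plaque f x V' :=
  fun _ hy n => levelComp_mono h n (hy n)

theorem mem_levelComp_of_closure {z : S} (hz : z ∈ closure (levelComp f x V n))
    (hzV : f^[n] z ∈ V) : z ∈ levelComp f x V n :=
  mem_connectedComponentIn_of_mem_closure hz hzV

theorem isPreconnected_levelComp : IsPreconnected (levelComp f x V n) :=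
  isPreconnected_connectedComponentIn

theorem subset_levelComp {A : Set S} (hA : IsPreconnected A) (hAV : ∀ z ∈ A, f^[n] z ∈ V) {z : S}
    (hz : z ∈ A) (hz' : z ∈ levelComp f x V n) : A ⊆ levelComp f x V n := by
  rw [levelComp, connectedComponentIn_eq hz']
  exact hA.subset_connectedComponentIn hz hAV

theorem iterate_levelComp_subset (hf : Continuous f) (m n : ℕ) :
    f^[m] '' levelComp f x V (n + m) ⊆ levelComp f x V n := by
  by_cases hx : x.1 0 ∈ V
  · refine subset_levelComp (isPreconnected_levelComp.image _ (hf.iterate m).continuousOn) ?_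
      (mem_image_of_mem _ (mem_levelComp hx (n + m))) ?_
    · rintro _ ⟨z, hz, rfl⟩
      rw [← Function.iterate_add_apply]
      exact iterate_mem_of_mem_levelComp hz
    · rw [iterate_apply]
      exact mem_levelComp hx n
  · rw [levelComp, connectedComponentIn_eq_empty]
    · simp
    · rwa [mem_preimage, iterate_apply_zero]

theorem iterate_sub_mem_levelComp (hf : Continuous f) {m n : ℕ} (h : n ≤ m) {z : S}
    (hz : z ∈ levelComp f x V m) : f^[m - n] z ∈ levelComp f x V n := by
  obtain ⟨k, rfl⟩ := Nat.exists_eq_add_of_le h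
  simpa using iterate_levelComp_subset hf k n (mem_image_of_mem _ hz)

theorem iterate_sub_mem_closure_levelComp (hf : Continuous f) {m n : ℕ} (h : n ≤ m) {z : S}
    (hz : z ∈ closure (levelComp f x V m)) : f^[m - n] z ∈ closure (levelComp f x V n) := by
  obtain ⟨k, rfl⟩ := Nat.exists_eq_add_of_le h
  have := image_closure_subset_closure_image (hf.iterate k) (mem_image_of_mem _ hz)
  simpa using closure_mono (iterate_levelComp_subset hf k n) this

theorem closure_levelComp_subset (hf : Continuous f) : closure (levelComp f x V n) ⊆
    f^[n] ⁻¹' closure V :=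
  fun _ hz => closure_mono (image_subset_iff.2 (connectedComponentIn_subset _ _))
    (image_closure_subset_closure_image (hf.iterate n) (mem_image_of_mem _ hz))

theorem closure_levelComp_subset_levelComp (hf : Continuous f) {V' : Set S} (hV : closure V ⊆ V') :
    closure (levelComp f x V n) ⊆ levelComp f x V' n := fun _ hz =>
  mem_levelComp_of_closure (closure_mono (levelComp_mono (subset_closure.trans hV) n) hz)
    (hV (closure_levelComp_subset hf hz))

theorem mem_plaque_of_infinite (hf : Continuous f) {y : StandardInverseLimit f}
    (h : ∀ N, ∃ n ≥ N, y.1 n ∈ levelComp f x V n) : y ∈ plaque f x V := by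
  intro n
  obtain ⟨m, hm, hy⟩ := h n
  rw [← iterate_sub_apply y hm]
  exact iterate_sub_mem_levelComp hf hm hy

variable [LocallyConnectedSpace S]

theorem isOpen_levelComp (hf : Continuous f) (hV : IsOpen V) (n : ℕ) :
    IsOpen (levelComp f x V n) :=
  (hV.preimage (hf.iterate n)).connectedComponentIn

theorem image_levelComp_succ (hf : IsTopBranched f) (hV : IsOpen V)
    (hx : x.1 0 ∈ V) (n : ℕ) : f '' levelComp f x V (n + 1) = levelComp f x V n := by
  have h : levelComp f x V (n + 1) = connectedComponentIn (f ⁻¹' levelComp f x V n) (x.1 (n + 1)) := by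
    rw [levelComp, Function.iterate_succ, preimage_comp,
      connectedComponentIn_preimage_eq hf.continuous, x.2 n]
    · rfl
    · rwa [mem_preimage, x.2 n, iterate_apply_zero]
  rw [h]
  refine image_connectedComponentIn_preimage hf.continuous hf.isOpenMap hf.proper.isClosedMap
    (isOpen_levelComp hf.continuous hV n) isPreconnected_levelComp ?_
  rw [x.2 n]
  exact mem_levelComp hx n

/-- The components map onto each other, so each point of a component is a coordinate of a point of
the plaque. -/
theorem exists_mem_plaque (hf : IsTopBranched f) (hV : IsOpen V) (hx : x.1 0 ∈ V) {z : S}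
    (hz : z ∈ levelComp f x V n) : ∃ y ∈ plaque f x V, y.1 n = z := by
  have step : ∀ m, ∀ w ∈ levelComp f x V m, ∃ w' ∈ levelComp f x V (m + 1), f w' = w := by
    intro m w hw
    rwa [← image_levelComp_succ hf hV hx m] at hw
  choose! g hg hg' using step
  let u : ℕ → S := fun m => Nat.rec z (fun k w => g (n + k) w) m
  have hu : ∀ m, u m ∈ levelComp f x V (n + m) := fun m => by
    induction m with
    | zero => exact hz
    | succ m ih => exact hg (n + m) _ ih
  have hu' : ∀ m, f (u (m + 1)) = u m := fun m => hg' (n + m) _ (hu m)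
  let y : ℕ → S := fun m => if m ≤ n then f^[n - m] z else u (m - n)
  have hy : ∀ m, f (y (m + 1)) = y m := by
    intro m
    rcases lt_trichotomy m n with h | h | h
    · have : n - m = (n - (m + 1)) + 1 := by omega
      simp only [y, h.le, Nat.succ_le_of_lt h, if_true, this, Function.iterate_succ_apply']
    · subst h
      simp only [y, le_refl, if_true, Nat.not_succ_le_self, if_false, Nat.sub_self,
        Nat.add_sub_cancel_left]
      exact hu' 0
    · have h1 : ¬ m + 1 ≤ n := by omega
      have h2 : m + 1 - n = (m - n) + 1 := by omega
      simp only [y, h1, h.not_ge, if_false, h2]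
      exact hu' _
  refine ⟨⟨y, hy⟩, mem_plaque_of_infinite hf.continuous fun N => ⟨n + N + 1, by omega, ?_⟩, ?_⟩
  · have h1 : ¬ n + N + 1 ≤ n := by omega
    have h2 : n + N + 1 - n = N + 1 := by omega
    simp only [y, h1, if_false, h2]
    exact hu (N + 1)
  · simp [y]

end LevelComp

end Plaque

section PlaqueTopology

variable {S : Type*} [TopologicalSpace S] {f : S → S}

open StandardInverseLimit

variable [LocallyConnectedSpace S] [T2Space S] {x : StandardInverseLimit f} {V : Set S}

/-- A plaque is connected: each of the two parts of a separation of it would have full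
projections to all levels, hence would accumulate at `x`. -/
theorem isPreconnected_plaque (hf : IsTopBranched f) (hV : IsOpen V) (hx : x.1 0 ∈ V) :
    IsPreconnected (plaque f x V) := by
  intro u v hu hv huv hnu hnv
  by_contra hdis
  rw [not_nonempty_iff_eq_empty] at hdis
  have key : ∀ u v : Set (StandardInverseLimit f), IsOpen u → IsOpen v → plaque f x V ⊆ u ∪ v →
      (plaque f x V ∩ u).Nonempty → plaque f x V ∩ (u ∩ v) = ∅ → x ∉ v := by
    intro u v hu hv huv hnu hdis hxv
    -- the part `u` projects onto each component: its projection is open because `f` is, and closed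
    -- because the coordinates are proper
    have full : ∀ n, levelComp f x V n ⊆ (fun y : StandardInverseLimit f => y.1 n) ''
        (plaque f x V ∩ u) := by
      intro n
      refine isPreconnected_levelComp.subset_of_closure_inter_subset ?_ ?_ ?_
      · rw [isOpen_iff_mem_nhds]
        rintro _ ⟨y, ⟨hyP, hyu⟩, rfl⟩
        obtain ⟨N, hN, G, hG, hyG, hsub⟩ := exists_coord_subset hf.continuous hu hyu n
        have ho : IsOpen (f^[N - n] '' (G ∩ levelComp f x V N)) :=
          hf.isOpenMap_iterate _ _ (hG.inter (isOpen_levelComp hf.continuous hV N))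
        refine mem_of_superset (ho.mem_nhds ⟨y.1 N, ⟨hyG, hyP N⟩, iterate_sub_apply y hN⟩) ?_
        rintro _ ⟨w, ⟨hwG, hwN⟩, rfl⟩
        obtain ⟨y', hy', rfl⟩ := exists_mem_plaque hf hV hx hwN
        exact ⟨y', ⟨hy', hsub y' hwG⟩, (iterate_sub_apply y' hN).symm⟩
      · obtain ⟨y, hy⟩ := hnu
        exact ⟨y.1 n, hy.1 n, mem_image_of_mem _ hy⟩
      · rintro z ⟨hz, hzn⟩
        obtain ⟨y, hy, rfl⟩ :=
          (isProperMap_coord hf.proper n).isClosedMap.closure_image_subset _ hz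
        have hyP : y ∈ plaque f x V := by
          intro m
          refine mem_levelComp_of_closure ?_ ?_
          · have := image_closure_subset_closure_image (continuous_coord m)
              (mem_image_of_mem _ hy)
            refine closure_mono ?_ this
            rintro _ ⟨w, hw, rfl⟩
            exact hw.1 m
          · have := iterate_mem_of_mem_levelComp hzn
            rwa [iterate_apply_zero] at this ⊢
        have hyv : y ∉ v := fun hyv => by
          obtain ⟨w, hwv, hwP, hwu⟩ := mem_closure_iff.1 hy v hv hyv
          exact (hdis.subset ⟨hwP, hwu, hwv⟩ : w ∈ (∅ : Set _))
        exact ⟨y, ⟨hyP, (huv hyP).resolve_right hyv⟩, rfl⟩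
    obtain ⟨N, -, G, hG, hxG, hsub⟩ := exists_coord_subset hf.continuous hv hxv 0
    obtain ⟨y, ⟨hyP, hyu⟩, hyx⟩ := full N (mem_levelComp hx N)
    have hyv : y ∈ v := hsub y (by rw [show y.1 N = x.1 N from hyx]; exact hxG)
    exact (hdis.subset ⟨hyP, hyu, hyv⟩ : y ∈ (∅ : Set _))
  rcases huv (mem_plaque hx) with h | h
  · refine key v u hv hu (by rwa [union_comm]) hnv (by rwa [inter_comm v u]) h
  · exact key u v hu hv huv hnu hdis h

theorem plaque_eq_connectedComponentIn (hf : IsTopBranched f) (hV : IsOpen V) (hx : x.1 0 ∈ V) :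
    plaque f x V = connectedComponentIn ((fun y : StandardInverseLimit f => y.1 0) ⁻¹' V) x := by
  apply Subset.antisymm
  · exact (isPreconnected_plaque hf hV hx).subset_connectedComponentIn (mem_plaque hx)
      fun y hy => iterate_mem_of_mem_levelComp (hy 0)
  · intro y hy n
    refine subset_levelComp (isPreconnected_connectedComponentIn.image _
      (continuous_coord n).continuousOn) ?_ (mem_image_of_mem _ (mem_connectedComponentIn hx))
      (mem_levelComp hx n) (mem_image_of_mem _ hy)
    rintro _ ⟨w, hw, rfl⟩
    rw [iterate_apply_zero]
    exact connectedComponentIn_subset ((fun y : StandardInverseLimit f => y.1 0) ⁻¹' V) _ hw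

/-- The components of the preimages of small neighbourhoods are small. -/
theorem exists_levelComp_subset (hf : IsTopBranched f) (n : ℕ) {G : Set S} (hG : IsOpen G)
    (hxG : x.1 n ∈ G) : ∃ V, IsOpen V ∧ x.1 0 ∈ V ∧ ∀ V' ⊆ V, levelComp f x V' n ⊆ G := by
  have hfin := hf.finite_preimage_iterate n (finite_singleton (x.1 0))
  obtain ⟨A, B, hA, hB, hxA, hB', hAB⟩ : ∃ A B : Set S, IsOpen A ∧ IsOpen B ∧ x.1 n ∈ A ∧
      (f^[n] ⁻¹' {x.1 0}) \ {x.1 n} ⊆ B ∧ Disjoint A B := by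
    obtain ⟨A, B, hA, hB, h1, h2, h3⟩ := SeparatedNhds.of_isCompact_isCompact
      (isCompact_singleton (x := x.1 n)) (hfin.subset sdiff_subset : ((f^[n] ⁻¹' {x.1 0}) \
        {x.1 n}).Finite).isCompact disjoint_sdiff_right
    exact ⟨A, B, hA, hB, h1 rfl, h2, h3⟩
  have hU : IsOpen ((A ∩ G) ∪ B) := (hA.inter hG).union hB
  have hcl := (hf.proper_iterate n).isClosedMap _ hU.isClosed_compl
  refine ⟨_, hcl.isOpen_compl, ?_, fun V' hV' => ?_⟩
  · rintro ⟨w, hw, hwx⟩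
    refine hw ?_
    by_cases h : w = x.1 n
    · exact Or.inl (h ▸ ⟨hxA, hxG⟩)
    · exact Or.inr (hB' ⟨hwx, h⟩)
  · by_cases hx : x.1 0 ∈ V'
    · have hsub : levelComp f x V' n ⊆ (A ∩ G) ∪ B := by
        intro z hz
        by_contra hzU
        exact hV' (iterate_mem_of_mem_levelComp hz) (mem_image_of_mem _ hzU)
      refine (isPreconnected_levelComp.subset_left_of_subset_union (hA.inter hG) hB
        (hAB.mono_left inter_subset_left) hsub ⟨x.1 n, mem_levelComp hx n, hxA, hxG⟩).trans
        inter_subset_right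
    · rw [levelComp, connectedComponentIn_eq_empty]
      · simp
      · rwa [mem_preimage, iterate_apply_zero]

theorem isOpen_plaqueTopology_iff {W : Set (StandardInverseLimit f)} :
    IsOpen[PlaqueInverseLimit.plaqueTopology f] W ↔ ∀ y ∈ W, ∃ O : Set (StandardInverseLimit f),
      IsOpen O ∧ y ∈ O ∧ connectedComponentIn O y ⊆ W := by
  rw [@TopologicalSpace.IsTopologicalBasis.isOpen_iff _ (PlaqueInverseLimit.plaqueTopology f) _ _
    (PlaqueInverseLimit.isTopologicalBasis_components f)]
  refine forall₂_congr fun y hy => ⟨?_, ?_⟩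
  · rintro ⟨_, ⟨O, hO, z, hz, rfl⟩, hyz, hsub⟩
    refine ⟨O, hO, connectedComponentIn_subset _ _ hyz, ?_⟩
    rwa [← connectedComponentIn_eq hyz]
  · rintro ⟨O, hO, hyO, hsub⟩
    exact ⟨_, ⟨O, hO, y, hyO, rfl⟩, mem_connectedComponentIn hyO, hsub⟩

/-- The plaque topology is finer than the Tychonoff topology. -/
theorem isOpen_plaqueTopology_of_isOpen {O : Set (StandardInverseLimit f)} (hO : IsOpen O) :
    IsOpen[PlaqueInverseLimit.plaqueTopology f] O :=
  isOpen_plaqueTopology_iff.2 fun _ hy => ⟨O, hO, hy, connectedComponentIn_subset _ _⟩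

theorem isOpen_plaque (hf : IsTopBranched f) (hV : IsOpen V) (hx : x.1 0 ∈ V) :
    IsOpen[PlaqueInverseLimit.plaqueTopology f] (plaque f x V) := by
  rw [plaque_eq_connectedComponentIn hf hV hx]
  exact @TopologicalSpace.IsTopologicalBasis.isOpen _ (PlaqueInverseLimit.plaqueTopology f) _ _
    (PlaqueInverseLimit.isTopologicalBasis_components f) ⟨_, hV.preimage (continuous_coord 0), x, hx, rfl⟩

/-- The plaques of the small connected neighbourhoods of `x 0` form a neighbourhood base of `x`. -/
theorem exists_plaque_subset (hf : IsTopBranched f) {W : Set (StandardInverseLimit f)}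
    (hW : IsOpen[PlaqueInverseLimit.plaqueTopology f] W) (hxW : x ∈ W) :
    ∃ V, IsOpen V ∧ x.1 0 ∈ V ∧ ∀ V' ⊆ V, IsOpen V' → x.1 0 ∈ V' → plaque f x V' ⊆ W := by
  obtain ⟨O, hO, hxO, hsub⟩ := isOpen_plaqueTopology_iff.1 hW x hxW
  obtain ⟨N, -, G, hG, hxG, hGO⟩ := exists_coord_subset hf.continuous hO hxO 0
  obtain ⟨V, hV, hxV, hVG⟩ := exists_levelComp_subset hf N hG hxG
  refine ⟨V, hV, hxV, fun V' hV' hV'o hx' => Subset.trans ?_ hsub⟩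
  exact (isPreconnected_plaque hf hV'o hx').subset_connectedComponentIn (mem_plaque hx')
    fun y hy => hGO y (hVG V' hV' (hy N))

/-- A map from a locally connected space into the inverse limit is continuous for the plaque
topology as soon as its coordinates are continuous. -/
theorem continuous_plaqueTopology {X : Type*} [TopologicalSpace X] [LocallyConnectedSpace X]
    {g : X → StandardInverseLimit f} (hg : ∀ n, Continuous fun t => (g t).1 n) :
    Continuous[_, PlaqueInverseLimit.plaqueTopology f] g := by
  have hg' : Continuous g := continuous_iff_coord.2 hg
  refine continuous_def.2 fun W hW => isOpen_iff_mem_nhds.2 fun t ht => ?_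
  obtain ⟨O, hO, htO, hsub⟩ := isOpen_plaqueTopology_iff.1 hW (g t) ht
  have hmem : t ∈ g ⁻¹' O := htO
  refine mem_of_superset (((hO.preimage hg').connectedComponentIn).mem_nhds
    (mem_connectedComponentIn hmem)) fun s hs => hsub ?_
  refine (isPreconnected_connectedComponentIn.image g hg'.continuousOn).subset_connectedComponentIn
    (mem_image_of_mem g (mem_connectedComponentIn hmem)) ?_ (mem_image_of_mem g hs)
  exact image_subset_iff.2 (connectedComponentIn_subset _ _)

theorem continuous_proj (n : ℕ) : Continuous (PlaqueInverseLimit.proj n : PlaqueInverseLimit f → S) :=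
  continuous_def.2 fun _ hO => isOpen_plaqueTopology_of_isOpen (hO.preimage (continuous_coord n))

theorem image_proj_plaque (hf : IsTopBranched f) (hV : IsOpen V) (hx : x.1 0 ∈ V) (n : ℕ) :
    PlaqueInverseLimit.proj n '' (show Set (PlaqueInverseLimit f) from plaque f x V) =
      levelComp f x V n := by
  apply Subset.antisymm
  · rintro _ ⟨y, hy, rfl⟩
    exact hy n
  · intro z hz
    obtain ⟨y, hy, rfl⟩ := exists_mem_plaque hf hV hx hz
    exact ⟨y, hy, rfl⟩

end PlaqueTopology

/-! ### The signature through components -/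

section SignatureCriterion

variable {S : Type*} [TopologicalSpace S] {f : S → S}
  [LocallyConnectedSpace S] [T2Space S]

/-- The signature of `x` with respect to `c` is nontrivial if and only if `c` lies in infinitely
many of the components around the coordinates of `x`, for each neighbourhood of `x 0`. In one
direction a pseudo-intersection of a decreasing sequence of infinite sets is needed. -/
theorem sign_ne_bot_iff (hf : IsTopBranched f) (x : PlaqueInverseLimit f) (c : S)
    {V : ℕ → Set S} (hVo : ∀ j, IsOpen (V j)) (hxV : ∀ j, PlaqueInverseLimit.proj 0 x ∈ V j)
    (hanti : Antitone V) (hbasis : ∀ G, IsOpen G → PlaqueInverseLimit.proj 0 x ∈ G → ∃ j, V j ⊆ G) :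
    sign x c ≠ {⊥} ↔ ∀ j, ∀ N, ∃ n ≥ N, c ∈ levelComp f x (V j) n := by
  classical
  have hsh : ShrinksTo (fun j => (show Set (PlaqueInverseLimit f) from plaque f x (V j))) x := by
    refine ⟨fun j => isOpen_plaque hf (hVo j) (hxV j), fun j => mem_plaque (hxV j),
      fun j => plaque_mono (hanti (Nat.le_succ j)), fun W hW hxW => ?_⟩
    obtain ⟨G, hG, hxG, hsub⟩ := exists_plaque_subset hf hW hxW
    obtain ⟨j, hj⟩ := hbasis G hG hxG
    exact ⟨j, hsub _ hj (hVo j) (hxV j)⟩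
  have hind : ∀ j, ind (show Set (PlaqueInverseLimit f) from plaque f x (V j)) c =
      ((fun n => decide (c ∈ levelComp f x (V j) n) : ℕ → Bool) : BinaryClass) := by
    intro j
    unfold ind
    congr 1
    funext n
    rw [image_proj_plaque hf (hVo j) (hxV j) n]
  rw [sign_eq_of_shrinking hsh c]
  simp only [hind]
  constructor
  · intro hne j N
    by_contra hcon
    push Not at hcon
    refine hne (Subset.antisymm (fun b hb => ?_) ?_)
    · have h1 := mem_iInter.1 hb j
      refine le_bot_iff.1 (le_trans h1 (Germ.coe_le.2 ?_))
      rw [Nat.cofinite_eq_atTop]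
      filter_upwards [eventually_ge_atTop N] with n hn
      simp [hcon n hn]
    · rintro _ rfl
      refine mem_iInter.2 fun j => ?_
      rw [alpha, mem_ofPred_eq]
      exact bot_le
  · intro h heq
    -- a strictly increasing choice of levels `g j` at which `c` is met by the `j`-th components
    have hfreq : ∀ j, ∃ᶠ n in atTop, c ∈ levelComp f x (V j) n := fun j =>
      frequently_atTop.2 (h j)
    obtain ⟨g, hg, hgm⟩ := extraction_forall_of_frequently hfreq
    let b : ℕ → Bool := fun n => decide (∃ j, g j = n)
    have hb : (b : BinaryClass) ∈ ⋂ j, alpha ((fun n => decide (c ∈ levelComp f x (V j) n) :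
        ℕ → Bool) : BinaryClass) := by
      refine mem_iInter.2 fun j => Germ.coe_le.2 ?_
      rw [Nat.cofinite_eq_atTop]
      filter_upwards [eventually_ge_atTop (g j)] with n hn
      by_cases hbn : ∃ k, g k = n
      · obtain ⟨k, rfl⟩ := hbn
        have : c ∈ levelComp f x (V j) (g k) :=
          levelComp_mono (hanti (hg.le_iff_le.1 hn)) _ (hgm k)
        simp [this]
      · simp [b, hbn]
    rw [heq, mem_singleton_iff] at hb
    have hb' := Germ.coe_eq.1 (show (b : BinaryClass) = ((fun _ => false : ℕ → Bool) : BinaryClass) from hb)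
    rw [Nat.cofinite_eq_atTop] at hb'
    obtain ⟨M, hM⟩ := eventually_atTop.1 hb'
    have := hM (g M) (hg.id_le M)
    simp [b] at this

end SignatureCriterion

/-! ### A criterion for breaking -/

section Breaking

/-- A criterion for breaking: a Cantor family of points of the path component such that each of
them is joined to countably many others only. -/
theorem breaksUncountably_of_countable_classes {X : Type*} [TopologicalSpace X] {W : Set X} {x : X}
    (y : (ℕ → Bool) → X) (hy : ∀ ε, JoinedIn W x (y ε)) (hyx : ∀ ε, y ε ≠ x)
    (h : ∀ ε, {δ | JoinedIn (W \ {x}) (y ε) (y δ)}.Countable) : BreaksUncountably W x := by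
  let g : (ℕ → Bool) → ↥(pathComponentIn W x \ {x}) := fun ε => ⟨y ε, hy ε, hyx ε⟩
  by_contra hcon
  have hc : Countable (ZerothHomotopy ↥(pathComponentIn W x \ {x})) := by
    rwa [BreaksUncountably, not_uncountable_iff] at hcon
  have hsub : pathComponentIn W x \ {x} ⊆ W \ {x} := sdiff_subset_sdiff_left pathComponentIn_subset
  have huniv : (univ : Set (ℕ → Bool)) =
      ⋃ q : ZerothHomotopy ↥(pathComponentIn W x \ {x}), {δ | (Quotient.mk _ (g δ) : ZerothHomotopy _) = q} := by
    refine (eq_univ_of_forall fun δ => ?_).symm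
    exact mem_iUnion.2 ⟨(Quotient.mk _ (g δ) : ZerothHomotopy _), rfl⟩
  have hcount : (univ : Set (ℕ → Bool)).Countable := by
    rw [huniv]
    refine countable_iUnion fun q => ?_
    by_cases hne : ∃ ε, (Quotient.mk _ (g ε) : ZerothHomotopy _) = q
    · obtain ⟨ε, rfl⟩ := hne
      refine (h ε).mono fun δ hδ => ?_
      have hj : Joined (g δ) (g ε) := Quotient.exact hδ
      exact ((joinedIn_iff_joined (hsub (g δ).2) (hsub (g ε).2)).2
        (hj.map (continuous_inclusion hsub))).symm
    · push Not at hne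
      rw [show {δ | (Quotient.mk _ (g δ) : ZerothHomotopy _) = q} = ∅ from
        eq_empty_of_forall_notMem fun δ hδ => hne δ hδ]
      exact countable_empty
  have : Countable (ℕ → Bool) := countable_univ_iff.1 hcount
  obtain ⟨e, he⟩ := exists_surjective_nat (ℕ → Bool)
  obtain ⟨n, hn⟩ := he fun k => !(e k k)
  simpa using congr_fun hn n

end Breaking

/-! ### Complex analysis in one variable -/

section ComplexAnalysis

theorem finite_inter_of_locally_finite {X : Type*} [TopologicalSpace X] {K A : Set X}
    (hK : IsCompact K) (h : ∀ x ∈ K, ∃ U ∈ 𝓝 x, (U ∩ A).Finite) : (K ∩ A).Finite := by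
  refine hK.induction_on (p := fun s => (s ∩ A).Finite) (by simp)
    (fun s t hst ht => ht.subset (inter_subset_inter_left _ hst))
    (fun s t hs ht => by rw [union_inter_distrib_right]; exact hs.union ht) fun x hx => ?_
  obtain ⟨U, hU, hfin⟩ := h x hx
  exact ⟨U, mem_nhdsWithin_of_mem_nhds hU, hfin⟩

theorem exists_injOn_of_deriv_ne_zero {g : ℂ → ℂ} {z₀ : ℂ} (hg : AnalyticAt ℂ g z₀)
    (h : deriv g z₀ ≠ 0) : ∃ U ∈ 𝓝 z₀, InjOn g U := by
  have hs : HasStrictDerivAt g (deriv g z₀) z₀ := hg.hasStrictDerivAt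
  have hs' := hs.hasStrictFDerivAt_equiv h
  refine ⟨_, (hs'.toOpenPartialHomeomorph g).open_source.mem_nhds
    hs'.mem_toOpenPartialHomeomorph_source, ?_⟩
  exact (hs'.toOpenPartialHomeomorph g).injOn

/-- An injective holomorphic function has nonvanishing derivative: the inverse function is
holomorphic by removability of singularities. -/
theorem deriv_ne_zero_of_injOn {g : ℂ → ℂ} {z₀ : ℂ} (hg : AnalyticAt ℂ g z₀) {U : Set ℂ}
    (hU : U ∈ 𝓝 z₀) (hinj : InjOn g U) : deriv g z₀ ≠ 0 := by
  intro h0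
  have hnc : ¬ ∀ᶠ z in 𝓝 z₀, g z = g z₀ := by
    intro hc
    have h1 : ∀ᶠ z in 𝓝[≠] z₀, g z = g z₀ ∧ z ∈ U ∧ z ≠ z₀ := by
      filter_upwards [hc.filter_mono nhdsWithin_le_nhds, mem_nhdsWithin_of_mem_nhds hU,
        self_mem_nhdsWithin] with z h1 h2 h3
      exact ⟨h1, h2, h3⟩
    obtain ⟨z, h1, h2, h3⟩ := h1.exists
    exact h3 (hinj h2 (mem_of_mem_nhds hU) h1)
  have hder : ∀ᶠ z in 𝓝[≠] z₀, deriv g z ≠ 0 := by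
    refine (hg.deriv.eventually_eq_zero_or_eventually_ne_zero).resolve_left fun hz => hnc ?_
    obtain ⟨r, hr, hball⟩ := Metric.eventually_nhds_iff_ball.1 (hz.and hg.eventually_analyticAt)
    refine Metric.eventually_nhds_iff_ball.2 ⟨r, hr, fun z hz => ?_⟩
    refine (convex_ball z₀ r).is_const_of_fderivWithin_eq_zero (𝕜 := ℂ)
      (fun w hw => (hball w hw).2.differentiableAt.differentiableWithinAt) (fun w hw => ?_) hz
      (Metric.mem_ball_self hr)
    rw [fderivWithin_of_isOpen Metric.isOpen_ball hw]
    ext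
    simp [(hball w hw).1]
  obtain ⟨r, hr, hball⟩ := Metric.eventually_nhds_iff_ball.1
    ((eventually_nhdsWithin_iff.1 hder).and (hg.eventually_analyticAt.and hU))
  set B := Metric.ball z₀ r with hB
  have hinjB : InjOn g B := hinj.mono fun z hz => (hball z hz).2.2
  have hopen : ∀ z ∈ B, 𝓝 (g z) ≤ map g (𝓝 z) := by
    intro z hz
    refine (hball z hz).2.1.eventually_constant_or_nhds_le_map_nhds.resolve_left fun hc => ?_
    have h1 : ∀ᶠ w in 𝓝[≠] z, g w = g z ∧ w ∈ B ∧ w ≠ z := by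
      filter_upwards [hc.filter_mono nhdsWithin_le_nhds,
        mem_nhdsWithin_of_mem_nhds (Metric.isOpen_ball.mem_nhds hz), self_mem_nhdsWithin]
        with w h1 h2 h3
      exact ⟨h1, h2, h3⟩
    obtain ⟨w, h1, h2, h3⟩ := h1.exists
    exact h3 (hinjB h2 hz h1)
  -- the local inverse, which is holomorphic off `g z₀` and continuous there
  let k := Function.invFunOn g B
  have hk : ∀ z ∈ B, k (g z) = z := fun z hz => hinjB.leftInvOn_invFunOn hz
  have hkc : ∀ z ∈ B, ContinuousAt k (g z) := by
    intro z hz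
    have h1 : Tendsto (fun w => k (g w)) (𝓝 z) (𝓝 z) := by
      refine tendsto_id.congr' ?_
      filter_upwards [Metric.isOpen_ball.mem_nhds hz] with w hw
      exact (hk w hw).symm
    rw [ContinuousAt, hk z hz]
    exact (Filter.tendsto_map'_iff.2 h1).mono_left (hopen z hz)
  have hz₀ : z₀ ∈ B := Metric.mem_ball_self hr
  have himg : g '' B ∈ 𝓝 (g z₀) :=
    hopen z₀ hz₀ (image_mem_map (Metric.isOpen_ball.mem_nhds hz₀))
  have hkd : ∀ᶠ w in 𝓝[≠] (g z₀), DifferentiableAt ℂ k w := by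
    filter_upwards [mem_nhdsWithin_of_mem_nhds himg, self_mem_nhdsWithin]
    rintro _ ⟨z, hz, rfl⟩ hne
    have hzz : z ≠ z₀ := fun h => hne (by simp [h])
    refine (HasDerivAt.of_local_left_inverse (f := g) (f' := deriv g z) (hkc z hz)
      ?_ ((hball z hz).1 hzz) ?_).differentiableAt
    · rw [hk z hz]
      exact (hball z hz).2.1.differentiableAt.hasDerivAt
    · have : g '' B ∈ 𝓝 (g z) := hopen z hz (image_mem_map (Metric.isOpen_ball.mem_nhds hz))
      filter_upwards [this]
      rintro _ ⟨w, hw, rfl⟩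
      rw [hk w hw]
  have hka : AnalyticAt ℂ k (g z₀) :=
    Complex.analyticAt_of_differentiable_on_punctured_nhds_of_continuousAt hkd (hkc z₀ hz₀)
  have h1 : HasDerivAt (fun z => k (g z)) (deriv k (g z₀) * deriv g z₀) z₀ :=
    hka.differentiableAt.hasDerivAt.comp z₀ hg.differentiableAt.hasDerivAt
  have h2 : HasDerivAt (fun z => k (g z)) 1 z₀ := by
    refine (hasDerivAt_id z₀).congr_of_eventuallyEq ?_
    filter_upwards [Metric.isOpen_ball.mem_nhds hz₀] with w hw
    exact hk w hw
  have := h1.unique h2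
  simp [h0] at this

theorem finite_zeros_of_analyticOnNhd {g : ℂ → ℂ} {U K : Set ℂ} (hg : AnalyticOnNhd ℂ g U)
    (hU : IsPreconnected U) (hK : IsCompact K) (hKU : K ⊆ U) {z₀ : ℂ} (hz₀ : z₀ ∈ U)
    (hne : g z₀ ≠ 0) : (K ∩ {z | g z = 0}).Finite := by
  refine finite_inter_of_locally_finite hK fun z hz => ?_
  rcases (hg z (hKU hz)).eventually_eq_zero_or_eventually_ne_zero with h | h
  · exact absurd (hg.eqOn_zero_of_preconnected_of_eventuallyEq_zero hU (hKU hz) h hz₀) hne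
  · refine ⟨_, eventually_nhdsWithin_iff.1 h, (finite_singleton z).subset ?_⟩
    rintro w ⟨hw, hw0⟩
    by_contra hwz
    exact hw hwz hw0

/-- A proper entire function has finitely many critical points: at infinity it is, up to
inversion in the source and in the target, a nonconstant holomorphic function. -/
theorem finite_deriv_zeros_of_proper_entire {g : ℂ → ℂ} (hg : Differentiable ℂ g)
    (hp : Tendsto g (cocompact ℂ) (cocompact ℂ)) : {z | deriv g z = 0}.Finite := by
  rw [← Metric.cobounded_eq_cocompact] at hp
  have hinf : Tendsto (fun w : ℂ => g w⁻¹) (𝓝[≠] 0) (Bornology.cobounded ℂ) :=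
    hp.comp tendsto_inv₀_nhdsNE_zero
  -- the expression of `g` near infinity in the coordinate `1 / z`
  let u : ℂ → ℂ := fun w => if w = 0 then 0 else (g w⁻¹)⁻¹
  have hu : ∀ w ≠ 0, u w = (g w⁻¹)⁻¹ := fun w hw => if_neg hw
  have hne : ∀ᶠ w in 𝓝[≠] (0 : ℂ), g w⁻¹ ≠ 0 :=
    hinf.eventually (Bornology.eventually_ne_cobounded 0)
  have hder : ∀ w : ℂ, w ≠ 0 → g w⁻¹ ≠ 0 →
      HasDerivAt u (-(deriv g w⁻¹ * -(w ^ 2)⁻¹) / (g w⁻¹) ^ 2) w := by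
    intro w hw hgw
    have h1 : HasDerivAt (fun w : ℂ => (g w⁻¹)⁻¹) (-(deriv g w⁻¹ * -(w ^ 2)⁻¹) / (g w⁻¹) ^ 2) w :=
      (((hg w⁻¹).hasDerivAt).comp w (hasDerivAt_inv hw)).inv hgw
    refine h1.congr_of_eventuallyEq ?_
    filter_upwards [isOpen_ne.mem_nhds hw] with v hv
    exact hu v hv
  have hua : AnalyticAt ℂ u 0 := by
    refine Complex.analyticAt_of_differentiable_on_punctured_nhds_of_continuousAt ?_ ?_
    · filter_upwards [hne, self_mem_nhdsWithin] with w h1 h2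
      exact (hder w h2 h1).differentiableAt
    · rw [continuousAt_iff_punctured_nhds, show u 0 = 0 from if_pos rfl]
      refine (tendsto_inv₀_cobounded.comp hinf).congr' ?_
      filter_upwards [self_mem_nhdsWithin] with w hw
      exact (hu w hw).symm
  have hud : ∀ᶠ w in 𝓝[≠] (0 : ℂ), deriv u w ≠ 0 := by
    refine (hua.deriv.eventually_eq_zero_or_eventually_ne_zero).resolve_left fun hz => ?_
    obtain ⟨r, hr, hball⟩ := Metric.eventually_nhds_iff_ball.1 (hz.and hua.eventually_analyticAt)
    have hconst : ∀ w ∈ Metric.ball (0 : ℂ) r, u w = u 0 := fun w hw => by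
      refine (convex_ball (0 : ℂ) r).is_const_of_fderivWithin_eq_zero (𝕜 := ℂ)
        (fun w hw => (hball w hw).2.differentiableAt.differentiableWithinAt) (fun w hw => ?_) hw
        (Metric.mem_ball_self hr)
      rw [fderivWithin_of_isOpen Metric.isOpen_ball hw]
      ext
      simp [(hball w hw).1]
    have h1 : ∀ᶠ w in 𝓝[≠] (0 : ℂ), w ∈ Metric.ball (0 : ℂ) r ∧ w ≠ 0 ∧ g w⁻¹ ≠ 0 := by
      filter_upwards [hne, self_mem_nhdsWithin,
        mem_nhdsWithin_of_mem_nhds (Metric.ball_mem_nhds (0 : ℂ) hr)] with w h1 h2 h3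
      exact ⟨h3, h2, h1⟩
    obtain ⟨w, h1, h2, h3⟩ := h1.exists
    have := hconst w h1
    rw [hu w h2, show u 0 = 0 from if_pos rfl] at this
    exact h3 (inv_eq_zero.1 this)
  have hgd : ∀ᶠ z in Bornology.cobounded ℂ, deriv g z ≠ 0 := by
    have h1 : ∀ᶠ w in 𝓝[≠] (0 : ℂ), deriv g w⁻¹ ≠ 0 := by
      filter_upwards [hud, hne, self_mem_nhdsWithin] with w h1 h2 h3 h4
      refine h1 ?_
      rw [(hder w h3 h2).deriv, h4]
      simp
    have h2 : Tendsto (fun z : ℂ => z⁻¹) (Bornology.cobounded ℂ) (𝓝[≠] 0) := by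
      refine tendsto_nhdsWithin_iff.2 ⟨tendsto_inv₀_cobounded, ?_⟩
      filter_upwards [Bornology.eventually_ne_cobounded (0 : ℂ)] with z hz
      exact inv_ne_zero hz
    filter_upwards [h2.eventually h1] with z hz
    simpa using hz
  have hK := hgd
  rw [Metric.cobounded_eq_cocompact] at hK
  obtain ⟨K, hKc, hKs⟩ := mem_cocompact.1 hK
  obtain ⟨z₀, hz₀⟩ := hgd.exists
  have hfin := finite_zeros_of_analyticOnNhd (g := deriv g) (U := univ) (K := K)
    (fun z _ => (hg.analyticAt z).deriv) isPreconnected_univ hKc (subset_univ _) (mem_univ z₀) hz₀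
  refine hfin.subset fun z hz => ⟨?_, hz⟩
  by_contra hzK
  exact hKs hzK hz

/-- The filter of points of the unit disk that tend to the unit circle. -/
noncomputable def unitDiskBoundary : Filter ℂ := comap norm (𝓝[<] 1)

theorem tendsto_norm_unitDiskBoundary : Tendsto (fun z : ℂ => ‖z‖) unitDiskBoundary (𝓝[<] 1) :=
  tendsto_comap

theorem unitDiskBoundary_basis {p : ℂ → Prop} (h : ∀ᶠ z in unitDiskBoundary, p z) {s : ℝ}
    (hs : s < 1) : ∃ r, s < r ∧ r < 1 ∧ ∀ z : ℂ, r ≤ ‖z‖ → ‖z‖ < 1 → p z := by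
  obtain ⟨t, ht, hsub⟩ := mem_comap.1 h
  obtain ⟨r, hr, hrt⟩ := (mem_nhdsLT_iff_exists_Ioo_subset' (show (s : ℝ) < 1 from hs)).1 ht
  have hr1 : r < 1 := hr
  refine ⟨max ((r + 1) / 2) ((s + 1) / 2), lt_max_of_lt_right (by linarith),
    max_lt (by linarith) (by linarith), fun z hz hz1 => hsub (hrt ⟨?_, hz1⟩)⟩
  have := (le_max_left _ _).trans hz
  linarith

/-- The maximum principle, for boundary values of modulus `1`. -/
theorem norm_le_one_of_boundary {g : ℂ → ℂ} (hg : DifferentiableOn ℂ g (Metric.ball 0 1))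
    (hb : Tendsto (fun z => ‖g z‖) unitDiskBoundary (𝓝 1)) {z : ℂ} (hz : z ∈ Metric.ball (0 : ℂ) 1) :
    ‖g z‖ ≤ 1 := by
  refine le_of_forall_pos_le_add fun ε hε => ?_
  rw [mem_ball_zero_iff] at hz
  obtain ⟨r, hzr, hr1, hr⟩ := unitDiskBoundary_basis
    (hb.eventually (eventually_le_nhds (show (1 : ℝ) < 1 + ε by linarith))) hz
  have h0 : 0 < r := (norm_nonneg z).trans_lt hzr
  refine Complex.norm_le_of_forall_mem_frontier_norm_le (U := Metric.ball (0 : ℂ) r)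
    Metric.isBounded_ball ?_ ?_ (subset_closure (by simpa using hzr))
  · refine (hg.mono ?_).diffContOnCl
    rw [closure_ball _ h0.ne']
    exact Metric.closedBall_subset_ball hr1
  · intro w hw
    rw [frontier_ball _ h0.ne', mem_sphere_zero_iff_norm] at hw
    exact hr w hw.ge (hw ▸ hr1)

theorem norm_blaschke_sq (a z : ℂ) (h : 1 - (starRingEnd ℂ) a * z ≠ 0) :
    ‖(z - a) / (1 - (starRingEnd ℂ) a * z)‖ ^ 2 =
      1 - (1 - ‖a‖ ^ 2) * (1 - ‖z‖ ^ 2) / ‖1 - (starRingEnd ℂ) a * z‖ ^ 2 := by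
  have h' : ‖1 - (starRingEnd ℂ) a * z‖ ^ 2 ≠ 0 := by simpa using h
  rw [norm_div, div_pow, eq_sub_iff_add_eq, ← add_div, div_eq_one_iff_eq h']
  simp only [← Complex.normSq_eq_norm_sq, Complex.normSq_apply, Complex.sub_re, Complex.sub_im,
    Complex.mul_re, Complex.mul_im, Complex.conj_re, Complex.conj_im, Complex.one_re,
    Complex.one_im]
  ring

theorem one_sub_conj_mul_ne_zero {a z : ℂ} (h : ‖a‖ * ‖z‖ < 1) : 1 - (starRingEnd ℂ) a * z ≠ 0 := by
  intro h0
  rw [sub_eq_zero] at h0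
  have : ‖(starRingEnd ℂ) a * z‖ = 1 := by rw [← h0]; simp
  rw [norm_mul, RCLike.norm_conj] at this
  linarith

theorem norm_blaschke_lt_one {a z : ℂ} (ha : ‖a‖ < 1) (hz : ‖z‖ < 1) :
    ‖(z - a) / (1 - (starRingEnd ℂ) a * z)‖ < 1 := by
  have h : 1 - (starRingEnd ℂ) a * z ≠ 0 :=
    one_sub_conj_mul_ne_zero (mul_lt_one_of_nonneg_of_lt_one_left (norm_nonneg _) ha hz.le)
  have h1 := norm_blaschke_sq a z h
  have h2 : 0 < (1 - ‖a‖ ^ 2) * (1 - ‖z‖ ^ 2) / ‖1 - (starRingEnd ℂ) a * z‖ ^ 2 := by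
    have : 0 < ‖1 - (starRingEnd ℂ) a * z‖ := norm_pos_iff.2 h
    have : 0 < 1 - ‖a‖ ^ 2 := by nlinarith [norm_nonneg a]
    have : 0 < 1 - ‖z‖ ^ 2 := by nlinarith [norm_nonneg z]
    positivity
  by_contra hcon
  push Not at hcon
  nlinarith

theorem tendsto_norm_blaschke {a : ℂ} (ha : ‖a‖ < 1) :
    Tendsto (fun z => ‖(z - a) / (1 - (starRingEnd ℂ) a * z)‖) unitDiskBoundary (𝓝 1) := by
  have hn : Tendsto (fun z : ℂ => ‖z‖) unitDiskBoundary (𝓝 1) :=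
    tendsto_norm_unitDiskBoundary.mono_right nhdsWithin_le_nhds
  have hlt : ∀ᶠ z : ℂ in unitDiskBoundary, ‖z‖ < 1 :=
    tendsto_norm_unitDiskBoundary.eventually self_mem_nhdsWithin
  have hsq : Tendsto (fun z => ‖(z - a) / (1 - (starRingEnd ℂ) a * z)‖ ^ 2) unitDiskBoundary
      (𝓝 1) := by
    have hlow : Tendsto (fun z : ℂ => 1 - (1 - ‖z‖ ^ 2) / (1 - ‖a‖) ^ 2) unitDiskBoundary (𝓝 1) := by
      have := (tendsto_const_nhds (x := (1 : ℝ)) (f := unitDiskBoundary)).sub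
        (((tendsto_const_nhds (x := (1 : ℝ)) (f := unitDiskBoundary)).sub (hn.pow 2)).div_const
          ((1 - ‖a‖) ^ 2))
      simpa using this
    refine tendsto_of_tendsto_of_tendsto_of_le_of_le' hlow tendsto_const_nhds ?_ ?_
    · filter_upwards [hlt] with z hz
      have hm : ‖a‖ * ‖z‖ < 1 := mul_lt_one_of_nonneg_of_lt_one_left (norm_nonneg _) ha hz.le
      have h : 1 - (starRingEnd ℂ) a * z ≠ 0 := one_sub_conj_mul_ne_zero hm
      rw [norm_blaschke_sq a z h]
      have h1 : 1 - ‖a‖ ≤ ‖1 - (starRingEnd ℂ) a * z‖ := by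
        have := norm_sub_norm_le 1 ((starRingEnd ℂ) a * z)
        rw [norm_mul, RCLike.norm_conj, norm_one] at this
        nlinarith [norm_nonneg a, norm_nonneg z]
      have h3 : 0 ≤ 1 - ‖z‖ ^ 2 := by nlinarith [norm_nonneg z]
      have h4 : (1 - ‖a‖ ^ 2) * (1 - ‖z‖ ^ 2) ≤ 1 - ‖z‖ ^ 2 := by nlinarith [sq_nonneg ‖a‖]
      gcongr
    · filter_upwards [hlt] with z hz
      have := norm_blaschke_lt_one ha hz
      nlinarith [norm_nonneg ((z - a) / (1 - (starRingEnd ℂ) a * z))]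
  have := hsq.sqrt
  rw [Real.sqrt_one] at this
  exact this.congr fun z => Real.sqrt_sq (norm_nonneg _)

/-- Blaschke factorization: a function on the disk whose modulus tends to `1` at the boundary
extends holomorphically to a larger disk. Each division by a Blaschke factor increases the modulus
at `z₀` by the factor `κ⁻¹`, so the induction on `N` removes all zeros. -/
theorem exists_extension_of_boundary {s κ : ℝ} (hs0 : 0 < s) {z₀ : ℂ}
    (hz₀ : z₀ ∈ Metric.ball (0 : ℂ) 1)
    (hκ : ∀ a : ℂ, ‖a‖ ≤ s → ‖(z₀ - a) / (1 - (starRingEnd ℂ) a * z₀)‖ ≤ κ) (hκ0 : 0 < κ) (N : ℕ) :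
    ∀ g : ℂ → ℂ, DifferentiableOn ℂ g (Metric.ball 0 1) →
      Tendsto (fun z => ‖g z‖) unitDiskBoundary (𝓝 1) →
      (∀ z ∈ Metric.ball (0 : ℂ) 1, g z = 0 → ‖z‖ ≤ s) → κ ^ N < ‖g z₀‖ →
      ∃ G : ℂ → ℂ, DifferentiableOn ℂ G (Metric.ball 0 s⁻¹) ∧ EqOn g G (Metric.ball 0 1) := by
  induction N with
  | zero =>
    intro g hg hb _ h
    exact absurd (norm_le_one_of_boundary hg hb hz₀) (by simpa using h)
  | succ N ih =>
    intro g hg hb hz h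
    by_cases hex : ∃ a ∈ Metric.ball (0 : ℂ) 1, g a = 0
    · obtain ⟨a, ha, hga⟩ := hex
      have has := hz a ha hga
      have ha1 : ‖a‖ < 1 := by simpa using ha
      have hden : ∀ z ∈ Metric.ball (0 : ℂ) 1, 1 - (starRingEnd ℂ) a * z ≠ 0 := fun z hz =>
        one_sub_conj_mul_ne_zero (mul_lt_one_of_nonneg_of_lt_one_left (norm_nonneg _) ha1
          (by simpa using (mem_ball_zero_iff.1 hz).le))
      -- the quotient of `g` by the Blaschke factor of its zero `a`
      let g₁ : ℂ → ℂ := fun z => dslope g a z * (1 - (starRingEnd ℂ) a * z)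
      have hfac : ∀ z ∈ Metric.ball (0 : ℂ) 1,
          g z = (z - a) / (1 - (starRingEnd ℂ) a * z) * g₁ z := by
        intro z hz
        have h1 : (z - a) * dslope g a z = g z := by
          have := sub_smul_dslope g a z
          simpa [hga] using this
        have h2 := hden z hz
        rw [← h1, div_mul_eq_mul_div, eq_div_iff h2]
        simp only [g₁]
        ring
      have hg₁ : DifferentiableOn ℂ g₁ (Metric.ball 0 1) := by
        refine ((Complex.differentiableOn_dslope (Metric.isOpen_ball.mem_nhds ha)).2 hg).mul ?_
        fun_prop
      have hlt : ∀ᶠ z : ℂ in unitDiskBoundary, ‖z‖ < 1 :=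
        tendsto_norm_unitDiskBoundary.eventually self_mem_nhdsWithin
      have hb₁ : Tendsto (fun z => ‖g₁ z‖) unitDiskBoundary (𝓝 1) := by
        have hB := tendsto_norm_blaschke ha1
        have := hb.div hB one_ne_zero
        rw [div_one] at this
        refine this.congr' ?_
        filter_upwards [hlt, hB.eventually (eventually_ne_nhds one_ne_zero)] with z hz1 hz2
        simp only [Pi.div_apply]
        rw [hfac z (by simpa using hz1), norm_mul, mul_div_cancel_left₀ _ hz2]
      have hz₁ : ∀ z ∈ Metric.ball (0 : ℂ) 1, g₁ z = 0 → ‖z‖ ≤ s := fun z hz1 h0 =>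
        hz z hz1 (by rw [hfac z hz1, h0, mul_zero])
      have hN : κ ^ N < ‖g₁ z₀‖ := by
        rw [hfac z₀ hz₀, norm_mul, pow_succ] at h
        have h1 := hκ a has
        have h2 : κ ^ N * κ < ‖g₁ z₀‖ * κ := by
          refine h.trans_le ?_
          rw [mul_comm]
          gcongr
        exact lt_of_mul_lt_mul_right h2 hκ0.le
      obtain ⟨G, hG, heq⟩ := ih g₁ hg₁ hb₁ hz₁ hN
      refine ⟨fun z => (z - a) / (1 - (starRingEnd ℂ) a * z) * G z, ?_, fun z hz => ?_⟩
      · refine DifferentiableOn.mul (DifferentiableOn.div (by fun_prop) (by fun_prop) ?_) hG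
        intro z hz
        refine one_sub_conj_mul_ne_zero ?_
        rw [mem_ball_zero_iff] at hz
        calc ‖a‖ * ‖z‖ ≤ s * ‖z‖ := by gcongr
          _ < s * s⁻¹ := by gcongr
          _ = 1 := mul_inv_cancel₀ hs0.ne'
      · simp only
        rw [hfac z hz, heq hz]
    · push Not at hex
      -- without zeros, the maximum principle for `g` and `g⁻¹` makes the modulus of `g` constant
      have hinv : ∀ z ∈ Metric.ball (0 : ℂ) 1, ‖(g z)⁻¹‖ ≤ 1 := fun z hz => by
        refine norm_le_one_of_boundary (g := fun z => (g z)⁻¹) (hg.inv hex) ?_ hz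
        have := hb.inv₀ one_ne_zero
        simpa using this
      have hone : ∀ z ∈ Metric.ball (0 : ℂ) 1, ‖g z‖ = 1 := fun z hz => by
        refine le_antisymm (norm_le_one_of_boundary hg hb hz) ?_
        have h1 := hinv z hz
        rw [norm_inv] at h1
        exact (inv_le_one₀ (norm_pos_iff.2 (hex z hz))).1 h1
      refine ⟨fun _ => g z₀, differentiableOn_const _, ?_⟩
      exact Complex.eqOn_of_isPreconnected_of_isMaxOn_norm (convex_ball _ _).isPreconnected
        Metric.isOpen_ball hg hz₀ fun z hz => by
          change ‖g z‖ ≤ ‖g z₀‖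
          rw [hone z hz, hone z₀ hz₀]

/-- A proper holomorphic self-map of the disk has finitely many critical points: it extends to a
larger disk, where the zeros of its derivative do not accumulate. -/
theorem finite_deriv_zeros_of_proper_disk {g : ℂ → ℂ} (hg : DifferentiableOn ℂ g (Metric.ball 0 1))
    (hb : Tendsto (fun z => ‖g z‖) unitDiskBoundary (𝓝 1)) {z₁ : ℂ}
    (hz₁ : z₁ ∈ Metric.ball (0 : ℂ) 1) (hd : deriv g z₁ ≠ 0) :
    (Metric.ball (0 : ℂ) 1 ∩ {z | deriv g z = 0}).Finite := by
  obtain ⟨s, hs0, hs1, hs⟩ := unitDiskBoundary_basis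
    (hb.eventually (eventually_ne_nhds one_ne_zero)) zero_lt_one
  have hzs : ∀ z ∈ Metric.ball (0 : ℂ) 1, g z = 0 → ‖z‖ ≤ s := by
    intro z hz h0
    by_contra hcon
    push Not at hcon
    exact hs z hcon.le (by simpa using hz) (by simp [h0])
  -- a point outside the disk of radius `s`, which contains all zeros
  have hz₀' : ‖(((s + 1) / 2 : ℝ) : ℂ)‖ = (s + 1) / 2 := by
    rw [Complex.norm_real, Real.norm_of_nonneg (by linarith)]
  have hz₀ : (((s + 1) / 2 : ℝ) : ℂ) ∈ Metric.ball (0 : ℂ) 1 := by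
    rw [mem_ball_zero_iff, hz₀']; linarith
  have hgz₀ : ‖g (((s + 1) / 2 : ℝ) : ℂ)‖ ≠ 0 := hs _ (by rw [hz₀']; linarith) (by rw [hz₀']; linarith)
  set z₀ : ℂ := (((s + 1) / 2 : ℝ) : ℂ)
  -- the Blaschke factors of points of that disk have modulus at most `κ < 1` at `z₀`
  obtain ⟨κ, hκ0, hκ1, hκ⟩ : ∃ κ : ℝ, 0 < κ ∧ κ < 1 ∧
      ∀ a : ℂ, ‖a‖ ≤ s → ‖(z₀ - a) / (1 - (starRingEnd ℂ) a * z₀)‖ ≤ κ := by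
    have hz₀1 : ‖z₀‖ < 1 := by simpa using hz₀
    obtain ⟨a, ha, hmax⟩ := (isCompact_closedBall (0 : ℂ) s).exists_isMaxOn
      ⟨0, by simpa using hs0.le⟩
      (f := fun a => ‖(z₀ - a) / (1 - (starRingEnd ℂ) a * z₀)‖) (by
        refine (ContinuousOn.div (by fun_prop) ?_ ?_).norm
        · exact (continuous_const.sub (Complex.continuous_conj.mul continuous_const)).continuousOn
        · intro a ha
          refine one_sub_conj_mul_ne_zero (mul_lt_one_of_nonneg_of_lt_one_left (norm_nonneg _) ?_
            hz₀1.le)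
          exact (mem_closedBall_zero_iff.1 ha).trans_lt hs1)
    refine ⟨max ‖(z₀ - a) / (1 - (starRingEnd ℂ) a * z₀)‖ (1 / 2), by positivity,
      max_lt (norm_blaschke_lt_one ?_ hz₀1) (by norm_num), fun b hb => ?_⟩
    · exact (mem_closedBall_zero_iff.1 ha).trans_lt hs1
    · exact (hmax (mem_closedBall_zero_iff.2 hb)).trans (le_max_left _ _)
  obtain ⟨N, hN⟩ := exists_pow_lt_of_lt_one (lt_of_le_of_ne (norm_nonneg (g z₀)) hgz₀.symm) hκ1
  obtain ⟨G, hG, heq⟩ := exists_extension_of_boundary hs0 hz₀ hκ hκ0 N g hg hb hzs hN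
  have hs' : 1 < s⁻¹ := (one_lt_inv₀ hs0).2 hs1
  have hdeq : EqOn (deriv g) (deriv G) (Metric.ball 0 1) := fun z hz =>
    (heq.eventuallyEq_of_mem (Metric.isOpen_ball.mem_nhds hz)).deriv_eq
  have hGa : AnalyticOnNhd ℂ (deriv G) (Metric.ball 0 s⁻¹) :=
    (hG.analyticOnNhd Metric.isOpen_ball).deriv
  have hfin := finite_zeros_of_analyticOnNhd hGa (convex_ball _ _).isPreconnected
    (isCompact_closedBall (0 : ℂ) 1) (Metric.closedBall_subset_ball hs')
    (Metric.ball_subset_ball hs'.le hz₁) (by rwa [← hdeq hz₁])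
  refine hfin.subset fun z hz => ⟨Metric.ball_subset_closedBall hz.1, ?_⟩
  change deriv G z = 0
  rw [← hdeq hz.1]
  exact hz.2

end ComplexAnalysis

/-! ### Holomorphic maps between surfaces -/

section HolomorphicMaps

variable {M N : Type*} [TopologicalSpace M] [ChartedSpace ℂ M] [IsManifold 𝓘(ℂ) 1 M]
  [TopologicalSpace N] [ChartedSpace ℂ N] [IsManifold 𝓘(ℂ) 1 N] {f : M → N}

/-- The expression of `f` in the preferred charts at `z` and at `f z`. -/
noncomputable def chartRep (f : M → N) (z : M) : ℂ → ℂ :=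
  chartAt ℂ (f z) ∘ f ∘ (chartAt ℂ z).symm

theorem differentiableOn_chartRep (hf : MDifferentiable 𝓘(ℂ) 𝓘(ℂ) f) (z : M) :
    DifferentiableOn ℂ (chartRep f z)
      ((chartAt ℂ z).target ∩ (chartAt ℂ z).symm ⁻¹' (f ⁻¹' (chartAt ℂ (f z)).source)) := by
  have h := (mdifferentiable_iff.1 hf).2 z (f z)
  simpa [chartRep, Function.comp_def] using h

theorem analyticAt_chartRep (hf : MDifferentiable 𝓘(ℂ) 𝓘(ℂ) f) (z : M) :
    AnalyticAt ℂ (chartRep f z) (chartAt ℂ z z) := by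
  have ho : IsOpen ((chartAt ℂ z).target ∩
      (chartAt ℂ z).symm ⁻¹' (f ⁻¹' (chartAt ℂ (f z)).source)) :=
    (chartAt ℂ z).isOpen_inter_preimage_symm
      ((chartAt ℂ (f z)).open_source.preimage hf.continuous)
  refine (differentiableOn_chartRep hf z).analyticAt (ho.mem_nhds ⟨mem_chart_target ℂ z, ?_⟩)
  rw [mem_preimage, (chartAt ℂ z).left_inv (mem_chart_source ℂ z)]
  exact mem_chart_source ℂ (f z)

theorem map_chart_symm_nhds (z : M) : map (chartAt ℂ z).symm (𝓝 (chartAt ℂ z z)) = 𝓝 z := by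
  rw [(chartAt ℂ z).symm_map_nhds_eq (mem_chart_source ℂ z)]

theorem map_chart_symm_punctured (z : M) :
    map (chartAt ℂ z).symm (𝓝[≠] (chartAt ℂ z z)) ≤ 𝓝[≠] z := by
  refine tendsto_nhdsWithin_iff.2 ⟨?_, ?_⟩
  · exact (map_chart_symm_nhds z).le.trans' (map_mono nhdsWithin_le_nhds)
  · filter_upwards [mem_nhdsWithin_of_mem_nhds (chart_target_mem_nhds ℂ z), self_mem_nhdsWithin]
      with w hw hne heq
    refine hne ?_
    exact ((chartAt ℂ z).right_inv hw).symm.trans (congrArg (chartAt ℂ z) heq)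

theorem map_chart_punctured (z : M) : Tendsto (chartAt ℂ z) (𝓝[≠] z) (𝓝[≠] (chartAt ℂ z z)) := by
  refine tendsto_nhdsWithin_iff.2 ⟨?_, ?_⟩
  · exact ((chartAt ℂ z).continuousAt (mem_chart_source ℂ z)).tendsto.mono_left nhdsWithin_le_nhds
  · filter_upwards [mem_nhdsWithin_of_mem_nhds (chart_source_mem_nhds ℂ z), self_mem_nhdsWithin]
      with w hw hne heq
    exact hne ((chartAt ℂ z).injOn hw (mem_chart_source ℂ z) heq)

instance nhdsNE_neBot_of_chartedSpace (z : M) : (𝓝[≠] z).NeBot :=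
  NeBot.mono inferInstance (map_chart_symm_punctured z)

theorem chartRep_apply (f : M → N) {z w : M} (hw : w ∈ (chartAt ℂ z).source) :
    chartRep f z (chartAt ℂ z w) = chartAt ℂ (f z) (f w) := by
  simp [chartRep, (chartAt ℂ z).left_inv hw]

theorem exists_injOn_iff_chartRep (hf : Continuous f) (z w : M) (hw : w ∈ (chartAt ℂ z).source)
    (hfw : f w ∈ (chartAt ℂ (f z)).source) :
    (∃ U ∈ 𝓝 w, InjOn f U) ↔ ∃ U ∈ 𝓝 (chartAt ℂ z w), InjOn (chartRep f z) U := by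
  constructor
  · rintro ⟨U, hU, hinj⟩
    have h1 : Tendsto (chartAt ℂ z).symm (𝓝 (chartAt ℂ z w)) (𝓝 w) :=
      ((chartAt ℂ z).symm_map_nhds_eq hw).le
    refine ⟨_, inter_mem (h1 (inter_mem hU (hf.continuousAt.preimage_mem_nhds
      ((chartAt ℂ (f z)).open_source.mem_nhds hfw))))
      ((chartAt ℂ z).open_target.mem_nhds ((chartAt ℂ z).map_source hw)), ?_⟩
    rintro a ⟨⟨ha, ha'⟩, ha''⟩ b ⟨⟨hb, hb'⟩, hb''⟩ hab
    exact (chartAt ℂ z).symm.injOn ha'' hb''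
      (hinj ha hb ((chartAt ℂ (f z)).injOn ha' hb' hab))
  · rintro ⟨U, hU, hinj⟩
    refine ⟨_, inter_mem (((chartAt ℂ z).continuousAt hw).preimage_mem_nhds hU)
      ((chartAt ℂ z).open_source.mem_nhds hw), ?_⟩
    rintro a ⟨ha, ha'⟩ b ⟨hb, hb'⟩ hab
    refine (chartAt ℂ z).injOn ha' hb' (hinj ha hb ?_)
    rw [chartRep_apply f ha', chartRep_apply f hb', hab]

theorem exists_injOn_iff_deriv (hf : MDifferentiable 𝓘(ℂ) 𝓘(ℂ) f) (z : M) :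
    (∃ U ∈ 𝓝 z, InjOn f U) ↔ deriv (chartRep f z) (chartAt ℂ z z) ≠ 0 := by
  rw [exists_injOn_iff_chartRep hf.continuous z z (mem_chart_source ℂ z) (mem_chart_source ℂ _)]
  exact ⟨fun ⟨U, hU, h⟩ => deriv_ne_zero_of_injOn (analyticAt_chartRep hf z) hU h,
    exists_injOn_of_deriv_ne_zero (analyticAt_chartRep hf z)⟩

/-- The critical points of a holomorphic map are the points near which it is not injective. -/
theorem mfderiv_eq_zero_iff_mem_branchSet (hf : MDifferentiable 𝓘(ℂ) 𝓘(ℂ) f) (z : M) :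
    mfderiv 𝓘(ℂ) 𝓘(ℂ) f z = 0 ↔ z ∈ branchSet f := by
  have h1 : z ∈ branchSet f ↔ ¬ ∃ U ∈ 𝓝 z, InjOn f U := by
    simp [branchSet]
  rw [h1, exists_injOn_iff_deriv hf z, not_not, (hf z).mfderiv]
  have h2 : writtenInExtChartAt 𝓘(ℂ) 𝓘(ℂ) z f = chartRep f z := by
    ext w; simp [chartRep, writtenInExtChartAt]
  rw [h2]
  simp only [modelWithCornersSelf_coe, range_id, fderivWithin_univ, mfld_simps]
  constructor
  · intro h
    have : fderiv ℂ (chartRep f z) (chartAt ℂ z z) = 0 := h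
    rw [← fderiv_apply_one_eq_deriv, this]
    rfl
  · intro h
    have : fderiv ℂ (chartRep f z) (chartAt ℂ z z) = 0 := by
      ext
      simp [h]
    exact this

theorem eventually_const_iff_chartRep (hf : Continuous f) (z : M) :
    (∀ᶠ w in 𝓝 z, f w = f z) ↔
      ∀ᶠ w in 𝓝 (chartAt ℂ z z), chartRep f z w = chartRep f z (chartAt ℂ z z) := by
  rw [← map_chart_symm_nhds z, eventually_map]
  have h1 : ∀ᶠ w in 𝓝 (chartAt ℂ z z), f ((chartAt ℂ z).symm w) ∈ (chartAt ℂ (f z)).source := by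
    have h2 := hf.continuousAt.preimage_mem_nhds (chart_source_mem_nhds ℂ (f z))
    rwa [← map_chart_symm_nhds z] at h2
  refine eventually_congr (h1.mono fun w hw => ?_)
  rw [chartRep_apply f (mem_chart_source ℂ z)]
  refine ⟨fun h => by simp [chartRep, h], fun h => ?_⟩
  exact (chartAt ℂ (f z)).injOn hw (mem_chart_source ℂ (f z)) h

/-- The critical points of a nonconstant holomorphic map are isolated. -/
theorem eventually_notMem_branchSet (hf : MDifferentiable 𝓘(ℂ) 𝓘(ℂ) f) {z : M}
    (hz : ¬ ∀ᶠ w in 𝓝 z, f w = f z) : ∀ᶠ w in 𝓝[≠] z, w ∉ branchSet f := by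
  rw [eventually_const_iff_chartRep hf.continuous] at hz
  have ha := analyticAt_chartRep hf z
  have hd : ∀ᶠ w in 𝓝[≠] (chartAt ℂ z z), deriv (chartRep f z) w ≠ 0 := by
    refine (ha.deriv.eventually_eq_zero_or_eventually_ne_zero).resolve_left fun h0 => hz ?_
    obtain ⟨r, hr, hball⟩ := Metric.eventually_nhds_iff_ball.1 (h0.and ha.eventually_analyticAt)
    refine Metric.eventually_nhds_iff_ball.2 ⟨r, hr, fun w hw => ?_⟩
    refine (convex_ball _ r).is_const_of_fderivWithin_eq_zero (𝕜 := ℂ)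
      (fun w hw => (hball w hw).2.differentiableAt.differentiableWithinAt) (fun w hw => ?_) hw
      (Metric.mem_ball_self hr)
    rw [fderivWithin_of_isOpen Metric.isOpen_ball hw]
    ext
    simp [(hball w hw).1]
  have hd' := (map_chart_punctured z).eventually
    (hd.and (ha.eventually_analyticAt.filter_mono nhdsWithin_le_nhds))
  filter_upwards [hd', mem_nhdsWithin_of_mem_nhds (chart_source_mem_nhds ℂ z),
    mem_nhdsWithin_of_mem_nhds (hf.continuous.continuousAt.preimage_mem_nhds
      (chart_source_mem_nhds ℂ (f z)))] with w hw hws hfw hb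
  obtain ⟨U, hU, hinj⟩ := (exists_injOn_iff_chartRep hf.continuous z w hws hfw).2
    (exists_injOn_of_deriv_ne_zero hw.2 hw.1)
  exact hb U hU hinj

/-- The open mapping theorem, at a point near which the map is not constant. -/
theorem nhds_le_map_of_not_eventually_const (hf : MDifferentiable 𝓘(ℂ) 𝓘(ℂ) f) {z : M}
    (hz : ¬ ∀ᶠ w in 𝓝 z, f w = f z) : 𝓝 (f z) ≤ map f (𝓝 z) := by
  rw [eventually_const_iff_chartRep hf.continuous] at hz
  have h1 := (analyticAt_chartRep hf z).eventually_constant_or_nhds_le_map_nhds.resolve_left hz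
  rw [chartRep_apply f (mem_chart_source ℂ z)] at h1
  have h2 := map_mono (m := (chartAt ℂ (f z)).symm) h1
  rw [map_chart_symm_nhds, map_map] at h2
  refine h2.trans ?_
  conv_rhs => rw [← map_chart_symm_nhds z, map_map]
  refine (map_congr ?_).le
  have h3 : ∀ᶠ w in 𝓝 (chartAt ℂ z z), f ((chartAt ℂ z).symm w) ∈ (chartAt ℂ (f z)).source := by
    have h2 := hf.continuous.continuousAt.preimage_mem_nhds (chart_source_mem_nhds ℂ (f z))
    rwa [← map_chart_symm_nhds z] at h2
  filter_upwards [h3] with w hw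
  simp [chartRep, (chartAt ℂ (f z)).left_inv hw]

theorem eventually_ne_of_not_eventually_const (hf : MDifferentiable 𝓘(ℂ) 𝓘(ℂ) f) {z : M}
    (hz : ¬ ∀ᶠ w in 𝓝 z, f w = f z) : ∀ᶠ w in 𝓝[≠] z, f w ≠ f z := by
  rw [eventually_const_iff_chartRep hf.continuous] at hz
  have h1 := ((analyticAt_chartRep hf z).eventually_eq_or_eventually_ne
    (analyticAt_const (v := chartRep f z (chartAt ℂ z z)))).resolve_left hz
  filter_upwards [(map_chart_punctured z).eventually h1,
    mem_nhdsWithin_of_mem_nhds (chart_source_mem_nhds ℂ z)] with w hw hws heq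
  rw [chartRep_apply f hws, chartRep_apply f (mem_chart_source ℂ z), heq] at hw
  exact hw rfl

/-- The identity theorem: a nonconstant holomorphic map on a connected surface is nowhere locally
constant. -/
theorem not_eventually_const [PreconnectedSpace M] (hf : MDifferentiable 𝓘(ℂ) 𝓘(ℂ) f)
    (hne : ∃ a b, f a ≠ f b) (z : M) : ¬ ∀ᶠ w in 𝓝 z, f w = f z := by
  intro hz
  have hopen : IsOpen {z | ∀ᶠ w in 𝓝 z, f w = f z} := by
    rw [isOpen_iff_mem_nhds]
    intro z hz
    filter_upwards [eventually_eventually_nhds.2 hz, hz] with w h1 h2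
    exact h2 ▸ h1
  have hclosed : IsClosed {z | ∀ᶠ w in 𝓝 z, f w = f z} := by
    refine isClosed_of_closure_subset fun z hz => ?_
    by_contra hcon
    have h1 := eventually_notMem_branchSet hf hcon
    rw [eventually_nhdsWithin_iff] at h1
    obtain ⟨w, hw1, hw2⟩ := (mem_closure_iff_frequently.1 hz).and_eventually h1 |>.exists
    have hwz : w ≠ z := by
      rintro rfl
      exact hcon hw1
    refine hw2 hwz fun U hU hinj => ?_
    have h2 : ∀ᶠ v in 𝓝[≠] w, f v = f w ∧ v ∈ U ∧ v ≠ w := by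
      filter_upwards [hw1.filter_mono nhdsWithin_le_nhds, mem_nhdsWithin_of_mem_nhds hU,
        self_mem_nhdsWithin] with v h1 h2 h3
      exact ⟨h1, h2, h3⟩
    obtain ⟨v, h3, h4, h5⟩ := h2.exists
    exact h5 (hinj h4 (mem_of_mem_nhds hU) h3)
  have huniv : {z | ∀ᶠ w in 𝓝 z, f w = f z} = univ := IsClopen.eq_univ ⟨hclosed, hopen⟩ ⟨z, hz⟩
  have hlc : IsLocallyConstant f := by
    rw [IsLocallyConstant.iff_eventually_eq]
    intro z
    exact huniv.symm.subset (mem_univ z)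
  obtain ⟨a, b, hab⟩ := hne
  exact hab (hlc.apply_eq_of_isPreconnected isPreconnected_univ (mem_univ a) (mem_univ b))

end HolomorphicMaps

/-! ### Global coordinates on the three surfaces -/

section Coordinates

variable {S : Type*} [TopologicalSpace S] [ChartedSpace ℂ S]

/-- The translations, extended by a fixed point at infinity, are holomorphic: at infinity, in the
coordinate `w = 1 / z`, translation by `a` is the map `w ↦ w / (1 + a * w)`. -/
theorem RiemannSphere.mdifferentiable_translate (a : ℂ) :
    MDifferentiable 𝓘(ℂ) 𝓘(ℂ)
      (Homeomorph.onePointCongr (Homeomorph.addRight a) : RiemannSphere → RiemannSphere) := by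
  have : IsManifold 𝓘(ℂ) 1 RiemannSphere := IsManifold.of_le (n := ω) le_top
  set τ : RiemannSphere ≃ₜ RiemannSphere := Homeomorph.onePointCongr (Homeomorph.addRight a)
  have hτ : ∀ z : ℂ, τ (z : OnePoint ℂ) = ((z + a : ℂ) : OnePoint ℂ) := fun z => rfl
  have hτi : τ OnePoint.infty = OnePoint.infty := rfl
  have h0 : chartZero ∈ atlas ℂ RiemannSphere := Or.inl rfl
  have h1 : chartInfty ∈ atlas ℂ RiemannSphere := Or.inr rfl
  intro p
  induction p using OnePoint.rec with
  | coe z =>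
    have hd : MDifferentiableAt 𝓘(ℂ) 𝓘(ℂ)
        (chartZero.symm ∘ (fun w : ℂ => w + a) ∘ chartZero) (z : OnePoint ℂ) := by
      refine MDifferentiableAt.comp (I' := 𝓘(ℂ)) _ (mdifferentiableAt_atlas_symm h0 ?_)
        (MDifferentiableAt.comp (I' := 𝓘(ℂ)) _ ?_ (mdifferentiableAt_atlas h0 ?_))
      · simp [chartZero]
      · exact (by fun_prop : DifferentiableAt ℂ (fun w : ℂ => w + a) _).mdifferentiableAt
      · simp [chartZero_source]
    refine hd.congr_of_eventuallyEq ?_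
    have : {OnePoint.infty}ᶜ ∈ 𝓝 (z : OnePoint ℂ) := isOpen_compl_singleton.mem_nhds (by simp)
    filter_upwards [this] with q hq
    induction q using OnePoint.rec with
    | infty => exact absurd rfl hq
    | coe w => simp only [Function.comp_apply, chartZero_coe, chartZero_symm, hτ]
  | infty =>
    have hc0 : chartInfty OnePoint.infty = 0 := by
      simp [chartInfty, invHomeo, inv_infty, chartZero_coe]
    have hsrc : OnePoint.infty ∈ chartInfty.source := by
      simp [chartInfty, chartZero_source, invHomeo, inv_infty]
    have hd : MDifferentiableAt 𝓘(ℂ) 𝓘(ℂ)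
        (chartInfty.symm ∘ (fun w : ℂ => w / (1 + a * w)) ∘ chartInfty) OnePoint.infty := by
      refine MDifferentiableAt.comp (I' := 𝓘(ℂ)) _ (mdifferentiableAt_atlas_symm h1 ?_)
        (MDifferentiableAt.comp (I' := 𝓘(ℂ)) _ ?_ (mdifferentiableAt_atlas h1 hsrc))
      · simp [chartInfty, chartZero]
      · refine DifferentiableAt.mdifferentiableAt ?_
        rw [hc0]
        refine DifferentiableAt.div (by fun_prop) (by fun_prop) (by simp)
    refine hd.congr_of_eventuallyEq ?_
    have hU : {((0 : ℂ) : OnePoint ℂ), ((-a : ℂ) : OnePoint ℂ)}ᶜ ∈ 𝓝 (OnePoint.infty : OnePoint ℂ) :=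
      (toFinite _).isClosed.isOpen_compl.mem_nhds (by simp)
    filter_upwards [hU] with q hq
    induction q using OnePoint.rec with
    | infty =>
      simp only [Function.comp_apply, hc0, hτi]
      simp [chartInfty, invHomeo, chartZero_symm, inv_zero]
    | coe w =>
      have hw0 : w ≠ 0 := fun h => hq (by simp [h])
      have hwa : w + a ≠ 0 := fun h => hq (by simp [eq_neg_of_add_eq_zero_left h])
      have e1 : chartInfty (w : OnePoint ℂ) = w⁻¹ := by
        simp [chartInfty, invHomeo, inv_coe hw0, chartZero_coe]
      have e2 : w⁻¹ / (1 + a * w⁻¹) = (w + a)⁻¹ := by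
        field_simp
      simp only [Function.comp_apply, e1, e2, hτ]
      simp [chartInfty, invHomeo, chartZero_symm, inv_coe (inv_ne_zero hwa)]

/-- Each of the three surfaces is covered by one holomorphic coordinate with values in the disk or
in the plane, except that an arbitrary point has to be removed from the sphere. -/
theorem exists_coordinate (hS : IsDiskPlaneOrSphere S) (q : S) :
    ∃ e : OpenPartialHomeomorph S ℂ, MDifferentiableOn 𝓘(ℂ) 𝓘(ℂ) e.symm e.target ∧
      ((e.source = univ ∧ MDifferentiable 𝓘(ℂ) 𝓘(ℂ) e ∧
          (e.target = univ ∨ e.target = Metric.ball 0 1)) ∨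
        (CompactSpace S ∧ e.source = {q}ᶜ ∧ e.target = univ)) := by
  rcases hS with ⟨⟨Φ⟩⟩ | ⟨⟨Φ⟩⟩ | ⟨⟨Φ⟩⟩
  · have h0 : (0 : ℂ) ∈ unitDisk := Metric.mem_ball_self one_pos
    have : Nonempty unitDisk := ⟨⟨0, h0⟩⟩
    refine ⟨Φ.toHomeomorph.toOpenPartialHomeomorph.trans
      (unitDisk.openPartialHomeomorphSubtypeCoe inferInstance), ?_, Or.inl ⟨?_, ?_, Or.inr ?_⟩⟩
    · intro z hz
      have hz' : z ∈ unitDisk := by simpa using hz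
      refine MDifferentiableAt.mdifferentiableWithinAt ?_
      have h1 : ContMDiffAt 𝓘(ℂ) 𝓘(ℂ) 1 (fun y : unitDisk =>
          (Φ.toHomeomorph.toOpenPartialHomeomorph.trans
            (unitDisk.openPartialHomeomorphSubtypeCoe inferInstance)).symm (y : ℂ)) ⟨z, hz'⟩ := by
        have : ContMDiffAt 𝓘(ℂ) 𝓘(ℂ) 1 Φ.symm ⟨z, hz'⟩ :=
          (Φ.symm.contMDiff.of_le le_top).contMDiffAt
        refine this.congr_of_eventuallyEq (Eventually.of_forall fun y => ?_)
        have := (unitDisk.openPartialHomeomorphSubtypeCoe inferInstance).left_inv (x := y) (by simp)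
        simp only [TopologicalSpace.Opens.openPartialHomeomorphSubtypeCoe_coe] at this
        simp [this]
      exact (contMDiffAt_subtype_iff.1 h1).mdifferentiableAt one_ne_zero
    · simp
    · have h1 : ContMDiff 𝓘(ℂ) 𝓘(ℂ) 1 (Subtype.val : unitDisk → ℂ) := contMDiff_subtype_val
      exact (h1.mdifferentiable one_ne_zero).comp (Φ.mdifferentiable (by simp))
    · change (Φ.toHomeomorph.toOpenPartialHomeomorph.trans
        (unitDisk.openPartialHomeomorphSubtypeCoe inferInstance)).target = (unitDisk : Set ℂ)
      simp
  · refine ⟨Φ.toHomeomorph.toOpenPartialHomeomorph, ?_, Or.inl ⟨rfl, ?_, Or.inl rfl⟩⟩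
    · exact (Φ.symm.mdifferentiable (by simp)).mdifferentiableOn
    · exact Φ.mdifferentiable (by simp)
  · have : CompactSpace S := Φ.symm.toHomeomorph.compactSpace
    -- `e₀` is a coordinate on the sphere without the point `Φ q`
    obtain ⟨e₀, hd, hs, ht⟩ : ∃ e₀ : OpenPartialHomeomorph RiemannSphere ℂ,
        MDifferentiableOn 𝓘(ℂ) 𝓘(ℂ) e₀.symm e₀.target ∧ e₀.source = {Φ q}ᶜ ∧ e₀.target = univ := by
      have : IsManifold 𝓘(ℂ) 1 RiemannSphere := IsManifold.of_le (n := ω) le_top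
      generalize Φ q = p
      induction p using OnePoint.rec with
      | infty =>
        exact ⟨RiemannSphere.chartZero, mdifferentiableOn_atlas_symm (Or.inl rfl),
          RiemannSphere.chartZero_source, by simp [RiemannSphere.chartZero]⟩
      | coe a =>
        refine ⟨(Homeomorph.onePointCongr
          (Homeomorph.addRight (-a))).toOpenPartialHomeomorph.trans RiemannSphere.chartInfty,
          ?_, ?_, ?_⟩
        · have h1 : (Homeomorph.onePointCongr (Homeomorph.addRight (-a)) :
              RiemannSphere ≃ₜ RiemannSphere).symm =
              Homeomorph.onePointCongr (Homeomorph.addRight a) := by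
            ext p
            induction p using OnePoint.rec with
            | infty => rfl
            | coe z =>
              change (((Homeomorph.addRight (-a)).symm z : ℂ) : OnePoint ℂ) = ((z + a : ℂ) : OnePoint ℂ)
              rw [Homeomorph.addRight_symm]
              simp
          have h2 := (RiemannSphere.mdifferentiable_translate a).comp_mdifferentiableOn
            (mdifferentiableOn_atlas_symm (I := 𝓘(ℂ)) (e := RiemannSphere.chartInfty) (Or.inr rfl))
          refine (h2.mono ?_).congr ?_
          · simp
          · intro z hz
            rw [← h1]
            rfl
        · ext p
          induction p using OnePoint.rec with
          | infty =>
            have : (Homeomorph.onePointCongr (Homeomorph.addRight (-a)) :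
              RiemannSphere ≃ₜ RiemannSphere) OnePoint.infty = OnePoint.infty := rfl
            simp [RiemannSphere.chartInfty, RiemannSphere.chartZero_source,
              RiemannSphere.invHomeo, this, RiemannSphere.inv_infty]
          | coe z =>
            have : (Homeomorph.onePointCongr (Homeomorph.addRight (-a)) :
              RiemannSphere ≃ₜ RiemannSphere) (z : OnePoint ℂ) = ((z + -a : ℂ) : OnePoint ℂ) := rfl
            by_cases hza : z = a
            · simp [RiemannSphere.chartInfty, RiemannSphere.chartZero_source,
                RiemannSphere.invHomeo, hza, RiemannSphere.inv_zero]
            · have h0 : z + -a ≠ 0 := by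
                rw [← sub_eq_add_neg]; exact sub_ne_zero.2 hza
              simp [RiemannSphere.chartInfty, RiemannSphere.chartZero_source,
                RiemannSphere.invHomeo, this, RiemannSphere.inv_coe h0, hza]
        · simp [RiemannSphere.chartInfty, RiemannSphere.chartZero]
    refine ⟨Φ.toHomeomorph.toOpenPartialHomeomorph.trans e₀, ?_, Or.inr ⟨inferInstance, ?_, ?_⟩⟩
    · exact (Φ.symm.mdifferentiable (by simp)).comp_mdifferentiableOn
        (hd.mono (by simp))
    · ext p
      simp [hs]
    · simp [ht]

end Coordinates

/-! ### Holomorphic branched coverings are topological branched coverings -/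

section HolomorphicBranched

variable {S : Type*} [TopologicalSpace S] [ChartedSpace ℂ S]

theorem IsDiskPlaneOrSphere.t2Space (hS : IsDiskPlaneOrSphere S) : T2Space S := by
  rcases hS with ⟨⟨Φ⟩⟩ | ⟨⟨Φ⟩⟩ | ⟨⟨Φ⟩⟩
  exacts [Φ.symm.toHomeomorph.t2Space, Φ.symm.toHomeomorph.t2Space, Φ.symm.toHomeomorph.t2Space]

theorem IsDiskPlaneOrSphere.connectedSpace (hS : IsDiskPlaneOrSphere S) : ConnectedSpace S := by
  rcases hS with ⟨⟨Φ⟩⟩ | ⟨⟨Φ⟩⟩ | ⟨⟨Φ⟩⟩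
  · have : ConnectedSpace unitDisk := Subtype.connectedSpace
      ⟨⟨0, Metric.mem_ball_self one_pos⟩, (convex_ball (0 : ℂ) 1).isPreconnected⟩
    exact Φ.symm.toHomeomorph.surjective.connectedSpace Φ.symm.toHomeomorph.continuous
  · exact Φ.symm.toHomeomorph.surjective.connectedSpace Φ.symm.toHomeomorph.continuous
  · exact Φ.symm.toHomeomorph.surjective.connectedSpace Φ.symm.toHomeomorph.continuous

variable [IsManifold 𝓘(ℂ) 1 S] {f : S → S}

/-- A constant map has degree at most one, because it has no preimages of the other points. -/
theorem IsBranchedCovering.exists_ne {d : ℕ} (hd : 1 < d) (hf : IsBranchedCovering f d)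
    [Nonempty S] : ∃ a b, f a ≠ f b := by
  by_contra hcon
  push Not at hcon
  obtain ⟨a⟩ := ‹Nonempty S›
  obtain ⟨y, hy⟩ := (inferInstance : (𝓝[≠] (f a)).NeBot).nonempty_of_mem self_mem_nhdsWithin
  have hno : ∀ z, f z ≠ y := fun z hz => hy (by rw [← hz, hcon z a]; rfl)
  have := hf.degree y fun z hz => absurd hz (hno z)
  rw [show f ⁻¹' {y} = ∅ from eq_empty_of_forall_notMem hno, ncard_empty] at this
  omega

/-- A proper nonconstant holomorphic self-map of one of the three surfaces has finitely many
critical points. -/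
theorem finite_branchSet (hS : IsDiskPlaneOrSphere S) (hf : MDifferentiable 𝓘(ℂ) 𝓘(ℂ) f)
    (hp : IsProperMap f) (hc : ∀ z, ¬ ∀ᶠ w in 𝓝 z, f w = f z) : (branchSet f).Finite := by
  obtain hS' | hS' := isEmpty_or_nonempty S
  · exact toFinite _
  obtain ⟨q⟩ := hS'
  obtain ⟨e, hes, h | ⟨hcomp, -, -⟩⟩ := exists_coordinate hS q
  · obtain ⟨hsrc, hed, htgt⟩ := h
    -- `f` in a global coordinate
    let g : ℂ → ℂ := fun z => e (f (e.symm z))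
    have hgd : DifferentiableOn ℂ g e.target := by
      rw [← mdifferentiableOn_iff_differentiableOn]
      exact hed.comp_mdifferentiableOn (hf.comp_mdifferentiableOn hes)
    have hga : AnalyticOnNhd ℂ g e.target := hgd.analyticOnNhd e.open_target
    have hmem : ∀ z, z ∈ e.source := fun z => hsrc ▸ mem_univ z
    have hgf : ∀ w, g (e w) = e (f w) := fun w => by simp [g, e.left_inv (hmem w)]
    have hinj : Function.Injective e := by
      rw [← injOn_univ, ← hsrc]; exact e.injOn
    have hsub : branchSet f ⊆ e ⁻¹' (e.target ∩ {z | deriv g z = 0}) := by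
      intro z hz
      refine ⟨e.map_source (hmem z), ?_⟩
      by_contra hne
      obtain ⟨U, hU, hUi⟩ := exists_injOn_of_deriv_ne_zero (hga _ (e.map_source (hmem z))) hne
      refine hz _ ((e.continuousAt (hmem z)).preimage_mem_nhds hU) fun a ha b hb hab => hinj ?_
      refine hUi ha hb ?_
      rw [hgf, hgf, hab]
    refine Finite.subset (Finite.preimage hinj.injOn ?_) hsub
    obtain ⟨z₁, hz₁⟩ : ∃ z₁, z₁ ∉ branchSet f :=
      (eventually_notMem_branchSet hf (hc q)).exists
    have hd₁ : deriv g (e z₁) ≠ 0 := by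
      simp only [branchSet, mem_ofPred_eq, not_forall, not_not] at hz₁
      obtain ⟨U, hU, hUi⟩ := hz₁
      have h1 : Tendsto e.symm (𝓝 (e z₁)) (𝓝 z₁) := (e.symm_map_nhds_eq (hmem z₁)).le
      refine deriv_ne_zero_of_injOn (hga _ (e.map_source (hmem z₁)))
        (inter_mem (h1 hU) (e.open_target.mem_nhds (e.map_source (hmem z₁)))) ?_
      rintro a ⟨ha, ha'⟩ b ⟨hb, hb'⟩ hab
      exact e.symm.injOn ha' hb' (hUi ha hb (hinj hab))
    rcases htgt with ht | ht
    · rw [ht, univ_inter]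
      let Ψ : S ≃ₜ ℂ := e.toHomeomorphOfSourceEqUnivTargetEqUniv hsrc ht
      rw [ht] at hgd
      refine finite_deriv_zeros_of_proper_entire (differentiableOn_univ.1 hgd) ?_
      have h1 : IsProperMap g := Ψ.isProperMap.comp (hp.comp Ψ.symm.isProperMap)
      exact (isProperMap_iff_tendsto_cocompact.1 h1).2
    · rw [ht] at hgd ⊢
      refine finite_deriv_zeros_of_proper_disk hgd ?_ (z₁ := e z₁) (ht ▸ e.map_source (hmem z₁)) hd₁
      have hlt1 : ∀ᶠ z : ℂ in unitDiskBoundary, ‖z‖ < 1 :=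
        tendsto_norm_unitDiskBoundary.eventually self_mem_nhdsWithin
      refine tendsto_order.2 ⟨fun r hr => ?_, fun r hr => ?_⟩
      · -- the preimage of a closed disk is compact, hence stays away from the boundary
        have hK : IsCompact (f ⁻¹' (e.symm '' Metric.closedBall 0 r)) := by
          refine hp.isCompact_preimage ((isCompact_closedBall _ _).image_of_continuousOn
            (e.continuousOn_symm.mono ?_))
          rw [ht]
          exact Metric.closedBall_subset_ball hr
        have hK' : IsCompact ((fun z => ‖e z‖) '' (f ⁻¹' (e.symm '' Metric.closedBall 0 r))) :=
          hK.image hed.continuous.norm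
        have hlt : ∀ t ∈ (fun z => ‖e z‖) '' (f ⁻¹' (e.symm '' Metric.closedBall 0 r)), t < 1 := by
          rintro _ ⟨z, -, rfl⟩
          have := e.map_source (hmem z)
          rw [ht] at this
          simpa using this
        obtain ⟨κ, hκ1, hκ⟩ : ∃ κ < 1, ∀ t ∈ (fun z => ‖e z‖) ''
            (f ⁻¹' (e.symm '' Metric.closedBall 0 r)), t ≤ κ := by
          rcases eq_empty_or_nonempty ((fun z => ‖e z‖) ''
            (f ⁻¹' (e.symm '' Metric.closedBall 0 r))) with h0 | h0
          · exact ⟨0, one_pos, by simp [h0]⟩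
          · obtain ⟨κ, hκ, hmax⟩ := hK'.exists_isGreatest h0
            exact ⟨κ, hlt κ hκ, hmax⟩
        have hev : ∀ᶠ z : ℂ in unitDiskBoundary, κ < ‖z‖ :=
          tendsto_norm_unitDiskBoundary.eventually (mem_nhdsWithin_of_mem_nhds (lt_mem_nhds hκ1))
        filter_upwards [hev, hlt1] with z hz hz1
        by_contra hcon
        push Not at hcon
        have hzt : z ∈ e.target := by rw [ht]; simpa using hz1
        have := hκ _ ⟨e.symm z, ⟨g z, by simpa using hcon, ?_⟩, rfl⟩
        · simp only [e.right_inv hzt] at this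
          linarith
        · simp [g, e.left_inv (hmem _)]
      · filter_upwards [hlt1] with z hz1
        have := e.map_source (hmem (f (e.symm z)))
        rw [ht, mem_ball_zero_iff] at this
        exact this.trans hr
  -- on the sphere, the critical points are isolated, hence finite in number by compactness
  · have := finite_inter_of_locally_finite (A := branchSet f) isCompact_univ fun z _ => by
      refine ⟨_, eventually_nhdsWithin_iff.1 (eventually_notMem_branchSet hf (hc z)),
        (finite_singleton z).subset ?_⟩
      rintro w ⟨hw, hwb⟩
      by_contra hwz
      exact hw hwz hwb
    rwa [univ_inter] at this

/-- Branched coverings in the holomorphic sense are topological branched coverings. The degree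
enters only in that it excludes constant maps. -/
theorem IsBranchedCovering.isTopBranched {d : ℕ} (hS : IsDiskPlaneOrSphere S) (hd : 1 < d)
    (hf : IsBranchedCovering f d) : IsTopBranched f := by
  have := hS.t2Space
  have := hS.connectedSpace
  have hc : ∀ z, ¬ ∀ᶠ w in 𝓝 z, f w = f z := not_eventually_const hf.holomorphic (hf.exists_ne hd)
  have ho : IsOpenMap f := isOpenMap_iff_nhds_le.2 fun z =>
    nhds_le_map_of_not_eventually_const hf.holomorphic (hc z)
  refine ⟨hf.proper, ho, ?_, fun y => ?_, finite_branchSet hS hf.holomorphic hf.proper hc⟩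
  · rw [← range_eq_univ]
    exact IsClopen.eq_univ ⟨hf.proper.isClosedMap.isClosed_range, ho.isOpen_range⟩
      (range_nonempty f)
  · have hcomp : IsCompact (f ⁻¹' {y}) := hf.proper.isCompact_preimage isCompact_singleton
    have := finite_inter_of_locally_finite (A := f ⁻¹' {y}) hcomp fun z hz => by
      refine ⟨_, eventually_nhdsWithin_iff.1
        (eventually_ne_of_not_eventually_const hf.holomorphic (hc z)),
        (finite_singleton z).subset ?_⟩
      rintro w ⟨hw, hwy⟩
      by_contra hwz
      exact hw hwz (by rw [show f w = y from hwy, show f z = y from hz])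
    rwa [inter_self] at this

/-- Near a noncritical point a holomorphic map is comparable to a coordinate. -/
theorem exists_tendsto_ratio {F : S → S} (hF : MDifferentiable 𝓘(ℂ) 𝓘(ℂ) F)
    {e φ : OpenPartialHomeomorph S ℂ} (he : MDifferentiableOn 𝓘(ℂ) 𝓘(ℂ) e.symm e.target)
    (hφ : MDifferentiableOn 𝓘(ℂ) 𝓘(ℂ) φ φ.source) {z : S}
    (hz : z ∈ e.source) (hFz : F z ∈ φ.source) (hb : z ∉ branchSet F) :
    ∃ L : ℂ, L ≠ 0 ∧ Tendsto (fun w => (φ (F w) - φ (F z)) / (e w - e z))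
      (𝓝[≠] z) (𝓝 L) := by
  let g : ℂ → ℂ := fun w => φ (F (e.symm w))
  have hU : IsOpen (e.target ∩ e.symm ⁻¹' (F ⁻¹' φ.source)) :=
    e.isOpen_inter_preimage_symm (φ.open_source.preimage hF.continuous)
  have hzU : e z ∈ e.target ∩ e.symm ⁻¹' (F ⁻¹' φ.source) :=
    ⟨e.map_source hz, by rwa [mem_preimage, e.left_inv hz]⟩
  have hgd : DifferentiableOn ℂ g (e.target ∩ e.symm ⁻¹' (F ⁻¹' φ.source)) := by
    rw [← mdifferentiableOn_iff_differentiableOn]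
    refine MDifferentiableOn.comp (I' := 𝓘(ℂ)) (u := φ.source)
      hφ
      (hF.comp_mdifferentiableOn (he.mono inter_subset_left)) ?_
    intro w hw
    exact hw.2
  have hga : AnalyticAt ℂ g (e z) := hgd.analyticAt (hU.mem_nhds hzU)
  simp only [branchSet, mem_ofPred_eq, not_forall, not_not] at hb
  obtain ⟨U, hUn, hUi⟩ := hb
  have h1 : Tendsto e.symm (𝓝 (e z)) (𝓝 z) := (e.symm_map_nhds_eq hz).le
  have hd : deriv g (e z) ≠ 0 := by
    refine deriv_ne_zero_of_injOn hga (inter_mem (h1 hUn) (hU.mem_nhds hzU)) ?_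
    rintro a ⟨ha, ha', ha''⟩ b ⟨hb, hb', hb''⟩ hab
    exact e.symm.injOn ha' hb' (hUi ha hb (φ.injOn ha'' hb'' hab))
  refine ⟨_, hd, ?_⟩
  have h2 := hasDerivAt_iff_tendsto_slope.1 hga.differentiableAt.hasDerivAt
  have h3 : Tendsto e (𝓝[≠] z) (𝓝[≠] (e z)) := by
    refine tendsto_nhdsWithin_iff.2
      ⟨(e.continuousAt hz).tendsto.mono_left nhdsWithin_le_nhds, ?_⟩
    filter_upwards [mem_nhdsWithin_of_mem_nhds (e.open_source.mem_nhds hz), self_mem_nhdsWithin]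
      with w hw hne heq
    exact hne (e.injOn hw hz heq)
  refine (h2.comp h3).congr' ?_
  filter_upwards [mem_nhdsWithin_of_mem_nhds (e.open_source.mem_nhds hz)] with w hw
  simp [g, slope_def_field, e.left_inv hw, e.left_inv hz]

theorem mdifferentiable_iterate (hf : MDifferentiable 𝓘(ℂ) 𝓘(ℂ) f) (n : ℕ) :
    MDifferentiable 𝓘(ℂ) 𝓘(ℂ) f^[n] := by
  induction n with
  | zero => exact mdifferentiable_id
  | succ n ih => exact ih.comp hf

end HolomorphicBranched

/-! ### Lifting through the iterates -/

section Lifting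

variable {S : Type*} [TopologicalSpace S] {f : S → S}

/-- The critical values of the `n`-th iterate of `f`. -/
def critVals (f : S → S) (n : ℕ) : Set S := ⋃ m : Fin n, f^[m + 1] '' branchSet f

/-- The critical values of all iterates of `f`. -/
def postcritical (f : S → S) : Set S := ⋃ m : ℕ, f^[m + 1] '' branchSet f

theorem critVals_subset_postcritical (n : ℕ) : critVals f n ⊆ postcritical f :=
  iUnion_subset fun m => subset_iUnion (fun m : ℕ => f^[m + 1] '' branchSet f) m

theorem notMem_critVals {z : S} (hz : z ∉ postcritical f) (n : ℕ) : z ∉ critVals f n :=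
  fun h => hz (critVals_subset_postcritical n h)

theorem IsTopBranched.finite_critVals (hf : IsTopBranched f) (n : ℕ) : (critVals f n).Finite :=
  finite_iUnion fun _ => hf.finite_branchSet.image _

theorem IsTopBranched.countable_postcritical (hf : IsTopBranched f) : (postcritical f).Countable :=
  countable_iUnion fun _ => (hf.finite_branchSet.image _).countable

theorem notMem_branchSet_iterate (hf : Continuous f) {n : ℕ} {z : S}
    (hz : f^[n] z ∉ critVals f n) : z ∉ branchSet f^[n] := by
  have key : ∀ m, ∀ z, (∀ k < m, f^[k] z ∉ branchSet f) → ∃ U ∈ 𝓝 z, InjOn f^[m] U := by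
    intro m
    induction m with
    | zero => exact fun z _ => ⟨univ, univ_mem, injOn_id _⟩
    | succ m ih =>
      intro z hz
      obtain ⟨U, hU, hUi⟩ := ih (f z) fun k hk => by
        rw [← Function.iterate_succ_apply]; exact hz (k + 1) (by omega)
      have h0 := hz 0 (by omega)
      simp only [branchSet, mem_ofPred_eq, not_forall, not_not, Function.iterate_zero, id] at h0
      obtain ⟨U', hU', hUi'⟩ := h0
      refine ⟨_, inter_mem (hf.continuousAt.preimage_mem_nhds hU) hU', ?_⟩
      rintro a ⟨ha, ha'⟩ b ⟨hb, hb'⟩ hab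
      exact hUi' ha' hb' (hUi ha hb hab)
  obtain ⟨U, hU, hUi⟩ := key n z fun k hk hb => hz <| by
    refine mem_iUnion.2 ⟨⟨n - k - 1, by omega⟩, f^[k] z, hb, ?_⟩
    rw [← Function.iterate_add_apply]
    congr 1
    simp only
    omega
  exact fun hb => hb U hU hUi

theorem exists_openPartialHomeomorph {F : S → S} (hc : Continuous F) (ho : IsOpenMap F) {z : S}
    (hz : z ∉ branchSet F) : ∃ φ : OpenPartialHomeomorph S S, z ∈ φ.source ∧ (φ : S → S) = F := by
  simp only [branchSet, mem_ofPred_eq, not_forall, not_not] at hz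
  obtain ⟨U, hU, hUi⟩ := hz
  have : Nonempty S := ⟨z⟩
  obtain ⟨V, hVU, hV, hzV⟩ := mem_nhds_iff.1 hU
  exact ⟨OpenPartialHomeomorph.ofContinuousOpen ((hUi.mono hVU).toPartialEquiv F V) hc.continuousOn ho hV,
    hzV, rfl⟩

variable [T2Space S]

theorem isCoveringMapOn_iterate (hf : IsTopBranched f) (n : ℕ) :
    IsCoveringMapOn f^[n] (critVals f n)ᶜ := by
  refine (hf.proper_iterate n).isClosedMap.isCoveringMapOn_of_isLocalHomeomorphOn
    (fun y _ => hf.finite_preimage_iterate n (finite_singleton y)) fun z hz => ?_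
  obtain ⟨φ, hφ, h⟩ := exists_openPartialHomeomorph (hf.continuous_iterate n)
    (hf.isOpenMap_iterate n) (notMem_branchSet_iterate hf.continuous hz)
  exact ⟨φ, hφ, h.symm⟩

theorem exists_lift (hf : IsTopBranched f) {A : Type*} [TopologicalSpace A]
    [SimplyConnectedSpace A] [LocallyPathConnectedSpace A] {n : ℕ} {g : A → S} (hg : Continuous g)
    (hgc : ∀ a, g a ∉ critVals f n) {a₀ : A} {z : S} (hz : f^[n] z = g a₀) :
    ∃ G : A → S, Continuous G ∧ G a₀ = z ∧ ∀ a, f^[n] (G a) = g a := by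
  obtain ⟨G, ⟨h1, h2⟩, -⟩ := (isCoveringMapOn_iterate hf n).existsUnique_continuousMap_lifts
    ⟨g, hg⟩ (a₀ := a₀) (e₀ := z) hz hgc
  exact ⟨G, G.continuous, h1, fun a => congr_fun h2 a⟩

/-- Two lifts through `f^[n]` of a map which avoids the critical values agree if they agree at one
point. -/
theorem lift_unique (hf : IsTopBranched f) {A : Type*} [TopologicalSpace A]
    [PreconnectedSpace A] {n : ℕ} {G₁ G₂ : A → S} (h₁ : Continuous G₁) (h₂ : Continuous G₂)
    (h : ∀ a, f^[n] (G₁ a) = f^[n] (G₂ a)) (hc : ∀ a, f^[n] (G₁ a) ∉ critVals f n) {a₀ : A}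
    (h₀ : G₁ a₀ = G₂ a₀) : G₁ = G₂ := by
  have hcov := IsCoveringMapOn.isCoveringMap_restrictPreimage _ (isCoveringMapOn_iterate hf n)
  have hc' : ∀ a, f^[n] (G₂ a) ∉ critVals f n := fun a => h a ▸ hc a
  have := hcov.eq_of_comp_eq (g₁ := fun a => ⟨G₁ a, hc a⟩) (g₂ := fun a => ⟨G₂ a, hc' a⟩)
    (by fun_prop) (by fun_prop) (by
      funext a
      exact Subtype.ext (h a)) a₀ (Subtype.ext h₀)
  funext a
  exact congrArg Subtype.val (congr_fun this a)

/-- Maps of simply connected spaces lift to the inverse limit, if they avoid the postcritical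
set. -/
theorem exists_limit_lift (hf : IsTopBranched f) {A : Type*} [TopologicalSpace A]
    [SimplyConnectedSpace A] [LocallyPathConnectedSpace A] {g : A → S} (hg : Continuous g)
    (hgc : ∀ a, g a ∉ postcritical f) {a₀ : A} {y : StandardInverseLimit f} (hy : y.1 0 = g a₀) :
    ∃ G : A → StandardInverseLimit f, Continuous G ∧ G a₀ = y ∧ ∀ a, (G a).1 0 = g a := by
  have h : ∀ n, ∃ G : A → S, Continuous G ∧ G a₀ = y.1 n ∧ ∀ a, f^[n] (G a) = g a := fun n =>
    exists_lift hf hg (fun a => notMem_critVals (hgc a) n)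
      (by rw [StandardInverseLimit.iterate_apply_zero, hy])
  choose G hGc hG0 hG using h
  have hcoh : ∀ n, f ∘ G (n + 1) = G n := fun n => by
    refine lift_unique hf (hf.continuous.comp (hGc (n + 1))) (hGc n) (n := n) (a₀ := a₀) ?_ ?_ ?_
    · intro a
      rw [Function.comp_apply, ← Function.iterate_succ_apply, hG, hG]
    · intro a
      rw [Function.comp_apply, ← Function.iterate_succ_apply, hG]
      exact notMem_critVals (hgc a) n
    · rw [Function.comp_apply, hG0, hG0, y.2]
  refine ⟨fun a => ⟨fun n => G n a, fun n => congr_fun (hcoh n) a⟩,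
    StandardInverseLimit.continuous_iff_coord.2 hGc, ?_, fun a => ?_⟩
  · exact Subtype.ext (funext fun n => hG0 n)
  · exact hG 0 a

end Lifting

/-! ### Paths avoiding a countable set -/

section Generic

variable {S : Type*} [TopologicalSpace S] [ChartedSpace ℂ S]

/-- A ball in the plane remains path connected when a countable set is removed. -/
theorem isPathConnected_ball_diff_countable (c : ℂ) {r : ℝ} (hr : 0 < r) {Q : Set ℂ}
    (hQ : Q.Countable) : IsPathConnected (Metric.ball c r \ Q) := by
  set u := OpenPartialHomeomorph.univBall (P := ℂ) c r
  have hs : u.source = univ := OpenPartialHomeomorph.univBall_source c r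
  have ht : u.target = Metric.ball c r := OpenPartialHomeomorph.univBall_target c hr
  have hinj : InjOn u (u ⁻¹' Q) := u.injOn.mono (by simp [hs])
  have h1 : (u ⁻¹' Q).Countable :=
    (mapsTo_preimage u Q).countable_of_injOn hinj hQ
  have h2 := (h1.isPathConnected_compl_of_one_lt_rank (by simp)).image' (f := u)
    (u.continuousOn.mono (by simp [hs]))
  convert h2 using 1
  rw [← ht, ← u.image_source_eq_target, hs]
  ext z
  constructor
  · rintro ⟨⟨w, -, rfl⟩, hw⟩
    exact ⟨w, hw, rfl⟩
  · rintro ⟨w, hw, rfl⟩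
    exact ⟨⟨w, trivial, rfl⟩, hw⟩

theorem exists_nhds_isPathConnected_diff {Q : Set S} (hQ : Q.Countable) {G : Set S}
    (hG : IsOpen G) {z : S} (hz : z ∈ G) :
    ∃ U, IsOpen U ∧ z ∈ U ∧ U ⊆ G ∧ IsPathConnected (U \ Q) := by
  set φ := chartAt ℂ z
  have hzs : z ∈ φ.source := mem_chart_source ℂ z
  have ho : IsOpen (φ.target ∩ φ.symm ⁻¹' G) := φ.isOpen_inter_preimage_symm hG
  obtain ⟨r, hr, hball⟩ := Metric.isOpen_iff.1 ho (φ z)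
    ⟨φ.map_source hzs, by rwa [mem_preimage, φ.left_inv hzs]⟩
  have hbt : Metric.ball (φ z) r ⊆ φ.target := hball.trans inter_subset_left
  have hcount : (φ '' (φ.source ∩ Q)).Countable := (hQ.mono inter_subset_right).image _
  refine ⟨φ.symm '' Metric.ball (φ z) r,
    φ.symm.isOpen_image_of_subset_source Metric.isOpen_ball hbt,
    ⟨φ z, Metric.mem_ball_self hr, φ.left_inv hzs⟩, ?_, ?_⟩
  · rintro _ ⟨w, hw, rfl⟩
    exact (hball hw).2
  · have h := (isPathConnected_ball_diff_countable (φ z) hr hcount).image' (f := φ.symm)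
      (φ.continuousOn_symm.mono (sdiff_subset.trans hbt))
    convert h using 1
    ext p
    constructor
    · rintro ⟨⟨w, hw, rfl⟩, hp⟩
      refine ⟨w, ⟨hw, ?_⟩, rfl⟩
      rintro ⟨q, ⟨hqs, hq⟩, rfl⟩
      rw [φ.left_inv hqs] at hp
      exact hp hq
    · rintro ⟨w, ⟨hw, hwQ⟩, rfl⟩
      exact ⟨⟨w, hw, rfl⟩, fun hq => hwQ ⟨φ.symm w,
        ⟨φ.map_target (hbt hw), hq⟩, φ.right_inv (hbt hw)⟩⟩

theorem exists_mem_diff_countable {Q : Set S} (hQ : Q.Countable) {G : Set S} (hG : IsOpen G)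
    (hne : G.Nonempty) : ∃ p ∈ G, p ∉ Q := by
  obtain ⟨z, hz⟩ := hne
  obtain ⟨U, -, -, hUG, hU⟩ := exists_nhds_isPathConnected_diff hQ hG hz
  obtain ⟨p, hp⟩ := hU.nonempty
  exact ⟨p, hUG hp.1, hp.2⟩

/-- A connected open subset of a surface remains path connected when a countable set is removed. -/
theorem joinedIn_diff_countable {D Q : Set S} (hD : IsOpen D) (hDc : IsPreconnected D)
    (hQ : Q.Countable) {a b : S} (ha : a ∈ D) (haQ : a ∉ Q) (hb : b ∈ D) (hbQ : b ∉ Q) :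
    JoinedIn (D \ Q) a b := by
  have hloc : ∀ z ∈ D, ∃ U, IsOpen U ∧ z ∈ U ∧ U ⊆ D ∧ IsPathConnected (U \ Q) := fun z hz =>
    exists_nhds_isPathConnected_diff hQ hD hz
  choose! U hUo hzU hUD hUp using hloc
  let A : Set S := {z | z ∈ D ∧ ∃ p ∈ U z \ Q, JoinedIn (D \ Q) a p}
  have hmono : ∀ z ∈ D, U z \ Q ⊆ D \ Q := fun z hz => sdiff_subset_sdiff_left (hUD z hz)
  have step : ∀ z ∈ A, ∀ w ∈ D, (U z ∩ U w).Nonempty → w ∈ A := by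
    rintro z ⟨hz, p, hp, hap⟩ w hw hne
    obtain ⟨q, hq, hqQ⟩ := exists_mem_diff_countable hQ ((hUo z hz).inter (hUo w hw)) hne
    exact ⟨hw, q, ⟨hq.2, hqQ⟩,
      hap.trans (((hUp z hz).joinedIn p hp q ⟨hq.1, hqQ⟩).mono (hmono z hz))⟩
  have hAo : IsOpen A := by
    rw [isOpen_iff_mem_nhds]
    intro z hz
    refine mem_of_superset ((hUo z hz.1).mem_nhds (hzU z hz.1)) fun w hw => ?_
    exact step z hz w (hUD z hz.1 hw) ⟨w, hw, hzU w (hUD z hz.1 hw)⟩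
  have hA : D ⊆ A := by
    refine hDc.subset_of_closure_inter_subset hAo
      ⟨a, ha, ha, a, ⟨hzU a ha, haQ⟩, JoinedIn.refl ⟨ha, haQ⟩⟩ ?_
    rintro w ⟨hw, hwD⟩
    obtain ⟨z, hzw, hzA⟩ := mem_closure_iff.1 hw (U w) (hUo w hwD) (hzU w hwD)
    exact step z hzA w hwD ⟨z, hzU z hzA.1, hzw⟩
  obtain ⟨-, p, hp, hap⟩ := hA hb
  exact hap.trans (((hUp b hb).joinedIn p hp b ⟨hzU b hb, hbQ⟩).mono (hmono b hb))

end Generic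

/-! ### Disc coordinates -/

section Disc

variable {S : Type*} [TopologicalSpace S] {e : OpenPartialHomeomorph S ℂ} {x₀ : S}

/-- `e` is a coordinate centred at `x₀` whose range contains the closed unit disk. -/
structure IsDiscCoord (e : OpenPartialHomeomorph S ℂ) (x₀ : S) : Prop where
  mem_source : x₀ ∈ e.source
  map_center : e x₀ = 0
  subset_target : Metric.closedBall 0 1 ⊆ e.target

/-- The open disk of radius `r` in the coordinate `e`. -/
def disc (e : OpenPartialHomeomorph S ℂ) (r : ℝ) : Set S := e.symm '' Metric.ball 0 r

/-- The closed disk of radius `r` in the coordinate `e`. -/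
def cdisc (e : OpenPartialHomeomorph S ℂ) (r : ℝ) : Set S := e.symm '' Metric.closedBall 0 r

theorem disc_subset_cdisc (r : ℝ) : disc e r ⊆ cdisc e r :=
  image_mono Metric.ball_subset_closedBall

theorem cdisc_subset_disc {r s : ℝ} (h : s < r) : cdisc e s ⊆ disc e r :=
  image_mono (Metric.closedBall_subset_ball h)

theorem disc_mono {r s : ℝ} (h : s ≤ r) : disc e s ⊆ disc e r :=
  image_mono (Metric.ball_subset_ball h)

namespace IsDiscCoord

variable (he : IsDiscCoord e x₀) {r s : ℝ}
include he

theorem mem_target {w : ℂ} (hw : ‖w‖ ≤ 1) : w ∈ e.target :=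
  he.subset_target (mem_closedBall_zero_iff.2 hw)

theorem symm_zero : e.symm 0 = x₀ := by
  rw [← he.map_center, e.left_inv he.mem_source]

theorem ball_subset_target (hr : r ≤ 1) : Metric.ball 0 r ⊆ e.target :=
  (Metric.ball_subset_closedBall.trans (Metric.closedBall_subset_closedBall hr)).trans
    he.subset_target

theorem closedBall_subset_target (hr : r ≤ 1) : Metric.closedBall 0 r ⊆ e.target :=
  (Metric.closedBall_subset_closedBall hr).trans he.subset_target

theorem mem_disc_iff (hr : r ≤ 1) {z : S} : z ∈ disc e r ↔ z ∈ e.source ∧ ‖e z‖ < r := by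
  constructor
  · rintro ⟨w, hw, rfl⟩
    have := he.ball_subset_target hr hw
    exact ⟨e.map_target this, by rw [e.right_inv this]; simpa using hw⟩
  · rintro ⟨hz, hr⟩
    exact ⟨e z, by simpa using hr, e.left_inv hz⟩

theorem mem_cdisc_iff (hr : r ≤ 1) {z : S} : z ∈ cdisc e r ↔ z ∈ e.source ∧ ‖e z‖ ≤ r := by
  constructor
  · rintro ⟨w, hw, rfl⟩
    have := he.closedBall_subset_target hr hw
    exact ⟨e.map_target this, by rw [e.right_inv this]; simpa using hw⟩
  · rintro ⟨hz, hr⟩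
    exact ⟨e z, by simpa using hr, e.left_inv hz⟩

theorem symm_mem_disc_iff {w : ℂ} (hw : ‖w‖ ≤ 1) (hr : r ≤ 1) : e.symm w ∈ disc e r ↔ ‖w‖ < r := by
  rw [he.mem_disc_iff hr, e.right_inv (he.mem_target hw)]
  simp [e.map_target (he.mem_target hw)]

theorem symm_mem_cdisc_iff {w : ℂ} (hw : ‖w‖ ≤ 1) (hr : r ≤ 1) : e.symm w ∈ cdisc e r ↔ ‖w‖ ≤ r := by
  rw [he.mem_cdisc_iff hr, e.right_inv (he.mem_target hw)]
  simp [e.map_target (he.mem_target hw)]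

theorem isOpen_disc (hr : r ≤ 1) : IsOpen (disc e r) :=
  e.symm.isOpen_image_of_subset_source Metric.isOpen_ball (he.ball_subset_target hr)

theorem isPreconnected_disc (hr : r ≤ 1) : IsPreconnected (disc e r) :=
  (convex_ball (0 : ℂ) r).isPreconnected.image _
    (e.continuousOn_symm.mono (he.ball_subset_target hr))

theorem mem_disc (hr : 0 < r) : x₀ ∈ disc e r :=
  ⟨0, Metric.mem_ball_self hr, he.symm_zero⟩

theorem isCompact_cdisc (hr : r ≤ 1) : IsCompact (cdisc e r) :=
  (isCompact_closedBall (0 : ℂ) r).image_of_continuousOn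
    (e.continuousOn_symm.mono (he.closedBall_subset_target hr))

theorem closure_disc_subset [T2Space S] (hr : r ≤ 1) : closure (disc e r) ⊆ cdisc e r :=
  closure_minimal (disc_subset_cdisc r) (he.isCompact_cdisc hr).isClosed

theorem exists_disc_subset {G : Set S} (hG : IsOpen G) (hx : x₀ ∈ G) :
    ∃ r, 0 < r ∧ r ≤ 1 ∧ disc e r ⊆ G := by
  have ho : IsOpen (e.target ∩ e.symm ⁻¹' G) := e.isOpen_inter_preimage_symm hG
  obtain ⟨r, hr, hball⟩ := Metric.isOpen_iff.1 ho 0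
    ⟨he.mem_target (by simp), by rwa [mem_preimage, he.symm_zero]⟩
  refine ⟨min r 1, lt_min hr one_pos, min_le_right _ _, ?_⟩
  rintro _ ⟨w, hw, rfl⟩
  exact (hball (Metric.ball_subset_ball (min_le_left _ _) hw)).2

theorem continuous_symm_comp {A : Type*} [TopologicalSpace A] {g : A → ℂ} (hg : Continuous g)
    (h : ∀ a, ‖g a‖ ≤ 1) : Continuous fun a => e.symm (g a) :=
  e.continuousOn_symm.comp_continuous hg fun a => he.mem_target (h a)

end IsDiscCoord

end Disc

section LevelDisc

variable {S : Type*} [TopologicalSpace S] [T2Space S] [LocallyConnectedSpace S] {f : S → S}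
  {e : OpenPartialHomeomorph S ℂ} {x : StandardInverseLimit f} {r : ℝ} {n : ℕ}

/-- Near a noncritical boundary point, the closure of a component of the preimage of a disk fills
the preimage of the closed disk. -/
theorem eventually_mem_closure_levelComp (hf : IsTopBranched f) (he : IsDiscCoord e (x.1 0))
    (hr0 : 0 < r) (hr : r ≤ 1) {z : S} (hz : z ∈ closure (levelComp f x (disc e r) n))
    (hzc : f^[n] z ∉ critVals f n) :
    ∀ᶠ w in 𝓝 z, f^[n] w ∈ cdisc e r → w ∈ closure (levelComp f x (disc e r) n) := by
  obtain ⟨φ, hφ, hφF⟩ := exists_openPartialHomeomorph (hf.continuous_iterate n)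
    (hf.isOpenMap_iterate n) (notMem_branchSet_iterate hf.continuous hzc)
  have hzs : f^[n] z ∈ e.source :=
    ((he.mem_cdisc_iff hr).1 (he.closure_disc_subset hr (closure_levelComp_subset hf.continuous hz))).1
  -- a coordinate at `z` in which the preimage of the disc is a ball about the origin
  let h := φ.trans e
  have hh : ∀ w, h w = e (f^[n] w) := fun w => by simp [h, hφF]
  have hzh : z ∈ h.source := by simp [h, hφ, hφF, hzs]
  obtain ⟨δ, hδ, hball⟩ := Metric.isOpen_iff.1 h.open_target (h z) (h.map_source hzh)
  set B := Metric.ball (h z) δ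
  have hG : h.source ∩ h ⁻¹' B ∈ 𝓝 z :=
    (h.isOpen_inter_preimage Metric.isOpen_ball).mem_nhds ⟨hzh, Metric.mem_ball_self hδ⟩
  have hsrc : ∀ w ∈ h.source, f^[n] w ∈ e.source := fun w hw => by
    have := hw.2
    simpa [hφF] using this
  have hA : IsPreconnected (h.symm '' (B ∩ Metric.ball 0 r)) :=
    ((convex_ball _ _).inter (convex_ball _ _)).isPreconnected.image _
      (h.continuousOn_symm.mono (inter_subset_left.trans hball))
  have hAV : ∀ w ∈ h.symm '' (B ∩ Metric.ball 0 r), f^[n] w ∈ disc e r := by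
    rintro _ ⟨w, ⟨hwB, hw⟩, rfl⟩
    refine (he.mem_disc_iff hr).2 ⟨hsrc _ (h.map_target (hball hwB)), ?_⟩
    rw [← hh, h.right_inv (hball hwB)]
    simpa using hw
  obtain ⟨p, hpG, hpD⟩ := mem_closure_iff_nhds.1 hz _ hG
  have hpA : p ∈ h.symm '' (B ∩ Metric.ball 0 r) := by
    refine ⟨h p, ⟨hpG.2, ?_⟩, h.left_inv hpG.1⟩
    rw [mem_ball_zero_iff, hh]
    exact ((he.mem_disc_iff hr).1 (iterate_mem_of_mem_levelComp hpD)).2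
  have hAD := subset_levelComp hA hAV hpA hpD
  filter_upwards [hG] with w hw hwc
  refine closure_mono hAD ?_
  have h1 : h w ∈ closure (B ∩ Metric.ball 0 r) := by
    refine Metric.isOpen_ball.inter_closure ⟨hw.2, ?_⟩
    rw [closure_ball _ hr0.ne', mem_closedBall_zero_iff, hh]
    exact ((he.mem_cdisc_iff hr).1 hwc).2
  have h2 : ContinuousWithinAt h.symm (B ∩ Metric.ball 0 r) (h w) :=
    ((h.continuousOn_symm.continuousAt (h.open_target.mem_nhds (hball hw.2)))).continuousWithinAt
  have := h2.mem_closure_image h1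
  rwa [h.left_inv hw.1] at this

/-- A connected set over the closed disk without critical values, which meets the closure of a
component over the open disk, lies in that closure. -/
theorem subset_closure_levelComp (hf : IsTopBranched f) (he : IsDiscCoord e (x.1 0))
    (hr0 : 0 < r) (hr : r ≤ 1) {A : Set S} (hA : IsPreconnected A)
    (hAc : ∀ z ∈ A, f^[n] z ∈ cdisc e r) (hAv : ∀ z ∈ A, f^[n] z ∉ critVals f n) {z : S}
    (hz : z ∈ A) (hzD : z ∈ closure (levelComp f x (disc e r) n)) :
    A ⊆ closure (levelComp f x (disc e r) n) := by
  set D := closure (levelComp f x (disc e r) n)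
  intro w hw
  by_contra hwD
  obtain ⟨p, hpA, hp1, hp2⟩ := hA {z | ∀ᶠ w in 𝓝 z, f^[n] w ∈ cdisc e r → w ∈ D} Dᶜ
    isOpen_setOfPred_eventually_nhds isClosed_closure.isOpen_compl
    (fun p hp => by
      by_cases hpD : p ∈ D
      · exact Or.inl (eventually_mem_closure_levelComp hf he hr0 hr hpD (hAv p hp))
      · exact Or.inr hpD)
    ⟨z, hz, eventually_mem_closure_levelComp hf he hr0 hr hzD (hAv z hz)⟩ ⟨w, hw, hwD⟩
  exact hp2 (hp1.self_of_nhds (hAc p hpA))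

end LevelDisc

/-! ### Paths in the plaque topology -/

section PlaquePaths

variable {S : Type*} [TopologicalSpace S] [LocallyConnectedSpace S] [T2Space S] {f : S → S}

theorem continuous_plaqueTopology_unitInterval {g : unitInterval → StandardInverseLimit f}
    (hg : Continuous g) : Continuous[_, PlaqueInverseLimit.plaqueTopology f] g := by
  have h1 : Continuous fun t : ℝ => g (projIcc 0 1 zero_le_one t) := hg.comp continuous_projIcc
  have h2 : Continuous[_, PlaqueInverseLimit.plaqueTopology f]
      fun t : ℝ => g (projIcc 0 1 zero_le_one t) :=
    continuous_plaqueTopology (StandardInverseLimit.continuous_iff_coord.1 h1)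
  have h3 := @Continuous.comp _ _ _ _ _ (PlaqueInverseLimit.plaqueTopology f) _ _ h2
    (continuous_subtype_val (p := fun t : ℝ => t ∈ unitInterval))
  have h4 : (fun t : ℝ => g (projIcc 0 1 zero_le_one t)) ∘ (Subtype.val : unitInterval → ℝ) = g := by
    funext t
    simp
  rwa [h4] at h3

/-- The plaque topology and the Tychonoff topology have the same paths. -/
theorem joinedIn_plaque_iff {W : Set (PlaqueInverseLimit f)} {y z : PlaqueInverseLimit f} :
    JoinedIn W y z ↔
      JoinedIn (X := StandardInverseLimit f) (show Set (StandardInverseLimit f) from W) y z := by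
  constructor
  · rintro ⟨γ, hγ⟩
    exact ⟨⟨⟨γ.toFun, StandardInverseLimit.continuous_iff_coord.2 fun n =>
      (continuous_proj n).comp γ.continuous⟩, γ.source, γ.target⟩, hγ⟩
  · rintro ⟨γ, hγ⟩
    exact ⟨⟨⟨γ.toFun, continuous_plaqueTopology_unitInterval γ.continuous⟩, γ.source,
      γ.target⟩, hγ⟩

end PlaquePaths

/-! ### Existence of disc coordinates -/

section ExistsDisc

variable {S : Type*} [TopologicalSpace S] [ChartedSpace ℂ S]

theorem exists_angle_notMem {B : Set ℂ} (hB : B.Countable) {a b : ℝ} (hab : a < b)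
    (hb : b - a ≤ 2 * Real.pi) : ∃ α ∈ Ioo a b, Complex.exp (α * Complex.I) ∉ B := by
  have hinj : InjOn (fun α : ℝ => Complex.exp (α * Complex.I)) (Ioo a b) := by
    intro α hα α' hα' h
    obtain ⟨n, hn⟩ := Complex.exp_eq_exp_iff_exists_int.1 h
    have h1 : α = α' + n * (2 * Real.pi) := by
      have := congrArg Complex.im hn
      simpa using this
    have h2 : |(n : ℝ) * (2 * Real.pi)| < 2 * Real.pi := by
      rw [abs_lt]
      constructor <;> linarith [hα.1, hα.2, hα'.1, hα'.2]
    rw [abs_mul, abs_of_pos Real.two_pi_pos] at h2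
    have h3 : |(n : ℝ)| < 1 := by
      by_contra hcon
      push Not at hcon
      nlinarith [Real.two_pi_pos]
    have h4 : n = 0 := by
      have : |n| < 1 := by exact_mod_cast h3
      exact Int.abs_lt_one_iff.1 this
    simpa [h4] using h1
  have hc : (Ioo a b ∩ (fun α : ℝ => Complex.exp (α * Complex.I)) ⁻¹' B).Countable :=
    MapsTo.countable_of_injOn (f := fun α : ℝ => Complex.exp (α * Complex.I)) (fun α hα => hα.2)
      (hinj.mono inter_subset_left) hB
  obtain ⟨α, hα, h1⟩ := (hc.dense_compl ℝ).exists_between hab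
  exact ⟨α, h1, fun h => hα ⟨h1, h⟩⟩

/-- Around each point there is a disc coordinate for which the positive radius avoids a given
countable set. -/
theorem exists_isDiscCoord [IsManifold 𝓘(ℂ) 1 S] (x₀ : S) {Q : Set S} (hQ : Q.Countable) :
    ∃ e : OpenPartialHomeomorph S ℂ, IsDiscCoord e x₀ ∧ MDifferentiableOn 𝓘(ℂ) 𝓘(ℂ) e e.source ∧
      ∀ t : ℝ, 0 < t → t ≤ 1 → e.symm t ∉ Q := by
  set φ := chartAt ℂ x₀
  set c := φ x₀
  have hs : x₀ ∈ φ.source := mem_chart_source ℂ x₀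
  obtain ⟨R, hR, hball⟩ := Metric.nhds_basis_closedBall.mem_iff.1
    (φ.open_target.mem_nhds (φ.map_source hs))
  -- the directions of the points of `Q` are countable in number, and a rotation takes another
  -- direction to the positive radius
  have hB : ((fun p => (‖φ p - c‖ : ℂ) / (φ p - c)) '' Q).Countable := hQ.image _
  obtain ⟨α, -, hα⟩ := exists_angle_notMem hB (a := 0) (b := 1) one_pos
    (by linarith [Real.two_le_pi])
  set ζ := Complex.exp (α * Complex.I)
  have hζ : ‖ζ‖ = 1 := Complex.norm_exp_ofReal_mul_I α
  have hζ0 : ζ ≠ 0 := Complex.exp_ne_zero _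
  have hk : ζ / R ≠ 0 := div_ne_zero hζ0 (by exact_mod_cast hR.ne')
  let h : ℂ ≃ₜ ℂ := (Homeomorph.addRight (-c)).trans (Homeomorph.mulLeft₀ (ζ / R) hk)
  have hh : ∀ w, h w = ζ / R * (w - c) := fun w => by simp [h, sub_eq_add_neg]
  have hhs : ∀ w, h.symm w = w * (R / ζ) + c := fun w => by
    rw [Homeomorph.symm_apply_eq, hh]
    have : (R : ℂ) ≠ 0 := by exact_mod_cast hR.ne'
    field_simp
    ring
  refine ⟨φ.trans h.toOpenPartialHomeomorph, ⟨by simpa using hs, ?_, ?_⟩, ?_, ?_⟩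
  · simp [hh, c]
  · intro w hw
    have h1 : h.symm w ∈ φ.target := by
      refine hball ?_
      rw [mem_closedBall_iff_norm, hhs, add_sub_cancel_right, norm_mul, norm_div, hζ,
        Complex.norm_real, Real.norm_of_nonneg hR.le, div_one]
      rw [mem_closedBall_zero_iff] at hw
      nlinarith
    simpa using h1
  · have h1 : MDifferentiableOn 𝓘(ℂ) 𝓘(ℂ) φ φ.source :=
      mdifferentiableOn_atlas (chart_mem_atlas ℂ x₀)
    have h2 : MDifferentiable 𝓘(ℂ) 𝓘(ℂ) h := by
      refine mdifferentiable_iff_differentiable.2 ?_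
      have : (h : ℂ → ℂ) = fun w => ζ / R * (w - c) := funext hh
      rw [this]
      fun_prop
    exact (h2.comp_mdifferentiableOn h1).mono (by simp)
  · intro t ht ht1 hmem
    refine hα ⟨_, hmem, ?_⟩
    have hsymm : (φ.trans h.toOpenPartialHomeomorph).symm t = φ.symm (t * (R / ζ) + c) := by
      simp [hhs]
    have htgt : (t * (R / ζ) + c : ℂ) ∈ φ.target := by
      refine hball ?_
      rw [mem_closedBall_iff_norm, add_sub_cancel_right, norm_mul, norm_div, hζ,
        Complex.norm_real, Complex.norm_real, Real.norm_of_nonneg hR.le, Real.norm_of_nonneg ht.le,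
        div_one]
      nlinarith
    simp only
    rw [hsymm, φ.right_inv htgt, add_sub_cancel_right, norm_mul, norm_div, hζ,
        Complex.norm_real, Complex.norm_real, Real.norm_of_nonneg hR.le, Real.norm_of_nonneg ht.le]
    have h1 : (R : ℂ) ≠ 0 := by exact_mod_cast hR.ne'
    have h2 : (t : ℂ) ≠ 0 := by exact_mod_cast ht.ne'
    push_cast
    field_simp

end ExistsDisc

/-! ### Regular points -/

section Regular

variable {S : Type*} [TopologicalSpace S] {f : S → S}

/-- Over a simply connected open set, a component of the preimage without critical points is the
image of a section. -/
theorem exists_section_of_component [T2Space S] [LocallyConnectedSpace S] (hf : IsTopBranched f)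
    {A : Set S} (hA : IsOpen A) [SimplyConnectedSpace A] [LocallyPathConnectedSpace A] {z : S}
    (hz : f z ∈ A) (hb : Disjoint (connectedComponentIn (f ⁻¹' A) z) (branchSet f)) :
    ∃ s : A → S, Continuous s ∧ s ⟨f z, hz⟩ = z ∧ (∀ a, f (s a) = a) ∧
      range s = connectedComponentIn (f ⁻¹' A) z := by
  set B := connectedComponentIn (f ⁻¹' A) z
  have hBo : IsOpen B := (hA.preimage hf.continuous).connectedComponentIn
  have hBA : ∀ w ∈ B, f w ∈ A := fun w hw => connectedComponentIn_subset (f ⁻¹' A) z hw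
  have hzB : z ∈ B := mem_connectedComponentIn hz
  -- the restriction of `f` to the component is a covering of `A`; the range of a section of it is
  -- open and closed
  let g : B → A := fun w => ⟨f w, hBA w w.2⟩
  have hgc : Continuous g := by
    have := hf.continuous
    fun_prop
  have hgo : IsOpenMap g := by
    intro O hO
    have h1 : IsOpen (f '' (Subtype.val '' O)) := hf.isOpenMap _ (hBo.isOpenMap_subtype_val O hO)
    convert h1.preimage (continuous_subtype_val (p := fun a => a ∈ A)) using 1
    ext a
    constructor
    · rintro ⟨w, hw, rfl⟩
      exact ⟨w, ⟨w, hw, rfl⟩, rfl⟩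
    · rintro ⟨_, ⟨w, hw, rfl⟩, hwa⟩
      exact ⟨w, hw, Subtype.ext hwa⟩
  have hgcl : IsClosedMap g := by
    intro C hC
    obtain ⟨C', hC', rfl⟩ := isClosed_induced_iff.1 hC
    have h1 : IsClosed (f '' (C' ∩ closure B)) :=
      hf.proper.isClosedMap _ (hC'.inter isClosed_closure)
    convert h1.preimage (continuous_subtype_val (p := fun a => a ∈ A)) using 1
    ext a
    constructor
    · rintro ⟨w, hw, rfl⟩
      exact ⟨w, ⟨hw, subset_closure w.2⟩, rfl⟩
    · rintro ⟨w, ⟨hw, hwB⟩, hwa⟩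
      have hwB' : w ∈ B := mem_connectedComponentIn_of_mem_closure hwB
        (show f w ∈ A by rw [hwa]; exact a.2)
      exact ⟨⟨w, hwB'⟩, hw, Subtype.ext hwa⟩
  have hloc : IsLocalHomeomorph g := by
    rw [isLocalHomeomorph_iff_isOpenEmbedding_restrict]
    intro w
    have hw : (w : S) ∉ branchSet f := fun h => hb.le_bot ⟨w.2, h⟩
    simp only [branchSet, mem_ofPred_eq, not_forall, not_not] at hw
    obtain ⟨U, hU, hUi⟩ := hw
    obtain ⟨V, hVU, hV, hwV⟩ := mem_nhds_iff.1 hU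
    have hVo : IsOpen (Subtype.val ⁻¹' V : Set B) := hV.preimage continuous_subtype_val
    refine ⟨Subtype.val ⁻¹' V, hVo.mem_nhds hwV, IsOpenEmbedding.of_continuous_injective_isOpenMap
      (hgc.comp continuous_subtype_val) ?_ (hgo.comp hVo.isOpenMap_subtype_val)⟩
    rintro ⟨a, ha⟩ ⟨b, hb⟩ hab
    exact Subtype.ext (Subtype.ext (hUi (hVU ha) (hVU hb) (congrArg Subtype.val hab)))
  have hcov : IsCoveringMap g := by
    rw [isCoveringMap_iff_isCoveringMapOn_univ]
    refine hgcl.isCoveringMapOn_of_isLocalHomeomorphOn (fun a _ => ?_)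
      fun w _ => hloc w
    refine Finite.of_finite_image (f := Subtype.val) ((hf.finite_fiber a).subset ?_)
      Subtype.val_injective.injOn
    rintro _ ⟨w, hw, rfl⟩
    exact congrArg Subtype.val hw
  obtain ⟨s, ⟨hs0, hs⟩, -⟩ := hcov.existsUnique_continuousMap_lifts (ContinuousMap.id A)
    ⟨f z, hz⟩ ⟨z, hzB⟩ rfl
  have hgs : ∀ a, g (s a) = a := fun a => congr_fun hs a
  have hclopen : IsClopen (range s) := by
    constructor
    · have h1 : range s = {w | s (g w) = w} := by
        ext w
        constructor
        · rintro ⟨a, rfl⟩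
          change s (g (s a)) = s a
          rw [hgs]
        · exact fun hw => ⟨g w, hw⟩
      rw [h1]
      exact isClosed_eq (s.continuous.comp hgc) continuous_id
    · rw [isOpen_iff_mem_nhds]
      rintro _ ⟨a, rfl⟩
      obtain ⟨U, hU, hUe⟩ := isLocalHomeomorph_iff_isOpenEmbedding_restrict.1 hloc (s a)
      have h1 : Tendsto (fun w => s (g w)) (𝓝 (s a)) (𝓝 (s a)) := by
        have := (s.continuous.comp hgc).tendsto (s a)
        rwa [Function.comp_apply, hgs] at this
      filter_upwards [hU, h1 hU] with w hw hw'
      refine ⟨g w, ?_⟩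
      have := hUe.injective (a₁ := ⟨s (g w), hw'⟩) (a₂ := ⟨w, hw⟩)
        (by simp only [domRestrict_apply, hgs])
      exact congrArg Subtype.val this
  have : PreconnectedSpace B := isPreconnected_iff_preconnectedSpace.1
    isPreconnected_connectedComponentIn
  have hrange : range s = univ := hclopen.eq_univ ⟨_, ⟨f z, hz⟩, rfl⟩
  refine ⟨fun a => s a, by fun_prop, congrArg Subtype.val hs0, fun a => congrArg Subtype.val (hgs a),
    ?_⟩
  ext w
  constructor
  · rintro ⟨a, rfl⟩
    exact (s a).2
  · intro hw
    obtain ⟨a, ha⟩ := hrange.symm.subset (mem_univ (⟨w, hw⟩ : B))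
    exact ⟨a, congrArg Subtype.val ha⟩

end Regular

section RegularPoints

variable {S : Type*} [TopologicalSpace S] [T2Space S] [LocallyConnectedSpace S] {f : S → S}

/-- If no component over `G` beyond the level `m` contains a critical point, then over a simply
connected `G` the component of the inverse limit is the image of a section. -/
theorem exists_limit_section (hf : IsTopBranched f) (x : StandardInverseLimit f) (m : ℕ) {G : Set S}
    (hG : IsOpen G) [SimplyConnectedSpace G] [LocallyPathConnectedSpace G] (hx : x.1 m ∈ G)
    (hb : ∀ k, Disjoint (connectedComponentIn (f^[k] ⁻¹' G) (x.1 (m + k))) (branchSet f)) :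
    ∃ s : G → StandardInverseLimit f, Continuous s ∧ s ⟨x.1 m, hx⟩ = x ∧ (∀ a, (s a).1 m = a) ∧
      range s = connectedComponentIn ((fun y : StandardInverseLimit f => y.1 m) ⁻¹' G) x := by
  have hxk : ∀ k, f^[k] (x.1 (m + k)) ∈ G := fun k => by
    rwa [StandardInverseLimit.iterate_apply]
  -- the sections over the finite levels
  have key : ∀ k, ∃ s : G → S, Continuous s ∧ s ⟨x.1 m, hx⟩ = x.1 (m + k) ∧
      (∀ a, f^[k] (s a) = a) ∧ range s = connectedComponentIn (f^[k] ⁻¹' G) (x.1 (m + k)) := by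
    intro k
    induction k with
    | zero =>
      refine ⟨Subtype.val, continuous_subtype_val, rfl, fun a => rfl, ?_⟩
      have : IsPreconnected G := isPreconnected_iff_preconnectedSpace.2 inferInstance
      rw [Subtype.range_coe]
      exact (this.connectedComponentIn hx).symm
    | succ k ih =>
      obtain ⟨s, hs, hs0, hsf, hsr⟩ := ih
      set A := connectedComponentIn (f^[k] ⁻¹' G) (x.1 (m + k))
      have hAo : IsOpen A := (hG.preimage (hf.continuous_iterate k)).connectedComponentIn
      have hsA : ∀ a, s a ∈ A := fun a => hsr ▸ mem_range_self a
      have hAG : ∀ w ∈ A, f^[k] w ∈ G := fun w hw => connectedComponentIn_subset (f^[k] ⁻¹' G) _ hw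
      let Ψ : G ≃ₜ A :=
        { toFun := fun a => ⟨s a, hsA a⟩
          invFun := fun w => ⟨f^[k] w, hAG w w.2⟩
          left_inv := fun a => Subtype.ext (hsf a)
          right_inv := by
            rintro ⟨w, hw⟩
            obtain ⟨a, rfl⟩ := hsr.symm.subset hw
            refine Subtype.ext ?_
            change s ⟨f^[k] (s a), _⟩ = s a
            congr 1
            exact Subtype.ext (hsf a)
          continuous_toFun := by fun_prop
          continuous_invFun := by
            have := hf.continuous_iterate k
            fun_prop }
      have : SimplyConnectedSpace A := Ψ.symm.toHomotopyEquiv.simplyConnectedSpace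
      have : LocallyPathConnectedSpace A := Ψ.symm.isOpenEmbedding.locallyPathConnectedSpace
      have hfx : f (x.1 (m + (k + 1))) = x.1 (m + k) := x.2 (m + k)
      have hfA : f (x.1 (m + (k + 1))) ∈ A := by
        rw [hfx]
        exact mem_connectedComponentIn (hxk k)
      have hcomp : connectedComponentIn (f^[k + 1] ⁻¹' G) (x.1 (m + (k + 1))) =
          connectedComponentIn (f ⁻¹' A) (x.1 (m + (k + 1))) := by
        rw [Function.iterate_succ, preimage_comp, connectedComponentIn_preimage_eq hf.continuous,
          hfx]
        rw [hfx]
        exact hxk k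
      obtain ⟨t, ht, ht0, htf, htr⟩ := exists_section_of_component hf hAo hfA
        (hcomp ▸ hb (k + 1))
      refine ⟨fun a => t ⟨s a, hsA a⟩, by fun_prop, ?_, fun a => ?_, ?_⟩
      · rw [← ht0]
        exact congrArg t (Subtype.ext (hs0.trans hfx.symm))
      · rw [Function.iterate_succ_apply, htf]
        exact hsf a
      · rw [hcomp, ← htr]
        have : range Ψ = univ := Ψ.surjective.range_eq
        rw [show (fun a => t ⟨s a, hsA a⟩) = t ∘ Ψ from rfl, range_comp, this, image_univ]
  choose s hs hs0 hsf hsr using key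
  have hsD : ∀ k a, s k a ∈ connectedComponentIn (f^[k] ⁻¹' G) (x.1 (m + k)) := fun k a =>
    hsr k ▸ mem_range_self a
  have huniq : ∀ k, ∀ w ∈ connectedComponentIn (f^[k] ⁻¹' G) (x.1 (m + k)), ∀ a : G,
      f^[k] w = a → w = s k a := by
    intro k w hw a hwa
    obtain ⟨b, rfl⟩ := (hsr k).symm.subset hw
    rw [hsf] at hwa
    rw [Subtype.ext hwa]
  have hcoh : ∀ k a, f (s (k + 1) a) = s k a := by
    intro k a
    refine huniq k _ ?_ a ?_
    · have h1 : IsPreconnected (f '' connectedComponentIn (f^[k + 1] ⁻¹' G) (x.1 (m + (k + 1)))) :=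
        isPreconnected_connectedComponentIn.image _ hf.continuous.continuousOn
      refine h1.subset_connectedComponentIn ⟨x.1 (m + (k + 1)), mem_connectedComponentIn (hxk (k + 1)),
        x.2 (m + k)⟩ ?_ (mem_image_of_mem f (hsD (k + 1) a))
      rintro _ ⟨w, hw, rfl⟩
      rw [mem_preimage, ← Function.iterate_succ_apply]
      exact connectedComponentIn_subset (f^[k + 1] ⁻¹' G) _ hw
    · rw [← Function.iterate_succ_apply, hsf]
  -- the sections of all levels, assembled
  let u : G → ℕ → S := fun a n => if n ≤ m then f^[m - n] (a : S) else s (n - m) a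
  have hum : ∀ a k, u a (m + k) = s k a := by
    intro a k
    rcases Nat.eq_zero_or_pos k with rfl | hk
    · have := hsf 0 a
      simp only [Function.iterate_zero, id] at this
      simp [u, this]
    · have : ¬ m + k ≤ m := by omega
      simp [u, this]
  have hu : ∀ a n, f (u a (n + 1)) = u a n := by
    intro a n
    rcases lt_or_ge n m with h | h
    · have : m - n = (m - (n + 1)) + 1 := by omega
      simp only [u, h.le, Nat.succ_le_of_lt h, if_true, this, Function.iterate_succ_apply']
    · obtain ⟨k, rfl⟩ := Nat.exists_eq_add_of_le h
      rw [add_assoc, hum, hum, hcoh]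
  let σ : G → StandardInverseLimit f := fun a => ⟨u a, hu a⟩
  have hσm : ∀ a k, (σ a).1 (m + k) = s k a := hum
  have hσc : Continuous σ := by
    refine StandardInverseLimit.continuous_iff_coord.2 fun n => ?_
    by_cases hn : n ≤ m
    · have := (hf.continuous_iterate (m - n)).comp (continuous_subtype_val (p := fun a => a ∈ G))
      simpa [σ, u, hn, Function.comp_def] using this
    · simpa [σ, u, hn] using hs (n - m)
  have hσ0 : ∀ a, (σ a).1 m = a := fun a => by simp [σ, u]
  have hσx : σ ⟨x.1 m, hx⟩ = x := by
    refine StandardInverseLimit.exists_eq_of_infinite fun N => ⟨m + N, by omega, ?_⟩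
    rw [hσm, hs0]
  refine ⟨σ, hσc, hσx, hσ0, Subset.antisymm ?_ ?_⟩
  · refine (isPreconnected_range hσc).subset_connectedComponentIn ⟨_, hσx⟩ ?_
    rintro _ ⟨a, rfl⟩
    rw [mem_preimage, hσ0]
    exact a.2
  · intro y hy
    have hyG : y.1 m ∈ G :=
      connectedComponentIn_subset ((fun y : StandardInverseLimit f => y.1 m) ⁻¹' G) x hy
    refine ⟨⟨y.1 m, hyG⟩, StandardInverseLimit.exists_eq_of_infinite fun N => ⟨m + N, by omega, ?_⟩⟩
    rw [hσm]
    refine (huniq N _ ?_ _ (StandardInverseLimit.iterate_apply y N m)).symm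
    refine (isPreconnected_connectedComponentIn.image _
      (StandardInverseLimit.continuous_coord (m + N)).continuousOn).subset_connectedComponentIn
      (mem_image_of_mem (fun y : StandardInverseLimit f => y.1 (m + N)) (mem_connectedComponentIn hx))
      ?_ (mem_image_of_mem _ hy)
    rintro _ ⟨w, hw, rfl⟩
    rw [mem_preimage, StandardInverseLimit.iterate_apply]
    exact connectedComponentIn_subset ((fun y : StandardInverseLimit f => y.1 m) ⁻¹' G) x hw

variable [ChartedSpace ℂ S] [IsManifold 𝓘(ℂ) 1 S]

theorem IsDiscCoord.simplyConnectedSpace_disc {e : OpenPartialHomeomorph S ℂ} {x₀ : S}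
    (he : IsDiscCoord e x₀) {r : ℝ} (hr0 : 0 < r) (hr : r ≤ 1) : SimplyConnectedSpace (disc e r) := by
  have : ContractibleSpace (Metric.ball (0 : ℂ) r) :=
    (convex_ball (0 : ℂ) r).contractibleSpace ⟨0, Metric.mem_ball_self hr0⟩
  let Ψ : Metric.ball (0 : ℂ) r ≃ₜ disc e r :=
    { toFun := fun w => ⟨e.symm w, mem_image_of_mem _ w.2⟩
      invFun := fun z => ⟨e z, by
        have := (he.mem_disc_iff hr).1 z.2
        simpa using this.2⟩
      left_inv := fun w => Subtype.ext (e.right_inv (he.ball_subset_target hr w.2))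
      right_inv := fun z => Subtype.ext (e.left_inv ((he.mem_disc_iff hr).1 z.2).1)
      continuous_toFun := by
        have := e.continuousOn_symm.mono (he.ball_subset_target hr)
        exact (continuousOn_iff_continuous_domRestrict.1 this).subtype_mk _
      continuous_invFun := by
        have := e.continuousOn.mono (fun z hz => ((he.mem_disc_iff hr).1 hz).1 : disc e r ⊆ e.source)
        exact (continuousOn_iff_continuous_domRestrict.1 this).subtype_mk _ }
  exact Ψ.symm.toHomotopyEquiv.simplyConnectedSpace

/-- A point with trivial signature has arbitrarily small connected neighbourhoods which remain path
connected when the point is deleted. -/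
theorem exists_connected_not_breaksUncountably (hf : IsTopBranched f) (x : PlaqueInverseLimit f)
    (h : ∀ c ∈ branchSet f, sign x c = {⊥}) {U : Set (PlaqueInverseLimit f)} (hU : IsOpen U)
    (hxU : x ∈ U) :
    ∃ W : Set (PlaqueInverseLimit f), IsOpen W ∧ IsConnected W ∧ x ∈ W ∧ W ⊆ U ∧
      ¬ BreaksUncountably W x := by
  let y : StandardInverseLimit f := x
  obtain ⟨e, he, -, -⟩ := exists_isDiscCoord (y.1 0) countable_empty
  have hr : ∀ j : ℕ, (0 : ℝ) < 1 / (j + 1) ∧ 1 / ((j : ℝ) + 1) ≤ 1 := fun j =>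
    ⟨Nat.one_div_pos_of_nat, by
      rw [div_le_one (by positivity)]
      linarith [(Nat.cast_nonneg j : (0 : ℝ) ≤ j)]⟩
  have hanti : Antitone fun j : ℕ => disc e (1 / ((j : ℝ) + 1)) := fun i j hij =>
    disc_mono (Nat.one_div_le_one_div hij)
  have hbasis : ∀ G, IsOpen G → y.1 0 ∈ G → ∃ j : ℕ, disc e (1 / ((j : ℝ) + 1)) ⊆ G := by
    intro G hG hxG
    obtain ⟨r, hr0, -, hrG⟩ := he.exists_disc_subset hG hxG
    obtain ⟨j, hj⟩ := exists_nat_one_div_lt hr0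
    exact ⟨j, (disc_mono hj.le).trans hrG⟩
  have hsig : ∀ c ∈ branchSet f, ∃ j N : ℕ, ∀ n ≥ N, c ∉ levelComp f y (disc e (1 / ((j : ℝ) + 1))) n := by
    intro c hc
    by_contra hcon
    push Not at hcon
    exact (sign_ne_bot_iff hf x c (V := fun j : ℕ => disc e (1 / ((j : ℝ) + 1)))
      (fun j => he.isOpen_disc (hr j).2)
      (fun j => he.mem_disc (hr j).1) hanti hbasis).2 (fun j N => hcon j N) (h c hc)
  -- since there are finitely many critical points, one disc and one level serve for all of them
  choose! j N hjN using hsig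
  obtain ⟨J, hJ⟩ := (hf.finite_branchSet.image j).bddAbove
  obtain ⟨M, hM⟩ := (hf.finite_branchSet.image N).bddAbove
  obtain ⟨V, hV, hxV, hVU⟩ := exists_plaque_subset hf hU hxU
  obtain ⟨J', hJ'⟩ := hbasis V hV hxV
  set r : ℝ := 1 / ((max J J' : ℕ) + 1)
  have hr0 : 0 < r := (hr _).1
  have hr1 : r ≤ 1 := (hr _).2
  have hno : ∀ n ≥ M, Disjoint (levelComp f y (disc e r) n) (branchSet f) := by
    intro n hn
    rw [Set.disjoint_left]
    intro c hc hcb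
    refine hjN c hcb n ((hM (mem_image_of_mem N hcb)).trans hn) (levelComp_mono (hanti ?_) n hc)
    exact (hJ (mem_image_of_mem j hcb)).trans (le_max_left _ _)
  set D := levelComp f y (disc e r) M
  have hDo : IsOpen D := isOpen_levelComp hf.continuous (he.isOpen_disc hr1) M
  have hyD : y.1 M ∈ D := mem_levelComp (he.mem_disc hr0) M
  obtain ⟨e', he', -, -⟩ := exists_isDiscCoord (y.1 M) countable_empty
  obtain ⟨t, ht0, ht1, htD⟩ := he'.exists_disc_subset hDo hyD
  set G := disc e' t
  have hGo : IsOpen G := he'.isOpen_disc ht1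
  have hGc : IsPreconnected G := he'.isPreconnected_disc ht1
  have hyG : y.1 M ∈ G := he'.mem_disc ht0
  have : SimplyConnectedSpace G := he'.simplyConnectedSpace_disc ht0 ht1
  have : LocallyPathConnectedSpace S := ChartedSpace.locallyPathConnectedSpace ℂ S
  have : LocallyPathConnectedSpace G := hGo.locallyPathConnectedSpace
  obtain ⟨s, hs, hsx, hsM, hsr⟩ := exists_limit_section hf y M hGo hyG (fun k => by
    refine Disjoint.mono_left ?_ (hno (M + k) (by omega))
    refine subset_levelComp isPreconnected_connectedComponentIn (fun z hz => ?_)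
      (mem_connectedComponentIn (by rwa [mem_preimage, StandardInverseLimit.iterate_apply]))
      (mem_levelComp (he.mem_disc hr0) _)
    have h1 : f^[k] z ∈ G := connectedComponentIn_subset (f^[k] ⁻¹' G) _ hz
    rw [Function.iterate_add_apply]
    exact iterate_mem_of_mem_levelComp (htD h1))
  set W : Set (StandardInverseLimit f) :=
    connectedComponentIn ((fun y : StandardInverseLimit f => y.1 M) ⁻¹' G) y
  have hyW : y ∈ W := mem_connectedComponentIn hyG
  have hWo : IsOpen[PlaqueInverseLimit.plaqueTopology f] W :=
    @TopologicalSpace.IsTopologicalBasis.isOpen _ (PlaqueInverseLimit.plaqueTopology f) _ _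
    (PlaqueInverseLimit.isTopologicalBasis_components f)
      ⟨_, hGo.preimage (StandardInverseLimit.continuous_coord M), y, hyG, rfl⟩
  -- paths in `G` give paths in `W`
  have hjoin : ∀ Q : Set S, Q.Countable → ∀ a b : G, (a : S) ∉ Q → (b : S) ∉ Q →
      JoinedIn (W ∩ {w | w.1 M ∉ Q}) (s a) (s b) := by
    intro Q hQ a b ha hb
    obtain ⟨γ, hγ⟩ := joinedIn_diff_countable hGo hGc hQ a.2 ha b.2 hb
    refine ⟨⟨⟨fun t => s ⟨γ t, (hγ t).1⟩, by fun_prop⟩, ?_, ?_⟩, fun t => ⟨?_, ?_⟩⟩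
    · simp
    · simp
    · exact hsr ▸ mem_range_self _
    · change (s _).1 M ∉ Q
      rw [hsM]
      exact (hγ t).2
  have hWs : ∀ w ∈ W, ∃ a, s a = w := fun w hw => hsr.symm.subset hw
  have hinj : ∀ w ∈ W, w.1 M = y.1 M → w = y := by
    intro w hw hwM
    obtain ⟨a, rfl⟩ := hWs w hw
    rw [hsM] at hwM
    rw [← hsx]
    congr 1
    exact Subtype.ext hwM
  refine ⟨W, hWo, ?_, hyW, ?_, ?_⟩
  · have hpc : IsPathConnected (X := PlaqueInverseLimit f) W := by
      refine ⟨y, hyW, fun {w} hw => joinedIn_plaque_iff.2 ?_⟩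
      obtain ⟨a, rfl⟩ := hWs w hw
      have := hjoin ∅ countable_empty ⟨y.1 M, hyG⟩ a (by simp) (by simp)
      rw [hsx] at this
      exact this.mono inter_subset_left
    exact hpc.isConnected
  · refine Subset.trans ?_ (hVU (disc e r) ((hanti (le_max_right J J')).trans hJ')
      (he.isOpen_disc hr1) (he.mem_disc hr0))
    intro w hw
    refine mem_plaque_of_infinite hf.continuous fun n => ⟨M + n, by omega, ?_⟩
    refine subset_levelComp (isPreconnected_connectedComponentIn.image _
      (StandardInverseLimit.continuous_coord (M + n)).continuousOn) ?_
      (mem_image_of_mem _ (mem_connectedComponentIn hyG))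
      (mem_levelComp (he.mem_disc hr0) (M + n)) (mem_image_of_mem _ hw)
    rintro _ ⟨v, hv, rfl⟩
    have h1 : v.1 M ∈ G :=
      connectedComponentIn_subset ((fun y : StandardInverseLimit f => y.1 M) ⁻¹' G) y hv
    have h2 : f^[M] (v.1 M) ∈ disc e r := iterate_mem_of_mem_levelComp (htD h1)
    simpa only [StandardInverseLimit.iterate_apply_zero] using h2
  · have hsub : Subsingleton (ZerothHomotopy ↥(pathComponentIn (X := PlaqueInverseLimit f) W x \ {x})) := by
      refine ⟨fun p q => ?_⟩
      induction p using Quotient.inductionOn with | _ p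
      induction q using Quotient.inductionOn with | _ q
      refine Quotient.sound ?_
      have hpW : p.1 ∈ W := pathComponentIn_subset p.2.1
      have hqW : q.1 ∈ W := pathComponentIn_subset q.2.1
      obtain ⟨a, ha⟩ := hWs _ hpW
      obtain ⟨b, hb⟩ := hWs _ hqW
      have haM : (a : S) ∉ ({y.1 M} : Set S) := fun h => p.2.2 (hinj _ hpW (by
        rw [← ha, hsM]; exact h))
      have hbM : (b : S) ∉ ({y.1 M} : Set S) := fun h => q.2.2 (hinj _ hqW (by
        rw [← hb, hsM]; exact h))
      have h1 := hjoin {y.1 M} (countable_singleton _) a b haM hbM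
      rw [ha, hb] at h1
      have h2 : JoinedIn (X := PlaqueInverseLimit f) (W \ {x}) p.1 q.1 := by
        refine joinedIn_plaque_iff.2 (h1.mono ?_)
        rintro w ⟨hw, hwM⟩
        refine ⟨hw, ?_⟩
        rintro rfl
        exact hwM rfl
      have h3 : JoinedIn (X := PlaqueInverseLimit f) (pathComponentIn W x \ {x}) p.1 q.1 := by
        obtain ⟨γ, hγ⟩ := h2
        refine ⟨γ, fun t => ⟨?_, (hγ t).2⟩⟩
        have h4 : JoinedIn (X := PlaqueInverseLimit f) W p.1 (γ t) := by
          have h5 : IsPathConnected (X := PlaqueInverseLimit f) (γ.extend '' Icc 0 1) :=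
            ((convex_Icc (0 : ℝ) 1).isPathConnected ⟨0, by simp⟩).image' γ.continuous_extend.continuousOn
          refine (h5.joinedIn p.1 ⟨0, by simp, by simp⟩ (γ t) ⟨t, t.2, by simp⟩).mono ?_
          rintro _ ⟨u, hu, rfl⟩
          rw [γ.extend_apply hu]
          exact (hγ ⟨u, hu⟩).1
        have h6 : JoinedIn (X := PlaqueInverseLimit f) W x p.1 := p.2.1
        exact h6.trans h4
      exact (joinedIn_iff_joined p.2 q.2).1 h3
    intro hun
    have : Uncountable (ZerothHomotopy ↥(pathComponentIn (X := PlaqueInverseLimit f) W x \ {x})) := hun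
    exact not_countable (α := ZerothHomotopy ↥(pathComponentIn (X := PlaqueInverseLimit f) W x \ {x}))
      inferInstance

end RegularPoints

/-! ### Continuous logarithms -/

section HasLogOn

variable {X Y : Type*} [TopologicalSpace X] [TopologicalSpace Y]

/-- The function `g` has a continuous logarithm on the set `Z`. -/
def HasLogOn (g : X → ℂ) (Z : Set X) : Prop :=
  ∃ Φ : X → ℂ, ContinuousOn Φ Z ∧ ∀ z ∈ Z, g z = Complex.exp (Φ z)

variable {g h : X → ℂ} {Z Z' : Set X}

theorem HasLogOn.mono (hg : HasLogOn g Z) (hZ : Z' ⊆ Z) : HasLogOn g Z' := by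
  obtain ⟨Φ, hΦ, h⟩ := hg
  exact ⟨Φ, hΦ.mono hZ, fun z hz => h z (hZ hz)⟩

theorem HasLogOn.congr (hg : HasLogOn g Z) (hgh : ∀ z ∈ Z, h z = g z) : HasLogOn h Z := by
  obtain ⟨Φ, hΦ, h⟩ := hg
  exact ⟨Φ, hΦ, fun z hz => (hgh z hz).trans (h z hz)⟩

theorem HasLogOn.mul (hg : HasLogOn g Z) (hh : HasLogOn h Z) : HasLogOn (fun z => g z * h z) Z := by
  obtain ⟨Φ, hΦ, h1⟩ := hg
  obtain ⟨Ψ, hΨ, h2⟩ := hh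
  exact ⟨fun z => Φ z + Ψ z, hΦ.add hΨ, fun z hz => by
    simp only [h1 z hz, h2 z hz, Complex.exp_add]⟩

theorem HasLogOn.inv (hg : HasLogOn g Z) : HasLogOn (fun z => (g z)⁻¹) Z := by
  obtain ⟨Φ, hΦ, h1⟩ := hg
  exact ⟨fun z => -Φ z, hΦ.neg, fun z hz => by simp only [h1 z hz, Complex.exp_neg]⟩

theorem hasLogOn_const {c : ℂ} (hc : c ≠ 0) : HasLogOn (fun _ : X => c) Z :=
  ⟨fun _ => Complex.log c, continuousOn_const, fun _ _ => (Complex.exp_log hc).symm⟩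

theorem HasLogOn.prod {ι : Type*} (s : Finset ι) {G : ι → X → ℂ}
    (hG : ∀ i ∈ s, HasLogOn (G i) Z) : HasLogOn (fun z => ∏ i ∈ s, G i z) Z := by
  classical
  induction s using Finset.induction_on with
  | empty => simpa using hasLogOn_const (X := X) (Z := Z) one_ne_zero
  | insert i s hi ih =>
    refine ((hG i (Finset.mem_insert_self i s)).mul
      (ih fun j hj => hG j (Finset.mem_insert_of_mem hj))).congr fun z _ => ?_
    rw [Finset.prod_insert hi]

theorem HasLogOn.comp {u : Y → X} {T : Set Y} (hg : HasLogOn g Z) (hu : ContinuousOn u T)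
    (huT : MapsTo u T Z) : HasLogOn (fun y => g (u y)) T := by
  obtain ⟨Φ, hΦ, h1⟩ := hg
  exact ⟨fun y => Φ (u y), hΦ.comp hu huT, fun y hy => h1 _ (huT hy)⟩

theorem hasLogOn_of_mem_slitPlane (hg : ContinuousOn g Z) (h : ∀ z ∈ Z, g z ∈ Complex.slitPlane) :
    HasLogOn g Z :=
  ⟨fun z => Complex.log (g z), hg.clog h, fun z hz =>
    (Complex.exp_log (Complex.slitPlane_ne_zero (h z hz))).symm⟩

theorem hasLogOn_of_convex {g : ℂ → ℂ} {A : Set ℂ} (hA : Convex ℝ A) (hAo : IsOpen A)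
    (hne : A.Nonempty) (hg : ContinuousOn g A) (h0 : ∀ z ∈ A, g z ≠ 0) : HasLogOn g A := by
  have : ContractibleSpace A := hA.contractibleSpace hne
  have hs : IsSimplyConnected A := (inferInstance : SimplyConnectedSpace A)
  obtain ⟨Φ, hΦ, h⟩ := Complex.exists_continuousOn_eqOn_exp_comp hs hAo hg
    (by rintro ⟨z, hz, h⟩; exact h0 z hz h)
  exact ⟨Φ, hΦ, fun z hz => (h hz).symm⟩

/-- A nonvanishing function on the line has a continuous logarithm. -/
theorem exists_continuous_log {g : ℝ → ℂ} (hg : Continuous g) (h0 : ∀ t, g t ≠ 0) :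
    ∃ μ : ℝ → ℂ, Continuous μ ∧ ∀ t, g t = Complex.exp (μ t) := by
  have hs : IsSimplyConnected (univ : Set ℝ) := by
    have : ContractibleSpace (univ : Set ℝ) := convex_univ.contractibleSpace univ_nonempty
    exact (inferInstance : SimplyConnectedSpace (univ : Set ℝ))
  obtain ⟨Φ, hΦ, h⟩ := Complex.exists_continuousOn_eqOn_exp_comp hs isOpen_univ hg.continuousOn
    (by rintro ⟨z, -, h⟩; exact h0 z h)
  exact ⟨Φ, continuousOn_univ.1 hΦ, fun t => (h (mem_univ t)).symm⟩

theorem hasLogOn_one_add (hg : ContinuousOn g Z) (h : ∀ z ∈ Z, ‖g z‖ < 1) :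
    HasLogOn (fun z => 1 + g z) Z := by
  refine hasLogOn_of_mem_slitPlane (continuousOn_const.add hg) fun z hz => ?_
  exact Complex.mem_slitPlane_of_norm_lt_one (h z hz)

/-- The index of a compact set with respect to a point off it is locally constant in the point. -/
theorem eventually_hasLogOn {Z : Set ℂ} (hZ : IsCompact Z) {x : ℂ} (hx : x ∉ Z) :
    ∀ᶠ y in 𝓝 x, y ∉ Z ∧ HasLogOn (fun w => (w - x) / (w - y)) Z := by
  obtain ⟨δ, hδ, hball⟩ := Metric.isOpen_iff.1 hZ.isClosed.isOpen_compl x hx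
  filter_upwards [Metric.ball_mem_nhds x (half_pos hδ)] with y hy
  rw [Metric.mem_ball, dist_eq_norm] at hy
  have hxw : ∀ w ∈ Z, δ ≤ ‖w - x‖ := fun w hw => by
    by_contra hcon
    exact hball (by rw [Metric.mem_ball, dist_eq_norm]; exact lt_of_not_ge hcon) hw
  have hyw : ∀ w ∈ Z, δ / 2 < ‖w - y‖ := fun w hw => by
    have h1 := hxw w hw
    have h2 : ‖w - x‖ ≤ ‖w - y‖ + ‖y - x‖ := by
      simpa using norm_add_le (w - y) (y - x)
    linarith
  have hne : ∀ w ∈ Z, w - y ≠ 0 := fun w hw => norm_pos_iff.1 ((half_pos hδ).trans (hyw w hw))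
  refine ⟨fun hyZ => hne y hyZ (sub_self y), ?_⟩
  refine (hasLogOn_one_add (g := fun w => (y - x) / (w - y)) ?_ ?_).congr ?_
  · exact continuousOn_const.div (continuousOn_id.sub continuousOn_const) hne
  · intro w hw
    rw [norm_div, div_lt_one (norm_pos_iff.2 (hne w hw))]
    exact hy.trans (hyw w hw)
  · intro w hw
    have := hne w hw
    field_simp
    ring

/-- Two points of a connected set disjoint from the compact set `Z` have the same index with
respect to all loops of `Z`. -/
theorem hasLogOn_sub_div_sub {Z C : Set ℂ} (hZ : IsCompact Z) (hC : IsPreconnected C)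
    (hd : Disjoint Z C) {x y : ℂ} (hx : x ∈ C) (hy : y ∈ C) :
    HasLogOn (fun w => (w - x) / (w - y)) Z := by
  refine hC.induction₂' (fun x y => HasLogOn (fun w => (w - x) / (w - y)) Z) ?_ ?_ hx hy
  · intro x hx
    refine eventually_nhdsWithin_of_eventually_nhds ?_
    filter_upwards [eventually_hasLogOn hZ (Set.disjoint_right.1 hd hx)] with y hy
    refine ⟨hy.2, hy.2.inv.congr fun w _ => (inv_div _ _).symm⟩
  · intro x y z _ hy _ h1 h2
    refine (h1.mul h2).congr fun w hw => ?_
    have : w - y ≠ 0 := sub_ne_zero.2 (fun h => Set.disjoint_left.1 hd hw (h ▸ hy))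
    field_simp

/-- The index of a set with respect to points farther from the origin is zero. -/
theorem hasLogOn_sub_of_norm_lt {Z : Set ℂ} {y : ℂ} (h : ∀ w ∈ Z, ‖w‖ < ‖y‖) :
    HasLogOn (fun w => w - y) Z := by
  rcases Z.eq_empty_or_nonempty with rfl | ⟨w₀, hw₀⟩
  · exact ⟨fun _ => 0, continuousOn_empty _, fun _ h => h.elim⟩
  have hy : y ≠ 0 := norm_pos_iff.1 ((norm_nonneg w₀).trans_lt (h w₀ hw₀))
  refine ((hasLogOn_const (neg_ne_zero.2 hy)).mul
    (hasLogOn_one_add (g := fun w => -(w / y)) (by fun_prop) ?_)).congr ?_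
  · intro w hw
    rw [norm_neg, norm_div, div_lt_one (norm_pos_iff.2 hy)]
    exact h w hw
  · intro w _
    field_simp
    ring

end HasLogOn

section PlanarLog

variable {S : Type*} [TopologicalSpace S]

/-- If `B` is connected, disjoint from `K` and reaches the point at infinity of the coordinate `e`,
then the loops in `K` have index zero with respect to the points of `B`. -/
theorem hasLogOn_sub_of_isPreconnected {e : OpenPartialHomeomorph S ℂ} {K B : Set S}
    (hK : IsCompact K) (hKs : K ⊆ e.source) (hB : IsPreconnected B) (hd : Disjoint K B)
    (hinf : ∀ q ∈ B, q ∉ e.source → ∀ M : ℝ, ∀ᶠ s in 𝓝 q, s ∈ e.source → M < ‖e s‖)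
    (hfar : ∃ q ∈ B, q ∉ e.source ∨ ∀ z ∈ K, ‖e z‖ < ‖e q‖) {s : S} (hs : s ∈ B)
    (hss : s ∈ e.source) : HasLogOn (fun z => e z - e s) K := by
  have hZ : IsCompact (e '' K) := hK.image_of_continuousOn (e.continuousOn.mono hKs)
  have hdZ : ∀ q ∈ B, q ∈ e.source → e q ∉ e '' K := by
    rintro q hq hqs ⟨z, hz, hzq⟩
    rw [e.injOn (hKs hz) hqs hzq] at hz
    exact Set.disjoint_left.1 hd hz hq
  -- to have index zero is a locally constant property of the points of `B`
  let L : S → Prop := fun s => s ∉ e.source ∨ HasLogOn (fun w => w - e s) (e '' K)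
  suffices h : L s by
    rcases h with h | h
    · exact absurd hss h
    · exact h.comp (e.continuousOn.mono hKs) (mapsTo_image e K)
  obtain ⟨q, hq, hqL⟩ := hfar
  have hLq : L q := by
    refine hqL.imp id fun h => hasLogOn_sub_of_norm_lt ?_
    rintro _ ⟨z, hz, rfl⟩
    exact h z hz
  refine hB.induction₂' (fun x y => L x → L y) ?_ (fun x y z _ _ _ h1 h2 h => h2 (h1 h)) hq hs hLq
  intro x hx
  refine eventually_nhdsWithin_of_eventually_nhds ?_
  by_cases hxs : x ∈ e.source
  · filter_upwards [(e.continuousAt hxs).eventually (eventually_hasLogOn hZ (hdZ x hx hxs)),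
      e.open_source.mem_nhds hxs] with y ⟨hyZ, hy⟩ hys
    constructor
    · rintro (h | h)
      · exact absurd hxs h
      · refine Or.inr ((h.mul hy.inv).congr fun w hw => ?_)
        have h1 : w - e x ≠ 0 := sub_ne_zero.2 (fun h => hdZ x hx hxs (h ▸ hw))
        field_simp
    · rintro (h | h)
      · exact absurd hys h
      · refine Or.inr ((h.mul hy).congr fun w hw => ?_)
        have h1 : w - e y ≠ 0 := sub_ne_zero.2 (fun h => hyZ (h ▸ hw))
        field_simp
  · obtain ⟨M, hM⟩ := hZ.isBounded.exists_norm_le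
    filter_upwards [hinf x hx hxs M] with y hy
    refine ⟨fun _ => ?_, fun _ => Or.inl hxs⟩
    by_cases hys : y ∈ e.source
    · exact Or.inr (hasLogOn_sub_of_norm_lt fun w hw => (hM w hw).trans_lt (hy hys))
    · exact Or.inl hys

variable [ChartedSpace ℂ S] [IsManifold 𝓘(ℂ) 1 S] [T2Space S]

/-- On a disk, plane or sphere there is a global coordinate, defined away from a given point of the
connected set `B` at most, such that the loops of `K` have index zero with respect to `B`. -/
theorem exists_coordinate_hasLogOn (hS : IsDiskPlaneOrSphere S) {K B : Set S} (hK : IsCompact K)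
    (hB : IsPreconnected B) (hd : Disjoint K B) (hBc : ∃ C, IsCompact C ∧ Bᶜ ⊆ C) {q : S}
    (hq : q ∈ B) :
    ∃ e : OpenPartialHomeomorph S ℂ, MDifferentiableOn 𝓘(ℂ) 𝓘(ℂ) e.symm e.target ∧
      {q}ᶜ ⊆ e.source ∧ Convex ℝ e.target ∧ e.target.Nonempty ∧
      ∀ s ∈ B, s ∈ e.source → HasLogOn (fun z => e z - e s) K := by
  obtain ⟨e, he, h⟩ := exists_coordinate hS q
  have hqK : q ∉ K := Set.disjoint_right.1 hd hq
  refine ⟨e, he, ?_, ?_, ?_, ?_⟩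
  · rcases h with ⟨h, -⟩ | ⟨-, h, -⟩ <;> simp [h]
  · rcases h with ⟨-, -, h | h⟩ | ⟨-, -, h⟩ <;> rw [h]
    · exact convex_univ
    · exact convex_ball _ _
    · exact convex_univ
  · rcases h with ⟨-, -, h | h⟩ | ⟨-, -, h⟩ <;> rw [h]
    · exact univ_nonempty
    · exact ⟨0, by simp⟩
    · exact univ_nonempty
  intro s hs hss
  rcases h with ⟨hsrc, -, ht⟩ | ⟨hc, hsrc, ht⟩
  · refine hasLogOn_sub_of_isPreconnected hK (by simp [hsrc]) hB hd (by simp [hsrc]) ?_ hs hss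
    obtain ⟨C, hC, hBC⟩ := hBc
    have heC : IsCompact (e '' C) := hC.image_of_continuousOn (e.continuousOn.mono (by simp [hsrc]))
    -- a point of `B` that is farther from the origin than all of `K`
    obtain ⟨w, hwt, hw⟩ : ∃ w ∈ e.target, ∀ v ∈ e '' C, ‖v‖ < ‖w‖ := by
      rcases ht with ht | ht
      · obtain ⟨M, hM⟩ := heC.isBounded.exists_norm_le
        refine ⟨((|M| + 1 : ℝ) : ℂ), by simp [ht], fun v hv => ?_⟩
        rw [Complex.norm_real, Real.norm_of_nonneg (by positivity)]
        linarith [hM v hv, le_abs_self M]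
      · rcases (e '' C).eq_empty_or_nonempty with h0 | hne
        · exact ⟨0, by simp [ht], by simp [h0]⟩
        · obtain ⟨v₀, hv₀, hmax⟩ := heC.exists_isMaxOn hne continuous_norm.continuousOn
          have hv1 : ‖v₀‖ < 1 := by
            obtain ⟨z, -, rfl⟩ := hv₀
            have := e.map_source (show z ∈ e.source by simp [hsrc])
            rwa [ht, mem_ball_zero_iff] at this
          have h1 : ‖(((‖v₀‖ + 1) / 2 : ℝ) : ℂ)‖ = (‖v₀‖ + 1) / 2 := by
            rw [Complex.norm_real, Real.norm_of_nonneg (by positivity)]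
          refine ⟨(((‖v₀‖ + 1) / 2 : ℝ) : ℂ), ?_, fun v hv => ?_⟩
          · rw [ht, mem_ball_zero_iff, h1]
            linarith
          · rw [h1]
            have : ‖v‖ ≤ ‖v₀‖ := hmax hv
            linarith
    have hwC : e.symm w ∉ C := fun h => by
      have := hw _ (mem_image_of_mem e h)
      rw [e.right_inv hwt] at this
      exact lt_irrefl _ this
    have hwB : e.symm w ∈ B := by
      by_contra hcon
      exact hwC (hBC hcon)
    refine ⟨_, hwB, Or.inr fun z hz => ?_⟩
    rw [e.right_inv hwt]
    exact hw _ (mem_image_of_mem e (hBC fun hzB => Set.disjoint_left.1 hd hz hzB))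
  · refine hasLogOn_sub_of_isPreconnected hK ?_ hB hd ?_ ⟨q, hq, Or.inl (by simp [hsrc])⟩ hs hss
    · rw [hsrc]
      exact fun z hz h => hqK (h ▸ hz)
    · intro y _ hys M
      have hcpt : IsCompact (e.symm '' Metric.closedBall 0 M) :=
        (isCompact_closedBall (0 : ℂ) M).image_of_continuousOn
          (e.continuousOn_symm.mono (by simp [ht]))
      have hy : y ∉ e.symm '' Metric.closedBall 0 M := by
        rintro ⟨w, -, rfl⟩
        exact hys (e.map_target (by simp [ht]))
      filter_upwards [hcpt.isClosed.isOpen_compl.mem_nhds hy] with s' hs' hs's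
      by_contra hcon
      exact hs' ⟨e s', by simpa using hcon, e.left_inv hs's⟩

/-- A function with a simple zero at `s₁ ∈ D` and a simple pole at `s₂ ∈ B` has, up to a continuous
logarithm, the same index as `e - e p` for each `p ∈ D` along the loops of `K \ D`. -/
theorem hasLogOn_div_sub_of_zero_pole {e : OpenPartialHomeomorph S ℂ} {K D B : Set S}
    (hK : IsCompact K) (hD : IsPreconnected D) (hDo : IsOpen D) (hKs : K ⊆ e.source)
    (hDs : D ⊆ e.source) (ht : Convex ℝ e.target)
    (htne : e.target.Nonempty)
    (hKB : Disjoint K B) {s₁ s₂ p : S} (h₁ : s₁ ∈ D) (h₂ : s₂ ∈ B) (h₂s : s₂ ∈ e.source) (hp : p ∈ D)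
    (hlog : HasLogOn (fun z => e z - e s₂) K) (h₁₂ : s₁ ≠ s₂) {Θ : S → ℂ}
    (hΘ : ∀ z, z ≠ s₁ → z ≠ s₂ → ContinuousAt Θ z ∧ Θ z ≠ 0)
    (hzero : ∃ L : ℂ, L ≠ 0 ∧ Tendsto (fun z => Θ z / (e z - e s₁)) (𝓝[≠] s₁) (𝓝 L))
    (hpole : ∃ L : ℂ, L ≠ 0 ∧ Tendsto (fun z => Θ z * (e z - e s₂)) (𝓝[≠] s₂) (𝓝 L)) :
    HasLogOn (fun z => Θ z / (e z - e p)) (K \ D) := by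
  classical
  obtain ⟨L₁, hL₁, hz⟩ := hzero
  obtain ⟨L₂, hL₂, hpo⟩ := hpole
  have h₁s := hDs h₁
  have hinj : ∀ {z s : S}, z ∈ e.source → s ∈ e.source → z ≠ s → e z - e s ≠ 0 := fun hz hs hne =>
    sub_ne_zero.2 fun h => hne (e.injOn hz hs h)
  -- removing the zero and the pole leaves a nonvanishing function `g` on the domain of a coordinate
  -- with convex range; it has a logarithm
  let g₀ : S → ℂ := fun z => Θ z * (e z - e s₂) / (e z - e s₁)
  let g : S → ℂ := fun z => if z = s₁ then L₁ * (e s₁ - e s₂) else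
    if z = s₂ then L₂ / (e s₂ - e s₁) else g₀ z
  have hcont₁ : Tendsto (fun z => e z - e s₂) (𝓝[≠] s₁) (𝓝 (e s₁ - e s₂)) :=
    ((e.continuousAt h₁s).sub continuousAt_const).tendsto.mono_left nhdsWithin_le_nhds
  have hcont₂ : Tendsto (fun z => e z - e s₁) (𝓝[≠] s₂) (𝓝 (e s₂ - e s₁)) :=
    ((e.continuousAt h₂s).sub continuousAt_const).tendsto.mono_left nhdsWithin_le_nhds
  have hgeq : ∀ z, z ≠ s₁ → z ≠ s₂ → g z = g₀ z := fun z h1 h2 => by simp [g, h1, h2]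
  have hg1 : g s₁ = L₁ * (e s₁ - e s₂) := by simp [g]
  have hg2 : g s₂ = L₂ / (e s₂ - e s₁) := by simp [g, h₁₂.symm]
  have hgc : ∀ z ∈ e.source, ContinuousAt g z ∧ g z ≠ 0 := by
    intro z hzs
    by_cases hz1 : z = s₁
    · rw [hz1]
      refine ⟨?_, by rw [hg1]; exact mul_ne_zero hL₁ (hinj h₁s h₂s h₁₂)⟩
      rw [continuousAt_iff_punctured_nhds, hg1]
      refine (hz.mul hcont₁).congr' ?_
      filter_upwards [self_mem_nhdsWithin,
        mem_nhdsWithin_of_mem_nhds (isOpen_ne.mem_nhds h₁₂)] with z h1 h2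
      rw [hgeq z h1 h2]
      simp only [g₀]
      ring
    by_cases hz2 : z = s₂
    · rw [hz2]
      refine ⟨?_, by rw [hg2]; exact div_ne_zero hL₂ (hinj h₂s h₁s h₁₂.symm)⟩
      rw [continuousAt_iff_punctured_nhds, hg2]
      refine (hpo.div hcont₂ (hinj h₂s h₁s h₁₂.symm)).congr' ?_
      filter_upwards [self_mem_nhdsWithin,
        mem_nhdsWithin_of_mem_nhds (isOpen_ne.mem_nhds h₁₂.symm)] with z h1 h2
      rw [hgeq z h2 h1]
      rfl
    · obtain ⟨hc, h0⟩ := hΘ z hz1 hz2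
      refine ⟨?_, ?_⟩
      · have h1 : ContinuousAt g₀ z := (hc.mul ((e.continuousAt hzs).sub continuousAt_const)).div
          ((e.continuousAt hzs).sub continuousAt_const) (hinj hzs h₁s hz1)
        refine h1.congr ?_
        filter_upwards [isOpen_ne.mem_nhds hz1, isOpen_ne.mem_nhds hz2] with w hw1 hw2
        exact (hgeq w hw1 hw2).symm
      · rw [hgeq z hz1 hz2]
        exact div_ne_zero (mul_ne_zero h0 (hinj hzs h₂s hz2)) (hinj hzs h₁s hz1)
  have hlogg : HasLogOn g (K \ D) := by
    have h1 : HasLogOn (fun w => g (e.symm w)) e.target := by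
      refine hasLogOn_of_convex ht e.open_target htne (fun w hw => ?_) fun w hw => (hgc _ (e.map_target hw)).2
      exact ((hgc _ (e.map_target hw)).1.comp (e.continuousAt_symm hw)).continuousWithinAt
    refine (h1.comp (u := e) (T := K \ D) (e.continuousOn.mono (sdiff_subset.trans hKs))
      fun z hz => e.map_source (hKs hz.1)).congr fun z hz => ?_
    rw [e.left_inv (hKs hz.1)]
  have hlogD : HasLogOn (fun z => (e z - e s₁) / (e z - e p)) (K \ D) := by
    have hY : IsCompact (e '' (K \ D)) :=
      (hK.diff hDo).image_of_continuousOn (e.continuousOn.mono (sdiff_subset.trans hKs))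
    have hDe : IsPreconnected (e '' D) := hD.image _ (e.continuousOn.mono hDs)
    have hdis : Disjoint (e '' (K \ D)) (e '' D) := by
      rw [Set.disjoint_left]
      rintro _ ⟨z, hz, rfl⟩ ⟨z', hz', h⟩
      rw [e.injOn (hDs hz') (hKs hz.1) h] at hz'
      exact hz.2 hz'
    exact (hasLogOn_sub_div_sub hY hDe hdis (mem_image_of_mem e h₁) (mem_image_of_mem e hp)).comp
      (e.continuousOn.mono (sdiff_subset.trans hKs)) (mapsTo_image e _)
  refine ((hlogg.mul hlogD).mul (hlog.mono sdiff_subset).inv).congr fun z hz => ?_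
  have hz1 : z ≠ s₁ := fun h => hz.2 (h ▸ h₁)
  have hz2 : z ≠ s₂ := fun h => Set.disjoint_left.1 hKB hz.1 (h ▸ h₂)
  have hzs := hKs hz.1
  have a1 := hinj hzs h₁s hz1
  have a2 := hinj hzs h₂s hz2
  rw [hgeq z hz1 hz2]
  simp only [g₀]
  field_simp

end PlanarLog

/-! ### A function counting the crossings of a segment -/

section CutFunction

/-- A distance from `v` to the segment `[p, q]` of the real line, which is nonpositive exactly on
the segment. -/
def segDist (p q : ℝ) (v : ℂ) : ℝ := max |v.im| (max (p - v.re) (v.re - q))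

theorem continuous_segDist (p q : ℝ) : Continuous (segDist p q) := by
  unfold segDist
  fun_prop

variable {p q : ℝ} {κ : ℂ → ℂ}

theorem segDist_le_zero_iff {v : ℂ} : segDist p q v ≤ 0 ↔ v.im = 0 ∧ p ≤ v.re ∧ v.re ≤ q := by
  simp [segDist]

theorem div_mem_slitPlane_of_segDist_pos (hpq : p < q) {v : ℂ} (hv : 0 < segDist p q v) :
    (v - p) / (v - q) ∈ Complex.slitPlane := by
  have hvq : v - q ≠ 0 := by
    intro h
    have h1 : v = q := sub_eq_zero.1 h
    exact absurd (segDist_le_zero_iff.2 (by simp [h1, hpq.le])) (not_le.2 hv)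
  by_contra hcon
  rw [Complex.mem_slitPlane_iff] at hcon
  push Not at hcon
  set s := (v - p) / (v - q)
  have hs : s = ((s.re : ℝ) : ℂ) := Complex.ext (by simp) (by simp [hcon.2])
  have h1 : v - p = s.re * (v - q) := by
    rw [← hs]
    simp only [s]
    field_simp
  have hre := congrArg Complex.re h1
  have him := congrArg Complex.im h1
  simp at hre him
  refine absurd (segDist_le_zero_iff.2 ⟨?_, ?_, ?_⟩) (not_le.2 hv)
  · nlinarith
  · nlinarith
  · nlinarith

/-- A continuous correction which deforms the Möbius map with zero `p` and pole `q` to the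
constant `1` away from the segment `[p, q]`. -/
theorem exists_cut_function (hpq : p < q) {η : ℝ} (hη : 0 < η) :
    ∃ κ : ℂ → ℂ, Continuous κ ∧ (∀ v, |(κ v).im| ≤ Real.pi) ∧
      (∀ v, η ≤ segDist p q v → (v - p) / (v - q) * Complex.exp (κ v) = 1) ∧
      ∀ v, 0 < segDist p q v → (v - p) / (v - q) * Complex.exp (κ v) ∈ Complex.slitPlane := by
  -- a cut-off function, equal to `1` near the segment and to `0` beyond `η`; the correction is `c -
  -- 1` times the logarithm of the Möbius map, which is defined off the segment
  let c : ℂ → ℝ := fun v => max 0 (min 1 (2 - 2 * segDist p q v / η))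
  have hc : Continuous c := by
    have := continuous_segDist p q
    simp only [c]
    fun_prop
  have hc0 : ∀ v, 0 ≤ c v := fun v => le_max_left _ _
  have hc1 : ∀ v, c v ≤ 1 := fun v => max_le zero_le_one (min_le_left _ _)
  have hcs : ∀ v, segDist p q v < η / 2 → c v = 1 := by
    intro v hv
    have : 2 * segDist p q v / η ≤ 1 := by
      rw [div_le_one hη]
      linarith
    simp only [c]
    rw [min_eq_left (by linarith), max_eq_right zero_le_one]
  have hcl : ∀ v, η ≤ segDist p q v → c v = 0 := by
    intro v hv
    have : 2 ≤ 2 * segDist p q v / η := by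
      rw [le_div_iff₀ hη]
      linarith
    simp only [c]
    exact max_eq_left ((min_le_right _ _).trans (by linarith))
  let κ : ℂ → ℂ := fun v => ((c v - 1 : ℝ) : ℂ) * Complex.log ((v - p) / (v - q))
  have hne : ∀ v, 0 < segDist p q v → (v - p) / (v - q) ≠ 0 := fun v hv =>
    Complex.slitPlane_ne_zero (div_mem_slitPlane_of_segDist_pos hpq hv)
  have hexp : ∀ v, 0 < segDist p q v → (v - p) / (v - q) * Complex.exp (κ v) =
      Complex.exp (c v * Complex.log ((v - p) / (v - q))) := by
    intro v hv
    have h1 : (c v : ℂ) * Complex.log ((v - p) / (v - q)) =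
        Complex.log ((v - p) / (v - q)) + κ v := by
      simp only [κ]
      push_cast
      ring
    rw [h1, Complex.exp_add, Complex.exp_log (hne v hv)]
  refine ⟨κ, ?_, ?_, ?_, ?_⟩
  · refine continuous_iff_continuousAt.2 fun v => ?_
    by_cases hv : segDist p q v < η / 2
    · refine (continuousAt_const (y := (0 : ℂ))).congr ?_
      filter_upwards [(isOpen_lt (continuous_segDist p q) continuous_const).mem_nhds hv] with w hw
      have : c w = 1 := hcs w hw
      simp [κ, this]
    · have hpos : 0 < segDist p q v := by linarith [not_lt.1 hv, half_pos hη]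
      have hsl := div_mem_slitPlane_of_segDist_pos hpq hpos
      have hvq : v - q ≠ 0 := fun h => Complex.slitPlane_ne_zero hsl (by rw [h, div_zero])
      have h1 : ContinuousAt (fun v : ℂ => (v - p) / (v - q)) v :=
        (continuousAt_id.sub continuousAt_const).div (continuousAt_id.sub continuousAt_const) hvq
      have h2 : ContinuousAt (fun v => ((c v - 1 : ℝ) : ℂ)) v := by fun_prop
      exact h2.mul (h1.clog hsl)
  · intro v
    have h1 : (κ v).im = (c v - 1) * Complex.arg ((v - p) / (v - q)) := by
      simp only [κ]
      rw [Complex.im_ofReal_mul, Complex.log_im]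
    rw [h1, abs_mul]
    have h2 : |c v - 1| ≤ 1 := by
      rw [abs_le]
      constructor <;> linarith [hc0 v, hc1 v]
    calc _ ≤ 1 * Real.pi := mul_le_mul h2 (Complex.abs_arg_le_pi _) (abs_nonneg _) zero_le_one
      _ = Real.pi := one_mul _
  · intro v hv
    rw [hexp v (hη.trans_le hv), hcl v hv]
    simp
  · intro v hv
    rw [hexp v hv, Complex.mem_slitPlane_iff_arg]
    refine ⟨?_, Complex.exp_ne_zero _⟩
    have him : ((c v : ℂ) * Complex.log ((v - p) / (v - q))).im =
        c v * Complex.arg ((v - p) / (v - q)) := by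
      rw [Complex.im_ofReal_mul, Complex.log_im]
    have hlt : |Complex.arg ((v - p) / (v - q))| < Real.pi :=
      abs_lt.2 ⟨Complex.neg_pi_lt_arg _, lt_of_le_of_ne (Complex.arg_le_pi _)
        (Complex.mem_slitPlane_iff_arg.1 (div_mem_slitPlane_of_segDist_pos hpq hv)).1⟩
    have hlt2 : |c v * Complex.arg ((v - p) / (v - q))| < Real.pi := by
      rw [abs_mul, abs_of_nonneg (hc0 v)]
      nlinarith [hc1 v, hc0 v, abs_nonneg (Complex.arg ((v - p) / (v - q))), Real.pi_pos]
    rw [abs_lt] at hlt2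
    rw [Complex.arg_exp, him, (toIocMod_eq_self Real.two_pi_pos).2 ⟨hlt2.1, by linarith⟩]
    exact hlt2.2.ne

/-- Along a circle separating `p` and `q` the function of `exists_cut_function` has index one. -/
theorem exists_circle_log (hp : 0 < p) (hκ : Continuous κ) (hκi : ∀ v, |(κ v).im| ≤ Real.pi) {ρ : ℝ}
    (hpρ : p < ρ) (hρq : ρ < q) :
    ∃ ℓ : ℝ → ℂ, Continuous ℓ ∧ (∀ t : ℝ, (ρ * Complex.exp (t * Complex.I) - p) /
        (ρ * Complex.exp (t * Complex.I) - q) * Complex.exp (κ (ρ * Complex.exp (t * Complex.I))) =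
        Complex.exp (ℓ t)) ∧
      (∀ (t : ℝ) (m : ℤ), ℓ (t + 2 * Real.pi * m) = ℓ t + 2 * Real.pi * m * Complex.I) ∧
      ∀ t, |(ℓ t).im - t| ≤ 4 * Real.pi := by
  have hρ : 0 < ρ := hp.trans hpρ
  have hq : 0 < q := hρ.trans hρq
  let v : ℝ → ℂ := fun t => ρ * Complex.exp (t * Complex.I)
  have hv : Continuous v := by fun_prop
  have hvn : ∀ t, ‖v t‖ = ρ := fun t => by
    simp only [v]
    rw [norm_mul, Complex.norm_exp_ofReal_mul_I, Complex.norm_real, Real.norm_of_nonneg hρ.le, mul_one]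
  have hv0 : ∀ t, v t ≠ 0 := fun t => norm_pos_iff.1 (by rw [hvn]; exact hρ)
  have h1 : ∀ t, 1 - p / v t ∈ Complex.slitPlane := fun t => by
    rw [sub_eq_add_neg]
    refine Complex.mem_slitPlane_of_norm_lt_one ?_
    rw [norm_neg, norm_div, hvn, Complex.norm_real, Real.norm_of_nonneg hp.le, div_lt_one hρ]
    exact hpρ
  have h2 : ∀ t, 1 - v t / q ∈ Complex.slitPlane := fun t => by
    rw [sub_eq_add_neg]
    refine Complex.mem_slitPlane_of_norm_lt_one ?_
    rw [norm_neg, norm_div, hvn, Complex.norm_real, Real.norm_of_nonneg hq.le, div_lt_one hq]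
    exact hρq
  have hqc : (q : ℂ) ≠ 0 := by exact_mod_cast hq.ne'
  have hper : ∀ (t : ℝ) (m : ℤ), v (t + 2 * Real.pi * m) = v t := fun t m => by
    simp only [v]
    rw [Complex.exp_eq_exp_iff_exists_int.2 ⟨m, ?_⟩]
    push_cast
    ring
  have hlogq : Complex.log (-q : ℂ) = Real.log q + Real.pi * Complex.I := by
    apply Complex.ext
    · simp [Complex.log_re, abs_of_pos hq]
    · rw [Complex.log_im, ← Complex.ofReal_neg, Complex.arg_ofReal_of_neg (by linarith)]
      simp
  -- `(v - p) / (v - q)` is `v * (1 - p / v)` divided by `-q * (1 - v / q)`, and only `v` turns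
  let ℓ : ℝ → ℂ := fun t => Real.log ρ + t * Complex.I + Complex.log (1 - p / v t) -
    (Complex.log (-q) + Complex.log (1 - v t / q)) + κ (v t)
  refine ⟨ℓ, ?_, ?_, ?_, ?_⟩
  · have a1 : Continuous fun t => Complex.log (1 - p / v t) :=
      Continuous.clog (continuous_const.sub (continuous_const.div hv hv0)) h1
    have a2 : Continuous fun t => Complex.log (1 - v t / q) :=
      Continuous.clog (by fun_prop) h2
    simp only [ℓ]
    fun_prop
  · intro t
    change (v t - p) / (v t - q) * Complex.exp (κ (v t)) = _
    have hvt : Complex.exp (Real.log ρ + t * Complex.I) = v t := by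
      rw [Complex.exp_add, ← Complex.ofReal_exp, Real.exp_log hρ]
    simp only [ℓ]
    rw [Complex.exp_add, Complex.exp_sub, Complex.exp_add, Complex.exp_add (Complex.log (-q)), hvt,
      Complex.exp_log (Complex.slitPlane_ne_zero (h1 t)),
      Complex.exp_log (Complex.slitPlane_ne_zero (h2 t)), Complex.exp_log (neg_ne_zero.2 hqc)]
    congr 1
    have e1 : v t * (1 - p / v t) = v t - p := by
      have := hv0 t
      field_simp
    have e2 : -(q : ℂ) * (1 - v t / q) = v t - q := by
      field_simp
      ring
    rw [e1, e2]
  · intro t m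
    simp only [ℓ]
    rw [hper]
    push_cast
    ring
  · intro t
    have him : (ℓ t).im - t = Complex.arg (1 - p / v t) - Real.pi - Complex.arg (1 - v t / q) +
        (κ (v t)).im := by
      simp only [ℓ]
      rw [hlogq]
      simp [Complex.log_im]
      ring
    rw [him]
    have b1 := abs_le.1 (Complex.abs_arg_le_pi (1 - p / v t))
    have b2 := abs_le.1 (Complex.abs_arg_le_pi (1 - v t / q))
    have b3 := abs_le.1 (hκi (v t))
    rw [abs_le]
    constructor <;> linarith

/-- A logarithm of the function of `exists_cut_function` over the strip between `p` and `q`. -/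
theorem exists_strip_log (hκ : Continuous κ) (hκi : ∀ v, |(κ v).im| ≤ Real.pi) :
    ∃ Λ : ℂ → ℂ, ContinuousOn Λ {v | p < v.re ∧ v.re < q} ∧
      ∀ v : ℂ, p < v.re → v.re < q → (v - p) / (v - q) * Complex.exp (κ v) = Complex.exp (Λ v) ∧
        |(Λ v).im - Real.pi| ≤ 3 * Real.pi := by
  have h1 : ∀ v : ℂ, p < v.re → v - p ∈ Complex.slitPlane := fun v hv =>
    Complex.mem_slitPlane_iff.2 (Or.inl (by simpa using hv))
  have h2 : ∀ v : ℂ, v.re < q → q - v ∈ Complex.slitPlane := fun v hv =>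
    Complex.mem_slitPlane_iff.2 (Or.inl (by simpa using hv))
  refine ⟨fun v => Complex.log (v - p) - Complex.log (q - v) + Real.pi * Complex.I + κ v, ?_, ?_⟩
  · refine ContinuousOn.add (ContinuousOn.add (ContinuousOn.sub ?_ ?_) continuousOn_const)
      hκ.continuousOn
    · exact ContinuousOn.clog (by fun_prop) fun v hv => h1 v hv.1
    · exact ContinuousOn.clog (by fun_prop) fun v hv => h2 v hv.2
  · intro v hv hv'
    constructor
    · rw [Complex.exp_add, Complex.exp_add, Complex.exp_sub, Complex.exp_pi_mul_I,
        Complex.exp_log (Complex.slitPlane_ne_zero (h1 v hv)),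
        Complex.exp_log (Complex.slitPlane_ne_zero (h2 v hv'))]
      congr 1
      rw [← neg_sub (q : ℂ) v, div_neg]
      ring
    · have b1 := abs_le.1 (Complex.abs_arg_le_pi (v - p))
      have b2 := abs_le.1 (Complex.abs_arg_le_pi (q - v))
      have b3 := abs_le.1 (hκi v)
      simp only [Complex.add_im, Complex.sub_im, Complex.log_im, Complex.mul_im, Complex.ofReal_re,
        Complex.I_im, Complex.ofReal_im, Complex.I_re, mul_one, mul_zero, add_zero]
      rw [abs_le]
      constructor <;> linarith

end CutFunction

/-! ### Arcs over a radius -/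

section Arcs

variable {S : Type*} [TopologicalSpace S] [T2Space S] [LocallyConnectedSpace S] {f : S → S}
  {e : OpenPartialHomeomorph S ℂ} {n : ℕ} {A : Set ℂ}

/-- Over a convex set without critical values, a component of the preimage is the image of a
section. -/
theorem exists_convex_section (hf : IsTopBranched f) (hA : Convex ℝ A) (hAo : IsOpen A)
    (hAt : A ⊆ e.target) (hAc : ∀ v ∈ A, e.symm v ∉ critVals f n) {a : S}
    (ha : f^[n] a ∈ e.symm '' A) :
    ∃ ς : ℂ → S, ContinuousOn ς A ∧
      (∀ v ∈ A, ς v ∈ connectedComponentIn (f^[n] ⁻¹' (e.symm '' A)) a ∧ f^[n] (ς v) = e.symm v) ∧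
      ∀ z ∈ connectedComponentIn (f^[n] ⁻¹' (e.symm '' A)) a, e (f^[n] z) ∈ A ∧
        ς (e (f^[n] z)) = z := by
  classical
  obtain ⟨v₀, hv₀, hav⟩ := ha
  have : ContractibleSpace A := hA.contractibleSpace ⟨v₀, hv₀⟩
  have : LocallyPathConnectedSpace A := hAo.locallyPathConnectedSpace
  have hcont : Continuous fun v : A => e.symm v :=
    continuousOn_iff_continuous_domRestrict.1 (e.continuousOn_symm.mono hAt)
  obtain ⟨G, hG, hG0, hGf⟩ := exists_lift hf hcont (fun v => hAc v v.2) (a₀ := ⟨v₀, hv₀⟩)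
    (z := a) hav.symm
  set E := connectedComponentIn (f^[n] ⁻¹' (e.symm '' A)) a
  have haA : a ∈ f^[n] ⁻¹' (e.symm '' A) := ⟨v₀, hv₀, hav⟩
  have heF : ∀ z ∈ E, e (f^[n] z) ∈ A ∧ e.symm (e (f^[n] z)) = f^[n] z := by
    intro z hz
    obtain ⟨v, hv, hvz⟩ := connectedComponentIn_subset (f^[n] ⁻¹' (e.symm '' A)) a hz
    rw [← hvz, e.right_inv (hAt hv)]
    exact ⟨hv, rfl⟩
  have hGE : ∀ v, G v ∈ E := by
    intro v
    refine (isPreconnected_range hG).subset_connectedComponentIn ⟨_, hG0⟩ ?_ (mem_range_self v)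
    rintro _ ⟨w, rfl⟩
    exact ⟨w, w.2, (hGf w).symm⟩
  have hcF : Continuous fun z : E => e (f^[n] z) := by
    have h1 : ContinuousOn (fun z => e (f^[n] z)) E := by
      refine e.continuousOn.comp (hf.continuous_iterate n).continuousOn fun z hz => ?_
      rw [← (heF z hz).2]
      exact e.map_target (hAt (heF z hz).1)
    exact continuousOn_iff_continuous_domRestrict.1 h1
  have : PreconnectedSpace E := Subtype.preconnectedSpace isPreconnected_connectedComponentIn
  have huniq := lift_unique hf (n := n) (A := E) (G₁ := fun z => G ⟨e (f^[n] z), (heF z z.2).1⟩)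
    (G₂ := Subtype.val) (hG.comp (hcF.subtype_mk _)) continuous_subtype_val
    (fun z => by rw [hGf, (heF z z.2).2]) (fun z => by rw [hGf]; exact hAc _ (heF z z.2).1)
    (a₀ := ⟨a, mem_connectedComponentIn haA⟩) (by
      refine Eq.trans (congrArg G (Subtype.ext ?_)) hG0
      change e (f^[n] a) = v₀
      rw [← hav, e.right_inv (hAt hv₀)])
  refine ⟨fun v => if hv : v ∈ A then G ⟨v, hv⟩ else a, ?_, ?_, ?_⟩
  · rw [continuousOn_iff_continuous_domRestrict]
    convert hG using 1
    funext v
    simp [Set.domRestrict_apply]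
  · intro v hv
    simp only [hv, dif_pos]
    exact ⟨hGE _, hGf _⟩
  · intro z hz
    refine ⟨(heF z hz).1, ?_⟩
    simp only [(heF z hz).1, dif_pos]
    exact congr_fun huniq ⟨z, hz⟩

open Classical in
/-- The function which is `M` in the coordinate `e` of the `n`-th image on the component over `A`
that contains `a`, and equal to `1` elsewhere. -/
noncomputable def arcFun (f : S → S) (n : ℕ) (e : OpenPartialHomeomorph S ℂ) (A : Set ℂ) (M : ℂ → ℂ) (a z : S) : ℂ :=
  if z ∈ connectedComponentIn (f^[n] ⁻¹' (e.symm '' A)) a then M (e (f^[n] z)) else 1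

variable {M : ℂ → ℂ} {a : S}

theorem isOpen_component_symm_image (hf : IsTopBranched f) (hAo : IsOpen A) (hAt : A ⊆ e.target) (a : S) :
    IsOpen (connectedComponentIn (f^[n] ⁻¹' (e.symm '' A)) a) :=
  ((e.symm.isOpen_image_of_subset_source hAo hAt).preimage
    (hf.continuous_iterate n)).connectedComponentIn

theorem arcFun_of_mem {z : S} (hz : z ∈ connectedComponentIn (f^[n] ⁻¹' (e.symm '' A)) a) :
    arcFun f n e A M a z = M (e (f^[n] z)) := if_pos hz

theorem arcFun_of_notMem {z : S} (hz : z ∉ connectedComponentIn (f^[n] ⁻¹' (e.symm '' A)) a) :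
    arcFun f n e A M a z = 1 := if_neg hz

/-- The function of an arc is `1` near the points off the arc, also near the ends of the arc: it is
already `1` over the points of `A` off the compact set `C`. -/
theorem eventually_arcFun_eq_one (hf : IsTopBranched f) (hAo : IsOpen A) (hAt : A ⊆ e.target)
    {C : Set ℂ} (hC : IsCompact C) (hCA : C ⊆ A) (hM : ∀ v ∈ A, v ∉ C → M v = 1) {z : S}
    (hz : z ∉ connectedComponentIn (f^[n] ⁻¹' (e.symm '' A)) a) :
    ∀ᶠ w in 𝓝 z, arcFun f n e A M a w = 1 := by
  have hF := hf.continuous_iterate n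
  by_cases hzC : f^[n] z ∈ e.symm '' C
  · have hzA : z ∈ f^[n] ⁻¹' (e.symm '' A) := image_mono hCA hzC
    have ho := isOpen_component_symm_image (n := n) hf hAo hAt z
    filter_upwards [ho.mem_nhds (mem_connectedComponentIn hzA)] with w hw
    refine arcFun_of_notMem fun hwa => hz ?_
    rw [connectedComponentIn_eq hwa, ← connectedComponentIn_eq hw]
    exact mem_connectedComponentIn hzA
  · have hcl : IsClosed (e.symm '' C) :=
      (hC.image_of_continuousOn (e.continuousOn_symm.mono (hCA.trans hAt))).isClosed
    filter_upwards [(hcl.isOpen_compl.preimage hF).mem_nhds hzC] with w hw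
    by_cases hwa : w ∈ connectedComponentIn (f^[n] ⁻¹' (e.symm '' A)) a
    · rw [arcFun_of_mem hwa]
      obtain ⟨v, hv, hvw⟩ := connectedComponentIn_subset (f^[n] ⁻¹' (e.symm '' A)) a hwa
      rw [← hvw, e.right_inv (hAt hv)]
      refine hM v hv fun hvC => hw ⟨v, hvC, hvw⟩
    · exact arcFun_of_notMem hwa

variable [ChartedSpace ℂ S] [IsManifold 𝓘(ℂ) 1 S]

/-- The function attached to an arc which begins in `D` and ends in `B` has, up to a continuous
logarithm, the same index as `ζ - ζ p` for each `p ∈ D` along the loops of `K \ D`. -/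
theorem hasLogOn_arcFun (hf : IsTopBranched f) (hfM : MDifferentiable 𝓘(ℂ) 𝓘(ℂ) f)
    (heM : MDifferentiableOn 𝓘(ℂ) 𝓘(ℂ) e e.source) (hAo : IsOpen A)
    (hAt : A ⊆ e.target) (hAc : ∀ v ∈ A, e.symm v ∉ critVals f n) {ς : ℂ → S}
    (hςm : ∀ v ∈ A, ς v ∈ connectedComponentIn (f^[n] ⁻¹' (e.symm '' A)) a ∧ f^[n] (ς v) = e.symm v)
    (hςi : ∀ z ∈ connectedComponentIn (f^[n] ⁻¹' (e.symm '' A)) a, e (f^[n] z) ∈ A ∧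
        ς (e (f^[n] z)) = z)
    {C : Set ℂ} (hC : IsCompact C) (hCA : C ⊆ A) {κ : ℂ → ℂ} (hκ : Continuous κ) {p q : ℝ}
    (hM : ∀ v ∈ A, v ∉ C → (v - p) / (v - q) * Complex.exp (κ v) = 1)
    (hpA : (p : ℂ) ∈ A) (hqA : (q : ℂ) ∈ A) (hpq : p < q)
    {ζ : OpenPartialHomeomorph S ℂ} (hζ : MDifferentiableOn 𝓘(ℂ) 𝓘(ℂ) ζ.symm ζ.target)
    {K D B : Set S} (hK : IsCompact K) (hD : IsPreconnected D) (hDo : IsOpen D)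
    (hKs : K ⊆ ζ.source) (hDs : D ⊆ ζ.source) (ht : Convex ℝ ζ.target) (htne : ζ.target.Nonempty)
    (hKB : Disjoint K B) (hpD : ς p ∈ D) (hqB : ς q ∈ B) (hqs : ς q ∈ ζ.source) {o : S}
    (ho : o ∈ D) (hlog : HasLogOn (fun z => ζ z - ζ (ς q)) K) :
    HasLogOn (fun z => arcFun f n e A (fun v => (v - p) / (v - q) * Complex.exp (κ v)) a z /
      (ζ z - ζ o)) (K \ D) := by
  set M : ℂ → ℂ := fun v => (v - p) / (v - q) * Complex.exp (κ v)
  set Θ := arcFun f n e A M a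
  have hF := hf.continuous_iterate n
  have hpqc : (p : ℂ) - q ≠ 0 := sub_ne_zero.2 (by exact_mod_cast hpq.ne)
  have heς : ∀ v ∈ A, e (f^[n] (ς v)) = v := fun v hv => by rw [(hςm v hv).2, e.right_inv (hAt hv)]
  have hsrc : ∀ v ∈ A, f^[n] (ς v) ∈ e.source := fun v hv => by
    rw [(hςm v hv).2]
    exact e.map_target (hAt hv)
  have hev : ∀ v ∈ A, ∀ᶠ z in 𝓝 (ς v), z ∈ connectedComponentIn (f^[n] ⁻¹' (e.symm '' A)) a :=
    fun v hv => (isOpen_component_symm_image hf hAo hAt a).mem_nhds (hςm v hv).1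
  have hcv : ∀ v ∈ A, ContinuousAt (fun z => e (f^[n] z)) (ς v) := fun v hv =>
    ContinuousAt.comp (g := e) (e.continuousAt (hsrc v hv)) hF.continuousAt
  -- `f^[n]` is locally biholomorphic along the arc, so the zero and the pole are simple
  have hratio : ∀ v ∈ A, ς v ∈ ζ.source → ∃ L : ℂ, L ≠ 0 ∧
      Tendsto (fun z => (e (f^[n] z) - v) / (ζ z - ζ (ς v))) (𝓝[≠] (ς v)) (𝓝 L) := by
    intro v hv hvs
    obtain ⟨L, hL, h⟩ := exists_tendsto_ratio (mdifferentiable_iterate hfM n) hζ heM hvs (hsrc v hv)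
      (notMem_branchSet_iterate hf.continuous (by rw [(hςm v hv).2]; exact hAc v hv))
    rw [heς v hv] at h
    exact ⟨L, hL, h⟩
  refine hasLogOn_div_sub_of_zero_pole hK hD hDo hKs hDs ht htne hKB hpD hqB hqs ho hlog ?_ ?_ ?_ ?_
  · intro h
    have := heς p hpA
    rw [h, heς q hqA] at this
    exact hpq.ne (by exact_mod_cast this.symm)
  · intro z hz1 hz2
    by_cases hz : z ∈ connectedComponentIn (f^[n] ⁻¹' (e.symm '' A)) a
    · obtain ⟨hzA, hzς⟩ := hςi z hz
      have hzp : e (f^[n] z) - p ≠ 0 := fun h => hz1 (by rw [← hzς, sub_eq_zero.1 h])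
      have hzq : e (f^[n] z) - q ≠ 0 := fun h => hz2 (by rw [← hzς, sub_eq_zero.1 h])
      have hMc : ContinuousAt M (e (f^[n] z)) :=
        ((continuousAt_id.sub continuousAt_const).div (continuousAt_id.sub continuousAt_const)
          hzq).mul (by fun_prop)
      refine ⟨?_, ?_⟩
      · have h1 : ContinuousAt (fun w => M (e (f^[n] w))) z :=
          ContinuousAt.comp (g := M) hMc (by simpa only [hzς] using hcv _ hzA)
        refine h1.congr ?_
        filter_upwards [(isOpen_component_symm_image hf hAo hAt a).mem_nhds hz] with w hw
        exact (arcFun_of_mem hw).symm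
      · rw [show Θ z = M (e (f^[n] z)) from arcFun_of_mem hz]
        exact mul_ne_zero (div_ne_zero hzp hzq) (Complex.exp_ne_zero _)
    · have h1 := eventually_arcFun_eq_one (M := M) hf hAo hAt hC hCA hM hz
      refine ⟨continuousAt_const.congr (h1.mono fun w hw => hw.symm), ?_⟩
      rw [show Θ z = 1 from h1.self_of_nhds]
      exact one_ne_zero
  · obtain ⟨L, hL, h⟩ := hratio p hpA (hDs hpD)
    refine ⟨L * (Complex.exp (κ p) / (p - q)),
      mul_ne_zero hL (div_ne_zero (Complex.exp_ne_zero _) hpqc), ?_⟩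
    have h2 : ContinuousAt (fun v : ℂ => Complex.exp (κ v) / (v - q)) (e (f^[n] (ς p))) := by
      rw [heς p hpA]
      exact ContinuousAt.div (by fun_prop) (by fun_prop) hpqc
    have h3 : Tendsto (fun z => Complex.exp (κ (e (f^[n] z))) / (e (f^[n] z) - q)) (𝓝[≠] (ς p))
        (𝓝 (Complex.exp (κ p) / (p - q))) := by
      have h4 : ContinuousAt (fun z => Complex.exp (κ (e (f^[n] z))) / (e (f^[n] z) - q)) (ς p) :=
        ContinuousAt.comp (g := fun v : ℂ => Complex.exp (κ v) / (v - q)) h2 (hcv p hpA)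
      have h5 := h4.tendsto
      rw [heς p hpA] at h5
      exact h5.mono_left nhdsWithin_le_nhds
    refine (h.mul h3).congr' ?_
    filter_upwards [nhdsWithin_le_nhds (hev p hpA)] with z hz
    rw [show Θ z = M (e (f^[n] z)) from arcFun_of_mem hz]
    simp only [M]
    ring
  · obtain ⟨L, hL, h⟩ := hratio q hqA hqs
    have hqpc : (q : ℂ) - p ≠ 0 := sub_ne_zero.2 (by exact_mod_cast hpq.ne')
    refine ⟨L⁻¹ * ((q - p) * Complex.exp (κ q)),
      mul_ne_zero (inv_ne_zero hL) (mul_ne_zero hqpc (Complex.exp_ne_zero _)), ?_⟩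
    have h2 : ContinuousAt (fun v : ℂ => (v - p) * Complex.exp (κ v)) (e (f^[n] (ς q))) := by
      fun_prop
    have h3 : Tendsto (fun z => (e (f^[n] z) - p) * Complex.exp (κ (e (f^[n] z)))) (𝓝[≠] (ς q))
        (𝓝 ((q - p) * Complex.exp (κ q))) := by
      have h4 : ContinuousAt (fun z => (e (f^[n] z) - p) * Complex.exp (κ (e (f^[n] z)))) (ς q) :=
        ContinuousAt.comp (g := fun v : ℂ => (v - p) * Complex.exp (κ v)) h2 (hcv q hqA)
      have h5 := h4.tendsto
      rw [heς q hqA] at h5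
      exact h5.mono_left nhdsWithin_le_nhds
    refine ((h.inv₀ hL).mul h3).congr' ?_
    filter_upwards [nhdsWithin_le_nhds (hev q hqA)] with z hz
    rw [show Θ z = M (e (f^[n] z)) from arcFun_of_mem hz]
    simp only [M]
    rw [inv_div]
    ring

end Arcs

/-! ### The crossing function of a radius -/

section Crossing

/-- A thin neighbourhood of the part `(a, 1)` of the positive radius of the unit disk. -/
def slitTube (a η : ℝ) : Set ℂ := {v | a < v.re ∧ |v.im| < η ∧ ‖v‖ < 1}

/-- The Möbius map with zero `p` and pole `q`, corrected by the exponential of `κ`. -/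
noncomputable def cutFun (p q : ℝ) (κ : ℂ → ℂ) (v : ℂ) : ℂ := (v - p) / (v - q) * Complex.exp (κ v)

theorem convex_slitTube (a η : ℝ) : Convex ℝ (slitTube a η) := by
  have h1 : Convex ℝ {v : ℂ | a < v.re} := convex_halfSpace_re_gt a
  have h2 : Convex ℝ {v : ℂ | v.im < η} := convex_halfSpace_im_lt η
  have h3 : Convex ℝ {v : ℂ | -η < v.im} := convex_halfSpace_im_gt (-η)
  have h4 : Convex ℝ (Metric.ball (0 : ℂ) 1) := convex_ball 0 1
  convert h1.inter ((h2.inter h3).inter h4) using 1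
  ext v
  simp only [slitTube, mem_inter_iff, mem_ofPred_eq, mem_ball_zero_iff, abs_lt]
  tauto

theorem isOpen_slitTube (a η : ℝ) : IsOpen (slitTube a η) := by
  have h1 : IsOpen {v : ℂ | a < v.re} := isOpen_lt continuous_const Complex.continuous_re
  have h2 : IsOpen {v : ℂ | |v.im| < η} := isOpen_lt (Complex.continuous_im.abs) continuous_const
  have h3 : IsOpen {v : ℂ | ‖v‖ < 1} := isOpen_lt continuous_norm continuous_const
  exact h1.inter (h2.inter h3)

variable {S : Type*} [TopologicalSpace S] {f : S → S}
  {e : OpenPartialHomeomorph S ℂ} {n : ℕ} {x : StandardInverseLimit f}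

/-- The boundary points of the component `levelComp f x (disc e r) n` over the point of modulus `r`
of the positive radius. -/
def endpoints (f : S → S) (x : StandardInverseLimit f) (e : OpenPartialHomeomorph S ℂ) (r : ℝ)
    (n : ℕ) : Set S :=
  {a | f^[n] a = e.symm r ∧ a ∈ closure (levelComp f x (disc e r) n)}

theorem finite_endpoints (hf : IsTopBranched f) (r : ℝ) : (endpoints f x e r n).Finite :=
  (hf.finite_preimage_iterate n (finite_singleton (e.symm r))).subset fun _ ha => ha.1

/-- `Θ` counts the crossings of the arcs over the positive radius which begin at the component over
the disk of radius `r`: it is equal to `1` off a neighbourhood `T` of these arcs, and to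
`cutFun (r / 2) R κ` on `T`. -/
structure IsCrossingFunction (f : S → S) (x : StandardInverseLimit f)
    (e : OpenPartialHomeomorph S ℂ) (r R' R η : ℝ) (n : ℕ) (ζ : S → ℂ) (κ : ℂ → ℂ) (T : Set S)
    (Θ : S → ℂ) : Prop where
  continuous_correction : Continuous κ
  abs_im_correction : ∀ v, |(κ v).im| ≤ Real.pi
  hasLogOn : HasLogOn (fun z => Θ z / (ζ z - ζ (x.1 n)) ^ (endpoints f x e r n).ncard)
    (closure (levelComp f x (disc e R') n) \ levelComp f x (disc e r) n)
  mem_slitPlane : ∀ z, f^[n] z ∉ e.symm '' {v | segDist (r / 2) R v ≤ 0} → Θ z ∈ Complex.slitPlane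
  eq_on_boundary : ∀ z ∈ closure (levelComp f x (disc e r) n), ‖e (f^[n] z)‖ = r →
    Θ z = cutFun (r / 2) R κ (e (f^[n] z))
  eventually_eq_one : ∀ z ∉ T, ∀ᶠ w in 𝓝 z, Θ w = 1
  mem_tube : ∀ z ∈ T, f^[n] z ∈ e.symm '' slitTube (r / 3) η
  exists_path : ∀ z ∈ T, z ∈ levelComp f x (disc e R') n → z ∉ levelComp f x (disc e r) n →
    ∃ a ∈ endpoints f x e r n, ∃ g : ℝ → S, Continuous g ∧ g 0 = a ∧ g 1 = z ∧
      ∀ t, g t ∈ T ∧ g t ∈ levelComp f x (disc e R') n ∧ g t ∉ levelComp f x (disc e r) n ∧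
        r / 2 < (e (f^[n] (g t))).re ∧ (e (f^[n] (g t))).re < R ∧ e (f^[n] (g t)) ∈ e.target ∧
        Θ (g t) = cutFun (r / 2) R κ (e (f^[n] (g t)))

variable [T2Space S]

/-- The critical values off the positive radius are finite in number, so a thin tube avoids them. -/
theorem exists_slitTube_avoiding (hf : IsTopBranched f) {x₀ : S} (he : IsDiscCoord e x₀)
    (hs : ∀ t : ℝ, 0 < t → t ≤ 1 → e.symm t ∉ critVals f n) {a : ℝ} (ha : 0 < a) :
    ∃ η, 0 < η ∧ ∀ η' ≤ η, ∀ v ∈ slitTube a η', e.symm v ∉ critVals f n := by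
  have hfin : ((fun c => |(e c).im|) '' critVals f n \ {0}).Finite :=
    ((hf.finite_critVals n).image _).subset sdiff_subset
  obtain ⟨η, hη, hmin⟩ : ∃ η > 0, ∀ y ∈ (fun c => |(e c).im|) '' critVals f n \ {0}, η ≤ y := by
    rcases ((fun c => |(e c).im|) '' critVals f n \ {0}).eq_empty_or_nonempty with h0 | hne
    · exact ⟨1, one_pos, by simp [h0]⟩
    · obtain ⟨y, hy, hmin⟩ := hfin.exists_minimalFor id _ hne
      obtain ⟨⟨c, -, rfl⟩, hy0⟩ := hy
      refine ⟨_, lt_of_le_of_ne (abs_nonneg (e c).im) (Ne.symm hy0), fun z hz => ?_⟩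
      rcases le_total |(e c).im| z with h | h
      · exact h
      · exact hmin hz h
  refine ⟨η, hη, fun η' hη' v hv hcv => ?_⟩
  have hvt : v ∈ e.target := he.mem_target hv.2.2.le
  have hre : v.re ≤ ‖v‖ := Complex.re_le_norm v
  by_cases him : v.im = 0
  · have : v = (v.re : ℝ) := Complex.ext (by simp) (by simp [him])
    rw [this] at hcv
    exact hs v.re (ha.trans hv.1) (hre.trans hv.2.2.le) hcv
  · have := hmin |v.im| ⟨⟨_, hcv, by simp [e.right_inv hvt]⟩, by simpa using him⟩
    linarith [hv.2.1]

variable [LocallyConnectedSpace S]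

/-- The part over the closed disc of the image of a section over a convex set lies in the closure
of one component, if one of its points does. -/
theorem convex_section_mem_closure (hf : IsTopBranched f) (he : IsDiscCoord e (x.1 0)) {A : Set ℂ}
    (hA : Convex ℝ A) (hAc : ∀ v ∈ A, e.symm v ∉ critVals f n) {ς : ℂ → S}
    (hςc : ContinuousOn ς A) (hςf : ∀ v ∈ A, f^[n] (ς v) = e.symm v) {r : ℝ} (hr0 : 0 < r) (hr : r ≤ 1)
    {b : S} (hbA : e (f^[n] b) ∈ A) (hςb : ς (e (f^[n] b)) = b)
    (hb : b ∈ closure (levelComp f x (disc e r) n)) {w : ℂ} (hw : w ∈ A) (hwr : ‖w‖ ≤ r) :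
    ς w ∈ closure (levelComp f x (disc e r) n) := by
  have hbr : ‖e (f^[n] b)‖ ≤ r := ((he.mem_cdisc_iff hr).1
    (he.closure_disc_subset hr (closure_levelComp_subset hf.continuous hb))).2
  have hseg : segment ℝ (e (f^[n] b)) w ⊆ A := hA.segment_subset hbA hw
  have hsegr : segment ℝ (e (f^[n] b)) w ⊆ Metric.closedBall 0 r :=
    (convex_closedBall (0 : ℂ) r).segment_subset (by simpa using hbr) (by simpa using hwr)
  have hpre : IsPreconnected (ς '' segment ℝ (e (f^[n] b)) w) :=
    (convex_segment _ _).isPreconnected.image _ (hςc.mono hseg)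
  refine subset_closure_levelComp hf he hr0 hr hpre ?_ ?_
    ⟨_, left_mem_segment ℝ _ _, hςb⟩ hb (mem_image_of_mem ς (right_mem_segment ℝ _ _))
  · rintro _ ⟨v, hv, rfl⟩
    rw [hςf v (hseg hv)]
    exact ⟨v, hsegr hv, rfl⟩
  · rintro _ ⟨v, hv, rfl⟩
    rw [hςf v (hseg hv)]
    exact hAc v (hseg hv)

/-- A path in a slit tube from the point `r` to `v` which stays outside the disk of radius `r`. -/
theorem exists_path_slitTube {r η R' : ℝ} (hr : 0 < r) (hη : η ≤ r / 2) (hR' : R' < 1) {v : ℂ}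
    (hv : v ∈ slitTube (r / 3) η) (hvr : r ≤ ‖v‖) (hvR : ‖v‖ < R') :
    ∃ g : ℝ → ℂ, Continuous g ∧ g 0 = r ∧ g 1 = v ∧ ∀ t, g t ∈ slitTube (r / 3) η ∧ r ≤ ‖g t‖ ∧
      ‖g t‖ < R' ∧ r / 2 < (g t).re := by
  have hrR : r < R' := hvr.trans_lt hvR
  let s : ℝ → ℝ := fun t => projIcc 0 1 zero_le_one t
  have hs0 : ∀ t, 0 ≤ s t := fun t => (projIcc (0 : ℝ) 1 zero_le_one t).2.1
  have hs1 : ∀ t, s t ≤ 1 := fun t => (projIcc (0 : ℝ) 1 zero_le_one t).2.2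
  -- the segment from `r` to `v`, to be pushed outwards along rays to modulus at least `r`
  let q : ℝ → ℂ := fun t => ((1 - s t) * r : ℝ) + (s t : ℂ) * v
  have hq : Continuous q := by fun_prop
  have hqre : ∀ t, (q t).re = (1 - s t) * r + s t * v.re := fun t => by simp [q]
  have hqim : ∀ t, (q t).im = s t * v.im := fun t => by simp [q]
  have hsq : ∀ w : ℂ, ‖w‖ ^ 2 = w.re ^ 2 + w.im ^ 2 := fun w => by
    rw [Complex.sq_norm, Complex.normSq_apply]
    ring
  have him := abs_lt.1 hv.2.1
  have hre : r / 2 < v.re := by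
    have h1 := hsq v
    have h2 : v.im ^ 2 < (r / 2) ^ 2 := by nlinarith
    have h3 : r ^ 2 ≤ ‖v‖ ^ 2 := by nlinarith
    nlinarith [hv.1]
  have hqre' : ∀ t, r / 2 < (q t).re := fun t => by
    rw [hqre]
    rcases (hs0 t).eq_or_lt with h | h
    · rw [← h]
      linarith
    · have h1 := mul_pos h (sub_pos.2 hre)
      have h2 := mul_nonneg (sub_nonneg.2 (hs1 t)) hr.le
      nlinarith
  have hqn : ∀ t, 0 < ‖q t‖ := fun t => by
    have := Complex.re_le_norm (q t)
    linarith [hqre' t, half_pos hr]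
  have hqR : ∀ t, ‖q t‖ < R' := fun t => by
    have h1 : ‖q t‖ ≤ (1 - s t) * r + s t * ‖v‖ := by
      refine (norm_add_le _ _).trans (le_of_eq ?_)
      rw [norm_mul, Complex.norm_real, Complex.norm_real, Real.norm_of_nonneg (hs0 t),
        Real.norm_of_nonneg (mul_nonneg (sub_nonneg.2 (hs1 t)) hr.le)]
    nlinarith [hs0 t, hs1 t]
  have hqs : ∀ t, s t * r ≤ ‖q t‖ := fun t => by
    have h1 := hsq (q t)
    rw [hqre, hqim] at h1
    have h2 := hsq v
    have h3 : (s t * r) ^ 2 ≤ ‖q t‖ ^ 2 := by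
      have a1 : 0 ≤ (1 - s t) * r := mul_nonneg (sub_nonneg.2 (hs1 t)) hr.le
      have a2 : 0 ≤ s t * v.re := mul_nonneg (hs0 t) (by linarith [half_pos hr])
      have a3 : (s t * r) ^ 2 ≤ (s t) ^ 2 * ‖v‖ ^ 2 := by
        rw [mul_pow]
        exact mul_le_mul_of_nonneg_left (by nlinarith) (sq_nonneg _)
      nlinarith [mul_nonneg a1 a2, sq_nonneg ((1 - s t) * r)]
    exact le_of_sq_le_sq h3 (hqn t).le
  let m : ℝ → ℝ := fun t => max 1 (r / ‖q t‖)
  have hm : Continuous m := continuous_const.max (continuous_const.div hq.norm fun t => (hqn t).ne')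
  have hm1 : ∀ t, 1 ≤ m t := fun t => le_max_left _ _
  have hgn : ∀ t, ‖(m t : ℂ) * q t‖ = max ‖q t‖ r := fun t => by
    rw [norm_mul, Complex.norm_real, Real.norm_of_nonneg (zero_le_one.trans (hm1 t))]
    simp only [m]
    rw [max_mul_of_nonneg _ _ (hqn t).le, one_mul, div_mul_cancel₀ _ (hqn t).ne']
  refine ⟨fun t => (m t : ℂ) * q t, by fun_prop, ?_, ?_, fun t => ?_⟩
  · have h0 : s 0 = 0 := by simp [s]
    have hq0 : q 0 = r := by simp [q, h0]
    have hm0 : m 0 = 1 := by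
      simp only [m]
      rw [hq0, Complex.norm_real, Real.norm_of_nonneg hr.le, div_self hr.ne', max_self]
    simp only [hm0, hq0]
    simp
  · have h0 : s 1 = 1 := by simp [s]
    have hq1 : q 1 = v := by simp [q, h0]
    have hm1' : m 1 = 1 := by
      simp only [m]
      rw [hq1]
      exact max_eq_left ((div_le_one (hr.trans_le hvr)).2 hvr)
    simp only [hm1', hq1]
    simp
  · have hnorm : ‖(m t : ℂ) * q t‖ < R' := by
      rw [hgn]
      exact max_lt (hqR t) hrR
    have hre' : r / 2 < ((m t : ℂ) * q t).re := by
      rw [Complex.re_ofReal_mul]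
      nlinarith [hqre' t, hm1 t, half_pos hr]
    refine ⟨⟨by linarith, ?_, hnorm.trans hR'⟩, by rw [hgn]; exact le_max_right _ _, hnorm, hre'⟩
    rw [Complex.im_ofReal_mul, hqim, ← mul_assoc, abs_mul]
    have hms : m t * s t ≤ 1 := by
      simp only [m]
      rw [max_mul_of_nonneg _ _ (hs0 t), one_mul]
      refine max_le (hs1 t) ?_
      rw [div_mul_eq_mul_div, div_le_one (hqn t), mul_comm]
      exact hqs t
    have hms0 : 0 ≤ m t * s t := mul_nonneg (zero_le_one.trans (hm1 t)) (hs0 t)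
    rw [abs_of_nonneg hms0]
    nlinarith [abs_nonneg v.im, hv.2.1]

variable [ChartedSpace ℂ S] [IsManifold 𝓘(ℂ) 1 S]

/-- The crossing function is a product over the endpoints, one factor for each arc. By planarity
each factor has the same index as `ζ - ζ (x n)`, because its zero lies in the component and its pole
in the complement. -/
theorem exists_isCrossingFunction (hf : IsTopBranched f) (hfM : MDifferentiable 𝓘(ℂ) 𝓘(ℂ) f)
    (he : IsDiscCoord e (x.1 0)) (heM : MDifferentiableOn 𝓘(ℂ) 𝓘(ℂ) e e.source)
    (hs : ∀ t : ℝ, 0 < t → t ≤ 1 → e.symm t ∉ critVals f n) {r R' R η₀ : ℝ} (hr : 0 < r)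
    (hrR' : r < R') (hR'R : R' < R) (hR : R < 1) (hη₀ : 0 < η₀)
    {ζ : OpenPartialHomeomorph S ℂ} (hζ : MDifferentiableOn 𝓘(ℂ) 𝓘(ℂ) ζ.symm ζ.target)
    (ht : Convex ℝ ζ.target) (htne : ζ.target.Nonempty) {q : S}
    (hq : q ∉ levelComp f x (disc e R) n) (hqR : f^[n] q ≠ e.symm R) (hζs : {q}ᶜ ⊆ ζ.source)
    (hlog : ∀ s ∉ levelComp f x (disc e R) n, s ∈ ζ.source →
      HasLogOn (fun z => ζ z - ζ s) (closure (levelComp f x (disc e R') n))) :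
    ∃ (η : ℝ) (κ : ℂ → ℂ) (T : Set S) (Θ : S → ℂ), 0 < η ∧ η ≤ η₀ ∧
      IsCrossingFunction f x e r R' R η n ζ κ T Θ := by
  obtain ⟨η₁, hη₁, hav⟩ := exists_slitTube_avoiding hf he hs (a := r / 3) (by linarith)
  set η := min η₀ (min η₁ (r / 2))
  have hη : 0 < η := lt_min hη₀ (lt_min hη₁ (by linarith))
  have hη2 : η ≤ r / 2 := (min_le_right _ _).trans (min_le_right _ _)
  set A := slitTube (r / 3) η
  have hAc : ∀ v ∈ A, e.symm v ∉ critVals f n :=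
    hav η ((min_le_right _ _).trans (min_le_left _ _))
  have hA : Convex ℝ A := convex_slitTube _ _
  have hAo : IsOpen A := isOpen_slitTube _ _
  have hAt : A ⊆ e.target := fun v hv => he.mem_target hv.2.2.le
  have hr1 : r ≤ 1 := by linarith
  have hR'1 : R' ≤ 1 := by linarith
  have hpos : ∀ t : ℝ, r / 3 < t → t < 1 → (t : ℂ) ∈ A := fun t h1 h2 => by
    refine ⟨by simpa using h1, by simpa using hη, ?_⟩
    rw [Complex.norm_real, Real.norm_of_nonneg (by linarith)]
    exact h2
  -- so small that the set `C`, outside which the cut function equals `1`, lies in the tube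
  set η' := min (η / 2) (min (r / 7) ((1 - R) / 3))
  have hη' : 0 < η' := lt_min (by linarith) (lt_min (by linarith) (by linarith))
  have hη'1 : η' ≤ η / 2 := min_le_left _ _
  have hη'2 : η' ≤ r / 7 := (min_le_right _ _).trans (min_le_left _ _)
  have hη'3 : η' ≤ (1 - R) / 3 := (min_le_right _ _).trans (min_le_right _ _)
  obtain ⟨κ, hκ, hκi, hκ1, hκs⟩ := exists_cut_function (p := r / 2) (q := R) (by linarith) hη'
  set M := cutFun (r / 2) R κ
  set C : Set ℂ := {v | segDist (r / 2) R v ≤ η'}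
  have hCA : C ⊆ A := by
    intro v hv
    have hv' : |v.im| ≤ η' ∧ r / 2 - v.re ≤ η' ∧ v.re - R ≤ η' := by
      simpa [C, segDist] using hv
    refine ⟨by linarith [hv'.2.1], by linarith [hv'.1], ?_⟩
    refine (Complex.norm_le_abs_re_add_abs_im v).trans_lt ?_
    rw [abs_of_nonneg (by linarith [hv'.2.1] : (0 : ℝ) ≤ v.re)]
    linarith [hv'.1, hv'.2.2]
  have hC : IsCompact C := by
    refine Metric.isCompact_of_isClosed_isBounded
      (isClosed_le (continuous_segDist _ _) continuous_const) ?_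
    exact Metric.isBounded_ball.subset fun v hv => mem_ball_zero_iff.2 (hCA hv).2.2
  have hM1 : ∀ v, v ∉ C → M v = 1 := fun v hv => hκ1 v (not_le.1 hv).le
  set D := levelComp f x (disc e r) n
  set D' := levelComp f x (disc e R') n
  have hDD' : closure D ⊆ D' := closure_levelComp_subset_levelComp hf.continuous
    ((he.closure_disc_subset hr1).trans (cdisc_subset_disc hrR'))
  have hD'B : closure D' ⊆ levelComp f x (disc e R) n :=
    closure_levelComp_subset_levelComp hf.continuous
      ((he.closure_disc_subset hR'1).trans (cdisc_subset_disc hR'R))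
  let Eo : S → Set S := fun a => connectedComponentIn (f^[n] ⁻¹' (e.symm '' A)) a
  have hsec : ∀ b, f^[n] b ∈ e.symm '' A → ∃ ς : ℂ → S, ContinuousOn ς A ∧
      (∀ v ∈ A, ς v ∈ Eo b ∧ f^[n] (ς v) = e.symm v) ∧
      ∀ z ∈ Eo b, e (f^[n] z) ∈ A ∧ ς (e (f^[n] z)) = z := fun b hb =>
    exists_convex_section hf hA hAo hAt hAc hb
  choose! ς hςc hςm hςi using hsec
  have hself : ∀ b, f^[n] b ∈ e.symm '' A → b ∈ Eo b := fun b hb => mem_connectedComponentIn hb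
  have hcl : ∀ b, f^[n] b ∈ e.symm '' A → b ∈ closure D → ∀ w ∈ A, ‖w‖ ≤ r →
      ς b w ∈ closure D := fun b hb hbD w hw hwr =>
    convex_section_mem_closure hf he hA hAc (hςc b hb) (fun v hv => (hςm b hb v hv).2) hr hr1
      (hςi b hb b (hself b hb)).1 (hςi b hb b (hself b hb)).2 hbD hw hwr
  have hrA : (r : ℂ) ∈ A := hpos r (by linarith) (by linarith)
  have hptA : ∀ a ∈ endpoints f x e r n, f^[n] a ∈ e.symm '' A := fun a ha => ⟨r, hrA, ha.1.symm⟩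
  have hςr : ∀ a ∈ endpoints f x e r n, ς a r = a := fun a ha => by
    have := (hςi a (hptA a ha) a (hself a (hptA a ha))).2
    rwa [ha.1, e.right_inv (hAt hrA)] at this
  -- distinct endpoints lie on distinct tubes
  have hdisj : ∀ a ∈ endpoints f x e r n, ∀ b ∈ endpoints f x e r n, ∀ z, z ∈ Eo a → z ∈ Eo b →
      a = b := by
    intro a ha b hb z hza hzb
    have hab : b ∈ Eo a := by
      have h1 : Eo a = Eo b := (connectedComponentIn_eq hza).trans (connectedComponentIn_eq hzb).symm
      rw [h1]
      exact hself b (hptA b hb)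
    have := (hςi a (hptA a ha) b hab).2
    rw [hb.1, e.right_inv (hAt hrA), hςr a ha] at this
    exact this
  have hfin := finite_endpoints (x := x) (e := e) (n := n) hf r
  set Θ : S → ℂ := fun z => ∏ a ∈ hfin.toFinset, arcFun f n e A M a z
  set T : Set S := {z | ∃ a ∈ endpoints f x e r n, z ∈ Eo a}
  have hΘT : ∀ a ∈ endpoints f x e r n, ∀ z ∈ Eo a, Θ z = M (e (f^[n] z)) := by
    intro a ha z hz
    simp only [Θ]
    rw [Finset.prod_eq_single a, arcFun_of_mem hz]
    · intro b hb hba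
      refine arcFun_of_notMem fun hzb => hba ?_
      exact hdisj b (hfin.mem_toFinset.1 hb) a ha z hzb hz
    · exact fun h => absurd (hfin.mem_toFinset.2 ha) h
  have hΘ1 : ∀ z ∉ T, ∀ᶠ w in 𝓝 z, Θ w = 1 := by
    intro z hz
    have h1 : ∀ a ∈ hfin.toFinset, ∀ᶠ w in 𝓝 z, arcFun f n e A M a w = 1 := fun a ha =>
      eventually_arcFun_eq_one hf hAo hAt hC hCA (fun v _ hv => hM1 v hv)
        fun hza => hz ⟨a, hfin.mem_toFinset.1 ha, hza⟩
    filter_upwards [(Filter.eventually_all_finset hfin.toFinset).2 h1] with w hw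
    exact Finset.prod_eq_one hw
  refine ⟨η, κ, T, Θ, hη, min_le_left _ _, hκ, hκi, ?_, ?_, ?_, hΘ1, ?_, ?_⟩
  · have hqK : q ∉ closure D' := fun h => hq (hD'B h)
    have hKs : closure D' ⊆ ζ.source := fun z hz => hζs fun h => hqK (h ▸ hz)
    have hDs : D ⊆ ζ.source := (subset_closure.trans (hDD'.trans subset_closure)).trans hKs
    have hK : IsCompact (closure D') := by
      refine ((hf.proper_iterate n).isCompact_preimage (he.isCompact_cdisc hR'1)).of_isClosed_subset
        isClosed_closure ?_
      exact (closure_levelComp_subset hf.continuous).trans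
        (preimage_mono (he.closure_disc_subset hR'1))
    have key : ∀ a ∈ hfin.toFinset, HasLogOn
        (fun z => arcFun f n e A M a z / (ζ z - ζ (x.1 n))) (closure D' \ D) := by
      intro a ha
      rw [hfin.mem_toFinset] at ha
      have haA := hptA a ha
      have hpA : ((r / 2 : ℝ) : ℂ) ∈ A := hpos _ (by linarith) (by linarith)
      have hRA : (R : ℂ) ∈ A := hpos _ (by linarith) hR
      have hfp := (hςm a haA _ hpA).2
      have hfR := (hςm a haA _ hRA).2
      have hsR : ς a R ∉ levelComp f x (disc e R) n := by
        intro h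
        have h1 := iterate_mem_of_mem_levelComp h
        have h2 : ‖(R : ℂ)‖ = R := by
          rw [Complex.norm_real, Real.norm_of_nonneg (by linarith)]
        rw [hfR, he.symm_mem_disc_iff (by rw [h2]; exact hR.le) hR.le, h2] at h1
        exact lt_irrefl _ h1
      have hsRs : ς a R ∈ ζ.source := hζs fun h => hqR (by rw [← h, hfR])
      have hsp : ς a (r / 2 : ℝ) ∈ D := by
        have h2 : ‖((r / 2 : ℝ) : ℂ)‖ = r / 2 := by
          rw [Complex.norm_real, Real.norm_of_nonneg (by linarith)]
        refine mem_levelComp_of_closure (hcl a haA ha.2 _ hpA (by rw [h2]; linarith)) ?_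
        rw [hfp, he.symm_mem_disc_iff (by rw [h2]; linarith) hr1, h2]
        linarith
      exact hasLogOn_arcFun hf hfM heM hAo hAt hAc (hςm a haA) (hςi a haA) hC hCA hκ
        (fun v _ hv => hM1 v hv) hpA hRA (by linarith) hζ hK isPreconnected_levelComp
        (isOpen_levelComp hf.continuous (he.isOpen_disc hr1) n) hKs hDs ht htne
        (B := (levelComp f x (disc e R) n)ᶜ) (Set.disjoint_left.2 fun z hz hzB => hzB (hD'B hz))
        hsp hsR hsRs (mem_levelComp (he.mem_disc hr) n) (hlog _ hsR hsRs)
    refine (HasLogOn.prod hfin.toFinset key).congr fun z _ => ?_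
    rw [Finset.prod_div_distrib, Finset.prod_const, ncard_eq_toFinset_card _ hfin]
  · intro z hz
    by_cases hzT : z ∈ T
    · obtain ⟨a, ha, hza⟩ := hzT
      rw [hΘT a ha z hza]
      refine hκs _ (lt_of_not_ge fun h => hz ?_)
      obtain ⟨v, hv, hvz⟩ := connectedComponentIn_subset (f^[n] ⁻¹' (e.symm '' A)) a hza
      refine ⟨v, ?_, hvz⟩
      rwa [← hvz, e.right_inv (hAt hv)] at h
    · rw [(hΘ1 z hzT).self_of_nhds]
      exact Complex.one_mem_slitPlane
  · intro z hz hzr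
    by_cases hzA : e (f^[n] z) ∈ A
    · have hzs : f^[n] z ∈ e.source := ((he.mem_cdisc_iff hr1).1
        (he.closure_disc_subset hr1 (closure_levelComp_subset hf.continuous hz))).1
      have hzA' : f^[n] z ∈ e.symm '' A := ⟨_, hzA, e.left_inv hzs⟩
      have hrn : ‖(r : ℂ)‖ = r := by rw [Complex.norm_real, Real.norm_of_nonneg hr.le]
      have ha : ς z r ∈ endpoints f x e r n :=
        ⟨(hςm z hzA' r hrA).2, hcl z hzA' hz r hrA hrn.le⟩
      refine hΘT _ ha z ?_
      have h1 : Eo z = Eo (ς z r) := connectedComponentIn_eq (hςm z hzA' r hrA).1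
      rw [← h1]
      exact hself z hzA'
    · have hzT : z ∉ T := by
        rintro ⟨a, ha, hza⟩
        exact hzA (hςi a (hptA a ha) z hza).1
      rw [(hΘ1 z hzT).self_of_nhds, show cutFun (r / 2) R κ (e (f^[n] z)) = 1 from
        hM1 _ fun h => hzA (hCA h)]
  · rintro z ⟨a, ha, hza⟩
    exact connectedComponentIn_subset (f^[n] ⁻¹' (e.symm '' A)) a hza
  · rintro z ⟨a, ha, hza⟩ hzD' hzD
    have haA := hptA a ha
    obtain ⟨hvA, hςv⟩ := hςi a haA z hza
    have hzR' := (he.mem_disc_iff hR'1).1 (iterate_mem_of_mem_levelComp hzD')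
    have hvr : r ≤ ‖e (f^[n] z)‖ := by
      by_contra hcon
      push Not at hcon
      have h1 := hcl a haA ha.2 _ hvA hcon.le
      rw [hςv] at h1
      exact hzD (mem_levelComp_of_closure h1 ((he.mem_disc_iff hr1).2 ⟨hzR'.1, hcon⟩))
    obtain ⟨g, hg, hg0, hg1, hgt⟩ := exists_path_slitTube hr hη2 (by linarith) hvA hvr hzR'.2
    have hςg : Continuous fun t => ς a (g t) := (hςc a haA).comp_continuous hg fun t => (hgt t).1
    have hFg : ∀ t, f^[n] (ς a (g t)) = e.symm (g t) := fun t => (hςm a haA _ (hgt t).1).2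
    have heg : ∀ t, e (f^[n] (ς a (g t))) = g t := fun t => by
      rw [hFg, e.right_inv (hAt (hgt t).1)]
    refine ⟨a, ha, fun t => ς a (g t), hςg, ?_, ?_, fun t => ?_⟩
    · simp only [hg0, hςr a ha]
    · simp only [hg1, hςv]
    · have hmemE : ς a (g t) ∈ Eo a := (hςm a haA _ (hgt t).1).1
      have hn1 : ‖g t‖ ≤ 1 := by linarith [(hgt t).2.2.1]
      refine ⟨⟨a, ha, hmemE⟩, ?_, ?_, ?_, ?_, ?_, hΘT a ha _ hmemE⟩
      · refine subset_levelComp (isPreconnected_range hςg) ?_ ⟨0, rfl⟩ ?_ (mem_range_self t)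
        · rintro _ ⟨t', rfl⟩
          simp only [hFg]
          exact (he.symm_mem_disc_iff (by linarith [(hgt t').2.2.1]) hR'1).2 (hgt t').2.2.1
        · simp only [hg0, hςr a ha]
          exact hDD' ha.2
      · intro h
        have h1 := iterate_mem_of_mem_levelComp h
        rw [hFg, he.symm_mem_disc_iff hn1 hr1] at h1
        linarith [(hgt t).2.1]
      · rw [heg]
        exact (hgt t).2.2.2
      · rw [heg]
        have := Complex.re_le_norm (g t)
        linarith [(hgt t).2.2.1]
      · rw [heg]
        exact hAt (hgt t).1

end Crossing

/-! ### Turning around a component -/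

section Logs

variable {X : Type*} [TopologicalSpace X]

theorem eq_of_exp_eq_of_norm_lt {a b : ℂ} (h : Complex.exp a = Complex.exp b)
    (hab : ‖a - b‖ < 2 * Real.pi) : a = b := by
  obtain ⟨m, hm⟩ := Complex.exp_eq_exp_iff_exists_int.1 h
  have h1 : a - b = m * (2 * Real.pi * Complex.I) := by rw [hm]; ring
  rw [h1, norm_mul, norm_mul, norm_mul, Complex.norm_I, Complex.norm_real, Complex.norm_intCast,
    Real.norm_of_nonneg Real.pi_pos.le] at hab
  have h2 : |(m : ℝ)| < 1 := by
    by_contra hcon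
    push Not at hcon
    have h3 : ‖(2 : ℂ)‖ = 2 := by simp
    rw [h3] at hab
    nlinarith [Real.pi_pos]
  have h3 : m = 0 := Int.abs_lt_one_iff.1 (by exact_mod_cast h2)
  rw [hm, h3]
  simp

/-- Two continuous logarithms of the same function on a connected set differ by a constant. -/
theorem sub_eq_sub_of_exp_eq {s : Set X} (hs : IsPreconnected s) {A B : X → ℂ} (hA : ContinuousOn A s)
    (hB : ContinuousOn B s) (h : ∀ t ∈ s, Complex.exp (A t) = Complex.exp (B t)) {t u : X}
    (ht : t ∈ s) (hu : u ∈ s) : A t - A u = B t - B u := by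
  suffices h : A t - B t = A u - B u by linear_combination h
  refine hs.induction₂' (fun t u => A t - B t = A u - B u) ?_
    (fun x y z _ _ _ h1 h2 => h1.trans h2) ht hu
  intro t ht
  have h1 : Tendsto (fun u => (A u - B u) - (A t - B t)) (𝓝[s] t) (𝓝 ((A t - B t) - (A t - B t))) :=
    ((hA t ht).sub (hB t ht)).sub continuousWithinAt_const
  rw [sub_self] at h1
  filter_upwards [h1 (Metric.ball_mem_nhds 0 Real.two_pi_pos), self_mem_nhdsWithin] with u hu hus
  have h2 : A u - B u = A t - B t := by
    refine eq_of_exp_eq_of_norm_lt ?_ (by simpa using hu)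
    rw [Complex.exp_sub, Complex.exp_sub, h u hus, h t ht, div_self (Complex.exp_ne_zero _),
      div_self (Complex.exp_ne_zero _)]
  exact ⟨h2.symm, h2⟩

/-- An argument of a function with values in the slit plane varies by at most one turn. -/
theorem abs_im_sub_le_of_mem_slitPlane {s : Set X} (hs : IsPreconnected s) {L : X → ℂ}
    (hL : ContinuousOn L s) (h : ∀ t ∈ s, Complex.exp (L t) ∈ Complex.slitPlane) {t u : X}
    (ht : t ∈ s) (hu : u ∈ s) : |(L t).im - (L u).im| ≤ 2 * Real.pi := by
  have h1 := sub_eq_sub_of_exp_eq hs hL (B := fun t => Complex.log (Complex.exp (L t)))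
    (hL.cexp.clog h) (fun t _ => (Complex.exp_log (Complex.exp_ne_zero _)).symm) ht hu
  have h2 := congrArg Complex.im h1
  simp only [Complex.sub_im, Complex.log_im] at h2
  have b1 := abs_le.1 (Complex.abs_arg_le_pi (Complex.exp (L t)))
  have b2 := abs_le.1 (Complex.abs_arg_le_pi (Complex.exp (L u)))
  rw [h2, abs_le]
  constructor <;> linarith

end Logs

section Rotation

variable {S : Type*} [TopologicalSpace S] {x₀ : S}

/-- The coordinate `e`, turned so that the radius of angle `τ` becomes the positive radius. -/
noncomputable def rotate (e : OpenPartialHomeomorph S ℂ) (τ : ℝ) : OpenPartialHomeomorph S ℂ :=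
  e.trans (Homeomorph.mulLeft₀ (Complex.exp (-τ * Complex.I))
    (Complex.exp_ne_zero _)).toOpenPartialHomeomorph

variable {e : OpenPartialHomeomorph S ℂ} {τ : ℝ}

theorem rotate_apply (z : S) : rotate e τ z = Complex.exp (-τ * Complex.I) * e z := by
  simp [rotate]

theorem rotate_symm_apply (v : ℂ) : (rotate e τ).symm v = e.symm (Complex.exp (τ * Complex.I) * v) := by
  simp [rotate, ← Complex.exp_neg]

theorem rotate_source : (rotate e τ).source = e.source := by
  simp [rotate]

theorem mem_rotate_target {v : ℂ} : v ∈ (rotate e τ).target ↔ Complex.exp (τ * Complex.I) * v ∈ e.target := by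
  simp [rotate, ← Complex.exp_neg]

theorem rotate_zero : rotate e 0 = e :=
  OpenPartialHomeomorph.ext _ _ (fun z => by simp [rotate_apply])
    (fun v => by simp [rotate_symm_apply]) rotate_source

theorem IsDiscCoord.rotate (he : IsDiscCoord e x₀) (τ : ℝ) : IsDiscCoord (rotate e τ) x₀ := by
  refine ⟨by rw [rotate_source]; exact he.mem_source, by rw [rotate_apply, he.map_center, mul_zero],
    fun v hv => ?_⟩
  rw [mem_rotate_target]
  refine he.mem_target ?_
  rw [norm_mul, Complex.norm_exp_ofReal_mul_I, one_mul]
  simpa using hv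

theorem disc_rotate (he : IsDiscCoord e x₀) {r : ℝ} (hr : r ≤ 1) : disc (rotate e τ) r = disc e r := by
  ext z
  rw [(he.rotate τ).mem_disc_iff hr, he.mem_disc_iff hr, rotate_source, rotate_apply, norm_mul,
    ← Complex.ofReal_neg, Complex.norm_exp_ofReal_mul_I, one_mul]

theorem mdifferentiableOn_rotate [ChartedSpace ℂ S]
    (heM : MDifferentiableOn 𝓘(ℂ) 𝓘(ℂ) e e.source) :
    MDifferentiableOn 𝓘(ℂ) 𝓘(ℂ) (rotate e τ) (rotate e τ).source := by
  have h2 : MDifferentiable 𝓘(ℂ) 𝓘(ℂ) fun w : ℂ => Complex.exp (-τ * Complex.I) * w := by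
    refine mdifferentiable_iff_differentiable.2 ?_
    fun_prop
  rw [rotate_source]
  refine (h2.comp_mdifferentiableOn heM).congr fun z _ => ?_
  exact rotate_apply z

end Rotation

section Circle

variable {S : Type*} [TopologicalSpace S] [T2Space S] [LocallyConnectedSpace S] {f : S → S}
  {e : OpenPartialHomeomorph S ℂ} {n : ℕ} {x : StandardInverseLimit f} {r : ℝ}

/-- The curve `c` lifts the circle of radius `r` to the boundary of the component over the disk. -/
structure IsCircleLift (f : S → S) (x : StandardInverseLimit f) (e : OpenPartialHomeomorph S ℂ)
    (r : ℝ) (n : ℕ) (c : ℝ → S) : Prop where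
  continuous : Continuous c
  iterate_eq : ∀ t : ℝ, f^[n] (c t) = e.symm (r * Complex.exp (t * Complex.I))
  mem_closure : ∀ t, c t ∈ closure (levelComp f x (disc e r) n)

theorem norm_circle (hr : 0 < r) (t : ℝ) : ‖(r : ℂ) * Complex.exp (t * Complex.I)‖ = r := by
  rw [norm_mul, Complex.norm_exp_ofReal_mul_I, Complex.norm_real, Real.norm_of_nonneg hr.le, mul_one]

/-- The circle lifts through each point of the boundary of the component. -/
theorem exists_isCircleLift (hf : IsTopBranched f) (he : IsDiscCoord e (x.1 0)) (hr : 0 < r)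
    (hr1 : r ≤ 1) (hc : ∀ t : ℝ, e.symm (r * Complex.exp (t * Complex.I)) ∉ critVals f n) {a : S}
    {t₀ : ℝ} (ha : f^[n] a = e.symm (r * Complex.exp (t₀ * Complex.I)))
    (haD : a ∈ closure (levelComp f x (disc e r) n)) :
    ∃ c, IsCircleLift f x e r n c ∧ c t₀ = a := by
  have hcont : Continuous fun t : ℝ => e.symm (r * Complex.exp (t * Complex.I)) :=
    he.continuous_symm_comp (by fun_prop) fun t => by rw [norm_circle hr]; exact hr1
  obtain ⟨c, hcc, hc0, hcf⟩ := exists_lift hf hcont hc (a₀ := t₀) ha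
  refine ⟨c, ⟨hcc, hcf, fun t => ?_⟩, hc0⟩
  refine subset_closure_levelComp hf he hr hr1 (isPreconnected_range hcc) ?_ ?_ ⟨t₀, hc0⟩ haD
    (mem_range_self t)
  · rintro _ ⟨t, rfl⟩
    rw [hcf]
    exact ⟨_, by rw [mem_closedBall_zero_iff, norm_circle hr], rfl⟩
  · rintro _ ⟨t, rfl⟩
    rw [hcf]
    exact hc t

namespace IsCircleLift

variable {c c' : ℝ → S}

theorem add_two_pi (h : IsCircleLift f x e r n c) (m : ℤ) :
    IsCircleLift f x e r n fun t => c (t + 2 * Real.pi * m) := by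
  refine ⟨h.continuous.comp (by fun_prop), fun t => ?_, fun t => h.mem_closure _⟩
  rw [h.iterate_eq]
  congr 2
  rw [Complex.exp_eq_exp_iff_exists_int]
  exact ⟨m, by push_cast; ring⟩

theorem eq_of_eq (hf : IsTopBranched f)
    (hc : ∀ t : ℝ, e.symm (r * Complex.exp (t * Complex.I)) ∉ critVals f n)
    (h : IsCircleLift f x e r n c) (h' : IsCircleLift f x e r n c') {t₀ : ℝ} (h0 : c t₀ = c' t₀) :
    c = c' :=
  lift_unique hf h.continuous h'.continuous (fun t => by rw [h.iterate_eq, h'.iterate_eq])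
    (fun t => by rw [h.iterate_eq]; exact hc t) h0

theorem apply_two_pi_mem_endpoints (h : IsCircleLift f x e r n c) (m : ℤ) :
    c (2 * Real.pi * m) ∈ endpoints f x e r n := by
  refine ⟨?_, h.mem_closure _⟩
  rw [h.iterate_eq, Complex.exp_eq_one_iff.2 ⟨m, by push_cast; ring⟩, mul_one]

theorem coord_eq (h : IsCircleLift f x e r n c) (he : IsDiscCoord e (x.1 0)) (hr : 0 < r)
    (hr1 : r ≤ 1) (t : ℝ) : e (f^[n] (c t)) = r * Complex.exp (t * Complex.I) := by
  rw [h.iterate_eq, e.right_inv (he.mem_target (by rw [norm_circle hr]; exact hr1))]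

theorem notMem (h : IsCircleLift f x e r n c) (he : IsDiscCoord e (x.1 0)) (hr : 0 < r)
    (hr1 : r ≤ 1) (t : ℝ) : c t ∉ levelComp f x (disc e r) n := by
  intro hD
  have := ((he.mem_disc_iff hr1).1 (iterate_mem_of_mem_levelComp hD)).2
  rw [h.coord_eq he hr hr1, norm_circle hr] at this
  exact lt_irrefl _ this

/-- The winding number of a closed circle lift, computed with a function which, up to a continuous
logarithm, is the `k`-th power of `ζ`. -/
theorem mul_log_sub {Y : Set S} {Θ ζ Φ : S → ℂ} {ν ℓ : ℝ → ℂ} {k : ℕ} (h : IsCircleLift f x e r n c)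
    (hcY : ∀ t, c t ∈ Y) (hζ : ∀ z ∈ Y, ζ z ≠ 0) (hΦc : ContinuousOn Φ Y)
    (hΦ : ∀ z ∈ Y, Θ z / ζ z ^ k = Complex.exp (Φ z)) (hν : Continuous ν)
    (hνc : ∀ t, ζ (c t) = Complex.exp (ν t)) (hℓ : Continuous ℓ)
    (hΘ : ∀ t, Θ (c t) = Complex.exp (ℓ t)) (s t : ℝ) :
    k * (ν t - ν s) + (Φ (c t) - Φ (c s)) = ℓ t - ℓ s := by
  have h1 := sub_eq_sub_of_exp_eq isPreconnected_univ (A := fun t => k * ν t + Φ (c t)) (B := ℓ)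
    ((continuous_const.mul hν).add (hΦc.comp_continuous h.continuous hcY)).continuousOn
    hℓ.continuousOn (fun t _ => by
      rw [Complex.exp_add, Complex.exp_nat_mul, ← hνc, ← hΦ _ (hcY t),
        mul_div_cancel₀ _ (pow_ne_zero _ (hζ _ (hcY t))), hΘ]) (mem_univ t) (mem_univ s)
  rw [← h1]
  ring

/-- The circle lift runs through all points of `endpoints f x e r n` and has their number as its
period; it turns around the component exactly once in this time. -/
theorem period {Y : Set S} {Θ ζ Φ : S → ℂ} {ν ℓ : ℝ → ℂ} (h : IsCircleLift f x e r n c)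
    (hf : IsTopBranched f) (hc : ∀ t : ℝ, e.symm (r * Complex.exp (t * Complex.I)) ∉ critVals f n)
    (hcY : ∀ t, c t ∈ Y) (hζ : ∀ z ∈ Y, ζ z ≠ 0) (hΦc : ContinuousOn Φ Y)
    (hΦ : ∀ z ∈ Y, Θ z / ζ z ^ (endpoints f x e r n).ncard = Complex.exp (Φ z)) (hν : Continuous ν)
    (hνc : ∀ t, ζ (c t) = Complex.exp (ν t)) (hℓ : Continuous ℓ)
    (hΘ : ∀ t, Θ (c t) = Complex.exp (ℓ t))
    (hℓp : ∀ (t : ℝ) (m : ℤ), ℓ (t + 2 * Real.pi * m) = ℓ t + 2 * Real.pi * m * Complex.I) :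
    0 < (endpoints f x e r n).ncard ∧
    Function.Periodic c (2 * Real.pi * (endpoints f x e r n).ncard) ∧
    (∀ a ∈ endpoints f x e r n, ∃ m : ℤ, c (2 * Real.pi * m) = a) ∧
    ν (2 * Real.pi * (endpoints f x e r n).ncard) - ν 0 = 2 * Real.pi * Complex.I := by
  set P := endpoints f x e r n
  have hfin : P.Finite := finite_endpoints hf r
  have huniq : ∀ i j : ℤ, c (2 * Real.pi * i) = c (2 * Real.pi * j) →
      ∀ t, c (t + 2 * Real.pi * i) = c (t + 2 * Real.pi * j) := fun i j hij t =>
    congr_fun ((h.add_two_pi i).eq_of_eq hf hc (h.add_two_pi j) (t₀ := 0)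
      (by simpa using hij)) t
  have hshift : ∀ i j : ℕ, i ≤ j → c (2 * Real.pi * i) = c (2 * Real.pi * j) →
      c (2 * Real.pi * (j - i : ℕ)) = c 0 := by
    intro i j hij hcij
    have := huniq i j (by exact_mod_cast hcij) (-(2 * Real.pi * i))
    push_cast [hij] at this ⊢
    rw [show -(2 * Real.pi * i) + 2 * Real.pi * i = (0 : ℝ) by ring] at this
    rw [this]
    congr 1
    ring
  -- the lift closes up after `N` turns, where `N` is at most the number `k` of endpoints; if it
  -- winds `b` times around the component meanwhile, then `k * b = N`, so that `b = 1` and `N = k`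
  have hex : ∃ j : ℕ, 0 < j ∧ c (2 * Real.pi * j) = c 0 := by
    have hmaps : MapsTo (fun j : ℕ => c (2 * Real.pi * j)) univ P := fun j _ => by
      exact_mod_cast h.apply_two_pi_mem_endpoints (j : ℤ)
    obtain ⟨i, -, j, -, hij, hcij⟩ := infinite_univ.exists_ne_map_eq_of_mapsTo hmaps hfin
    rcases lt_or_gt_of_ne hij with h1 | h1
    · exact ⟨j - i, by omega, hshift i j h1.le hcij⟩
    · exact ⟨i - j, by omega, hshift j i h1.le hcij.symm⟩
  classical
  set N := Nat.find hex
  obtain ⟨hN0, hN⟩ := Nat.find_spec hex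
  have hinj : InjOn (fun j : ℕ => c (2 * Real.pi * j)) (Finset.range N : Set ℕ) := by
    have key : ∀ i j : ℕ, i < j → j < N → c (2 * Real.pi * i) ≠ c (2 * Real.pi * j) := by
      intro i j hij hj hcij
      exact Nat.find_min hex (m := j - i) (by omega) ⟨by omega, hshift i j hij.le hcij⟩
    intro i hi j hj hij
    rw [Finset.mem_coe, Finset.mem_range] at hi hj
    rcases lt_trichotomy i j with h1 | h1 | h1
    · exact absurd hij (key i j h1 hj)
    · exact h1
    · exact absurd hij.symm (key j i h1 hi)
  have hsub : ((Finset.range N).image fun j : ℕ => c (2 * Real.pi * j) : Set S) ⊆ P := by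
    intro a ha
    rw [Finset.coe_image] at ha
    obtain ⟨j, -, rfl⟩ := ha
    exact_mod_cast h.apply_two_pi_mem_endpoints (j : ℤ)
  have hcard : ((Finset.range N).image fun j : ℕ => c (2 * Real.pi * j) : Set S).ncard = N := by
    rw [Set.ncard_coe_finset, Finset.card_image_of_injOn hinj, Finset.card_range]
  have hle : N ≤ P.ncard := hcard ▸ ncard_le_ncard hsub hfin
  have hlog := h.mul_log_sub hcY hζ hΦc hΦ hν hνc hℓ hΘ 0 (2 * Real.pi * N)
  have hℓN := hℓp 0 N
  rw [hN, sub_self, add_zero] at hlog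
  simp only [zero_add] at hℓN
  push_cast at hℓN
  rw [hℓN, add_sub_cancel_left] at hlog
  have hexp : Complex.exp (ν (2 * Real.pi * N)) = Complex.exp (ν 0) := by rw [← hνc, ← hνc, hN]
  obtain ⟨b, hb⟩ := Complex.exp_eq_exp_iff_exists_int.1 hexp
  have hkb : (P.ncard : ℤ) * b = N := by
    have h1 : ((P.ncard : ℂ) * b) * (2 * Real.pi * Complex.I) = N * (2 * Real.pi * Complex.I) := by
      rw [hb] at hlog
      linear_combination hlog
    have h2 := mul_right_cancel₀ Complex.two_pi_I_ne_zero h1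
    exact_mod_cast h2
  have hb0 : 0 < b := by
    by_contra hcon
    push Not at hcon
    have : (P.ncard : ℤ) * b ≤ 0 := mul_nonpos_of_nonneg_of_nonpos (by positivity) hcon
    omega
  have hNk : N = P.ncard := by
    refine le_antisymm hle ?_
    have : (P.ncard : ℤ) * 1 ≤ P.ncard * b := mul_le_mul_of_nonneg_left (by omega) (by positivity)
    omega
  have hb1 : b = 1 := by
    rw [hNk] at hkb
    have h0 : (P.ncard : ℤ) ≠ 0 := by omega
    exact mul_left_cancel₀ h0 (by rw [hkb, mul_one])
  refine ⟨hNk ▸ hN0, fun t => ?_, fun a ha => ?_, ?_⟩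
  · have h1 := huniq N 0 (by simpa using hN) t
    rw [← hNk]
    simpa using h1
  · have h1 := Set.eq_of_subset_of_ncard_le hsub (by rw [hcard, hNk]) hfin
    rw [← h1, Finset.coe_image] at ha
    obtain ⟨j, -, rfl⟩ := ha
    exact ⟨j, by simp⟩
  · rw [← hNk, hb, hb1]
    push_cast
    ring

end IsCircleLift

end Circle

/-! ### Paths outside a component turn boundedly -/

section Turn

variable {S : Type*} [TopologicalSpace S] [T2Space S] [LocallyConnectedSpace S] {f : S → S}
  {e : OpenPartialHomeomorph S ℂ} {n : ℕ} {x : StandardInverseLimit f} {r R' R : ℝ}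

/-- Along the lifted circles the crossing function of the radius of angle `τ` has a logarithm which
depends on the time only, and whose imaginary part is comparable to the time. -/
theorem IsCrossingFunction.exists_boundary_log {τ η : ℝ} {ζ Θ : S → ℂ} {κ : ℂ → ℂ} {T : Set S}
    (h : IsCrossingFunction f x (rotate e τ) r R' R η n ζ κ T Θ) (he : IsDiscCoord e (x.1 0))
    (hr : 0 < r) (hr1 : r ≤ 1) (hrR : r < R) :
    ∃ ℓ : ℝ → ℂ, Continuous ℓ ∧
      (∀ c, IsCircleLift f x e r n c → ∀ t, Θ (c t) = Complex.exp (ℓ t)) ∧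
      (∀ (t : ℝ) (m : ℤ), ℓ (t + 2 * Real.pi * m) = ℓ t + 2 * Real.pi * m * Complex.I) ∧
      ∀ t, |(ℓ t).im - (t - τ)| ≤ 4 * Real.pi := by
  obtain ⟨ℓ, hℓ, hℓe, hℓp, hℓi⟩ := exists_circle_log (p := r / 2) (q := R) (ρ := r) (half_pos hr)
    h.continuous_correction h.abs_im_correction (by linarith) hrR
  refine ⟨fun t => ℓ (t - τ), hℓ.comp (by fun_prop), fun c hc t => ?_, fun t m => ?_,
    fun t => hℓi _⟩
  · have h1 : rotate e τ (f^[n] (c t)) = r * Complex.exp ((t - τ : ℝ) * Complex.I) := by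
      rw [rotate_apply, hc.coord_eq he hr hr1, mul_left_comm, ← Complex.exp_add]
      congr 2
      push_cast
      ring
    rw [h.eq_on_boundary (c t) (by rw [disc_rotate he hr1]; exact hc.mem_closure t)
      (by rw [h1, norm_circle hr]), h1]
    exact hℓe _
  · have h1 := hℓp (t - τ) m
    show ℓ (t + 2 * Real.pi * m - τ) = ℓ (t - τ) + _
    rw [← h1]
    congr 1
    ring

/-- Within the tube the crossing function depends on the projection only, which runs in a strip
where the cut function has a logarithm with bounded imaginary part. So the argument changes
boundedly between a point of the tube and the endpoint of its arc. -/
theorem IsCrossingFunction.exists_abs_im_sub_le {η : ℝ} {ζ Θ : S → ℂ} {κ : ℂ → ℂ} {T : Set S}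
    (h : IsCrossingFunction f x e r R' R η n ζ κ T Θ) {w : S → ℂ}
    (hw : ContinuousOn w (closure (levelComp f x (disc e R') n) \ levelComp f x (disc e r) n))
    (hwΘ : ∀ z ∈ T, z ∈ closure (levelComp f x (disc e R') n) \ levelComp f x (disc e r) n →
      Complex.exp (w z) = Θ z)
    (hf : Continuous f) (he : IsDiscCoord e (x.1 0)) (hR' : R' ≤ 1) {z : S}
    (hz : z ∈ T) (hzD' : z ∈ levelComp f x (disc e R') n) (hzD : z ∉ levelComp f x (disc e r) n) :
    ∃ a ∈ endpoints f x e r n, |(w z).im - (w a).im| ≤ 6 * Real.pi := by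
  obtain ⟨a, ha, g, hg, hg0, hg1, hgt⟩ := h.exists_path z hz hzD' hzD
  obtain ⟨Λ, hΛ, hΛe⟩ := exists_strip_log (p := r / 2) (q := R) h.continuous_correction
    h.abs_im_correction
  have hgY : ∀ t, g t ∈ closure (levelComp f x (disc e R') n) \ levelComp f x (disc e r) n :=
    fun t => ⟨subset_closure (hgt t).2.1, (hgt t).2.2.1⟩
  have hsrc : ∀ t, f^[n] (g t) ∈ e.source := fun t =>
    ((he.mem_disc_iff hR').1 (iterate_mem_of_mem_levelComp (hgt t).2.1)).1
  have hge : Continuous fun t => e (f^[n] (g t)) :=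
    e.continuousOn.comp_continuous ((hf.iterate n).comp hg) hsrc
  have hst : ∀ t, r / 2 < (e (f^[n] (g t))).re ∧ (e (f^[n] (g t))).re < R := fun t =>
    ⟨(hgt t).2.2.2.1, (hgt t).2.2.2.2.1⟩
  have h1 := sub_eq_sub_of_exp_eq isPreconnected_univ (A := fun t => w (g t))
    (B := fun t => Λ (e (f^[n] (g t)))) (hw.comp_continuous hg hgY).continuousOn
    (hΛ.comp_continuous hge hst).continuousOn (fun t _ => by
      rw [hwΘ _ (hgt t).1 (hgY t), (hgt t).2.2.2.2.2.2]
      exact (hΛe _ (hst t).1 (hst t).2).1) (mem_univ 1) (mem_univ 0)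
  refine ⟨a, ha, ?_⟩
  have h2 := congrArg Complex.im h1
  simp only [Complex.sub_im, hg0, hg1] at h2
  have b1 := abs_le.1 (hΛe _ (hst 1).1 (hst 1).2).2
  have b2 := abs_le.1 (hΛe _ (hst 0).1 (hst 0).2).2
  rw [hg1] at b1
  rw [hg0] at b2
  rw [h2, abs_le]
  constructor <;> linarith

theorem eventually_eq_of_exp_eq_one {w : S → ℂ} {G : Set S} (hG : IsOpen G) (hw : ContinuousOn w G)
    {z : S} (hz : z ∈ G) (h1 : ∀ᶠ y in 𝓝 z, Complex.exp (w y) = 1) : ∀ᶠ y in 𝓝 z, w y = w z := by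
  have h2 : Tendsto (fun y => w y - w z) (𝓝 z) (𝓝 (w z - w z)) :=
    ((hw.continuousAt (hG.mem_nhds hz)).sub continuousAt_const).tendsto
  rw [sub_self] at h2
  filter_upwards [h1, h2 (Metric.ball_mem_nhds 0 Real.two_pi_pos)] with y hy hy2
  exact eq_of_exp_eq_of_norm_lt (by rw [hy, h1.self_of_nhds]) (by simpa using hy2)

/-- Outside the component over the small disk, logarithms of two crossing functions with the same
index differ by a function with bounded imaginary part. -/
theorem abs_im_sub_le_of_crossing {τ η₀ η₁ : ℝ} {ζ Θ₀ Θ₁ : S → ℂ} {κ₀ κ₁ : ℂ → ℂ} {T₀ T₁ : Set S}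
    (h₀ : IsCrossingFunction f x e r R' R η₀ n ζ κ₀ T₀ Θ₀)
    (h₁ : IsCrossingFunction f x (rotate e τ) r R' R η₁ n ζ κ₁ T₁ Θ₁) (hT : Disjoint T₀ T₁)
    (hf : IsTopBranched f) (he : IsDiscCoord e (x.1 0)) (hr : 0 < r) (hrR' : r < R') (hR'R : R' < R)
    (hR : R < 1) (hc : ∀ t : ℝ, e.symm (r * Complex.exp (t * Complex.I)) ∉ critVals f n)
    {w : S → ℂ}
    (hw : ContinuousOn w (closure (levelComp f x (disc e R') n) \ levelComp f x (disc e r) n))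
    (hwΘ : ∀ z ∈ closure (levelComp f x (disc e R') n) \ levelComp f x (disc e r) n,
      Complex.exp (w z) = Θ₁ z / Θ₀ z) {c : ℝ → S} (hcl : IsCircleLift f x e r n c)
    (hcs : ∀ a ∈ endpoints f x e r n, ∃ m : ℤ, c (2 * Real.pi * m) = a) {z : S}
    (hzD' : z ∈ levelComp f x (disc e R') n) (hzD : z ∉ levelComp f x (disc e r) n) :
    |(w z).im - (w (c 0)).im| ≤ 23 * Real.pi := by
  have hpi := Real.pi_pos
  have hr1 : r ≤ 1 := by linarith
  have hR'1 : R' ≤ 1 := by linarith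
  set D := levelComp f x (disc e r) n
  set D' := levelComp f x (disc e R') n
  have hDo : IsOpen D := isOpen_levelComp hf.continuous (he.isOpen_disc hr1) n
  have hD'o : IsOpen D' := isOpen_levelComp hf.continuous (he.isOpen_disc hR'1) n
  have hDD' : closure D ⊆ D' := closure_levelComp_subset_levelComp hf.continuous
    ((he.closure_disc_subset hr1).trans (cdisc_subset_disc hrR'))
  have hcY : ∀ t, c t ∈ closure D' \ D := fun t =>
    ⟨subset_closure (hDD' (hcl.mem_closure t)), hcl.notMem he hr hr1 t⟩
  obtain ⟨ℓ₁, hℓ₁, hℓ₁e, -, hℓ₁i⟩ := h₁.exists_boundary_log he hr hr1 (hrR'.trans hR'R)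
  obtain ⟨ℓ₀, hℓ₀, hℓ₀e, -, hℓ₀i⟩ :=
    IsCrossingFunction.exists_boundary_log (τ := 0) (by rwa [rotate_zero]) he hr hr1 (hrR'.trans hR'R)
      (Θ := Θ₀) (ζ := ζ) (κ := κ₀) (T := T₀) (R' := R') (R := R) (η := η₀)
  -- the boundary of the small component
  have b1 : ∀ t, |(w (c t)).im - (w (c 0)).im| ≤ 16 * Real.pi := by
    intro t
    have h1 := sub_eq_sub_of_exp_eq isPreconnected_univ (A := fun t => w (c t))
      (B := fun t => ℓ₁ t - ℓ₀ t) (hw.comp_continuous hcl.continuous hcY).continuousOn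
      (hℓ₁.sub hℓ₀).continuousOn (fun t _ => by
        rw [hwΘ _ (hcY t), Complex.exp_sub, hℓ₁e c hcl, hℓ₀e c hcl]) (mem_univ t) (mem_univ 0)
    have h2 := congrArg Complex.im h1
    simp only [Complex.sub_im] at h2
    have a1 := abs_le.1 (hℓ₁i t)
    have a2 := abs_le.1 (hℓ₁i 0)
    have a3 := abs_le.1 (hℓ₀i t)
    have a4 := abs_le.1 (hℓ₀i 0)
    rw [h2, abs_le]
    constructor <;> linarith
  have b2 : ∀ y ∈ closure D, y ∉ D → |(w y).im - (w (c 0)).im| ≤ 16 * Real.pi := by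
    intro y hy hyD
    obtain ⟨hys, hyr⟩ := (he.mem_cdisc_iff hr1).1
      (he.closure_disc_subset hr1 (closure_levelComp_subset hf.continuous hy))
    have hyr' : ‖e (f^[n] y)‖ = r := by
      refine le_antisymm hyr (not_lt.1 fun hlt => hyD ?_)
      exact mem_levelComp_of_closure hy ((he.mem_disc_iff hr1).2 ⟨hys, hlt⟩)
    have hys' : f^[n] y = e.symm (r * Complex.exp ((Complex.arg (e (f^[n] y)) : ℝ) * Complex.I)) := by
      rw [← hyr', Complex.norm_mul_exp_arg_mul_I, e.left_inv hys]
    obtain ⟨c', hc', hc'y⟩ := exists_isCircleLift hf he hr hr1 hc hys' hy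
    obtain ⟨m, hm⟩ := hcs (c' 0) (by simpa using hc'.apply_two_pi_mem_endpoints 0)
    have := hc'.eq_of_eq hf hc (hcl.add_two_pi m) (t₀ := 0) (by simpa using hm.symm)
    rw [← hc'y, this]
    exact b1 _
  -- the tubes
  have b3 : ∀ y ∈ D', y ∉ D → y ∈ T₀ ∪ T₁ → |(w y).im - (w (c 0)).im| ≤ 22 * Real.pi := by
    intro y hyD' hyD hyT
    have hend : ∃ a, a ∈ closure D ∧ a ∉ D ∧ |(w y).im - (w a).im| ≤ 6 * Real.pi := by
      rcases hyT with hyT | hyT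
      · obtain ⟨a, ha, haw⟩ := h₀.exists_abs_im_sub_le hw.neg (fun u huT hu => by
          have hΘ : Θ₁ u = 1 :=
            (h₁.eventually_eq_one u (Set.disjoint_left.1 hT huT)).self_of_nhds
          rw [Pi.neg_apply, Complex.exp_neg, hwΘ u hu, hΘ, one_div, inv_inv]) hf.continuous he hR'1 hyT hyD' hyD
        refine ⟨a, ha.2, fun haD => ?_, ?_⟩
        · have hn : ‖(r : ℂ)‖ = r := by rw [Complex.norm_real, Real.norm_of_nonneg hr.le]
          have := iterate_mem_of_mem_levelComp haD
          rw [ha.1, he.symm_mem_disc_iff (by rw [hn]; exact hr1) hr1, hn] at this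
          exact lt_irrefl _ this
        · simp only [Pi.neg_apply, Complex.neg_im] at haw
          rw [← abs_neg]
          convert haw using 2
          ring
      · have e1 : levelComp f x (disc (rotate e τ) r) n = D := by rw [disc_rotate he hr1]
        have e2 : levelComp f x (disc (rotate e τ) R') n = D' := by rw [disc_rotate he hR'1]
        obtain ⟨a, ha, haw⟩ := h₁.exists_abs_im_sub_le (by rw [e1, e2]; exact hw) (fun u huT hu => by
          have hΘ : Θ₀ u = 1 :=
            (h₀.eventually_eq_one u (Set.disjoint_right.1 hT huT)).self_of_nhds
          rw [e1, e2] at hu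
          rw [hwΘ u hu, hΘ, div_one]) hf.continuous (he.rotate τ) hR'1 hyT (by rwa [e2]) (by rwa [e1])
        refine ⟨a, by rw [← e1]; exact ha.2, fun haD => ?_, haw⟩
        have hn : ‖(r : ℂ)‖ = r := by rw [Complex.norm_real, Real.norm_of_nonneg hr.le]
        have := iterate_mem_of_mem_levelComp (e1 ▸ haD)
        rw [ha.1, (he.rotate τ).symm_mem_disc_iff (by rw [hn]; exact hr1) hr1, hn] at this
        exact lt_irrefl _ this
    obtain ⟨a, haD, haD', haw⟩ := hend
    have a1 := abs_le.1 haw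
    have a2 := abs_le.1 (b2 a haD haD')
    rw [abs_le]
    constructor <;> linarith
  -- the set where the bound fails is open and closed in the large component
  let O : Set S := {y | y ∈ D' ∧ y ∉ D ∧ 23 * Real.pi < |(w y).im - (w (c 0)).im|}
  have hloc : ∀ y ∈ D', y ∉ closure D → y ∉ T₀ ∪ T₁ → ∀ᶠ u in 𝓝 y, u ∈ D' \ closure D ∧ w u = w y := by
    intro y hyD' hyD hyT
    have hG : IsOpen (D' \ closure D) := hD'o.sdiff isClosed_closure
    have hGY : D' \ closure D ⊆ closure D' \ D := sdiff_subset_sdiff subset_closure subset_closure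
    have hmem : ∀ᶠ u in 𝓝 y, u ∈ D' \ closure D := hG.mem_nhds ⟨hyD', hyD⟩
    refine hmem.and ?_
    refine eventually_eq_of_exp_eq_one hG (hw.mono hGY) ⟨hyD', hyD⟩ ?_
    filter_upwards [hG.mem_nhds ⟨hyD', hyD⟩, h₀.eventually_eq_one y fun h => hyT (Or.inl h),
      h₁.eventually_eq_one y fun h => hyT (Or.inr h)] with u hu hu0 hu1
    rw [hwΘ u (hGY hu), hu0, hu1, div_one]
  have hOloc : ∀ y ∈ D', y ∉ D → 23 * Real.pi ≤ |(w y).im - (w (c 0)).im| →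
      y ∉ closure D ∧ y ∉ T₀ ∪ T₁ := by
    intro y hyD' hyD hy
    refine ⟨fun h => ?_, fun h => ?_⟩
    · linarith [b2 y h hyD]
    · linarith [b3 y hyD' hyD h]
  by_contra hcon
  push Not at hcon
  have hOo : IsOpen O := by
    rw [isOpen_iff_mem_nhds]
    rintro y ⟨hyD', hyD, hy⟩
    obtain ⟨h1, h2⟩ := hOloc y hyD' hyD hy.le
    filter_upwards [hloc y hyD' h1 h2] with u hu
    exact ⟨hu.1.1, fun h => hu.1.2 (subset_closure h), by rw [hu.2]; exact hy⟩
  have hsub : D' ⊆ O := by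
    refine isPreconnected_levelComp.subset_of_closure_inter_subset hOo ⟨z, hzD', hzD', hzD, hcon⟩ ?_
    rintro y ⟨hyO, hyD'⟩
    have hyD : y ∉ D := by
      intro h
      obtain ⟨u, huD, huO⟩ := mem_closure_iff.1 hyO D hDo h
      exact huO.2.1 huD
    by_cases hy : y ∈ closure D ∨ y ∈ T₀ ∪ T₁
    · exfalso
      have hle : |(w y).im - (w (c 0)).im| ≤ 22 * Real.pi := by
        rcases hy with hy | hy
        · linarith [b2 y hy hyD]
        · exact b3 y hyD' hyD hy
      have hcont : ContinuousWithinAt (fun u => |(w u).im - (w (c 0)).im|) (closure D' \ D) y :=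
        ((Complex.continuous_im.continuousAt.comp_continuousWithinAt
          (hw y ⟨subset_closure hyD', hyD⟩)).sub continuousWithinAt_const).abs
      have h3 : ∀ᶠ u in 𝓝[closure D' \ D] y, |(w u).im - (w (c 0)).im| < 23 * Real.pi :=
        hcont.eventually_lt continuousWithinAt_const (by linarith)
      obtain ⟨G, hG, hyG, hGs⟩ := mem_nhdsWithin.1 h3
      obtain ⟨u, huG, huO⟩ := mem_closure_iff.1 hyO G hG hyG
      have h4 : |(w u).im - (w (c 0)).im| < 23 * Real.pi := hGs ⟨huG, subset_closure huO.1, huO.2.1⟩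
      linarith [huO.2.2]
    · push Not at hy
      obtain ⟨u, hu, huO⟩ := mem_closure_iff_nhds.1 hyO _ (hloc y hyD' hy.1 hy.2)
      refine ⟨hyD', hyD, ?_⟩
      rw [← hu.2]
      exact huO.2.2
  exact (hsub (mem_levelComp (he.mem_disc (hr.trans hrR')) n)).2.1 (mem_levelComp (he.mem_disc hr) n)

variable [ChartedSpace ℂ S] [IsManifold 𝓘(ℂ) 1 S]

/-- A path outside the component over the small disk joins two boundary points which differ by a
number of turns that depends on the projection of the path to the base only: it is bounded by the
number of pieces of the path which miss one of two radial slits. -/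
theorem exists_turn_of_path (hS : IsDiskPlaneOrSphere S) (hf : IsTopBranched f)
    (hfM : MDifferentiable 𝓘(ℂ) 𝓘(ℂ) f) (he : IsDiscCoord e (x.1 0))
    (heM : MDifferentiableOn 𝓘(ℂ) 𝓘(ℂ) e e.source) {τ : ℝ}
    (hτ : (Complex.exp (τ * Complex.I)).im ≠ 0)
    (hs₀ : ∀ t : ℝ, 0 < t → t ≤ 1 → e.symm t ∉ critVals f n)
    (hs₁ : ∀ t : ℝ, 0 < t → t ≤ 1 → (rotate e τ).symm t ∉ critVals f n)
    (hc : ∀ t : ℝ, e.symm (r * Complex.exp (t * Complex.I)) ∉ critVals f n)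
    (hr : 0 < r) (hrR' : r < R') (hR'R : R' < R) (hR : R < 1)
    (hconn : IsPreconnected (levelComp f x (disc e R) n)ᶜ) {γ : ℝ → S} (hγ : Continuous γ)
    (hγm : ∀ t, γ t ∈ levelComp f x (disc e R') n ∧ γ t ∉ levelComp f x (disc e r) n)
    (hγ0 : γ 0 ∈ endpoints f x e r n) (hγ1 : γ 1 ∈ endpoints f x e r n) {N : ℕ} {s : ℕ → ℝ}
    (hsm : Monotone s) (hs0 : s 0 = 0) (hsN : s N = 1)
    (hsl : ∀ i < N, (∀ u ∈ Icc (s i) (s (i + 1)),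
        f^[n] (γ u) ∉ e.symm '' {v | segDist (r / 2) R v ≤ 0}) ∨
      (∀ u ∈ Icc (s i) (s (i + 1)),
        f^[n] (γ u) ∉ (rotate e τ).symm '' {v | segDist (r / 2) R v ≤ 0})) :
    ∃ c, IsCircleLift f x e r n c ∧ c 0 = γ 0 ∧ ∃ m : ℤ, |m| ≤ 24 * N ∧
      c (2 * Real.pi * m) = γ 1 := by
  have hpi := Real.pi_pos
  have hr1 : r ≤ 1 := by linarith
  have hR'1 : R' ≤ 1 := by linarith
  have hR0 : 0 < R := by linarith
  set D := levelComp f x (disc e r) n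
  set D' := levelComp f x (disc e R') n
  set DR := levelComp f x (disc e R) n
  have hDD' : closure D ⊆ D' := closure_levelComp_subset_levelComp hf.continuous
    ((he.closure_disc_subset hr1).trans (cdisc_subset_disc hrR'))
  have hD'R : closure D' ⊆ DR := closure_levelComp_subset_levelComp hf.continuous
    ((he.closure_disc_subset hR'1).trans (cdisc_subset_disc hR'R))
  have hKc : ∀ ρ ≤ 1, IsCompact (closure (levelComp f x (disc e ρ) n)) := fun ρ hρ => by
    refine ((hf.proper_iterate n).isCompact_preimage (he.isCompact_cdisc hρ)).of_isClosed_subset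
      isClosed_closure ?_
    exact (closure_levelComp_subset hf.continuous).trans (preimage_mono (he.closure_disc_subset hρ))
  -- a point of the complement which lies over neither of the two radii
  obtain ⟨q, hq⟩ := hf.surjective_iterate n (e.symm (-R : ℝ))
  have hRn : ‖((-R : ℝ) : ℂ)‖ = R := by
    rw [Complex.norm_real, norm_neg, Real.norm_of_nonneg hR0.le]
  have hRn' : ‖(R : ℂ)‖ = R := by rw [Complex.norm_real, Real.norm_of_nonneg hR0.le]
  have hnRt : ((-R : ℝ) : ℂ) ∈ e.target := he.mem_target (by rw [hRn]; exact hR.le)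
  have hqD : q ∉ DR := fun h => by
    have := iterate_mem_of_mem_levelComp h
    rw [hq, he.symm_mem_disc_iff (by rw [hRn]; exact hR.le) hR.le, hRn] at this
    exact lt_irrefl _ this
  have hq0 : f^[n] q ≠ e.symm R := by
    rw [hq]
    intro h
    have := e.symm.injOn hnRt (he.mem_target (by rw [hRn']; exact hR.le)) h
    have h2 : -R = R := by exact_mod_cast this
    linarith
  have hq1 : f^[n] q ≠ (rotate e τ).symm R := by
    rw [hq, rotate_symm_apply]
    intro h
    have := e.symm.injOn hnRt (he.mem_target (by
      rw [norm_mul, Complex.norm_exp_ofReal_mul_I, hRn', one_mul]; exact hR.le)) h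
    have h2 := congrArg Complex.im this
    rw [Complex.im_mul_ofReal, Complex.ofReal_im] at h2
    exact hτ ((mul_eq_zero.1 h2.symm).resolve_right hR0.ne')
  obtain ⟨ζ, hζ, hζs, ht, htne, hlog⟩ := exists_coordinate_hasLogOn hS (hKc R' hR'1) hconn
    (Set.disjoint_left.2 fun z hz hzB => hzB (hD'R hz)) ⟨_, hKc R hR.le, by
      rw [compl_compl]; exact subset_closure⟩ hqD
  -- the tubes of the two radii are so thin that they are disjoint
  set η := |(Complex.exp (τ * Complex.I)).im| * r / 12
  have hη : 0 < η := by
    have := abs_pos.2 hτ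
    positivity
  obtain ⟨η₀, κ₀, T₀, Θ₀, hη₀, hη₀', h₀⟩ := exists_isCrossingFunction hf hfM he heM hs₀ hr hrR' hR'R hR
    hη hζ ht htne hqD hq0 hζs hlog
  have e1 : ∀ ρ ≤ 1, levelComp f x (disc (rotate e τ) ρ) n = levelComp f x (disc e ρ) n :=
    fun ρ hρ => by rw [disc_rotate he hρ]
  obtain ⟨η₁, κ₁, T₁, Θ₁, hη₁, hη₁', h₁⟩ := exists_isCrossingFunction hf hfM (he.rotate τ)
    (mdifferentiableOn_rotate heM) hs₁ hr hrR' hR'R hR hη hζ ht htne (by rwa [e1 R hR.le]) hq1 hζs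
    (by rwa [e1 R hR.le, e1 R' hR'1])
  have hT : Disjoint T₀ T₁ := by
    rw [Set.disjoint_left]
    intro z hz0 hz1
    obtain ⟨v₀, hv₀, hv₀z⟩ := h₀.mem_tube z hz0
    obtain ⟨v₁, hv₁, hv₁z⟩ := h₁.mem_tube z hz1
    rw [← hv₀z, rotate_symm_apply] at hv₁z
    have h2 := e.symm.injOn (he.mem_target (by
      rw [norm_mul, Complex.norm_exp_ofReal_mul_I, one_mul]; exact hv₁.2.2.le))
      (he.mem_target hv₀.2.2.le) hv₁z
    have h3 := congrArg Complex.im h2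
    rw [Complex.mul_im] at h3
    set u := Complex.exp (τ * Complex.I)
    have hu : |u.re| ≤ 1 := (Complex.abs_re_le_norm u).trans (Complex.norm_exp_ofReal_mul_I τ).le
    have h4 : |u.im| * v₁.re ≤ |v₀.im| + |v₁.im| := by
      have h5 : u.im * v₁.re = v₀.im - u.re * v₁.im := by linarith
      have h6 : |u.im * v₁.re| ≤ |v₀.im| + |u.re * v₁.im| := by
        rw [h5]
        exact abs_sub _ _
      rw [abs_mul, abs_mul, abs_of_pos (lt_trans (by positivity) hv₁.1)] at h6
      nlinarith [abs_nonneg v₁.im]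
    have h7 := mul_lt_mul_of_pos_left hv₁.1 (abs_pos.2 hτ)
    have h8 := hv₀.2.1
    have h9 := hv₁.2.1
    have h10 : η = |u.im| * r / 12 := rfl
    nlinarith
  obtain ⟨Φ₀, hΦ₀, hΦ₀e⟩ := h₀.hasLogOn
  obtain ⟨Φ₁, hΦ₁, hΦ₁e⟩ := h₁.hasLogOn
  rw [e1 r hr1, e1 R' hR'1] at hΦ₁ hΦ₁e
  set Y := closure D' \ D
  have hζ0 : ∀ z ∈ Y, ζ z - ζ (x.1 n) ≠ 0 := by
    intro z hz
    have hx : x.1 n ∈ D := mem_levelComp (he.mem_disc hr) n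
    refine sub_ne_zero.2 fun h => ?_
    have hz' := ζ.injOn (hζs fun h => hqD (h ▸ hD'R hz.1))
      (hζs fun h => hqD (h ▸ hD'R (subset_closure (hDD' (subset_closure hx))))) h
    exact hz.2 (hz' ▸ hx)
  have hζc : ContinuousOn (fun z => ζ z - ζ (x.1 n)) Y :=
    (ζ.continuousOn.mono fun z hz => hζs fun h => hqD (h ▸ hD'R hz.1)).sub continuousOn_const
  have hγ0' : f^[n] (γ 0) = e.symm (r * Complex.exp ((0 : ℝ) * Complex.I)) := by simpa using hγ0.1
  obtain ⟨c, hcl, hc0⟩ := exists_isCircleLift hf he hr hr1 hc hγ0' hγ0.2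
  have hcY : ∀ t, c t ∈ Y := fun t =>
    ⟨subset_closure (hDD' (hcl.mem_closure t)), hcl.notMem he hr hr1 t⟩
  have hγY : ∀ t, γ t ∈ Y := fun t => ⟨subset_closure (hγm t).1, (hγm t).2⟩
  obtain ⟨ν, hν, hνe⟩ := exists_continuous_log (hζc.comp_continuous hcl.continuous hcY)
    fun t => hζ0 _ (hcY t)
  obtain ⟨μ, hμ, hμe⟩ := exists_continuous_log (hζc.comp_continuous hγ hγY)
    fun t => hζ0 _ (hγY t)
  have hνe' : ∀ t, ζ (c t) - ζ (x.1 n) = Complex.exp (ν t) := hνe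
  have hμe' : ∀ t, ζ (γ t) - ζ (x.1 n) = Complex.exp (μ t) := hμe
  obtain ⟨ℓ₁, hℓ₁, hℓ₁e, hℓ₁p, hℓ₁i⟩ := h₁.exists_boundary_log he hr hr1 (hrR'.trans hR'R)
  obtain ⟨ℓ₀, hℓ₀, hℓ₀e, hℓ₀p, hℓ₀i⟩ :=
    IsCrossingFunction.exists_boundary_log (τ := 0) (by rwa [rotate_zero]) he hr hr1 (hrR'.trans hR'R)
      (Θ := Θ₀) (ζ := ζ) (κ := κ₀) (T := T₀) (R' := R') (R := R) (η := η₀)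
  obtain ⟨hk, hper, hsurj, hνk⟩ := hcl.period hf hc hcY hζ0 hΦ₀ hΦ₀e hν hνe hℓ₀ (hℓ₀e c hcl) hℓ₀p
  set k := (endpoints f x e r n).ncard
  -- both crossing functions have the same index
  have hk₁ : (endpoints f x (rotate e τ) r n).ncard = k := by
    have h2 := hcl.mul_log_sub hcY hζ0 hΦ₁ hΦ₁e hν hνe hℓ₁ (hℓ₁e c hcl) 0 (2 * Real.pi * k)
    have h3 := hℓ₁p 0 k
    have h4 : c (2 * Real.pi * k) = c 0 := by simpa using hper 0
    simp only [zero_add] at h3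
    push_cast at h3
    rw [h4, hνk, sub_self, add_zero, h3, add_sub_cancel_left] at h2
    have h5 : ((endpoints f x (rotate e τ) r n).ncard : ℂ) * (2 * Real.pi * Complex.I) =
        k * (2 * Real.pi * Complex.I) := by
      rw [h2]
      ring
    exact_mod_cast mul_right_cancel₀ Complex.two_pi_I_ne_zero h5
  rw [hk₁] at hΦ₁e
  have hΦ₁e' : ∀ z ∈ Y, Θ₁ z / (ζ z - ζ (x.1 n)) ^ k = Complex.exp (Φ₁ z) := hΦ₁e
  have hΦ₀e' : ∀ z ∈ Y, Θ₀ z / (ζ z - ζ (x.1 n)) ^ k = Complex.exp (Φ₀ z) := hΦ₀e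
  let w : S → ℂ := fun z => Φ₁ z - Φ₀ z
  have hwe : ∀ z ∈ Y, Complex.exp (w z) = Θ₁ z / Θ₀ z := by
    intro z hz
    rw [Complex.exp_sub, ← hΦ₁e' z hz, ← hΦ₀e' z hz, div_div_div_cancel_right₀ (pow_ne_zero _ (hζ0 z hz))]
  have hwb : ∀ t, |(w (γ t)).im - (w (c 0)).im| ≤ 23 * Real.pi := fun t =>
    abs_im_sub_le_of_crossing h₀ h₁ hT hf he hr hrR' hR'R hR hc (hΦ₁.sub hΦ₀) hwe hcl hsurj
      (hγm t).1 (hγm t).2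
  -- logarithms of the two crossing functions along `γ`; each moves by at most `2π` while `γ` misses
  -- the lifts of its radius, and by `hwb` the two stay close to each other
  let L₀ : ℝ → ℂ := fun t => k * μ t + Φ₀ (γ t)
  let L₁ : ℝ → ℂ := fun t => k * μ t + Φ₁ (γ t)
  have hL₀ : Continuous L₀ := (continuous_const.mul hμ).add (hΦ₀.comp_continuous hγ hγY)
  have hL₁ : Continuous L₁ := (continuous_const.mul hμ).add (hΦ₁.comp_continuous hγ hγY)
  have hL₀e : ∀ t, Complex.exp (L₀ t) = Θ₀ (γ t) := fun t => by
    simp only [L₀]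
    rw [Complex.exp_add, Complex.exp_nat_mul, ← hμe', ← hΦ₀e' _ (hγY t),
      mul_div_cancel₀ _ (pow_ne_zero _ (hζ0 _ (hγY t)))]
  have hL₁e : ∀ t, Complex.exp (L₁ t) = Θ₁ (γ t) := fun t => by
    simp only [L₁]
    rw [Complex.exp_add, Complex.exp_nat_mul, ← hμe', ← hΦ₁e' _ (hγY t),
      mul_div_cancel₀ _ (pow_ne_zero _ (hζ0 _ (hγY t)))]
  have hLw : ∀ t, (L₁ t).im - (L₀ t).im = (w (γ t)).im := fun t => by
    simp only [L₀, L₁, w, Complex.add_im, Complex.sub_im]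
    ring
  have hstep : ∀ i < N, |(L₀ (s (i + 1))).im - (L₀ (s i)).im| ≤ 48 * Real.pi := by
    intro i hi
    have hle := hsm (Nat.le_succ i)
    rcases hsl i hi with h | h
    · have := abs_im_sub_le_of_mem_slitPlane (isPreconnected_Icc (a := s i) (b := s (i + 1)))
        hL₀.continuousOn (fun t ht => by rw [hL₀e]; exact h₀.mem_slitPlane _ (h t ht))
        (right_mem_Icc.2 hle) (left_mem_Icc.2 hle)
      linarith
    · have h2 := abs_im_sub_le_of_mem_slitPlane (isPreconnected_Icc (a := s i) (b := s (i + 1)))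
        hL₁.continuousOn (fun t ht => by rw [hL₁e]; exact h₁.mem_slitPlane _ (h t ht))
        (right_mem_Icc.2 hle) (left_mem_Icc.2 hle)
      have a1 := abs_le.1 h2
      have a2 := abs_le.1 (hwb (s i))
      have a3 := abs_le.1 (hwb (s (i + 1)))
      have a4 := hLw (s i)
      have a5 := hLw (s (i + 1))
      rw [abs_le]
      constructor <;> linarith
  have hsum : ∀ i ≤ N, |(L₀ (s i)).im - (L₀ 0).im| ≤ 48 * Real.pi * i := by
    intro i
    induction i with
    | zero => simp [hs0]
    | succ i ih =>
      intro hi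
      have a1 := abs_le.1 (ih (by omega))
      have a2 := abs_le.1 (hstep i (by omega))
      push_cast
      rw [abs_le]
      constructor <;> linarith
  have htot := hsum N le_rfl
  rw [hsN] at htot
  -- `γ 1` is reached after `j` turns; `j` differs by a multiple of the period `k` from the number
  -- `m` of turns which the argument along `γ` counts
  obtain ⟨j, hj⟩ := hsurj _ hγ1
  have hℓj : ℓ₀ (2 * Real.pi * j) = ℓ₀ 0 + 2 * Real.pi * j * Complex.I := by
    simpa using hℓ₀p 0 j
  have hexp : Complex.exp (L₀ 1) = Complex.exp (L₀ 0) := by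
    rw [hL₀e, hL₀e, ← hj, ← hc0, hℓ₀e c hcl, hℓ₀e c hcl, hℓj, Complex.exp_add,
      (show Complex.exp (2 * Real.pi * j * Complex.I) = 1 from
        Complex.exp_eq_one_iff.2 ⟨j, by ring⟩), mul_one]
  obtain ⟨m, hm⟩ := Complex.exp_eq_exp_iff_exists_int.1 hexp
  refine ⟨c, hcl, hc0, m, ?_, ?_⟩
  · have h2 := congrArg Complex.im hm
    have h3 : (L₀ 1).im - (L₀ 0).im = m * (2 * Real.pi) := by
      rw [h2]
      simp
    rw [h3, abs_mul, abs_of_pos Real.two_pi_pos] at htot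
    have h4 : |(m : ℝ)| ≤ 24 * N := by
      by_contra hcon
      push Not at hcon
      nlinarith
    exact_mod_cast h4
  · have h2 := hcl.mul_log_sub hcY hζ0 hΦ₀ hΦ₀e hν hνe hℓ₀ (hℓ₀e c hcl) 0 (2 * Real.pi * j)
    rw [hj, hc0, hℓj, add_sub_cancel_left] at h2
    have h3 : k * (μ 1 - μ 0) + (Φ₀ (γ 1) - Φ₀ (γ 0)) = m * (2 * Real.pi * Complex.I) := by
      have h4 : L₀ 1 - L₀ 0 = m * (2 * Real.pi * Complex.I) := by
        rw [hm]
        ring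
      rw [← h4]
      simp only [L₀]
      ring
    obtain ⟨b₁, hb₁⟩ := Complex.exp_eq_exp_iff_exists_int.1
      (show Complex.exp (μ 1) = Complex.exp (ν (2 * Real.pi * j)) by rw [← hμe', ← hνe', hj])
    obtain ⟨b₀, hb₀⟩ := Complex.exp_eq_exp_iff_exists_int.1
      (show Complex.exp (μ 0) = Complex.exp (ν 0) by rw [← hμe', ← hνe', hc0])
    have h5 : ((j + (b₁ - b₀) * k : ℤ) : ℂ) * (2 * Real.pi * Complex.I) =
        (m : ℤ) * (2 * Real.pi * Complex.I) := by
      rw [hb₁, hb₀] at h3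
      push_cast
      linear_combination h3 - h2
    have h6 : j + (b₁ - b₀) * k = m := by
      exact_mod_cast mul_right_cancel₀ Complex.two_pi_I_ne_zero h5
    rw [← hj, ← h6, ← (hper.int_mul (b₁ - b₀)) (2 * Real.pi * j)]
    congr 1
    push_cast
    ring

end Turn

/-! ### Reaching the boundary of a component from deep inside -/

section JoinedInReal

variable {X : Type*} [TopologicalSpace X] {A : Set X}

theorem JoinedIn.exists_continuous_real {a b : X} (h : JoinedIn A a b) :
    ∃ γ : ℝ → X, Continuous γ ∧ γ 0 = a ∧ γ 1 = b ∧ ∀ t, γ t ∈ A :=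
  ⟨h.somePath.extend, h.somePath.continuous_extend, by simp, by simp, fun _ => h.somePath_mem _⟩

theorem joinedIn_of_continuous_real {γ : ℝ → X} (hγ : Continuous γ) (h : ∀ t, γ t ∈ A) (s t : ℝ) :
    JoinedIn A (γ s) (γ t) :=
  ((isPathConnected_range hγ).joinedIn _ ⟨s, rfl⟩ _ ⟨t, rfl⟩).mono (range_subset_iff.2 h)

end JoinedInReal

section Reach

variable {S : Type*} [TopologicalSpace S] [T2Space S] [LocallyConnectedSpace S] {f : S → S}
  {e : OpenPartialHomeomorph S ℂ} {n : ℕ} {x : StandardInverseLimit f} {r : ℝ}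

theorem endpoints_notMem (he : IsDiscCoord e (x.1 0)) (hr : 0 < r) (hr1 : r ≤ 1) {a : S}
    (ha : a ∈ endpoints f x e r n) : a ∉ levelComp f x (disc e r) n := by
  intro h
  have h1 := iterate_mem_of_mem_levelComp h
  rw [ha.1, he.symm_mem_disc_iff (by simpa [abs_of_pos hr] using hr1) hr1] at h1
  simp [abs_of_pos hr] at h1

/-- The radial segment lifts along the slit, which carries no critical values. -/
theorem exists_radial_lift (hf : IsTopBranched f) (he : IsDiscCoord e (x.1 0))
    (hs : ∀ t : ℝ, 0 < t → t ≤ 1 → e.symm t ∉ critVals f n) {s u : ℝ} (hs0 : 0 < s) (hr : r ≤ 1)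
    (hsu : s ≤ u) (hur : u ≤ r) {z : S} (hz : f^[n] z = e.symm u)
    (hzD : z ∈ closure (levelComp f x (disc e r) n)) :
    ∃ g : ℝ → S, Continuous g ∧ g u = z ∧
      ∀ t : ℝ, f^[n] (g t) = e.symm ((max s (min t r) : ℝ) : ℂ) ∧
        g t ∈ closure (levelComp f x (disc e r) n) := by
  have h0 : ∀ t : ℝ, 0 < max s (min t r) := fun t => lt_max_of_lt_left hs0
  have h1 : ∀ t : ℝ, max s (min t r) ≤ r := fun t =>
    max_le (hsu.trans hur) (min_le_right _ _)
  have hn : ∀ t : ℝ, ‖((max s (min t r) : ℝ) : ℂ)‖ = max s (min t r) := fun t => by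
    rw [Complex.norm_real, Real.norm_of_nonneg (h0 t).le]
  have hb : Continuous fun t : ℝ => e.symm ((max s (min t r) : ℝ) : ℂ) :=
    he.continuous_symm_comp (g := fun t : ℝ => ((max s (min t r) : ℝ) : ℂ)) (by fun_prop)
      fun t => (hn t).trans_le ((h1 t).trans hr)
  obtain ⟨g, hg, hgu, hgf⟩ := exists_lift hf (n := n) hb (fun t => hs _ (h0 t) ((h1 t).trans hr))
    (a₀ := u) (z := z) (by rw [hz, min_eq_left hur, max_eq_right hsu])
  refine ⟨g, hg, hgu, fun t => ⟨hgf t, ?_⟩⟩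
  refine subset_closure_levelComp hf he (hs0.trans_le (hsu.trans hur)) hr (isPreconnected_range hg)
    ?_ ?_ ⟨u, hgu⟩ hzD (mem_range_self t)
  · rintro _ ⟨t, rfl⟩
    rw [hgf, he.symm_mem_cdisc_iff ((hn t).trans_le ((h1 t).trans hr)) hr, hn]
    exact h1 t
  · rintro _ ⟨t, rfl⟩
    rw [hgf]
    exact hs _ (h0 t) ((h1 t).trans hr)

/-- An endpoint can be joined, by a path avoiding the postcritical set, to each endpoint that is
sufficiently deep; the path stays off the component that the deep endpoint bounds. -/
theorem exists_joinedIn_endpoints [ChartedSpace ℂ S] (hf : IsTopBranched f)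
    (he : IsDiscCoord e (x.1 0)) (hs : ∀ t : ℝ, 0 < t → t ≤ 1 → e.symm t ∉ postcritical f)
    (hr : 0 < r) (hr1 : r ≤ 1) {a : S} (ha : a ∈ endpoints f x e r n) :
    ∃ ρ > 0, ∀ r', 0 < r' → r' < ρ → ∀ a' ∈ endpoints f x e r' n,
      JoinedIn {z | f^[n] z ∉ postcritical f ∧ z ∈ closure (levelComp f x (disc e r) n) ∧
        z ∉ levelComp f x (disc e r') n} a' a := by
  have hsn : ∀ t : ℝ, 0 < t → t ≤ 1 → e.symm t ∉ critVals f n := fun t h0 h1 =>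
    notMem_critVals (hs t h0 h1) n
  have hnorm : ∀ t : ℝ, 0 < t → ‖(t : ℂ)‖ = t := fun t ht => by
    rw [Complex.norm_real, Real.norm_of_nonneg ht.le]
  set s := r / 2 with hsr
  have hs0 : 0 < s := half_pos hr
  have hsr' : s < r := half_lt_self hr
  have hs1 : s ≤ 1 := hsr'.le.trans hr1
  set D := levelComp f x (disc e r) n
  have hDo : IsOpen D := isOpen_levelComp hf.continuous (he.isOpen_disc hr1) n
  have hsD : closure (levelComp f x (disc e s) n) ⊆ D := closure_levelComp_subset_levelComp
    hf.continuous ((he.closure_disc_subset hs1).trans (cdisc_subset_disc hsr'))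
  have hsource : ∀ t : ℝ, 0 < t → t ≤ 1 → e.symm t ≠ x.1 0 := by
    intro t h0 h1 h
    rw [← he.symm_zero] at h
    have := e.symm.injOn (he.mem_target ((hnorm t h0).trans_le h1)) (he.mem_target (by simp)) h
    exact h0.ne' (by exact_mod_cast this)
  -- the inner point `b` of the radial lift that ends at `a`
  obtain ⟨g, hg, hga, hgf⟩ := exists_radial_lift hf he hsn hs0 hr1 hsr'.le le_rfl ha.1 ha.2
  have hgx : ∀ t, g t ≠ x.1 n := fun t h => by
    have h1 := (hgf t).1
    rw [h, StandardInverseLimit.iterate_apply_zero] at h1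
    exact hsource _ (lt_max_of_lt_left hs0) ((max_le hsr'.le (min_le_right _ _)).trans hr1) h1.symm
  have hgs : f^[n] (g s) = e.symm s := by
    rw [(hgf s).1, min_eq_left hsr'.le, max_self]
  have hgD : g s ∈ D := mem_levelComp_of_closure (hgf s).2 (by
    rw [hgs, he.symm_mem_disc_iff ((hnorm s hs0).trans_le hs1) hr1, hnorm s hs0]
    exact hsr')
  -- the middle endpoints, all joined to `a` off the base point
  have hmid : ∀ c ∈ endpoints f x e s n,
      JoinedIn {z | f^[n] z ∉ postcritical f ∧ z ∈ closure D ∧ z ≠ x.1 n} c a := by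
    intro c hc
    have hQ : (f^[n] ⁻¹' postcritical f ∪ {x.1 n}).Countable :=
      (hf.countable_preimage_iterate n hf.countable_postcritical).union (countable_singleton _)
    have h1 : JoinedIn (D \ (f^[n] ⁻¹' postcritical f ∪ {x.1 n})) c (g s) := by
      refine joinedIn_diff_countable hDo isPreconnected_levelComp hQ (hsD hc.2) ?_ hgD ?_
      · rintro (h | h)
        · rw [mem_preimage, hc.1] at h
          exact hs s hs0 hs1 h
        · rw [mem_singleton_iff] at h
          subst h
          have := hc.1
          rw [StandardInverseLimit.iterate_apply_zero] at this
          exact hsource s hs0 hs1 this.symm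
      · rintro (h | h)
        · rw [mem_preimage, hgs] at h
          exact hs s hs0 hs1 h
        · exact hgx s h
    have h2 : JoinedIn {z | f^[n] z ∉ postcritical f ∧ z ∈ closure D ∧ z ≠ x.1 n} (g s) (g r) := by
      refine joinedIn_of_continuous_real hg (fun t => ?_) s r
      refine ⟨?_, (hgf t).2, hgx t⟩
      rw [(hgf t).1]
      exact hs _ (lt_max_of_lt_left hs0) ((max_le hsr'.le (min_le_right _ _)).trans hr1)
    rw [hga] at h2
    refine JoinedIn.trans (h1.mono ?_) h2
    rintro z ⟨hz, hzQ⟩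
    exact ⟨fun h => hzQ (Or.inl h), subset_closure hz, fun h => hzQ (Or.inr h)⟩
  choose! γ hγ hγ0 hγ1 hγm using fun c hc => (hmid c hc).exists_continuous_real
  -- finitely many compact paths miss a whole component around the base point
  set K : Set S := ⋃ c ∈ endpoints f x e s n, γ c '' Icc 0 1
  have hK : IsCompact K := (finite_endpoints hf s).isCompact_biUnion fun c hc =>
    isCompact_Icc.image (hγ c hc)
  have hxK : x.1 n ∈ Kᶜ := by
    intro h
    obtain ⟨c, hc, t, -, ht⟩ := mem_iUnion₂.1 h
    exact (hγm c hc t).2.2 ht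
  obtain ⟨V, hVo, hxV, hV⟩ := exists_levelComp_subset hf n hK.isClosed.isOpen_compl hxK
  obtain ⟨ρ, hρ0, hρ1, hρV⟩ := he.exists_disc_subset hVo hxV
  refine ⟨min ρ s, lt_min hρ0 hs0, fun r' h0 h1 a' ha' => ?_⟩
  have hr's : r' ≤ s := h1.le.trans (min_le_right _ _)
  have hr'1 : r' ≤ 1 := hr's.trans hs1
  obtain ⟨g', hg', hga', hgf'⟩ := exists_radial_lift (r := s) hf he hsn h0 hs1 le_rfl hr's ha'.1
    (closure_mono (levelComp_mono (disc_mono hr's) n) ha'.2)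
  have hc : g' s ∈ endpoints f x e s n := by
    refine ⟨?_, (hgf' s).2⟩
    rw [(hgf' s).1, min_self, max_eq_right hr's]
  have hle : ∀ t : ℝ, max r' (min t s) ≤ 1 := fun t =>
    (max_le hr's (min_le_right _ _)).trans hs1
  have h2 : JoinedIn {z | f^[n] z ∉ postcritical f ∧ z ∈ closure D ∧
      z ∉ levelComp f x (disc e r') n} (g' r') (g' s) := by
    refine joinedIn_of_continuous_real hg' (fun t => ?_) _ _
    refine ⟨?_, subset_closure (hsD (hgf' t).2), ?_⟩
    · rw [(hgf' t).1]
      exact hs _ (lt_max_of_lt_left h0) (hle t)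
    · intro h
      have h3 := iterate_mem_of_mem_levelComp h
      rw [(hgf' t).1, he.symm_mem_disc_iff ((hnorm _ (lt_max_of_lt_left h0)).trans_le (hle t)) hr'1,
        hnorm _ (lt_max_of_lt_left h0)] at h3
      exact (le_max_left _ _).not_gt h3
  rw [hga'] at h2
  refine h2.trans ?_
  rw [← hγ0 _ hc, ← hγ1 _ hc]
  have h4 : IsPathConnected (γ (g' s) '' Icc 0 1) :=
    ((convex_Icc (0 : ℝ) 1).isPathConnected ⟨0, by simp⟩).image (hγ _ hc)
  refine (h4.joinedIn _ ⟨0, by simp, rfl⟩ _ ⟨1, by simp, rfl⟩).mono ?_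
  rintro _ ⟨t, ht, rfl⟩
  refine ⟨(hγm _ hc t).1, (hγm _ hc t).2.1, fun h => ?_⟩
  exact hV (disc e r') ((disc_mono (h1.le.trans (min_le_left _ _))).trans hρV) h
    (mem_iUnion₂.2 ⟨_, hc, t, ht, rfl⟩)

/-- All but countably many circles miss a given countable set. -/
theorem exists_circle_notMem {x₀ : S} (he : IsDiscCoord e x₀) {Q : Set S} (hQ : Q.Countable) {δ : ℝ}
    (hδ : 0 < δ) (hδ1 : δ ≤ 1) :
    ∃ r, 0 < r ∧ r < δ ∧ ∀ t : ℝ, e.symm (r * Complex.exp (t * Complex.I)) ∉ Q := by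
  have h1 : ((fun z => ‖e z‖) '' Q).Countable := hQ.image _
  obtain ⟨r, hr, hrQ⟩ := not_subset.1 fun hsub : Ioo 0 δ ⊆ _ =>
    hδ.not_ge (Cardinal.Real.Ioo_countable_iff.1 (h1.mono hsub))
  refine ⟨r, hr.1, hr.2, fun t ht => hrQ ⟨_, ht, ?_⟩⟩
  have h2 := norm_circle hr.1 t
  change ‖e (e.symm _)‖ = r
  rw [e.right_inv (he.mem_target (h2.trans_le (hr.2.le.trans hδ1))), h2]

end Reach

section Pairs

variable {S : Type*} [TopologicalSpace S] [T2Space S] [LocallyConnectedSpace S] {f : S → S}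
  {e : OpenPartialHomeomorph S ℂ} {n : ℕ} {x : StandardInverseLimit f} {r : ℝ}

/-- A critical point in a component gives two endpoints with the same image. -/
theorem exists_endpoints_iterate_eq [ChartedSpace ℂ S] (hf : IsTopBranched f)
    (he : IsDiscCoord e (x.1 0)) (hs : ∀ t : ℝ, 0 < t → t ≤ 1 → e.symm t ∉ postcritical f)
    (hr : 0 < r) (hr1 : r ≤ 1) {m : ℕ} (hm : m < n) {c : S} (hc : c ∈ branchSet f)
    (hcD : c ∈ levelComp f x (disc e r) n) :
    ∃ a : Bool → S, (∀ b, a b ∈ endpoints f x e r n) ∧ a false ≠ a true ∧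
      f^[n - m] (a false) = f^[n - m] (a true) := by
  set Q := postcritical f
  have hQ : Q.Countable := hf.countable_postcritical
  set D := levelComp f x (disc e r) n
  have hDo : IsOpen D := isOpen_levelComp hf.continuous (he.isOpen_disc hr1) n
  -- two generic points of `D` with the same image under `f`
  obtain ⟨z, z', hz, hz', hne, hzz, hzQ⟩ : ∃ z z', z ∈ D ∧ z' ∈ D ∧ z ≠ z' ∧ f z = f z' ∧
      f^[n] z ∉ Q := by
    have h1 : ¬ InjOn f D := hc D (hDo.mem_nhds hcD)
    rw [InjOn] at h1
    push Not at h1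
    obtain ⟨u, hu, u', hu', huu, hne⟩ := h1
    obtain ⟨A, B, hA, hB, huA, huB, hAB⟩ := t2_separation hne
    have hG : IsOpen (f '' (A ∩ D) ∩ f '' (B ∩ D)) :=
      (hf.isOpenMap _ (hA.inter hDo)).inter (hf.isOpenMap _ (hB.inter hDo))
    obtain ⟨w, ⟨⟨z, hz, hzw⟩, z', hz', hzw'⟩, hwQ⟩ :=
      exists_mem_diff_countable (hf.countable_preimage_iterate (n - 1) hQ) hG
        ⟨f u, ⟨u, ⟨huA, hu⟩, rfl⟩, u', ⟨huB, hu'⟩, huu.symm⟩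
    refine ⟨z, z', hz.2, hz'.2, fun h => disjoint_left.1 hAB hz.1 (h ▸ hz'.1),
      hzw.trans hzw'.symm, ?_⟩
    rwa [mem_preimage, ← hzw, ← Function.iterate_succ_apply, Nat.succ_eq_add_one,
      Nat.sub_add_cancel (by omega)] at hwQ
  have hitz : ∀ k, 0 < k → f^[k] z = f^[k] z' := by
    rintro (_ | k) hk
    · exact absurd hk (lt_irrefl _)
    · rw [Function.iterate_succ_apply, Function.iterate_succ_apply, hzz]
  -- a generic path in the base from the common image to the endpoint of the slit
  have hnorm : ∀ t : ℝ, 0 < t → ‖(t : ℂ)‖ = t := fun t ht => by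
    rw [Complex.norm_real, Real.norm_of_nonneg ht.le]
  have hr2 : 0 < r / 2 := half_pos hr
  have hr2' : r / 2 ≤ 1 := (half_le_self hr.le).trans hr1
  have hbase : JoinedIn (cdisc e r \ Q) (f^[n] z) (e.symm r) := by
    have h1 : JoinedIn (disc e r \ Q) (f^[n] z) (e.symm ((r / 2 : ℝ) : ℂ)) := by
      refine joinedIn_diff_countable (he.isOpen_disc hr1) (he.isPreconnected_disc hr1) hQ
        (iterate_mem_of_mem_levelComp hz) hzQ ?_ (hs _ hr2 hr2')
      rw [he.symm_mem_disc_iff ((hnorm _ hr2).trans_le hr2') hr1, hnorm _ hr2]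
      exact half_lt_self hr
    have hle : ∀ t : ℝ, max (r / 2) (min t r) ≤ r := fun t =>
      max_le (half_le_self hr.le) (min_le_right _ _)
    have hpos : ∀ t : ℝ, 0 < max (r / 2) (min t r) := fun t => lt_max_of_lt_left hr2
    have h2 := joinedIn_of_continuous_real (A := cdisc e r \ Q)
      (he.continuous_symm_comp (g := fun t : ℝ => ((max (r / 2) (min t r) : ℝ) : ℂ)) (by fun_prop)
      fun t => (hnorm _ (hpos t)).trans_le ((hle t).trans hr1)) (fun t => by
        refine ⟨?_, hs _ (hpos t) ((hle t).trans hr1)⟩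
        rw [he.symm_mem_cdisc_iff ((hnorm _ (hpos t)).trans_le ((hle t).trans hr1)) hr1,
          hnorm _ (hpos t)]
        exact hle t) (r / 2) r
    rw [min_eq_left (half_le_self hr.le), max_self, min_self,
      max_eq_right (half_le_self hr.le)] at h2
    exact (h1.mono (sdiff_subset_sdiff_left (disc_subset_cdisc r))).trans h2
  obtain ⟨p, hp, hp0, hp1, hpm⟩ := hbase.exists_continuous_real
  have hlift : ∀ y ∈ D, f^[n] y = f^[n] z → ∃ g : ℝ → S, Continuous g ∧ g 0 = y ∧
      (∀ t, f^[n] (g t) = p t) ∧ g 1 ∈ endpoints f x e r n := by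
    intro y hy hyz
    obtain ⟨g, hg, hg0, hgf⟩ := exists_lift hf (n := n) hp
      (fun t => notMem_critVals (hpm t).2 n) (a₀ := 0) (z := y) (by rw [hyz, hp0])
    refine ⟨g, hg, hg0, hgf, by rw [hgf, hp1], ?_⟩
    refine subset_closure_levelComp hf he hr hr1 (isPreconnected_range hg) ?_ ?_ ⟨0, hg0⟩
      (subset_closure hy) (mem_range_self 1)
    · rintro _ ⟨t, rfl⟩
      rw [hgf]
      exact (hpm t).1
    · rintro _ ⟨t, rfl⟩
      rw [hgf]
      exact notMem_critVals (hpm t).2 n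
  obtain ⟨g, hg, hg0, hgf, hg1⟩ := hlift z hz rfl
  obtain ⟨g', hg', hg0', hgf', hg1'⟩ := hlift z' hz' (hitz n (by omega)).symm
  refine ⟨fun b => cond b (g' 1) (g 1), fun b => by cases b <;> assumption, fun h => ?_, ?_⟩
  · have h1 := lift_unique hf hg hg' (fun t => by rw [hgf, hgf'])
      (fun t => by rw [hgf]; exact notMem_critVals (hpm t).2 n) (a₀ := 1) h
    exact hne (by rw [← hg0, ← hg0', h1])
  · have hit : ∀ y, f^[m] (f^[n - m] y) = f^[n] y := fun y => by
      rw [← Function.iterate_add_apply, Nat.add_sub_cancel' hm.le]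
    have h1 := lift_unique hf (n := m) (G₁ := fun t => f^[n - m] (g t))
      (G₂ := fun t => f^[n - m] (g' t)) ((hf.continuous_iterate _).comp hg)
      ((hf.continuous_iterate _).comp hg') (fun t => by rw [hit, hit, hgf, hgf'])
      (fun t => by rw [hit, hgf]; exact notMem_critVals (hpm t).2 m) (a₀ := 0)
      (by simp only [hg0, hg0']; exact hitz _ (by omega))
    exact congrFun h1 1

/-- If the complement of a component is disconnected, then it separates two endpoints. -/
theorem exists_endpoints_not_joinedIn [PreconnectedSpace S] (hf : IsTopBranched f)
    (he : IsDiscCoord e (x.1 0))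
    (hr : 0 < r) (hr1 : r ≤ 1)
    (hc : ∀ t : ℝ, e.symm (r * Complex.exp (t * Complex.I)) ∉ critVals f n)
    (hB : ¬ IsPreconnected (levelComp f x (disc e r) n)ᶜ) :
    ∃ a : Bool → S, (∀ b, a b ∈ endpoints f x e r n) ∧
      ¬ JoinedIn (levelComp f x (disc e r) n)ᶜ (a false) (a true) := by
  set D := levelComp f x (disc e r) n
  have hDo : IsOpen D := isOpen_levelComp hf.continuous (he.isOpen_disc hr1) n
  have hxD : x.1 n ∈ D := mem_levelComp (he.mem_disc hr) n
  rw [isPreconnected_closed_iff] at hB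
  push Not at hB
  obtain ⟨C, C', hC, hC', hcov, hCn, hCn', hdis⟩ := hB
  -- each part of the complement contains an endpoint
  have key : ∀ C C' : Set S, IsClosed C → IsClosed C' → Dᶜ ⊆ C ∪ C' → (Dᶜ ∩ C).Nonempty →
      Dᶜ ∩ (C ∩ C') = ∅ → ∃ a ∈ endpoints f x e r n, a ∈ C ∧ a ∉ D := by
    intro C C' hC hC' hcov hCn hdis
    have hcl : IsClosed (Dᶜ ∩ C) := hDo.isClosed_compl.inter hC
    have hmeet : ((Dᶜ ∩ C) ∩ closure D).Nonempty := by
      by_contra hcon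
      rw [not_nonempty_iff_eq_empty] at hcon
      have heq : Dᶜ ∩ C = ((Dᶜ ∩ C') ∪ closure D)ᶜ := by
        ext z
        constructor
        · rintro hz (h | h)
          · exact (eq_empty_iff_forall_notMem.1 hdis z) ⟨hz.1, hz.2, h.2⟩
          · exact (eq_empty_iff_forall_notMem.1 hcon z) ⟨hz, h⟩
        · intro hz
          have h1 : z ∉ D := fun h => hz (Or.inr (subset_closure h))
          exact ⟨h1, (hcov h1).resolve_right fun h => hz (Or.inl ⟨h1, h⟩)⟩
      have hop : IsOpen (Dᶜ ∩ C) := by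
        rw [heq]
        exact ((hDo.isClosed_compl.inter hC').union isClosed_closure).isOpen_compl
      have huniv := IsClopen.eq_univ ⟨hcl, hop⟩ hCn
      exact (huniv ▸ mem_univ (x.1 n) : x.1 n ∈ Dᶜ ∩ C).1 hxD
    obtain ⟨z, ⟨hzD, hzC⟩, hzcl⟩ := hmeet
    have h1 : f^[n] z ∈ cdisc e r := he.closure_disc_subset hr1 (closure_levelComp_subset hf.continuous hzcl)
    have h2 : f^[n] z ∉ disc e r := fun h => hzD (mem_levelComp_of_closure hzcl h)
    obtain ⟨v, hv, hvz⟩ := h1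
    rw [mem_closedBall_zero_iff] at hv
    rw [← hvz, he.symm_mem_disc_iff (hv.trans hr1) hr1, not_lt] at h2
    have hvr : ‖v‖ = r := le_antisymm hv h2
    have hvp : v = r * Complex.exp (v.arg * Complex.I) := by
      rw [← hvr, Complex.norm_mul_exp_arg_mul_I]
    obtain ⟨c, hcl', hcz⟩ := exists_isCircleLift hf he hr hr1 hc (a := z) (t₀ := v.arg)
      (by rw [← hvp, hvz]) hzcl
    have hcD : ∀ t, c t ∈ Dᶜ := fun t => hcl'.notMem he hr hr1 t
    have hrange : range c ⊆ C := by
      have hp := isPreconnected_range hcl'.continuous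
      rw [isPreconnected_closed_iff] at hp
      rintro w hw
      by_contra hwC
      have hsub : range c ⊆ Dᶜ := range_subset_iff.2 hcD
      obtain ⟨y, hy, hyC⟩ := hp C C' hC hC' (hsub.trans hcov)
        ⟨z, ⟨_, hcz⟩, hzC⟩ ⟨w, hw, (hcov (hsub hw)).resolve_left hwC⟩
      exact (eq_empty_iff_forall_notMem.1 hdis y) ⟨hsub hy, hyC⟩
    refine ⟨c 0, ?_, hrange ⟨0, rfl⟩, hcD 0⟩
    simpa using hcl'.apply_two_pi_mem_endpoints 0
  obtain ⟨a, ha, haC, haD⟩ := key C C' hC hC' hcov hCn hdis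
  obtain ⟨a', ha', haC', haD'⟩ := key C' C hC' hC (by rwa [union_comm]) hCn' (by rwa [inter_comm C'])
  refine ⟨fun b => cond b a' a, fun b => by cases b <;> assumption, fun hj => ?_⟩
  obtain ⟨γ, hγ, hγ0, hγ1, hγm⟩ := hj.exists_continuous_real
  have hp := isPreconnected_range hγ
  rw [isPreconnected_closed_iff] at hp
  obtain ⟨y, ⟨t, rfl⟩, hyC⟩ := hp C C' hC hC' ((range_subset_iff.2 hγm).trans hcov)
    ⟨a, ⟨0, hγ0⟩, haC⟩ ⟨a', ⟨1, hγ1⟩, haC'⟩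
  exact (eq_empty_iff_forall_notMem.1 hdis _) ⟨hγm t, hyC⟩

end Pairs

/-! ### Transport along paths in the inverse limit -/

section Transport

variable {S : Type*} [TopologicalSpace S] {f : S → S}

/-- A compatible sequence of points can be corrected to a sequence that is coherent for given
self-maps of the inverse limit, if these maps are defined level by level. -/
theorem exists_coherent {T : ℕ → StandardInverseLimit f → StandardInverseLimit f}
    (hT : ∀ j m y z, y.1 m = z.1 m → (T j y).1 m = (T j z).1 m) {n : ℕ → ℕ} (hn : StrictMono n)
    {y : ℕ → StandardInverseLimit f} (hy : ∀ j, (T j (y (j + 1))).1 (n j) = (y j).1 (n j)) :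
    ∃ E : ℕ → StandardInverseLimit f, (∀ j, T j (E (j + 1)) = E j) ∧
      ∀ j, (E j).1 (n j) = (y j).1 (n j) := by
  have hdown : ∀ {y z : StandardInverseLimit f} {m k : ℕ}, m ≤ k → y.1 k = z.1 k → y.1 m = z.1 m := by
    intro y z m k hmk h
    rw [← StandardInverseLimit.iterate_sub_apply y hmk, h, StandardInverseLimit.iterate_sub_apply z hmk]
  -- `C i j` is `y (j + i)` transported back by `i` steps; on each level it does not depend on `i`,
  -- once `i` is large
  let C : ℕ → ℕ → StandardInverseLimit f := fun i =>
    Nat.rec (motive := fun _ => ℕ → StandardInverseLimit f) y (fun _ F j => T j (F (j + 1))) i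
  have hC : ∀ i j, C (i + 1) j = T j (C i (j + 1)) := fun _ _ => rfl
  have hstep : ∀ i j m, m ≤ n (j + i) → (C (i + 1) j).1 m = (C i j).1 m := by
    intro i
    induction i with
    | zero => exact fun j m hm => hdown hm (hy j)
    | succ i ih =>
      intro j m hm
      rw [hC (i + 1) j, hC i j]
      exact hT _ _ _ _ (ih (j + 1) m (by rwa [show j + 1 + i = j + (i + 1) by omega]))
  have hstab : ∀ i k j m, m ≤ n (j + i) → (C (i + k) j).1 m = (C i j).1 m := by
    intro i k j m hm
    induction k with
    | zero => rfl
    | succ k ih =>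
      rw [← add_assoc, hstep (i + k) j m (hm.trans (hn.monotone (by omega))), ih]
  have hle : ∀ j m, m ≤ n (j + m) := fun j m =>
    (hn.id_le m).trans (hn.monotone (Nat.le_add_left m j))
  have hCE : ∀ j m i, m ≤ i → (C i j).1 m = (C m j).1 m := by
    intro j m i h
    obtain ⟨k, rfl⟩ := Nat.exists_eq_add_of_le h
    exact hstab m k j m (hle j m)
  let E : ℕ → StandardInverseLimit f := fun j => ⟨fun m => (C m j).1 m, fun m => by
    rw [(C (m + 1) j).2 m, hCE j m (m + 1) (Nat.le_succ m)]⟩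
  refine ⟨E, fun j => ?_, fun j => ?_⟩
  · refine Subtype.ext (funext fun m => ?_)
    exact (hT j m (E (j + 1)) (C m (j + 1)) rfl).trans (hCE j m (m + 1) (Nat.le_succ m))
  · change (C (n j) j).1 (n j) = (C 0 j).1 (n j)
    rw [← hstab 0 (n j) j (n j) le_rfl, zero_add]

variable [T2Space S]

/-- Lifting a base path that avoids the postcritical set, from all points over its origin. For the
other points the value is the constant path, which is of no importance. -/
theorem exists_transport (hf : IsTopBranched f) {p : ℝ → S} (hp : Continuous p)
    (hpQ : ∀ t, p t ∉ postcritical f) :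
    ∃ G : StandardInverseLimit f → ℝ → StandardInverseLimit f,
      (∀ y, y.1 0 = p 0 → Continuous (G y) ∧ G y 0 = y ∧ ∀ t, (G y t).1 0 = p t) ∧
      ∀ y, y.1 0 ≠ p 0 → ∀ t, G y t = y := by
  have h : ∀ y : StandardInverseLimit f, ∃ g : ℝ → StandardInverseLimit f,
      (y.1 0 = p 0 → Continuous g ∧ g 0 = y ∧ ∀ t, (g t).1 0 = p t) ∧
      (y.1 0 ≠ p 0 → ∀ t, g t = y) := by
    intro y
    by_cases hy : y.1 0 = p 0
    · obtain ⟨g, hg⟩ := exists_limit_lift hf hp hpQ (a₀ := 0) hy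
      exact ⟨g, fun _ => hg, fun h => absurd hy h⟩
    · exact ⟨fun _ => y, fun h => absurd h hy, fun _ _ => rfl⟩
  choose G hG hG' using h
  exact ⟨G, hG, hG'⟩

/-- Two lifts to the inverse limit of the same path which agree at some time on some level agree
at all times on that level. -/
theorem limit_lift_unique (hf : IsTopBranched f) {p : ℝ → S} (hpQ : ∀ t, p t ∉ postcritical f)
    {g g' : ℝ → StandardInverseLimit f} (hg : Continuous g) (hg' : Continuous g')
    (hgp : ∀ t, (g t).1 0 = p t) (hgp' : ∀ t, (g' t).1 0 = p t) {m : ℕ} {t₀ : ℝ}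
    (h : (g t₀).1 m = (g' t₀).1 m) (t : ℝ) : (g t).1 m = (g' t).1 m := by
  have hit : ∀ {g : ℝ → StandardInverseLimit f}, (∀ t, (g t).1 0 = p t) →
      ∀ t, f^[m] ((g t).1 m) = p t := fun h t => by
    rw [StandardInverseLimit.iterate_apply_zero, h]
  exact congrFun (lift_unique hf (n := m) (G₁ := fun t => (g t).1 m) (G₂ := fun t => (g' t).1 m)
    ((StandardInverseLimit.continuous_coord m).comp hg)
    ((StandardInverseLimit.continuous_coord m).comp hg') (fun t => by rw [hit hgp, hit hgp'])
    (fun t => by rw [hit hgp]; exact notMem_critVals (hpQ t) m) h) t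

end Transport

section Concatenation

variable {X : Type*} [TopologicalSpace X]

/-- Paths indexed by the integers, each starting where the preceding one ends, form one path on the
line. -/
theorem continuous_concatenation {γ : ℤ → ℝ → X} (hγ : ∀ k, Continuous (γ k))
    (h : ∀ k, γ k 1 = γ (k + 1) 0) : Continuous fun t : ℝ => γ ⌊t⌋ (Int.fract t) := by
  have hu : ∀ (k : ℤ), ∀ t ∈ Icc (k : ℝ) (k + 1), γ ⌊t⌋ (Int.fract t) = γ k (t - k) := by
    intro k t ht
    rcases ht.2.lt_or_eq with h1 | h1
    · have h2 : ⌊t⌋ = k := Int.floor_eq_iff.2 ⟨ht.1, h1⟩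
      rw [Int.fract, h2]
    · have h2 : ⌊t⌋ = k + 1 := by
        rw [h1]
        exact_mod_cast Int.floor_intCast (k + 1)
      rw [Int.fract, h2, h1]
      push_cast
      rw [sub_self, add_sub_cancel_left, h]
  refine (locallyFinite_Icc_of_tendsto (f := fun k : ℤ => (k : ℝ)) (g := fun k : ℤ => (k : ℝ) + 1)
    tendsto_intCast_atTop_atTop
    (tendsto_atBot_add_const_right _ _ (tendsto_intCast_atBot_iff.2 tendsto_id))).continuous
    ?_ (fun k => isClosed_Icc) fun k => ?_
  · exact eq_univ_of_forall fun t =>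
      mem_iUnion.2 ⟨⌊t⌋, Int.floor_le t, (Int.lt_floor_add_one t).le⟩
  · exact ((hγ k).comp (continuous_id.sub continuous_const)).continuousOn.congr (hu k)

/-- Infinitely many paths, each starting where the preceding one ends, and shrinking to a point,
join that point to the origin of the first one. -/
theorem joinedIn_of_infinite_concatenation {A : Set X} {x : X} (hx : x ∈ A) {γ : ℕ → ℝ → X}
    (hγ : ∀ j, Continuous (γ j)) (h : ∀ j, γ j 1 = γ (j + 1) 0) (hA : ∀ j t, γ j t ∈ A)
    (hlim : ∀ O, IsOpen O → x ∈ O → ∃ J, ∀ j ≥ J, ∀ t, γ j t ∈ O) : JoinedIn A x (γ 0 0) := by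
  -- the concatenation is parametrized by the whole line, constant at negative times
  let δ : ℤ → ℝ → X := fun k => if k < 0 then fun _ => γ 0 0 else γ k.toNat
  have hδ0 : ∀ k < 0, δ k = fun _ => γ 0 0 := fun k hk => if_pos hk
  have hδ1 : ∀ k : ℕ, δ k = γ k := fun k => by simp [δ]
  have hu : Continuous fun t : ℝ => δ ⌊t⌋ (Int.fract t) := by
    refine continuous_concatenation (fun k => ?_) fun k => ?_
    · rcases lt_or_ge k 0 with hk | hk
      · rw [hδ0 k hk]
        exact continuous_const
      · lift k to ℕ using hk
        rw [hδ1]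
        exact hγ k
    · rcases lt_or_ge k 0 with hk | hk
      · rw [hδ0 k hk]
        rcases (show k + 1 ≤ 0 by omega).lt_or_eq with hk' | hk'
        · rw [hδ0 _ hk']
        · rw [hk', show (0 : ℤ) = ((0 : ℕ) : ℤ) from rfl, hδ1]
      · lift k to ℕ using hk
        rw [hδ1, show (k : ℤ) + 1 = ((k + 1 : ℕ) : ℤ) by push_cast; rfl, hδ1, h]
  set u : ℝ → X := fun t => δ ⌊t⌋ (Int.fract t)
  -- a property of all the pieces from `J` on holds for the concatenation after time `J`
  have hup : ∀ (J : ℕ) (O : Set X), (∀ j ≥ J, ∀ t, γ j t ∈ O) → ∀ t : ℝ, J ≤ t → u t ∈ O := by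
    intro J O hO t ht
    have h1 : (J : ℤ) ≤ ⌊t⌋ := Int.le_floor.2 (by exact_mod_cast ht)
    obtain ⟨k, hk⟩ := Int.eq_ofNat_of_zero_le ((Int.natCast_nonneg J).trans h1)
    simp only [u]
    rw [hk, hδ1]
    exact hO k (by omega) _
  have huA : ∀ t, u t ∈ A := by
    intro t
    rcases lt_or_ge t 0 with ht | ht
    · have h1 : ⌊t⌋ < 0 := Int.floor_lt.2 (by exact_mod_cast ht)
      simp only [u]
      rw [hδ0 _ h1]
      exact hA 0 0
    · exact hup 0 A (fun j _ t => hA j t) t (by exact_mod_cast ht)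
  -- time is inverted, so that the limit is approached at time `0`
  let H : ℝ → X := fun t => if t ≤ 0 then x else u (t⁻¹ - 1)
  have hH0 : ∀ t ≤ 0, H t = x := fun t ht => if_pos ht
  have hH1 : ∀ t, 0 < t → H t = u (t⁻¹ - 1) := fun t ht => if_neg ht.not_ge
  have hH : Continuous H := by
    refine continuous_iff_continuousAt.2 fun t => ?_
    rcases lt_trichotomy t 0 with ht | rfl | ht
    · refine (continuousAt_const (y := x)).congr ?_
      filter_upwards [Iio_mem_nhds ht] with s hs
      exact (hH0 s (le_of_lt hs)).symm
    · rw [ContinuousAt, hH0 0 le_rfl, tendsto_nhds]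
      intro O hO hxO
      obtain ⟨J, hJ⟩ := hlim O hO hxO
      have hJ0 : (0 : ℝ) < J + 1 := by positivity
      filter_upwards [Iio_mem_nhds (inv_pos.2 hJ0)] with s hs
      rw [mem_preimage]
      rcases le_or_gt s 0 with hs0 | hs0
      · rwa [hH0 s hs0]
      · rw [hH1 s hs0]
        refine hup J O hJ _ ?_
        have := (lt_inv_comm₀ hs0 hJ0).1 hs
        linarith
    · refine ((hu.continuousAt.comp (f := fun t : ℝ => t⁻¹ - 1) ?_)).congr ?_
      · exact (continuousAt_inv₀ ht.ne').sub continuousAt_const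
      · filter_upwards [Ioi_mem_nhds ht] with s hs
        exact (hH1 s hs).symm
  have hHA : ∀ t, H t ∈ A := by
    intro t
    rcases le_or_gt t 0 with ht | ht
    · rwa [hH0 t ht]
    · rw [hH1 t ht]
      exact huA _
  have h1 := joinedIn_of_continuous_real hH hHA 0 1
  have h2 : u 0 = γ 0 0 := by
    simp only [u, Int.floor_zero, Int.fract_zero]
    exact congrFun (hδ1 0) 0
  rwa [hH0 0 le_rfl, hH1 1 one_pos, inv_one, sub_self, h2] at h1

end Concatenation

/-! ### A Cantor family of arms -/

section Arms

variable {S : Type*} [TopologicalSpace S] {f : S → S}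
  {e : OpenPartialHomeomorph S ℂ} {x : StandardInverseLimit f}

/-- The combinatorial data of a Cantor family of arms at `x`: radii `r j` decreasing to `0`, levels
`n j`, and for each `j` two endpoints `a j false` and `a j true` of radius `r j` on the level `n j`,
such that on that level both can be reached from all endpoints of radius `r (j + 1)`. -/
structure IsArmSystem (f : S → S) (x : StandardInverseLimit f) (e : OpenPartialHomeomorph S ℂ)
    (r : ℕ → ℝ) (n : ℕ → ℕ) (a : ℕ → Bool → S) : Prop where
  pos : ∀ j, 0 < r j
  lt_one : ∀ j, r j < 1
  succ_lt : ∀ j, r (j + 1) < r j / 2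
  strictMono : StrictMono n
  circle : ∀ j (t : ℝ), e.symm (r j * Complex.exp (t * Complex.I)) ∉ postcritical f
  mem : ∀ j b, a j b ∈ endpoints f x e (r j) (n j)
  reach : ∀ j b, ∀ v ∈ endpoints f x e (r (j + 1)) (n j),
    JoinedIn {z | f^[n j] z ∉ postcritical f ∧ z ∈ closure (levelComp f x (disc e (r j)) (n j)) ∧
      z ∉ levelComp f x (disc e (r (j + 1))) (n j)} v (a j b)

theorem iterate_sub_mem_endpoints (hf : Continuous f) {r : ℝ} {m n : ℕ} (h : n ≤ m) {a : S}
    (ha : a ∈ endpoints f x e r m) : f^[m - n] a ∈ endpoints f x e r n := by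
  refine ⟨?_, iterate_sub_mem_closure_levelComp hf h ha.2⟩
  rw [← Function.iterate_add_apply, Nat.add_sub_cancel' h, ha.1]

variable [T2Space S] [LocallyConnectedSpace S]

/-- Arm systems exist if arbitrarily small circles carry pairs of endpoints with a property `P`. -/
theorem exists_isArmSystem [ChartedSpace ℂ S] (hf : IsTopBranched f)
    (he : IsDiscCoord e (x.1 0)) (hs : ∀ t : ℝ, 0 < t → t ≤ 1 → e.symm t ∉ postcritical f)
    {P : ℕ → ℝ → ℕ → (Bool → S) → Prop}
    (hP : ∀ (n : ℕ) (r : ℝ), 0 < r → r < 1 →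
      (∀ t : ℝ, e.symm (r * Complex.exp (t * Complex.I)) ∉ postcritical f) →
      ∃ n', n < n' ∧ ∃ a : Bool → S, (∀ b, a b ∈ endpoints f x e r n') ∧ P n r n' a)
    {ρ : ℝ} (hρ : 0 < ρ) :
    ∃ r n a, IsArmSystem f x e r n a ∧ r 0 < ρ ∧
      ∀ j, P (n j) (r (j + 1)) (n (j + 1)) (a (j + 1)) := by
  -- a state is a radius, a level and a pair of endpoints; each state has a successor
  let State := {s : ℝ × ℕ × (Bool → S) // 0 < s.1 ∧ s.1 < 1 ∧
    (∀ t : ℝ, e.symm (s.1 * Complex.exp (t * Complex.I)) ∉ postcritical f) ∧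
    ∀ b, s.2.2 b ∈ endpoints f x e s.1 s.2.1}
  have hQ : (postcritical f).Countable := hf.countable_postcritical
  have hstep : ∀ s : State, ∃ s' : State, s'.1.1 < s.1.1 / 2 ∧ s.1.2.1 < s'.1.2.1 ∧
      (∀ b, ∀ v ∈ endpoints f x e s'.1.1 s.1.2.1,
        JoinedIn {z | f^[s.1.2.1] z ∉ postcritical f ∧
          z ∈ closure (levelComp f x (disc e s.1.1) s.1.2.1) ∧
          z ∉ levelComp f x (disc e s'.1.1) s.1.2.1} v (s.1.2.2 b)) ∧
      P s.1.2.1 s'.1.1 s'.1.2.1 s'.1.2.2 := by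
    rintro ⟨⟨r, n, a⟩, hr0, hr1, hrc, ha⟩
    choose ρ hρ0 hρ using fun b => exists_joinedIn_endpoints hf he hs hr0 hr1.le (ha b)
    obtain ⟨r', h0, h1, hc⟩ := exists_circle_notMem he hQ (δ := min (min (ρ false) (ρ true)) (r / 2))
      (lt_min (lt_min (hρ0 _) (hρ0 _)) (half_pos hr0))
      ((min_le_right _ _).trans ((half_lt_self hr0).le.trans hr1.le))
    rw [lt_min_iff, lt_min_iff] at h1
    have hr'1 : r' < 1 := h1.2.trans ((half_lt_self hr0).trans hr1)
    obtain ⟨n', hn, a', ha', hPa⟩ := hP n r' h0 hr'1 hc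
    refine ⟨⟨⟨r', n', a'⟩, h0, hr'1, hc, ha'⟩, h1.2, hn, fun b v hv => ?_, hPa⟩
    refine hρ b r' h0 ?_ v hv
    cases b
    exacts [h1.1.1, h1.1.2]
  obtain ⟨s₀, hs₀⟩ : ∃ s : State, s.1.1 < ρ := by
    obtain ⟨r, h0, h1, hc⟩ := exists_circle_notMem he hQ (δ := min ρ 1) (lt_min hρ one_pos)
      (min_le_right _ _)
    rw [lt_min_iff] at h1
    obtain ⟨n', -, a, ha, -⟩ := hP 0 r h0 h1.2 hc
    exact ⟨⟨⟨r, n', a⟩, h0, h1.2, hc, ha⟩, h1.1⟩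
  choose next hnext using hstep
  let s : ℕ → State := fun j => Nat.rec s₀ (fun _ s => next s) j
  refine ⟨fun j => (s j).1.1, fun j => (s j).1.2.1, fun j => (s j).1.2.2,
    ⟨fun j => (s j).2.1, fun j => (s j).2.2.1, fun j => (hnext (s j)).1,
      strictMono_nat_of_lt_succ fun j => (hnext (s j)).2.1, fun j => (s j).2.2.2.1,
      fun j => (s j).2.2.2.2, fun j => (hnext (s j)).2.2.1⟩, hs₀, fun j => (hnext (s j)).2.2.2⟩

/-- The arms of an arm system, in the inverse limit. Each binary sequence `ε` has a sequence of
points `E ε j` over the endpoints `a j (ε j)`. Successive points are joined by paths `γ ε j`, which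
avoid the smaller discs on all sufficiently high levels. -/
structure IsArmFamily (f : S → S) (x : StandardInverseLimit f) (e : OpenPartialHomeomorph S ℂ)
    (r : ℕ → ℝ) (n : ℕ → ℕ) (a : ℕ → Bool → S) (E : (ℕ → Bool) → ℕ → StandardInverseLimit f)
    (γ : (ℕ → Bool) → ℕ → ℝ → StandardInverseLimit f) : Prop where
  coord_eq : ∀ ε j, (E ε j).1 (n j) = a j (ε j)
  mem_endpoints : ∀ ε j m, (E ε j).1 m ∈ endpoints f x e (r j) m
  continuous : ∀ ε j, Continuous (γ ε j)
  apply_zero : ∀ ε j, γ ε j 0 = E ε (j + 1)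
  apply_one : ∀ ε j, γ ε j 1 = E ε j
  mem_closure : ∀ ε j t m, (γ ε j t).1 m ∈ closure (levelComp f x (disc e (r j)) m)
  notMem : ∀ ε j t m, n j ≤ m → (γ ε j t).1 m ∉ levelComp f x (disc e (r (j + 1))) m

namespace IsArmSystem

variable {r : ℕ → ℝ} {n : ℕ → ℕ} {a : ℕ → Bool → S}

theorem radius_le (h : IsArmSystem f x e r n a) (j : ℕ) : r j ≤ (1 / 2) ^ j := by
  induction j with
  | zero => simpa using (h.lt_one 0).le
  | succ j ih =>
    rw [pow_succ]
    linarith [h.succ_lt j]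

theorem antitone (h : IsArmSystem f x e r n a) : Antitone r :=
  antitone_nat_of_succ_le fun j => by linarith [h.succ_lt j, h.pos j]

theorem exists_radius_lt (h : IsArmSystem f x e r n a) {ρ : ℝ} (hρ : 0 < ρ) :
    ∃ J, ∀ j ≥ J, r j < ρ := by
  obtain ⟨J, hJ⟩ := exists_pow_lt_of_lt_one hρ (show (1 / 2 : ℝ) < 1 by norm_num)
  exact ⟨J, fun j hj => (h.antitone hj).trans_lt ((h.radius_le J).trans_lt hJ)⟩

/-- The arms are lifts of base paths, corrected so that they fit together at all levels. If the two
endpoints always have the same image on the previous level, then the base paths do not depend on the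
later terms of the binary sequence, and a point of an arm determines the next one. -/
theorem exists_arms (h : IsArmSystem f x e r n a) (hf : IsTopBranched f)
    (he : IsDiscCoord e (x.1 0)) :
    ∃ (E : (ℕ → Bool) → ℕ → StandardInverseLimit f)
      (γ : (ℕ → Bool) → ℕ → ℝ → StandardInverseLimit f),
      IsArmFamily f x e r n a E γ ∧
      ((∀ j, f^[n (j + 1) - n j] (a (j + 1) false) = f^[n (j + 1) - n j] (a (j + 1) true)) →
        ∀ ε δ j, E ε j = E δ j → ε j = δ j → E ε (j + 1) = E δ (j + 1)) := by
  have hle : ∀ j, n j ≤ n (j + 1) := fun j => h.strictMono.monotone (Nat.le_succ j)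
  -- the base paths
  choose! g hg hg0 hg1 hgm using fun j b v hv => (h.reach j b v hv).exists_continuous_real
  let v : ℕ → Bool → S := fun j b => f^[n (j + 1) - n j] (a (j + 1) b)
  have hv : ∀ j b, v j b ∈ endpoints f x e (r (j + 1)) (n j) := fun j b =>
    iterate_sub_mem_endpoints hf.continuous (hle j) (h.mem (j + 1) b)
  let p : ℕ → Bool → S → ℝ → S := fun j b w t => f^[n j] (g j b w t)
  have hp : ∀ j b c, Continuous (p j b (v j c)) := fun j b c =>
    (hf.continuous_iterate _).comp (hg j b _ (hv j c))
  have hpQ : ∀ j b c t, p j b (v j c) t ∉ postcritical f := fun j b c t => (hgm j b _ (hv j c) t).1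
  have hp0 : ∀ j b c, p j b (v j c) 0 = e.symm (r (j + 1)) := fun j b c => by
    simp only [p]
    rw [hg0 j b _ (hv j c), (hv j c).1]
  -- the transports along them
  choose G hGG using fun q : ℝ → S =>
    (show ∃ G : StandardInverseLimit f → ℝ → StandardInverseLimit f,
      (Continuous q ∧ ∀ t, q t ∉ postcritical f) →
        (∀ y, y.1 0 = q 0 → Continuous (G y) ∧ G y 0 = y ∧ ∀ t, (G y t).1 0 = q t) ∧
        ∀ y, y.1 0 ≠ q 0 → ∀ t, G y t = y from by
      by_cases hq : Continuous q ∧ ∀ t, q t ∉ postcritical f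
      · obtain ⟨G, hG⟩ := exists_transport hf hq.1 hq.2
        exact ⟨G, fun _ => hG⟩
      · exact ⟨fun y _ => y, fun h => absurd h hq⟩)
  have hGc : ∀ j b c y, y.1 0 = e.symm (r (j + 1)) → Continuous (G (p j b (v j c)) y) ∧
      G (p j b (v j c)) y 0 = y ∧ ∀ t, (G (p j b (v j c)) y t).1 0 = p j b (v j c) t :=
    fun j b c y hy => (hGG _ ⟨hp j b c, hpQ j b c⟩).1 y (hy.trans (hp0 j b c).symm)
  have hcong : ∀ j b c m y z, y.1 m = z.1 m →
      (G (p j b (v j c)) y 1).1 m = (G (p j b (v j c)) z 1).1 m := by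
    intro j b c m y z hyz
    have h0 : y.1 0 = z.1 0 := by
      rw [← StandardInverseLimit.iterate_apply_zero y m, hyz,
        StandardInverseLimit.iterate_apply_zero]
    by_cases hy : y.1 0 = e.symm (r (j + 1))
    · obtain ⟨c1, c2, c3⟩ := hGc j b c y hy
      obtain ⟨d1, d2, d3⟩ := hGc j b c z (h0 ▸ hy)
      exact limit_lift_unique hf (hpQ j b c) c1 d1 c3 d3 (t₀ := 0) (by rw [c2, d2, hyz]) 1
    · rw [(hGG _ ⟨hp j b c, hpQ j b c⟩).2 y (by rwa [hp0]), (hGG _ ⟨hp j b c, hpQ j b c⟩).2 z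
        (by rwa [hp0, ← h0]), hyz]
  -- the level `n j` of a transport from a point over `v`
  have hlev : ∀ j b c y, y.1 (n j) = v j c → ∀ t, (G (p j b (v j c)) y t).1 (n j) = g j b (v j c) t := by
    intro j b c y hy t
    have hy0 : y.1 0 = e.symm (r (j + 1)) := by
      rw [← StandardInverseLimit.iterate_apply_zero y (n j), hy, (hv j c).1]
    obtain ⟨c1, c2, c3⟩ := hGc j b c y hy0
    have hit : ∀ t, f^[n j] ((G (p j b (v j c)) y t).1 (n j)) = p j b (v j c) t := fun t => by
      rw [StandardInverseLimit.iterate_apply_zero, c3]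
    exact congrFun (lift_unique hf (n := n j) (G₁ := fun t => (G (p j b (v j c)) y t).1 (n j))
      ((StandardInverseLimit.continuous_coord _).comp c1) (hg j b _ (hv j c)) hit
      (fun t => by rw [hit]; exact notMem_critVals (hpQ j b c t) _) (a₀ := 0)
      (by simp only [c2, hy, hg0 j b _ (hv j c)])) t
  choose Y hY using fun j b => (show ∃ y : StandardInverseLimit f, y.1 (n j) = a j b from by
    obtain ⟨y, -, hy⟩ := exists_mem_plaque (x := x) hf (he.isOpen_disc le_rfl) (he.mem_disc one_pos)
      (closure_levelComp_subset_levelComp hf.continuous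
        ((he.closure_disc_subset (h.lt_one j).le).trans (cdisc_subset_disc (h.lt_one j)))
        (h.mem j b).2)
    exact ⟨y, hy⟩)
  have hYv : ∀ j b, (Y (j + 1) b).1 (n j) = v j b := fun j b => by
    rw [← StandardInverseLimit.iterate_sub_apply _ (hle j), hY]
  choose E hE hEa using fun ε : ℕ → Bool => exists_coherent
    (T := fun j y => G (p j (ε j) (v j (ε (j + 1)))) y 1) (n := n) (y := fun j => Y j (ε j))
    (fun j m y z hyz => hcong j _ _ m y z hyz) h.strictMono (fun j => by
      rw [hlev _ _ _ _ (hYv j _), hg1 j _ _ (hv j _), hY])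
  have hEa' : ∀ ε j, (E ε j).1 (n j) = a j (ε j) := fun ε j => by rw [hEa, hY]
  have hE0 : ∀ ε j, (E ε j).1 0 = e.symm (r j) := fun ε j => by
    rw [← StandardInverseLimit.iterate_apply_zero _ (n j), hEa', (h.mem j _).1]
  have hEv : ∀ ε j, (E ε (j + 1)).1 (n j) = v j (ε (j + 1)) := fun ε j => by
    rw [← StandardInverseLimit.iterate_sub_apply _ (hle j), hEa']
  let γ : (ℕ → Bool) → ℕ → ℝ → StandardInverseLimit f := fun ε j =>
    G (p j (ε j) (v j (ε (j + 1)))) (E ε (j + 1))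
  have hγ : ∀ ε j, Continuous (γ ε j) ∧ γ ε j 0 = E ε (j + 1) ∧
      ∀ t, (γ ε j t).1 0 = p j (ε j) (v j (ε (j + 1))) t := fun ε j =>
    hGc j _ _ _ (hE0 ε (j + 1))
  have hpc : ∀ j b c t, p j b (v j c) t ∈ cdisc e (r j) := fun j b c t =>
    he.closure_disc_subset (h.lt_one j).le
      (closure_levelComp_subset hf.continuous (hgm j b _ (hv j c) t).2.1)
  have hγcl : ∀ ε j m, (∃ t, (γ ε j t).1 m ∈ closure (levelComp f x (disc e (r j)) m)) →
      ∀ t, (γ ε j t).1 m ∈ closure (levelComp f x (disc e (r j)) m) := by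
    rintro ε j m ⟨t₀, ht₀⟩ t
    have hit : ∀ t, f^[m] ((γ ε j t).1 m) = p j (ε j) (v j (ε (j + 1))) t := fun t => by
      rw [StandardInverseLimit.iterate_apply_zero, (hγ ε j).2.2]
    refine subset_closure_levelComp hf he (h.pos j) (h.lt_one j).le (isPreconnected_range
      ((StandardInverseLimit.continuous_coord m).comp (hγ ε j).1)) ?_ ?_ ⟨t₀, rfl⟩ ht₀ ⟨t, rfl⟩
    · rintro _ ⟨t, rfl⟩
      simp only [Function.comp_apply, hit]
      exact hpc _ _ _ _
    · rintro _ ⟨t, rfl⟩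
      simp only [Function.comp_apply, hit]
      exact notMem_critVals (hpQ _ _ _ _) m
  have hEcl : ∀ ε i j m, m ≤ n (j + i) → (E ε j).1 m ∈ closure (levelComp f x (disc e (r j)) m) := by
    intro ε i
    induction i with
    | zero =>
      intro j m hm
      rw [← StandardInverseLimit.iterate_sub_apply _ hm]
      refine iterate_sub_mem_closure_levelComp hf.continuous hm ?_
      rw [add_zero, hEa']
      exact (h.mem j _).2
    | succ i ih =>
      intro j m hm
      rw [← hE ε j]
      refine hγcl ε j m ⟨0, ?_⟩ 1
      rw [(hγ ε j).2.1]
      exact closure_mono (levelComp_mono (disc_mono (h.antitone (Nat.le_succ j))) m)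
        (ih (j + 1) m (by rwa [show j + 1 + i = j + (i + 1) by omega]))
  have hEend : ∀ ε j m, (E ε j).1 m ∈ endpoints f x e (r j) m := fun ε j m =>
    ⟨by rw [StandardInverseLimit.iterate_apply_zero, hE0], hEcl ε m j m
      ((h.strictMono.id_le m).trans (h.strictMono.monotone (Nat.le_add_left m j)))⟩
  refine ⟨E, γ, ⟨hEa', hEend, fun ε j => (hγ ε j).1, fun ε j => (hγ ε j).2.1, hE,
    fun ε j t m => hγcl ε j m ⟨1, ?_⟩ t, fun ε j t m hm hmem => ?_⟩, fun hpair ε δ j hEj hεj => ?_⟩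
  · rw [show γ ε j 1 = E ε j from hE ε j]
    exact (hEend ε j m).2
  · have h1 := iterate_sub_mem_levelComp hf.continuous hm hmem
    rw [StandardInverseLimit.iterate_sub_apply _ hm, hlev _ _ _ _ (hEv ε j)] at h1
    exact (hgm j _ _ (hv j _) t).2.2 h1
  · have hvv : ∀ b c, v j b = v j c := by
      intro b c
      cases b <;> cases c <;> first | rfl | exact hpair j | exact (hpair j).symm
    have h1 : G (p j (ε j) (v j (ε (j + 1)))) (E ε (j + 1)) 1 =
        G (p j (ε j) (v j (ε (j + 1)))) (E δ (j + 1)) 1 := by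
      have h2 := hE ε j
      have h3 := hE δ j
      rw [← hεj, hvv (δ (j + 1)) (ε (j + 1))] at h3
      exact h2.trans (hEj.trans h3.symm)
    obtain ⟨c1, c2, c3⟩ := hGc j (ε j) (ε (j + 1)) _ (hE0 ε (j + 1))
    obtain ⟨d1, d2, d3⟩ := hGc j (ε j) (ε (j + 1)) _ (hE0 δ (j + 1))
    refine Subtype.ext (funext fun m => ?_)
    have := limit_lift_unique hf (hpQ _ _ _) c1 d1 c3 d3 (m := m) (t₀ := 1) (by rw [h1]) 0
    rwa [c2, d2] at this

end IsArmSystem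

end Arms

/-! ### Breaking by the arms -/

section Escape

/-- Countably many binary sequences agree with a given one from a given place on. -/
theorem countable_setOf_eq_from (ε : ℕ → Bool) (J : ℕ) :
    {δ : ℕ → Bool | ∀ j ≥ J, δ j = ε j}.Countable := by
  refine countable_of_injective_of_countable_image (f := fun δ (i : Fin J) => δ i) ?_
    (toFinite _).countable
  intro δ hδ δ' hδ' h
  funext j
  rcases lt_or_ge j J with hj | hj
  · exact congrFun h ⟨j, hj⟩
  · rw [hδ j hj, hδ' j hj]

variable {S : Type*} [TopologicalSpace S] [T2Space S] [LocallyConnectedSpace S] {f : S → S}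
  {e : OpenPartialHomeomorph S ℂ} {x : StandardInverseLimit f}

/-- A compact set which does not contain `x` misses a small component around `x` on all high
levels. -/
theorem exists_levelComp_notMem (hf : IsTopBranched f) (he : IsDiscCoord e (x.1 0))
    {K : Set (StandardInverseLimit f)} (hK : IsCompact K) (hx : x ∉ K) :
    ∃ ρ > 0, ∃ M, ∀ m ≥ M, ∀ y ∈ K, y.1 m ∉ levelComp f x (disc e ρ) m := by
  obtain ⟨N, -, G, hG, hxG, hGK⟩ := StandardInverseLimit.exists_coord_subset hf.continuous
    hK.isClosed.isOpen_compl hx 0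
  obtain ⟨V, hV, hxV, hVG⟩ := exists_levelComp_subset hf N hG hxG
  obtain ⟨ρ, h0, -, hρ⟩ := he.exists_disc_subset hV hxV
  refine ⟨ρ, h0, N, fun m hm y hy hmem => hGK y ?_ hy⟩
  have h1 := iterate_sub_mem_levelComp hf.continuous hm hmem
  rw [StandardInverseLimit.iterate_sub_apply _ hm] at h1
  exact hVG _ hρ h1

namespace IsArmFamily

variable {r : ℕ → ℝ} {n : ℕ → ℕ} {a : ℕ → Bool → S} {E : (ℕ → Bool) → ℕ → StandardInverseLimit f}
  {γ : (ℕ → Bool) → ℕ → ℝ → StandardInverseLimit f}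

theorem mem_plaque (h : IsArmFamily f x e r n a E γ) (hr : IsArmSystem f x e r n a)
    (hf : IsTopBranched f) (he : IsDiscCoord e (x.1 0)) {s : ℝ} (hs : r 0 < s) (ε : ℕ → Bool)
    (j : ℕ) (t : ℝ) : γ ε j t ∈ plaque f x (disc e s) := fun m =>
  closure_levelComp_subset_levelComp hf.continuous
    ((he.closure_disc_subset (hr.lt_one j).le).trans
      (cdisc_subset_disc ((hr.antitone (Nat.zero_le j)).trans_lt hs))) (h.mem_closure ε j t m)

/-- The arms emanate from `x`. -/
theorem joinedIn_plaque (h : IsArmFamily f x e r n a E γ) (hr : IsArmSystem f x e r n a)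
    (hf : IsTopBranched f) (he : IsDiscCoord e (x.1 0)) {s : ℝ} (hs : r 0 < s)
    (ε : ℕ → Bool) : JoinedIn (plaque f x (disc e s)) x (E ε 0) := by
  have h1 := joinedIn_of_infinite_concatenation (A := plaque f x (disc e s)) (x := x)
    (γ := fun j t => γ ε j (1 - t)) (_root_.mem_plaque (he.mem_disc ((hr.pos 0).trans hs)))
    (fun j => (h.continuous ε j).comp (by fun_prop))
    (fun j => by simp only [sub_self, sub_zero, h.apply_zero, h.apply_one])
    (fun j t => h.mem_plaque hr hf he hs ε j _) ?_
  · simpa only [sub_zero, h.apply_one] using h1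
  · intro O hO hxO
    obtain ⟨N, -, G, hG, hxG, hGO⟩ :=
      StandardInverseLimit.exists_coord_subset hf.continuous hO hxO 0
    obtain ⟨V, hV, hxV, hVG⟩ := exists_levelComp_subset hf N hG hxG
    obtain ⟨ρ, h0, -, hρ⟩ := he.exists_disc_subset hV hxV
    obtain ⟨J, hJ⟩ := hr.exists_radius_lt h0
    refine ⟨J, fun j hj t => hGO _ (hVG _ hρ ?_)⟩
    exact closure_levelComp_subset_levelComp hf.continuous
      ((he.closure_disc_subset (hr.lt_one j).le).trans (cdisc_subset_disc (hJ j hj)))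
      (h.mem_closure ε j _ N)

theorem ne_center (h : IsArmFamily f x e r n a E γ) (hr : IsArmSystem f x e r n a)
    (he : IsDiscCoord e (x.1 0)) (ε : ℕ → Bool) (j : ℕ) : E ε j ≠ x := by
  intro heq
  have h1 := endpoints_notMem he (hr.pos j) (hr.lt_one j).le (h.mem_endpoints ε j 0)
  rw [heq] at h1
  exact h1 (mem_levelComp (he.mem_disc (hr.pos j)) 0)

/-- Within an arm, one gets from its `J`-th point to its end outside the `J`-th disc. -/
theorem joinedIn_end (h : IsArmFamily f x e r n a E γ) (hr : IsArmSystem f x e r n a)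
    (hf : IsTopBranched f) (he : IsDiscCoord e (x.1 0)) {s : ℝ} (hs : r 0 < s)
    (ε : ℕ → Bool) (J : ℕ) :
    JoinedIn {z | z ∈ plaque f x (disc e s) ∧
      ∀ m ≥ n J, z.1 m ∉ levelComp f x (disc e (r J)) m} (E ε J) (E ε 0) := by
  induction J with
  | zero =>
    refine JoinedIn.refl ⟨?_, fun m _ => ?_⟩
    · rw [← h.apply_one]
      exact h.mem_plaque hr hf he hs ε 0 1
    · exact endpoints_notMem he (hr.pos 0) (hr.lt_one 0).le (h.mem_endpoints ε 0 m)
  | succ J ih =>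
    refine JoinedIn.trans (y := E ε J) ?_ (ih.mono ?_)
    · rw [← h.apply_zero, ← h.apply_one]
      refine joinedIn_of_continuous_real (h.continuous ε J) (fun t => ?_) 0 1
      exact ⟨h.mem_plaque hr hf he hs ε J t, fun m hm =>
        h.notMem ε J t m ((hr.strictMono.monotone (Nat.le_succ J)).trans hm)⟩
    · rintro z ⟨hz, hzm⟩
      exact ⟨hz, fun m hm hmem => hzm m ((hr.strictMono.monotone (Nat.le_succ J)).trans hm)
        (levelComp_mono (disc_mono (hr.antitone (Nat.le_succ J))) m hmem)⟩

/-- If the ends of two arms are joined off `x`, then far points of these arms are joined outside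
their disc, on all high levels. -/
theorem exists_joinedIn (h : IsArmFamily f x e r n a E γ) (hr : IsArmSystem f x e r n a)
    (hf : IsTopBranched f) (he : IsDiscCoord e (x.1 0)) {s : ℝ} (hs : r 0 < s)
    {W : Set (StandardInverseLimit f)} (hW : W ⊆ plaque f x (disc e s)) {ε δ : ℕ → Bool}
    (hj : JoinedIn (W \ {x}) (E ε 0) (E δ 0)) :
    ∃ J₀ M, ∀ J ≥ J₀, JoinedIn {z | z ∈ plaque f x (disc e s) ∧
      ∀ m ≥ M, m ≥ n J → z.1 m ∉ levelComp f x (disc e (r J)) m} (E ε J) (E δ J) := by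
  obtain ⟨g, hg⟩ := hj
  obtain ⟨ρ, h0, M, hM⟩ := exists_levelComp_notMem (x := x) hf he (isCompact_range g.continuous)
    (by rintro ⟨t, ht⟩; exact (hg t).2 ht)
  obtain ⟨J₀, hJ₀⟩ := hr.exists_radius_lt h0
  refine ⟨J₀, M, fun J hJ => ?_⟩
  have h1 : ∀ ε, JoinedIn {z | z ∈ plaque f x (disc e s) ∧
      ∀ m ≥ M, m ≥ n J → z.1 m ∉ levelComp f x (disc e (r J)) m} (E ε J) (E ε 0) := fun ε =>
    (h.joinedIn_end hr hf he hs ε J).mono fun z hz => ⟨hz.1, fun m _ hm => hz.2 m hm⟩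
  refine ((h1 ε).trans ⟨g, fun t => ⟨hW (hg t).1, fun m hm _ hmem => ?_⟩⟩).trans (h1 δ).symm
  exact hM m hm _ (mem_range_self t) (levelComp_mono (disc_mono (hJ₀ J hJ).le) m hmem)

/-- If the two endpoints of each pair are separated by the complement of the component, then arms
whose ends are joined off `x` have eventually equal binary sequences. -/
theorem countable_of_not_joinedIn (h : IsArmFamily f x e r n a E γ) (hr : IsArmSystem f x e r n a)
    (hf : IsTopBranched f) (he : IsDiscCoord e (x.1 0)) {s : ℝ} (hs : r 0 < s)
    (ha : ∀ j, ¬ JoinedIn (levelComp f x (disc e (r (j + 1))) (n (j + 1)))ᶜ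
      (a (j + 1) false) (a (j + 1) true))
    {W : Set (StandardInverseLimit f)} (hW : W ⊆ plaque f x (disc e s)) (ε : ℕ → Bool) :
    {δ | JoinedIn (W \ {x}) (E ε 0) (E δ 0)}.Countable := by
  refine (countable_iUnion fun J => countable_setOf_eq_from ε J).mono fun δ hδ => mem_iUnion.2 ?_
  obtain ⟨J₀, M, hJ⟩ := h.exists_joinedIn hr hf he hs hW hδ
  refine ⟨max (max J₀ M) 1, fun j hj => ?_⟩
  obtain ⟨i, rfl⟩ : ∃ i, j = i + 1 := ⟨j - 1, by omega⟩
  obtain ⟨g, hg⟩ := hJ (i + 1) (by omega)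
  have hM : M ≤ n (i + 1) := (show M ≤ i + 1 by omega).trans (hr.strictMono.id_le (i + 1))
  have h1 : JoinedIn (levelComp f x (disc e (r (i + 1))) (n (i + 1)))ᶜ
      (a (i + 1) (ε (i + 1))) (a (i + 1) (δ (i + 1))) := by
    rw [← h.coord_eq, ← h.coord_eq]
    exact ⟨g.map (StandardInverseLimit.continuous_coord (n (i + 1))), fun t =>
      (hg t).2 _ hM le_rfl⟩
  have h2 := ha i
  cases hε : ε (i + 1) <;> cases hδ : δ (i + 1) <;> rw [hε, hδ] at h1
  exacts [absurd h1 h2, absurd h1.symm h2]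

end IsArmFamily

end Escape

/-! ### Counting turns in the inverse limit -/

section Turning

variable {S : Type*} [TopologicalSpace S] [T2Space S] [LocallyConnectedSpace S] {f : S → S}
  {e : OpenPartialHomeomorph S ℂ} {x : StandardInverseLimit f} [ChartedSpace ℂ S]
  [IsManifold 𝓘(ℂ) 1 S]

/-- Two points over the same point of a circle which are joined off `x` differ by a number of turns
along the circle: on each level the number of turns is bounded by the number of times that the base
path changes from one slit to the other, so one number serves for infinitely many levels. -/
theorem exists_int_turn (hS : IsDiskPlaneOrSphere S) (hf : IsTopBranched f)
    (hfM : MDifferentiable 𝓘(ℂ) 𝓘(ℂ) f) (he : IsDiscCoord e (x.1 0))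
    (heM : MDifferentiableOn 𝓘(ℂ) 𝓘(ℂ) e e.source) {τ : ℝ}
    (hτ : (Complex.exp (τ * Complex.I)).im ≠ 0)
    (hs₀ : ∀ t : ℝ, 0 < t → t ≤ 1 → e.symm t ∉ postcritical f)
    (hs₁ : ∀ t : ℝ, 0 < t → t ≤ 1 → (rotate e τ).symm t ∉ postcritical f) {r R' R : ℝ}
    (hc : ∀ t : ℝ, e.symm (r * Complex.exp (t * Complex.I)) ∉ postcritical f)
    (hr : 0 < r) (hrR' : r < R') (hR'R : R' < R) (hR : R < 1) {M : ℕ}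
    (hconn : ∀ m ≥ M, IsPreconnected (levelComp f x (disc e R) m)ᶜ)
    {C : ℝ → StandardInverseLimit f} (hC : Continuous C)
    (hC0 : ∀ t : ℝ, (C t).1 0 = e.symm (r * Complex.exp (t * Complex.I)))
    {y : StandardInverseLimit f} (hCm : ∀ m, (C 0).1 m ∈ endpoints f x e r m)
    (hy : ∀ m, y.1 m ∈ endpoints f x e r m)
    (hj : JoinedIn {z | z ∈ plaque f x (disc e R') ∧
      ∀ m ≥ M, z.1 m ∉ levelComp f x (disc e r) m} (C 0) y) :
    ∃ k : ℤ, C (2 * Real.pi * k) = y := by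
  obtain ⟨g, hg, hg0, hg1, hgm⟩ := hj.exists_continuous_real
  -- the two slits are compact and disjoint
  let I₀ : Set ℂ := {v | segDist (r / 2) R v ≤ 0}
  have hI : ∀ v ∈ I₀, v = ((v.re : ℝ) : ℂ) ∧ 0 < v.re ∧ ‖v‖ ≤ 1 := by
    intro v hv
    obtain ⟨h1, h2, h3⟩ := segDist_le_zero_iff.1 hv
    have h4 : v = ((v.re : ℝ) : ℂ) := Complex.ext (by simp) (by simp [h1])
    have h5 : 0 < v.re := by linarith
    refine ⟨h4, h5, ?_⟩
    rw [h4, Complex.norm_real, Real.norm_of_nonneg h5.le]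
    linarith
  have hIc : IsCompact I₀ := (isCompact_closedBall (0 : ℂ) 1).of_isClosed_subset
    (isClosed_le (continuous_segDist _ _) continuous_const) fun v hv =>
      mem_closedBall_zero_iff.2 (hI v hv).2.2
  have hclosed : ∀ {e : OpenPartialHomeomorph S ℂ}, IsDiscCoord e (x.1 0) → IsClosed (e.symm '' I₀) :=
    fun {e} he => (hIc.image_of_continuousOn (e.continuousOn_symm.mono fun v hv =>
      he.mem_target (hI v hv).2.2)).isClosed
  let K : Bool → Set S := fun b => cond b ((rotate e τ).symm '' I₀) (e.symm '' I₀)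
  have hK : ∀ b, IsClosed (K b) := fun b => by
    cases b
    exacts [hclosed he, hclosed (he.rotate τ)]
  have hdis : ∀ z, z ∈ K false → z ∉ K true := by
    rintro _ ⟨v, hv, rfl⟩ ⟨w, hw, hwv⟩
    obtain ⟨v1, v2, v3⟩ := hI v hv
    obtain ⟨w1, w2, w3⟩ := hI w hw
    rw [rotate_symm_apply] at hwv
    have h1 := e.symm.injOn (he.mem_target (by
      rwa [norm_mul, Complex.norm_exp_ofReal_mul_I, one_mul])) (he.mem_target v3) hwv
    have h2 := congrArg Complex.im h1
    rw [v1, w1, Complex.im_mul_ofReal, Complex.ofReal_im] at h2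
    exact hτ ((mul_eq_zero.1 h2).resolve_right w2.ne')
  -- a partition of the base path into pieces each of which misses a slit
  have hgc : Continuous fun t : ℝ => (g t).1 0 := (StandardInverseLimit.continuous_coord 0).comp hg
  obtain ⟨s, hs0, hsm, ⟨N, hN⟩, hsK⟩ := exists_monotone_Icc_subset_open_cover_unitInterval
    (c := fun b => {t : unitInterval | (g t).1 0 ∉ K b})
    (fun b => (hK b).isOpen_compl.preimage (hgc.comp continuous_subtype_val)) (fun t _ => by
      by_cases h : (g t).1 0 ∈ K false
      · exact mem_iUnion.2 ⟨true, hdis _ h⟩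
      · exact mem_iUnion.2 ⟨false, h⟩)
  have hturn : ∀ m ≥ M, ∃ k : ℤ, |k| ≤ 24 * N ∧ (C (2 * Real.pi * k)).1 m = y.1 m := by
    intro m hm
    have hbase : ∀ t, f^[m] ((g t).1 m) = (g t).1 0 := fun t =>
      StandardInverseLimit.iterate_apply_zero _ m
    obtain ⟨c, hcl, hc0, k, hk, hck⟩ := exists_turn_of_path (n := m) (x := x) hS hf hfM he heM hτ
      (fun t h0 h1 => notMem_critVals (hs₀ t h0 h1) m)
      (fun t h0 h1 => notMem_critVals (hs₁ t h0 h1) m) (fun t => notMem_critVals (hc t) m)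
      hr hrR' hR'R hR (hconn m hm) (γ := fun t => (g t).1 m)
      ((StandardInverseLimit.continuous_coord m).comp hg)
      (fun t => ⟨(hgm t).1 m, (hgm t).2 m hm⟩) (by simp only [hg0]; exact hCm m)
      (by simp only [hg1]; exact hy m) (N := N) (s := fun i => (s i : ℝ)) (fun i j hij => hsm hij)
      (by simp [hs0]) (by simp [hN N le_rfl]) (fun i _ => by
        obtain ⟨b, hb⟩ := hsK i
        have h1 : ∀ u ∈ Icc (s i : ℝ) (s (i + 1)), f^[m] ((g u).1 m) ∉ K b := by
          intro u hu
          rw [hbase]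
          exact hb (a := ⟨u, (s i).2.1.trans hu.1, hu.2.trans (s (i + 1)).2.2⟩) hu
        cases b
        exacts [Or.inl h1, Or.inr h1])
    refine ⟨k, hk, ?_⟩
    have h1 : (fun t => (C t).1 m) = c := lift_unique hf (n := m)
      ((StandardInverseLimit.continuous_coord m).comp hC) hcl.continuous
      (fun t => by rw [StandardInverseLimit.iterate_apply_zero, hC0, hcl.iterate_eq])
      (fun t => by
        rw [StandardInverseLimit.iterate_apply_zero, hC0]
        exact notMem_critVals (hc t) m) (a₀ := 0) (by simp only [hc0, hg0])
    rw [← hg1, ← hck, ← h1]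
  choose k hk hky using fun i : ℕ => hturn (M + i) (Nat.le_add_right M i)
  obtain ⟨k₀, hk₀⟩ := Finite.exists_infinite_fiber
    (fun i => (⟨k i, abs_le.1 (hk i)⟩ : Icc (-(24 * N : ℤ)) (24 * N)))
  refine ⟨k₀, StandardInverseLimit.exists_eq_of_infinite fun L => ?_⟩
  obtain ⟨i, hi, hiL⟩ := (infinite_coe_iff.1 hk₀).exists_gt L
  refine ⟨M + i, by omega, ?_⟩
  have h1 : k i = k₀ := congrArg Subtype.val (show _ = k₀ from hi)
  rw [← h1]
  exact hky i

/-- If the complements of the components are connected, then the arms whose ends are joined off `x`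
to the end of a given one are determined, from some point on, by a number of turns. -/
theorem IsArmFamily.countable_of_isPreconnected_compl {r : ℕ → ℝ} {n : ℕ → ℕ} {a : ℕ → Bool → S}
    {E : (ℕ → Bool) → ℕ → StandardInverseLimit f}
    {γ : (ℕ → Bool) → ℕ → ℝ → StandardInverseLimit f}
    (h : IsArmFamily f x e r n a E γ) (hr : IsArmSystem f x e r n a)
    (hS : IsDiskPlaneOrSphere S) (hf : IsTopBranched f)
    (hfM : MDifferentiable 𝓘(ℂ) 𝓘(ℂ) f) (he : IsDiscCoord e (x.1 0))
    (heM : MDifferentiableOn 𝓘(ℂ) 𝓘(ℂ) e e.source) {τ : ℝ}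
    (hτ : (Complex.exp (τ * Complex.I)).im ≠ 0)
    (hs₀ : ∀ t : ℝ, 0 < t → t ≤ 1 → e.symm t ∉ postcritical f)
    (hs₁ : ∀ t : ℝ, 0 < t → t ≤ 1 → (rotate e τ).symm t ∉ postcritical f) {R' R : ℝ}
    (hrR' : r 0 < R') (hR'R : R' < R) (hR : R < 1) {M : ℕ}
    (hconn : ∀ m ≥ M, IsPreconnected (levelComp f x (disc e R) m)ᶜ)
    (ha : ∀ j, a (j + 1) false ≠ a (j + 1) true)
    (hE : ∀ ε δ j, E ε j = E δ j → ε j = δ j → E ε (j + 1) = E δ (j + 1))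
    {W : Set (StandardInverseLimit f)} (hW : W ⊆ plaque f x (disc e R')) (ε : ℕ → Bool) :
    {δ | JoinedIn (W \ {x}) (E ε 0) (E δ 0)}.Countable := by
  have hinj : ∀ ε δ j, E ε (j + 1) = E δ (j + 1) → ε (j + 1) = δ (j + 1) := by
    intro ε δ j hEj
    have h1 : a (j + 1) (ε (j + 1)) = a (j + 1) (δ (j + 1)) := by
      rw [← h.coord_eq, ← h.coord_eq, hEj]
    have h2 := ha j
    cases hε : ε (j + 1) <;> cases hδ : δ (j + 1) <;> rw [hε, hδ] at h1
    exacts [absurd h1 h2, absurd h1.symm h2]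
  -- a point of an arm determines the terms of the sequence from its place on
  have hfib : ∀ (J : ℕ) (v : StandardInverseLimit f), {δ | E δ (J + 1) = v}.Countable := by
    intro J v
    rcases eq_empty_or_nonempty {δ | E δ (J + 1) = v} with h0 | ⟨δ₀, hδ₀⟩
    · rw [h0]
      exact countable_empty
    refine (countable_setOf_eq_from δ₀ (J + 1)).mono fun δ hδ => ?_
    have h1 : ∀ i, E δ (J + 1 + i) = E δ₀ (J + 1 + i) := by
      intro i
      induction i with
      | zero => exact Eq.trans hδ hδ₀.symm
      | succ i ih =>
        refine hE δ δ₀ (J + 1 + i) ih ?_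
        rw [show J + 1 + i = J + i + 1 by omega] at ih ⊢
        exact hinj _ _ _ ih
    intro j hj
    obtain ⟨i, rfl⟩ := Nat.exists_eq_add_of_le hj
    have h2 := h1 i
    rw [show J + 1 + i = J + i + 1 by omega] at h2 ⊢
    exact hinj _ _ _ h2
  have hcirc : ∀ j, Continuous fun t : ℝ => e.symm (r j * Complex.exp (t * Complex.I)) := fun j =>
    he.continuous_symm_comp (g := fun t : ℝ => (r j : ℂ) * Complex.exp (t * Complex.I)) (by fun_prop)
      fun t => (norm_circle (hr.pos j) t).trans_le (hr.lt_one j).le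
  -- the circle through `E ε j`, lifted to the inverse limit
  choose C hC hC0 hCr using fun j => exists_limit_lift hf (hcirc j) (hr.circle j) (a₀ := 0)
    (y := E ε j) (by
      rw [(show (E ε j).1 0 = e.symm (r j) from (h.mem_endpoints ε j 0).1)]
      simp)
  refine (countable_iUnion fun J => countable_iUnion fun k : ℤ =>
    hfib J (C (J + 1) (2 * Real.pi * k))).mono fun δ hδ => ?_
  obtain ⟨J, M', hJ⟩ := h.exists_joinedIn hr hf he hrR' hW hδ
  obtain ⟨k, hk⟩ := exists_int_turn (M := max (max M M') (n (J + 1))) hS hf hfM he heM hτ hs₀ hs₁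
    (hr.circle (J + 1)) (hr.pos (J + 1)) ((hr.antitone (Nat.zero_le _)).trans_lt hrR') hR'R hR
    (fun m hm => hconn m (by omega)) (hC (J + 1)) (hCr (J + 1)) (y := E δ (J + 1))
    (fun m => by rw [hC0]; exact h.mem_endpoints ε (J + 1) m)
    (fun m => h.mem_endpoints δ (J + 1) m) (by
      rw [hC0]
      exact (hJ (J + 1) (Nat.le_succ J)).mono fun z hz =>
        ⟨hz.1, fun m hm => hz.2 m (by omega) (by omega)⟩)
  exact mem_iUnion₂.2 ⟨J, k, hk.symm⟩

/-- A critical point with nontrivial signature makes all small neighbourhoods break. -/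
theorem exists_breaksUncountably (hS : IsDiskPlaneOrSphere S) (hf : IsTopBranched f)
    (hfM : MDifferentiable 𝓘(ℂ) 𝓘(ℂ) f) {x : PlaqueInverseLimit f} {c : S} (hc : c ∈ branchSet f)
    (hsign : sign x c ≠ {⊥}) :
    ∃ U : Set (PlaqueInverseLimit f), IsOpen U ∧ x ∈ U ∧
      ∀ W : Set (PlaqueInverseLimit f), IsOpen W → x ∈ W → W ⊆ U → BreaksUncountably W x := by
  have := hS.connectedSpace
  have hQ : (postcritical f).Countable := hf.countable_postcritical
  obtain ⟨e, he, heM, hs₀⟩ := exists_isDiscCoord (PlaqueInverseLimit.proj 0 x) hQ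
  obtain ⟨τ, hτ, hτQ⟩ := exists_angle_notMem (hQ.image fun p => e p / ‖e p‖) Real.pi_pos
    (by linarith [Real.pi_pos])
  have hτ' : (Complex.exp (τ * Complex.I)).im ≠ 0 := by
    rw [Complex.exp_ofReal_mul_I_im]
    exact (Real.sin_pos_of_pos_of_lt_pi hτ.1 hτ.2).ne'
  have hs₁ : ∀ t : ℝ, 0 < t → t ≤ 1 → (rotate e τ).symm t ∉ postcritical f := by
    intro t h0 h1 hmem
    rw [rotate_symm_apply] at hmem
    refine hτQ ⟨_, hmem, ?_⟩
    have h2 : ‖Complex.exp (τ * Complex.I) * t‖ = t := by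
      rw [norm_mul, Complex.norm_exp_ofReal_mul_I, one_mul, Complex.norm_real,
        Real.norm_of_nonneg h0.le]
    simp only
    rw [e.right_inv (he.mem_target (h2.trans_le h1)), h2]
    exact mul_div_cancel_right₀ _ (by exact_mod_cast h0.ne')
  -- the critical point is met by all discs, infinitely often
  have hcrit : ∀ r : ℝ, 0 < r → ∀ N, ∃ n ≥ N, c ∈ levelComp f x (disc e r) n := by
    intro r hr N
    have hV1 : ∀ j : ℕ, (1 / ((j : ℝ) + 1)) ≤ 1 := fun j => by
      rw [div_le_one (by positivity)]
      linarith [(Nat.cast_nonneg j : (0 : ℝ) ≤ j)]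
    have hV0 : ∀ j : ℕ, 0 < (1 / ((j : ℝ) + 1)) := fun j => by positivity
    have hsm : ∀ ρ > 0, ∃ j : ℕ, 1 / ((j : ℝ) + 1) < ρ := fun ρ hρ => exists_nat_one_div_lt hρ
    have h1 := (sign_ne_bot_iff hf x c (V := fun j : ℕ => disc e (1 / ((j : ℝ) + 1)))
      (fun j => he.isOpen_disc (hV1 j)) (fun j => he.mem_disc (hV0 j))
      (fun i j hij => disc_mono (one_div_le_one_div_of_le (by positivity) (by
        have : (i : ℝ) ≤ j := by exact_mod_cast hij
        linarith)))
      (fun G hG hxG => by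
        obtain ⟨ρ, h0, -, hρ⟩ := he.exists_disc_subset hG hxG
        obtain ⟨j, hj⟩ := hsm ρ h0
        exact ⟨j, (disc_mono hj.le).trans hρ⟩)).1 hsign
    obtain ⟨j, hj⟩ := hsm r hr
    obtain ⟨n, hn, hcn⟩ := h1 j N
    exact ⟨n, hn, levelComp_mono (disc_mono hj.le) n hcn⟩
  -- an arm family in `W` whose classes are countable makes `W` break
  have hbreak : ∀ (R' : ℝ), 0 < R' → R' ≤ 1 → ∀ P : ℕ → ℝ → ℕ → (Bool → S) → Prop,
      (∀ (n : ℕ) (r : ℝ), 0 < r → r < 1 →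
        (∀ t : ℝ, e.symm (r * Complex.exp (t * Complex.I)) ∉ postcritical f) →
        ∃ n', n < n' ∧ ∃ a : Bool → S, (∀ b, a b ∈ endpoints f x e r n') ∧ P n r n' a) →
      (∀ r n a E γ, IsArmSystem f x e r n a → IsArmFamily f x e r n a E γ → r 0 < R' →
        (∀ j, P (n j) (r (j + 1)) (n (j + 1)) (a (j + 1))) →
        ((∀ j, f^[n (j + 1) - n j] (a (j + 1) false) = f^[n (j + 1) - n j] (a (j + 1) true)) →
          ∀ ε δ j, E ε j = E δ j → ε j = δ j → E ε (j + 1) = E δ (j + 1)) →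
        ∀ W ⊆ plaque f x (disc e R'), ∀ ε : ℕ → Bool,
          {δ | JoinedIn (W \ {x}) (E ε 0) (E δ 0)}.Countable) →
      ∃ U : Set (PlaqueInverseLimit f), IsOpen U ∧ x ∈ U ∧
        ∀ W : Set (PlaqueInverseLimit f), IsOpen W → x ∈ W → W ⊆ U → BreaksUncountably W x := by
    intro R' hR0 hR1 P hP hcount
    refine ⟨plaque f x (disc e R'), isOpen_plaque hf (he.isOpen_disc hR1) (he.mem_disc hR0),
      mem_plaque (he.mem_disc hR0), fun W hW hxW hWU => ?_⟩
    obtain ⟨V, hV, hxV, hVW⟩ := exists_plaque_subset hf hW hxW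
    obtain ⟨ρ, hρ0, hρ1, hρV⟩ := he.exists_disc_subset hV hxV
    obtain ⟨r, n, a, hr, hr0, hPr⟩ := exists_isArmSystem hf he hs₀ hP (lt_min hρ0 hR0)
    obtain ⟨E, γ, hE, hEi⟩ := hr.exists_arms hf he
    rw [lt_min_iff] at hr0
    refine breaksUncountably_of_countable_classes (fun ε => E ε 0) (fun ε => joinedIn_plaque_iff.2 ?_)
      (fun ε => hE.ne_center hr he ε 0) fun ε => ?_
    · exact (hE.joinedIn_plaque hr hf he hr0.1 ε).mono
        (hVW _ hρV (he.isOpen_disc hρ1) (he.mem_disc hρ0))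
    · exact (hcount r n a E γ hr hE hr0.2 hPr hEi W hWU ε).mono fun δ hδ =>
        joinedIn_plaque_iff.1 hδ
  by_cases hconn : ∃ R, 0 < R ∧ R < 1 ∧ ∃ M, ∀ m ≥ M, IsPreconnected (levelComp f x (disc e R) m)ᶜ
  · obtain ⟨R, hR0, hR1, M, hM⟩ := hconn
    refine hbreak (R / 2) (half_pos hR0) ((half_lt_self hR0).le.trans hR1.le)
      (fun n r n' a => a false ≠ a true ∧ f^[n' - n] (a false) = f^[n' - n] (a true)) ?_ ?_
    · intro n r h0 h1 _
      obtain ⟨n', hn', hcn⟩ := hcrit r h0 (n + 1)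
      exact ⟨n', hn', exists_endpoints_iterate_eq hf he hs₀ h0 h1.le hn' hc hcn⟩
    · intro r n a E γ hr hE hr0 hP hEi W hW ε
      exact hE.countable_of_isPreconnected_compl hr hS hf hfM he heM hτ' hs₀ hs₁ hr0
        (half_lt_self hR0) hR1 hM (fun j => (hP j).1) (hEi fun j => (hP j).2) hW ε
  · push Not at hconn
    refine hbreak 1 one_pos le_rfl
      (fun _ r n' a => ¬ JoinedIn (levelComp f x (disc e r) n')ᶜ (a false) (a true)) ?_ ?_
    · intro n r h0 h1 hc
      obtain ⟨n', hn', hB⟩ := hconn r h0 h1 (n + 1)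
      exact ⟨n', hn', exists_endpoints_not_joinedIn hf he h0 h1.le
        (fun t => notMem_critVals (hc t) n') hB⟩
    · intro r n a E γ hr hE hr0 hP _ W hW ε
      exact hE.countable_of_not_joinedIn hr hf he hr0 hP hW ε

end Turning

theorem mainTheorem6 {S : Type*} [TopologicalSpace S] [ChartedSpace ℂ S]
    [IsManifold 𝓘(ℂ) ω S] (hS : IsDiskPlaneOrSphere S)
    (f : S → S) (d : ℕ) (hd : 1 < d) (hf : IsBranchedCovering f d)
    (x : PlaqueInverseLimit f) :
    ((∃ c : S, IsCriticalPoint f c ∧ sign x c ≠ {⊥}) ↔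
      ∃ U : Set (PlaqueInverseLimit f), IsOpen U ∧ x ∈ U ∧
        ∀ W : Set (PlaqueInverseLimit f), IsOpen W → x ∈ W → W ⊆ U →
          BreaksUncountably W x) ∧
    ((∃ c : S, IsCriticalPoint f c ∧ sign x c ≠ {⊥}) ↔
      ∃ U : Set (PlaqueInverseLimit f), IsOpen U ∧ x ∈ U ∧
        ∀ W : Set (PlaqueInverseLimit f), IsOpen W → IsConnected W → x ∈ W → W ⊆ U →
          BreaksUncountably W x) := by
  have : T2Space S := hS.t2Space
  have : LocallyConnectedSpace S := ChartedSpace.locallyConnectedSpace ℂ S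
  have : IsManifold 𝓘(ℂ) 1 S := IsManifold.of_le (n := ω) le_top
  have hf' : IsTopBranched f := hf.isTopBranched hS hd
  have hcrit : ∀ c, IsCriticalPoint f c ↔ c ∈ branchSet f :=
    mfderiv_eq_zero_iff_mem_branchSet hf.holomorphic
  have h12 : (∃ c : S, IsCriticalPoint f c ∧ sign x c ≠ {⊥}) →
      ∃ U : Set (PlaqueInverseLimit f), IsOpen U ∧ x ∈ U ∧
        ∀ W : Set (PlaqueInverseLimit f), IsOpen W → x ∈ W → W ⊆ U →
          BreaksUncountably W x := fun ⟨c, hc, hsign⟩ =>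
    exists_breaksUncountably hS hf' hf.holomorphic ((hcrit c).1 hc) hsign
  have h31 : (∃ U : Set (PlaqueInverseLimit f), IsOpen U ∧ x ∈ U ∧
      ∀ W : Set (PlaqueInverseLimit f), IsOpen W → IsConnected W → x ∈ W → W ⊆ U →
        BreaksUncountably W x) → ∃ c : S, IsCriticalPoint f c ∧ sign x c ≠ {⊥} := by
    rintro ⟨U, hU, hxU, hUW⟩
    by_contra hcon
    push Not at hcon
    obtain ⟨W, hW, hWc, hxW, hWU, hWb⟩ := exists_connected_not_breaksUncountably hf' x
      (fun c hc => hcon c ((hcrit c).2 hc)) hU hxU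
    exact hWb (hUW W hW hWc hxW hWU)
  have h23 : (∃ U : Set (PlaqueInverseLimit f), IsOpen U ∧ x ∈ U ∧
      ∀ W : Set (PlaqueInverseLimit f), IsOpen W → x ∈ W → W ⊆ U → BreaksUncountably W x) →
      ∃ U : Set (PlaqueInverseLimit f), IsOpen U ∧ x ∈ U ∧
        ∀ W : Set (PlaqueInverseLimit f), IsOpen W → IsConnected W → x ∈ W → W ⊆ U →
          BreaksUncountably W x := fun ⟨U, hU, hxU, h⟩ =>
    ⟨U, hU, hxU, fun W hW _ hxW hWU => h W hW hxW hWU⟩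
  exact ⟨⟨h12, fun h => h31 (h23 h)⟩, ⟨fun h => h23 (h12 h), h31⟩⟩
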